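/- Let $V$ be a complete discrete valuation ring with algebraically closed residue field $k$ and fraction field $K$ of characteristic $0$. Let $X\hookrightarrow\mathbb{P}^n_V$ be a closed subscheme, flat over $V$, of (Krull) dimension $d+1$, whose generic fibre $X_K$ is reduced, and let $P$ be a closed point of the special fibre $X_k$ with $\dim_PX=d+1$. Let $G$ be the Grassmannian over $V$ of $d$-codimensional linear subspaces of $\mathbb{P}(\Gamma(\mathbb{P}^n_V,\mathcal{O}(2)))$; thus for a field $F$ over $V$ a point $L\in G(F)$ is a $d$-dimensional space of quadratic forms in $x_0,\dots,x_n$ over $F$, and for $Y\subset\mathbb{P}^n_F$ we write $Y\cap L$ for the scheme-theoretic intersection of $Y$ with the common zero locus of these forms (i.e. the intersection with $L$ of $Y$ embedded by the degree $2$ Veronese map). Let $\mathcal{H}_P\subset G_k$ be the closed subvariety of those $l$ all of whose forms vanish at $P$. For a finite extension $K'$ of $K$, let $V'$ be the integral closure of $V$ in $K'$ (a discrete valuation ring with residue field $k$). Since $G$ is proper, $L\in G(K')$ extends uniquely to a point of $G(V')$, still denoted $L$; its reduction in $G(k)$ is the specialization $\mathrm{sp}(L)$. For a closed point $L\in G_K$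 with residue field $K_L$, this is applied to the corresponding point of $G(K_L)$, with $V_L$ the integral closure of $V$ in $K_L$. (i) If $X$ is regular at $P$, then there is a dense open $U\subset\mathcal{H}_P$ such that for every $L\in G(K)$ with $\mathrm{sp}(L)\in U$, the scheme $X_k\cap\mathrm{sp}(L)$ is finite over $k$ and $X_K\cap L$ is étale over $K$. (ii) If $X$ is smooth over $V$ at $P$, then there is a dense open $U\subset\mathcal{H}_P$ such that for every closed point $L\in G_K$ with $\mathrm{sp}(L)\in U$, the scheme $X_k\cap\mathrm{sp}(L)$ is finite over $k$ and $X_{K_L}\cap L$ is étale over $K_L$; more generally, for every finite extension $K'/K$ and every $L\in G(K')$ with $\mathrm{sp}(L)\in U$, $X_k\cap\mathrm{sp}(L)$ is finite over $k$ and $X_{K'}\cap L$ is étale over $K'$. Moreover, for all such $L$ the scheme $X_{V_L}\cap L$ is nonempty (with $V_L=V$ in (i), and $V'$ in place of $V_L$ for $L\in G(K')$), and so is its generic fibre $X_{K_L}\cap L$ (resp. $X_{K'}\cap L$). -/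

import Mathlib

open CategoryTheory CategoryTheory.Limits AlgebraicGeometry

universe u

attribute [local instance] MvPolynomial.gradedAlgebra

/-! ### Projective space and its closed subschemes -/

section QuotientGrading

variable {R A : Type u} [CommRing R] [CommRing A] [Algebra R A]
  (𝒜 : ℕ → Submodule R A) [GradedAlgebra 𝒜]

/-- The grading of `A ⧸ I` by the images of the graded pieces of `A`. -/
def quotGrading (I : HomogeneousIdeal 𝒜) (m : ℕ) : Submodule R (A ⧸ I.toIdeal) :=
  (𝒜 m).map (Ideal.Quotient.mkₐ R I.toIdeal).toLinearMap

lemma mk_mem_quotGrading (I : HomogeneousIdeal 𝒜) {m : ℕ} {a : A} (ha : a ∈ 𝒜 m) :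
    Ideal.Quotient.mk I.toIdeal a ∈ quotGrading 𝒜 I m :=
  ⟨a, ha, rfl⟩

instance quotGrading_gradedMonoid (I : HomogeneousIdeal 𝒜) :
    SetLike.GradedMonoid (quotGrading 𝒜 I) where
  one_mem := ⟨1, SetLike.GradedOne.one_mem, map_one (Ideal.Quotient.mk I.toIdeal)⟩
  mul_mem := by
    rintro i j _ _ ⟨a, ha, rfl⟩ ⟨b, hb, rfl⟩
    exact ⟨a * b, SetLike.GradedMul.mul_mem ha hb, map_mul (Ideal.Quotient.mk I.toIdeal) a b⟩

/-- The componentwise quotient map, `a ↦ (class of the m-th component of a)ₘ`. -/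
noncomputable def quotDecomposeAux (I : HomogeneousIdeal 𝒜) :
    A →ₗ[R] DirectSum ℕ (fun m => quotGrading 𝒜 I m) :=
  (DirectSum.lmap (fun m => (Ideal.Quotient.mkₐ R I.toIdeal).toLinearMap.submoduleMap (𝒜 m))) ∘ₗ
    (DirectSum.decomposeLinearEquiv 𝒜).toLinearMap

lemma quotDecomposeAux_of_mem (I : HomogeneousIdeal 𝒜) {m : ℕ} {a : A} (ha : a ∈ 𝒜 m) :
    quotDecomposeAux 𝒜 I a = DirectSum.lof R ℕ (fun m => quotGrading 𝒜 I m) m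
      ⟨Ideal.Quotient.mk I.toIdeal a, mk_mem_quotGrading 𝒜 I ha⟩ := by
  simp only [quotDecomposeAux, LinearMap.comp_apply, LinearEquiv.coe_coe,
    DirectSum.decomposeLinearEquiv_apply, DirectSum.decompose_of_mem 𝒜 ha]
  exact DirectSum.lmap_lof _ _ _

lemma quotDecomposeAux_apply (I : HomogeneousIdeal 𝒜) (a : A) (m : ℕ) :
    (quotDecomposeAux 𝒜 I a m : A ⧸ I.toIdeal) =
      Ideal.Quotient.mk I.toIdeal (DirectSum.decompose 𝒜 a m) := by
  simp only [quotDecomposeAux, LinearMap.comp_apply, LinearEquiv.coe_coe,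
    DirectSum.decomposeLinearEquiv_apply]
  rfl

lemma quotDecomposeAux_eq_zero (I : HomogeneousIdeal 𝒜) (a : A) (ha : a ∈ I.toIdeal) :
    quotDecomposeAux 𝒜 I a = 0 := by
  refine DFinsupp.ext fun m => Subtype.ext ?_
  rw [quotDecomposeAux_apply]
  exact Ideal.Quotient.eq_zero_iff_mem.mpr (I.isHomogeneous m ha)

lemma quotDecomposeAux_congr (I : HomogeneousIdeal 𝒜) {a b : A}
    (h : Ideal.Quotient.mk I.toIdeal a = Ideal.Quotient.mk I.toIdeal b) :
    quotDecomposeAux 𝒜 I a = quotDecomposeAux 𝒜 I b := by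
  have h0 := quotDecomposeAux_eq_zero 𝒜 I _ (Ideal.Quotient.eq.mp h)
  have h1 := map_add (quotDecomposeAux 𝒜 I) (a - b) b
  rwa [sub_add_cancel, h0, zero_add] at h1

lemma coeAddMonoidHom_quotDecomposeAux (I : HomogeneousIdeal 𝒜) (a : A) :
    DirectSum.coeAddMonoidHom (quotGrading 𝒜 I) (quotDecomposeAux 𝒜 I a) =
      Ideal.Quotient.mk I.toIdeal a := by
  induction a using DirectSum.Decomposition.inductionOn 𝒜 with
  | zero => rw [map_zero, map_zero, map_zero]
  | homogeneous a =>
    rw [quotDecomposeAux_of_mem 𝒜 I a.2]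
    exact DirectSum.coeAddMonoidHom_of _ _ _
  | add a b ha hb => rw [map_add, map_add, map_add, ha, hb]

/-- A chosen representative of a class in `A ⧸ I`. -/
noncomputable def quotRep (I : HomogeneousIdeal 𝒜) (x : A ⧸ I.toIdeal) : A :=
  Function.surjInv Ideal.Quotient.mk_surjective x

lemma mk_quotRep (I : HomogeneousIdeal 𝒜) (x : A ⧸ I.toIdeal) :
    Ideal.Quotient.mk I.toIdeal (quotRep 𝒜 I x) = x :=
  Function.surjInv_eq _ x

/-- The decomposition of an element of `A ⧸ I` into its homogeneous components. -/
noncomputable instance quotGrading_decomposition (I : HomogeneousIdeal 𝒜) :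
    DirectSum.Decomposition (quotGrading 𝒜 I) where
  decompose' x := quotDecomposeAux 𝒜 I (quotRep 𝒜 I x)
  left_inv x := by
    rw [coeAddMonoidHom_quotDecomposeAux]
    exact mk_quotRep 𝒜 I x
  right_inv x := by
    induction x using DirectSum.induction_on with
    | zero =>
      exact quotDecomposeAux_eq_zero 𝒜 I _ (Ideal.Quotient.eq_zero_iff_mem.mp
        ((mk_quotRep 𝒜 I _).trans (map_zero _)))
    | of m x =>
      obtain ⟨_, a, ha, rfl⟩ := x
      exact (quotDecomposeAux_congr 𝒜 I (b := a) ((mk_quotRep 𝒜 I _).trans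
        (DirectSum.coeAddMonoidHom_of _ _ _))).trans (quotDecomposeAux_of_mem 𝒜 I ha)
    | add x y hx hy =>
      refine (quotDecomposeAux_congr 𝒜 I ?_).trans
        ((map_add (quotDecomposeAux 𝒜 I) _ _).trans (congrArg₂ (· + ·) hx hy))
      exact ((mk_quotRep 𝒜 I _).trans (map_add _ _ _)).trans
        ((map_add (Ideal.Quotient.mk I.toIdeal) _ _).trans
          (congrArg₂ (· + ·) (mk_quotRep 𝒜 I _) (mk_quotRep 𝒜 I _))).symm

noncomputable instance quotGrading_gradedRing (I : HomogeneousIdeal 𝒜) :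
    GradedRing (quotGrading 𝒜 I) where
  __ := quotGrading_gradedMonoid 𝒜 I
  __ := quotGrading_decomposition 𝒜 I

/-- The quotient map `A → A ⧸ I` as a homomorphism of graded rings. -/
def quotGradedHom (I : HomogeneousIdeal 𝒜) : GradedRingHom 𝒜 (quotGrading 𝒜 I) where
  __ := Ideal.Quotient.mk I.toIdeal
  map_mem := fun ha => mk_mem_quotGrading 𝒜 I ha

lemma quotGradedHom_irrelevant (I : HomogeneousIdeal 𝒜) :
    HomogeneousIdeal.irrelevant (quotGrading 𝒜 I) ≤
      (HomogeneousIdeal.irrelevant 𝒜).map (quotGradedHom 𝒜 I) := by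
  refine (HomogeneousIdeal.irrelevant_le _).mpr ?_
  rintro m hm _ ⟨a, ha, rfl⟩
  exact Ideal.mem_map_of_mem (quotGradedHom 𝒜 I)
    (HomogeneousIdeal.mem_irrelevant_of_mem 𝒜 hm ha)

/-- The closed subscheme `V₊(I) = Proj (A ⧸ I)` of `Proj A`. -/
noncomputable def projZeroLocus (I : HomogeneousIdeal 𝒜) : Scheme.{u} :=
  Proj (quotGrading 𝒜 I)

/-- The inclusion of `V₊(I)` into `Proj A`. -/
noncomputable def projZeroLocusι (I : HomogeneousIdeal 𝒜) : projZeroLocus 𝒜 I ⟶ Proj 𝒜 :=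
  Proj.map (quotGradedHom 𝒜 I) (quotGradedHom_irrelevant 𝒜 I)

end QuotientGrading

/-- Projective space `ℙⁿ_R = Proj R[x₀, …, xₙ]`. -/
noncomputable def projSpace (n : ℕ) (R : Type u) [CommRing R] : Scheme.{u} :=
  Proj (MvPolynomial.homogeneousSubmodule (Fin (n + 1)) R)

/-- The structure morphism `ℙⁿ_R ⟶ Spec R`. -/
noncomputable def projSpaceStr (n : ℕ) (R : Type u) [CommRing R] :
    projSpace n R ⟶ Spec (CommRingCat.of R) :=
  Proj.toSpecZero (MvPolynomial.homogeneousSubmodule (Fin (n + 1)) R) ≫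
    Spec.map (CommRingCat.ofHom
      (algebraMap R (MvPolynomial.homogeneousSubmodule (Fin (n + 1)) R 0)))

/-- The graded homomorphism `R[x₀, …, xₙ] → S[x₀, …, xₙ]` induced by `R → S`. -/
noncomputable def polyGradedHom (n : ℕ) (R S : Type u) [CommRing R] [CommRing S] [Algebra R S] :
    GradedRingHom (MvPolynomial.homogeneousSubmodule (Fin (n + 1)) R)
      (MvPolynomial.homogeneousSubmodule (Fin (n + 1)) S) where
  __ := MvPolynomial.map (algebraMap R S)
  map_mem := fun h => MvPolynomial.IsHomogeneous.map h _

lemma polyGradedHom_irrelevant (n : ℕ) (R S : Type u) [CommRing R] [CommRing S] [Algebra R S] :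
    HomogeneousIdeal.irrelevant (MvPolynomial.homogeneousSubmodule (Fin (n + 1)) S) ≤
      (HomogeneousIdeal.irrelevant (MvPolynomial.homogeneousSubmodule (Fin (n + 1)) R)).map
        (polyGradedHom n R S) := by
  refine (HomogeneousIdeal.irrelevant_le _).mpr ?_
  intro m hm p hp
  have hX : ∀ j : Fin (n + 1), (MvPolynomial.X j : MvPolynomial (Fin (n + 1)) S) ∈
      ((HomogeneousIdeal.irrelevant (MvPolynomial.homogeneousSubmodule (Fin (n + 1)) R)).map
        (polyGradedHom n R S)).toIdeal := fun j => by
    have := Ideal.mem_map_of_mem (polyGradedHom n R S)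
      (HomogeneousIdeal.mem_irrelevant_of_mem
        (MvPolynomial.homogeneousSubmodule (Fin (n + 1)) R) one_pos
        (MvPolynomial.isHomogeneous_X R j))
    have h2 : polyGradedHom n R S (MvPolynomial.X j) = MvPolynomial.X j :=
      MvPolynomial.map_X _ _
    rwa [h2] at this
  change p ∈ HomogeneousIdeal.toIdeal _
  rw [p.as_sum]
  refine Ideal.sum_mem _ fun s hs => ?_
  have hdeg : s.degree = m := by
    by_contra hne
    exact (MvPolynomial.mem_support_iff.mp hs) (MvPolynomial.IsHomogeneous.coeff_eq_zero hp hne)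
  have hs0 : s ≠ 0 := by
    rintro rfl
    simp at hdeg
    omega
  obtain ⟨j, hj⟩ := Finsupp.ne_iff.mp hs0
  have hdvd : (MvPolynomial.X j : MvPolynomial (Fin (n + 1)) S) ∣
      MvPolynomial.monomial s (p.coeff s) :=
    MvPolynomial.X_dvd_monomial.mpr (Or.inr hj)
  exact Ideal.mem_of_dvd _ hdvd (hX j)

/-- The projection `ℙⁿ_S ⟶ ℙⁿ_R` induced by `R → S`. -/
noncomputable def projSpaceMap (n : ℕ) (R S : Type u) [CommRing R] [CommRing S] [Algebra R S] :
    projSpace n S ⟶ projSpace n R :=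
  Proj.map (polyGradedHom n R S) (polyGradedHom_irrelevant n R S)

/-! ### Linear systems of quadrics -/

section Quadrics

/-- The homogeneous ideal of `R[x₀, …, xₙ]` generated by a module `M` of quadratic forms. -/
noncomputable def quadricIdeal {n : ℕ} {R : Type u} [CommRing R]
    (M : Submodule R (MvPolynomial (Fin (n + 1)) R))
    (hM : M ≤ MvPolynomial.homogeneousSubmodule (Fin (n + 1)) R 2) :
    HomogeneousIdeal (MvPolynomial.homogeneousSubmodule (Fin (n + 1)) R) :=
  ⟨Ideal.span (M : Set (MvPolynomial (Fin (n + 1)) R)),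
    Ideal.homogeneous_span _ _ fun _ hq => ⟨2, hM hq⟩⟩

/-- The closed subscheme `V₊(M)` of `ℙⁿ_R` cut out by a module `M` of quadratic forms. -/
noncomputable def quadricLocus {n : ℕ} {R : Type u} [CommRing R]
    (M : Submodule R (MvPolynomial (Fin (n + 1)) R))
    (hM : M ≤ MvPolynomial.homogeneousSubmodule (Fin (n + 1)) R 2) : Scheme.{u} :=
  projZeroLocus _ (quadricIdeal M hM)

/-- The closed immersion `V₊(M) ⟶ ℙⁿ_R`. -/
noncomputable def quadricLocusι {n : ℕ} {R : Type u} [CommRing R]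
    (M : Submodule R (MvPolynomial (Fin (n + 1)) R))
    (hM : M ≤ MvPolynomial.homogeneousSubmodule (Fin (n + 1)) R 2) :
    quadricLocus M hM ⟶ projSpace n R :=
  projZeroLocusι _ (quadricIdeal M hM)

/-- For `X ⟶ ℙⁿ_V`, a `V`-algebra `A` and a module `M` of quadratic forms over `A`, this is the
scheme-theoretic intersection `X_A ∩ V₊(M)` inside `ℙⁿ_A`, where `X_A = X ×_V A`. Since
`X_A = X ×_{ℙⁿ_V} ℙⁿ_A`, it is the fibre product of `X` and `V₊(M)` over `ℙⁿ_V`. -/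
noncomputable def quadricSection {V : Type u} [CommRing V] {n : ℕ} {X : Scheme.{u}}
    (i : X ⟶ projSpace n V) {A : Type u} [CommRing A] [Algebra V A]
    (M : Submodule A (MvPolynomial (Fin (n + 1)) A))
    (hM : M ≤ MvPolynomial.homogeneousSubmodule (Fin (n + 1)) A 2) : Scheme.{u} :=
  pullback i (quadricLocusι M hM ≫ projSpaceMap n V A)

/-- The structure morphism `X_A ∩ V₊(M) ⟶ Spec A`. -/
noncomputable def quadricSectionStr {V : Type u} [CommRing V] {n : ℕ} {X : Scheme.{u}}
    (i : X ⟶ projSpace n V) {A : Type u} [CommRing A] [Algebra V A]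
    (M : Submodule A (MvPolynomial (Fin (n + 1)) A))
    (hM : M ≤ MvPolynomial.homogeneousSubmodule (Fin (n + 1)) A 2) :
    quadricSection i M hM ⟶ Spec (CommRingCat.of A) :=
  pullback.snd i (quadricLocusι M hM ≫ projSpaceMap n V A) ≫ quadricLocusι M hM ≫
    projSpaceStr n A

end Quadrics

/-! ### The Grassmannian of `d`-dimensional linear systems of quadrics -/

section Grassmannian

/-- The `F`-valued points of the Grassmannian `G` of `d`-dimensional spaces of quadratic forms in
`x₀, …, xₙ`, that is, of codimension `d` linear subspaces `L` of `ℙ(Γ(ℙⁿ, 𝒪(2)))`. -/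
structure QuadGrass (n d : ℕ) (F : Type u) [Field F] where
  /-- the space of quadratic forms vanishing on `L` -/
  space : Submodule F (MvPolynomial (Fin (n + 1)) F)
  le_two : space ≤ MvPolynomial.homogeneousSubmodule (Fin (n + 1)) F 2
  finrank_eq : Module.finrank F space = d

/-- The `d`-tuples of linearly independent quadratic forms. -/
structure QuadFrame (n d : ℕ) (F : Type u) [Field F] where
  /-- the forms -/
  form : Fin d → MvPolynomial (Fin (n + 1)) F
  homogeneous : ∀ j, (form j).IsHomogeneous 2
  indep : LinearIndependent F form

/-- The linear system spanned by a frame. -/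
noncomputable def QuadFrame.span {n d : ℕ} {F : Type u} [Field F] (q : QuadFrame n d F) :
    QuadGrass n d F where
  space := Submodule.span F (Set.range q.form)
  le_two := Submodule.span_le.mpr (by rintro _ ⟨j, rfl⟩; exact q.homogeneous j)
  finrank_eq := by rw [finrank_span_eq_card q.indep, Fintype.card_fin]

/-- The Zariski topology on the affine space `F^σ`: its basic open sets are the non-vanishing loci
of polynomials. -/
@[reducible]
def zariskiTopology (σ : Type*) (F : Type*) [Field F] : TopologicalSpace (σ → F) :=
  TopologicalSpace.generateFrom
    (Set.range fun f : MvPolynomial σ F => {a : σ → F | MvPolynomial.eval a f ≠ 0})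

/-- The Zariski topology on frames, induced by the coefficients of the forms. -/
instance QuadFrame.zariski (n d : ℕ) (F : Type u) [Field F] :
    TopologicalSpace (QuadFrame n d F) :=
  (zariskiTopology (Fin d × (Fin (n + 1) →₀ ℕ)) F).induced
    fun q jm => (q.form jm.1).coeff jm.2

/-- The Zariski topology on the (closed points of the) Grassmannian, as the quotient of the space
of frames by the action of `GL_d`. -/
noncomputable instance QuadGrass.zariski (n d : ℕ) (F : Type u) [Field F] :
    TopologicalSpace (QuadGrass n d F) :=
  (QuadFrame.zariski n d F).coinduced QuadFrame.span

/-- For a point `P` of `X ⊆ ℙⁿ_V`, the closed subset `H_P` of the special fibre of the Grassmannian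
consisting of the linear systems all of whose members pass through `P`. It carries the
subspace topology. -/
def throughPoint {V : Type u} [CommRing V] [IsLocalRing V] {n : ℕ} {X : Scheme.{u}}
    (i : X ⟶ projSpace n V) (P : X) (d : ℕ) :
    Set (QuadGrass n d (IsLocalRing.ResidueField V)) :=
  {l | i P ∈ Set.range (quadricLocusι l.space l.le_two ≫
    projSpaceMap n V (IsLocalRing.ResidueField V))}

/-- The quadratic forms with coefficients in `A` that lie in a given linear system over `F ⊇ A`.
If `A` is a discrete valuation ring with fraction field `F`, this is the linear system over `A`
giving the unique extension of the `F`-point `L` of the Grassmannian to an `A`-point. -/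
noncomputable def QuadGrass.lattice {n d : ℕ} {F : Type u} [Field F] (L : QuadGrass n d F)
    (A : Type u) [CommRing A] [Algebra A F] : Submodule A (MvPolynomial (Fin (n + 1)) A) :=
  MvPolynomial.homogeneousSubmodule (Fin (n + 1)) A 2 ⊓
    (L.space.restrictScalars A).comap (MvPolynomial.mapAlgHom (Algebra.ofId A F)).toLinearMap

lemma QuadGrass.lattice_le_two {n d : ℕ} {F : Type u} [Field F] (L : QuadGrass n d F)
    (A : Type u) [CommRing A] [Algebra A F] :
    L.lattice A ≤ MvPolynomial.homogeneousSubmodule (Fin (n + 1)) A 2 :=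
  inf_le_left

/-- The `F`-point `L` of the Grassmannian specializes to the `k`-point `l`, where `A ⊆ F` is a
discrete valuation ring with fraction field `F` and `r : A → k` is its residue map: `l` is the
reduction of the `A`-point extending `L`. -/
def QuadGrass.SpecializesTo {n d : ℕ} {F k : Type u} [Field F] [Field k] (L : QuadGrass n d F)
    {A : Type u} [CommRing A] [Algebra A F] (r : A →+* k) (l : QuadGrass n d k) : Prop :=
  l.space = Submodule.span k (MvPolynomial.map r '' (L.lattice A : Set _))

end Grassmannian

/-! ### Residue maps, local dimension, smoothness at a point -/

section Local

lemma nonempty_residueHom (V : Type u) [CommRing V] [IsLocalRing V]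
    [IsAlgClosed (IsLocalRing.ResidueField V)] (F : Type u) [Field F] [Algebra V F] :
    Nonempty (integralClosure V F →ₐ[V] IsLocalRing.ResidueField V) := by
  obtain ⟨M, hM, hMV⟩ := Ideal.exists_ideal_over_maximal_of_isIntegral
    (S := integralClosure V F) (IsLocalRing.maximalIdeal V)
    (IsLocalRing.le_maximalIdeal (RingHom.ker_ne_top _))
  have : M.LiesOver (IsLocalRing.maximalIdeal V) := ⟨hMV.symm⟩
  let := Ideal.Quotient.field M
  let : Field (V ⧸ IsLocalRing.maximalIdeal V) := Ideal.Quotient.field _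
  have : IsAlgClosed (V ⧸ IsLocalRing.maximalIdeal V) :=
    inferInstanceAs (IsAlgClosed (IsLocalRing.ResidueField V))
  have hb := IsAlgClosed.algebraMap_bijective_of_isIntegral
    (k := V ⧸ IsLocalRing.maximalIdeal V) (K := integralClosure V F ⧸ M)
  let e := AlgEquiv.ofBijective (Algebra.ofId (V ⧸ IsLocalRing.maximalIdeal V)
    (integralClosure V F ⧸ M)) hb
  exact ⟨((e.symm.restrictScalars V).toAlgHom.comp (Ideal.Quotient.mkₐ V M) :)⟩

/-- The residue map `V_F → k` of the integral closure `V_F` of `V` in a finite extension `F` of the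
fraction field of `V`, where `V` is a complete discrete valuation ring with algebraically closed
residue field `k` (so that `V_F` is a discrete valuation ring with the same residue field). -/
noncomputable def residueHom (V : Type u) [CommRing V] [IsLocalRing V]
    [IsAlgClosed (IsLocalRing.ResidueField V)] (F : Type u) [Field F] [Algebra V F] :
    integralClosure V F →ₐ[V] IsLocalRing.ResidueField V :=
  Classical.choice (nonempty_residueHom V F)

/-- The dimension of a space at a point: the least dimension of an open neighbourhood. -/
noncomputable def dimAt {X : Type*} [TopologicalSpace X] (x : X) : WithBot ℕ∞ :=
  ⨅ U : {U : TopologicalSpace.Opens X // x ∈ U}, topologicalKrullDim U.1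

/-- A morphism is smooth at a point if it is smooth on an open neighbourhood of it. -/
def IsSmoothAtPoint {X Y : Scheme.{u}} (f : X ⟶ Y) (x : X) : Prop :=
  ∃ U : X.Opens, x ∈ U ∧ Smooth (U.ι ≫ f)

end Local

/-! ### Algebraic dependence -/

/-! Étaleness over `F` (`K`, or the finite extension `K'`) is tested on tangent vectors. By
`etale_quadricSectionStr` it is enough that at no point `x` of `X ∩ L`, with values in a finite
extension `κ` of `F`, there is a nonzero vector `u` tangent to `X` and killed by the differentials
of all forms of `L`. Given such a pair, a valuation ring of `κ` above `V` (`exists_valuationRing`)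
reduces `x` to a point `q` of `X_k` where the forms of the specialization vanish, and there are two
cases.

Case `q ≠ P`. The special fibre may be nonreduced, so smoothness of `X_k` is of no help; instead,
degeneracy on the generic fibre is specialized. In characteristic zero `X_K` has dimension at most
`d`, and a nonzero tangent vector killed by `d` covectors `v` forces a `d × d` determinant to
vanish. Hence `v` together with any `d` coordinates of `x` satisfies a nontrivial polynomial
equation, which can be scaled to be primitive over `V`, so that it remains nontrivial modulo the
maximal ideal (`exists_jet_equation`). Quadrics through `P` take arbitrary first-order jets at a
point other than `P`, and `X_k` has dimension at most `d`. A parameter count therefore shows that,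
for a generic `d`-tuple of quadrics through `P`, some reduced equation fails at each common zero
other than `P` (`isGeneric_not_relation`). So this case does not occur, and `u` may be rescaled to
have nonzero reduction (`exists_primitive_tangent_at_point`).

Case `q = P`. Let `𝔓` be the maximal ideal of `P`. If the cotangent space of `X_k` at `P` has
dimension at most `d`, the differentials of generic quadrics through `P` span it, so `u` reduces to
zero, a contradiction. This covers the smooth case, where the rank of the differentials at `P`
equals the rank at a generic point of a component through `P`. It also covers the regular case with
a uniformizer `π ∉ 𝔓²`. In the remaining regular case `π ∈ 𝔓²` and `𝔓/𝔓²` has dimension at most `d +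
1`. Since `L` is defined over `K`, its forms lift to `V`, and these lifts with one further element
generate `𝔓` locally. The prime `𝔮` of `x` is strictly contained in `𝔓`, so it is generated near `𝔓`
by the lifts alone (`exists_smul_mem_of_le_sup_span_singleton`). Thus `u` annihilates every relation
satisfied by `x`, and `u = 0` because the coordinates of `x` are separable over `K`.

Finiteness holds because a generic section misses a hyperplane and is therefore both proper and
affine. Nonemptiness comes from `dim_P X = d + 1`: the cone over a point of the generic fibre has `d
+ 1` independent parameters, more than the number `d` of forms, and a place at infinity of the cone
gives a common zero (`exists_projective_zero`).

Dimension counts are made with transcendence degrees. `exists_generic_point` turns a family of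
points on which no nonzero polynomial vanishes into one point with independent coordinates, which
inherits all relations common to the family. -/

section AlgebraicDependence

/-- The elements of `Ω` that are algebraic over the subfield generated by `S`. -/
noncomputable def algSpan (k : Type*) {Ω : Type*} [Field k] [Field Ω] [Algebra k Ω] (S : Set Ω) :
    IntermediateField k Ω :=
  (algebraicClosure (IntermediateField.adjoin k S) Ω).restrictScalars k

variable {k Ω : Type*} [Field k] [Field Ω] [Algebra k Ω]

lemma mem_algSpan {S : Set Ω} {a : Ω} :
    a ∈ algSpan k S ↔ IsAlgebraic (IntermediateField.adjoin k S) a :=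
  mem_algebraicClosure_iff

lemma subset_algSpan (S : Set Ω) : S ⊆ algSpan k S := fun a ha =>
  mem_algSpan.mpr (isAlgebraic_algebraMap
    (⟨a, IntermediateField.subset_adjoin k S ha⟩ : IntermediateField.adjoin k S))

lemma mem_algSpan_iff_adjoin {S : Set Ω} {a : Ω} :
    a ∈ algSpan k S ↔ IsAlgebraic (Algebra.adjoin k S) a :=
  mem_algSpan.trans (IntermediateField.isAlgebraic_adjoin_iff (F := k) (E := Ω))

lemma algSpan_le {S T : Set Ω} (h : S ⊆ algSpan k T) : algSpan k S ≤ algSpan k T := by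
  intro a ha
  rw [mem_algSpan] at ha
  have h1 : IntermediateField.adjoin k S ≤ algSpan k T := IntermediateField.adjoin_le_iff.mpr h
  have h2 : IsAlgebraic (algebraicClosure (IntermediateField.adjoin k T) Ω) a := by
    let f : IntermediateField.adjoin k S →+* algebraicClosure (IntermediateField.adjoin k T) Ω :=
      (IntermediateField.inclusion h1).toRingHom
    obtain ⟨p, hp, hpa⟩ := ha
    refine ⟨p.map f, (Polynomial.map_ne_zero_iff f.injective).mpr hp, ?_⟩
    rw [Polynomial.aeval_def, Polynomial.eval₂_map]
    exact hpa
  exact mem_algSpan.mpr (isAlgebraic_iff_isIntegral.mpr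
    (isIntegral_trans _ (isAlgebraic_iff_isIntegral.mp h2)))

lemma algSpan_mono {S T : Set Ω} (h : S ⊆ T) : algSpan k S ≤ algSpan k T :=
  algSpan_le (h.trans (subset_algSpan T))

lemma IsAlgebraic.of_map_subalgebra {A : Type*} [Field A] [Algebra k A] (f : A →ₐ[k] Ω)
    (B : Subalgebra k A) {x : A} (h : IsAlgebraic (B.map f) (f x)) : IsAlgebraic B x := by
  let e := B.equivMapOfInjective f f.injective
  refine IsAlgebraic.of_ringHom_of_comp_eq (f := e.toRingEquiv.toRingHom) (g := f.toRingHom) h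
    e.surjective f.injective ?_
  ext y
  rfl

/-- The field algebraic over `w` has transcendence degree at least `|σ| ≥ |τ|`, so a family of `|τ|`
elements over which it is algebraic must be a transcendence basis. All parameter counts go through
this statement. -/
lemma algebraicIndependent_of_card_le {σ τ : Type*} [Fintype σ] [Fintype τ] {a : σ → Ω}
    (ha : AlgebraicIndependent k a) (w : τ → Ω) (h : ∀ s, a s ∈ algSpan k (Set.range w))
    (hc : Fintype.card τ ≤ Fintype.card σ) : AlgebraicIndependent k w := by
  have hw : ∀ t, w t ∈ algSpan k (Set.range w) := fun t => subset_algSpan _ ⟨t, rfl⟩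
  have hx := fun x : algSpan k (Set.range w) => mem_algSpan_iff_adjoin.mp x.2
  generalize algSpan k (Set.range w) = A at h hw hx
  let w' : τ → A := fun t => ⟨w t, hw t⟩
  let a' : σ → A := fun s => ⟨a s, h s⟩
  have ha' : AlgebraicIndependent k a' := AlgebraicIndependent.of_comp A.val ha
  have hr : Algebra.adjoin k (Set.range w) = (Algebra.adjoin k (Set.range w')).map A.val := by
    rw [AlgHom.map_adjoin, ← Set.range_comp]; rfl
  have halg : Algebra.IsAlgebraic (Algebra.adjoin k (Set.range w')) A :=
    ⟨fun x => IsAlgebraic.of_map_subalgebra A.val _ (by rw [← hr]; exact hx x)⟩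
  have h1 : (Fintype.card σ : Cardinal) ≤ Algebra.trdeg k A := by
    have := ha'.lift_cardinalMk_le_trdeg
    rwa [Cardinal.mk_fintype, Cardinal.lift_natCast, Cardinal.nat_le_lift_iff] at this
  have := Algebra.IsAlgebraic.isTranscendenceBasis_of_lift_le_trdeg_of_finite k w' (by
    rw [Cardinal.mk_fintype, Cardinal.lift_natCast, Cardinal.nat_le_lift_iff]
    exact le_trans (by exact_mod_cast hc) h1)
  exact this.1.map' (f := A.val) Subtype.val_injective

lemma AlgebraicIndependent.algSpan_of_sumElim {σ τ : Type*} {t : τ → Ω} {v : σ → Ω}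
    (h : AlgebraicIndependent k (Sum.elim v t)) :
    AlgebraicIndependent (algSpan k (Set.range t)) v := by
  have h1 := (AlgebraicIndependent.sumElim_iff.mp h).2
  have h2 := IntermediateField.algebraicIndependent_adjoin_iff.mpr h1
  exact h2.algebraicClosure

lemma exists_finset_algSpan {ι : Type*} [Finite ι] (x : ι → Ω) :
    ∃ s : Finset ι, AlgebraicIndependent k (fun j : s => x j) ∧ ∀ l, x l ∈ algSpan k (x '' s) := by
  classical
  have := Fintype.ofFinite ι
  obtain ⟨s, hs, hmax⟩ := Set.Finite.exists_maximalFor Finset.card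
    {s : Finset ι | AlgebraicIndependent k (fun j : s => x j)} (Set.toFinite _)
    ⟨∅, algebraicIndependent_empty_type (K := k)⟩
  refine ⟨s, hs, fun l => ?_⟩
  by_contra hl
  have hls : l ∉ s := fun h => hl (subset_algSpan _ ⟨l, h, rfl⟩)
  have h2 : AlgebraicIndepOn k x (insert l (s : Set ι)) := by
    rw [AlgebraicIndepOn.insert_iff (by simpa using hls)]
    exact ⟨hs, fun h => hl (mem_algSpan_iff_adjoin.mpr h)⟩
  have h3 : (insert l s) ∈ {s : Finset ι | AlgebraicIndependent k (fun j : s => x j)} := by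
    rw [← Finset.coe_insert] at h2
    exact h2
  have := hmax h3 (Finset.card_le_card (Finset.subset_insert l s))
  rw [Finset.card_insert_of_notMem hls] at this
  omega

lemma MvPolynomial.aeval_pi_algHom {R E A ι σ : Type*} [CommRing R] [CommRing E] [CommRing A]
    [Algebra R E] [Algebra R A] (φ : (ι → E) →ₐ[R] A) (a : σ → ι → E) (F : MvPolynomial σ R) :
    MvPolynomial.aeval (fun s => φ (a s)) F =
      φ fun p => MvPolynomial.aeval (fun s => a s p) F := by
  rw [← MvPolynomial.comp_aeval_apply]
  congr 1
  funext p
  exact MvPolynomial.comp_aeval_apply a (Pi.evalAlgHom R (fun _ : ι => E) p) F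

/-- If no nonzero polynomial vanishes on a set of points over `E`, there is a generic point that
specializes to all of them: a point in a quotient of a product of copies of `E`. -/
lemma exists_generic_point {k : Type*} {E ι : Type u} {σ : Type*} [Field k] [Field E] [Algebra k E]
    (a : σ → ι → E)
    (h : ∀ f : MvPolynomial σ k, f ≠ 0 → ∃ j, MvPolynomial.aeval (fun s => a s j) f ≠ 0) :
    ∃ (Ω : Type u) (_ : Field Ω) (_ : Algebra k Ω) (_ : Algebra E Ω) (_ : IsScalarTower k E Ω)
      (φ : (ι → E) →ₐ[E] Ω), AlgebraicIndependent k (fun s => φ (a s)) := by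
  let g : MvPolynomial σ k →ₐ[k] (ι → E) := MvPolynomial.aeval a
  have hcomp : ∀ f j, g f j = MvPolynomial.aeval (fun s => a s j) f := fun f j => by
    have : (Pi.evalAlgHom k (fun _ : ι => E) j).comp g = MvPolynomial.aeval (fun s => a s j) := by
      ext s
      simp [g]
    exact DFunLike.congr_fun this f
  have hinj : Function.Injective g.toRingHom := by
    rw [injective_iff_map_eq_zero]
    intro f hf
    by_contra hne
    obtain ⟨j, hj⟩ := h f hne
    exact hj ((hcomp f j).symm.trans (congrFun hf j))
  -- Polynomials embed into functions on the family, so some prime of the product lies over the zero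
  -- ideal. Its residue field is `Ω`; an identity valid at every member of the family persists under
  -- `φ`.
  obtain ⟨q, hq, hq0⟩ := Ideal.exists_comap_eq_of_mem_minimalPrimes_of_injective hinj
    (⊥ : Ideal (MvPolynomial σ k)) (by rw [IsDomain.minimalPrimes_eq_singleton_bot]; rfl)
  let φ : (ι → E) →ₐ[E] FractionRing ((ι → E) ⧸ q) :=
    (IsScalarTower.toAlgHom E ((ι → E) ⧸ q) (FractionRing ((ι → E) ⧸ q))).comp
      (Ideal.Quotient.mkₐ E q)
  refine ⟨FractionRing ((ι → E) ⧸ q), inferInstance, inferInstance, inferInstance, inferInstance,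
    φ, ?_⟩
  rw [algebraicIndependent_iff]
  intro f hf
  have h1 : φ (g f) = 0 := by
    rw [← hf]
    have : ((φ.restrictScalars k).comp g) = MvPolynomial.aeval (fun s => φ (a s)) := by
      ext s
      simp [g]
    exact DFunLike.congr_fun this f
  have h2 : g f ∈ q := by
    have := (IsFractionRing.injective ((ι → E) ⧸ q) (FractionRing ((ι → E) ⧸ q)))
      (h1.trans (map_zero _).symm)
    exact Ideal.Quotient.eq_zero_iff_mem.mp this
  have h3 : f ∈ q.comap g.toRingHom := h2
  rw [hq0] at h3
  exact h3

end AlgebraicDependence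

/-! ### Directional derivatives -/

section DirDeriv

variable {R A B : Type*} [CommRing R] [CommRing A] [Algebra R A] [CommRing B] [Algebra R B]
  {σ : Type*} [Fintype σ]

/-- The derivative of polynomials at the point `x` in the direction `u`. -/
noncomputable def dirDeriv (x u : σ → A) : MvPolynomial σ R →ₗ[R] A where
  toFun F := ∑ l, MvPolynomial.aeval x (MvPolynomial.pderiv l F) * u l
  map_add' F G := by simp [add_mul, Finset.sum_add_distrib]
  map_smul' c F := by simp [Finset.smul_sum]

lemma dirDeriv_apply (x u : σ → A) (F : MvPolynomial σ R) :
    dirDeriv x u F = ∑ l, MvPolynomial.aeval x (MvPolynomial.pderiv l F) * u l := rfl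

lemma dirDeriv_mul (x u : σ → A) (F G : MvPolynomial σ R) :
    dirDeriv x u (F * G) =
      MvPolynomial.aeval x F * dirDeriv x u G + MvPolynomial.aeval x G * dirDeriv x u F := by
  simp only [dirDeriv_apply, Finset.mul_sum, ← Finset.sum_add_distrib]
  refine Finset.sum_congr rfl fun l _ => ?_
  simp only [Derivation.leibniz, smul_eq_mul, map_add, map_mul]
  ring

@[simp] lemma dirDeriv_X (x u : σ → A) (l : σ) :
    dirDeriv x u (MvPolynomial.X l : MvPolynomial σ R) = u l := by
  classical
  simp [dirDeriv_apply, MvPolynomial.pderiv_X, Pi.single_apply]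

@[simp] lemma dirDeriv_C (x u : σ → A) (c : R) : dirDeriv x u (MvPolynomial.C c) = 0 := by
  simp [dirDeriv_apply]

lemma map_dirDeriv (φ : A →ₐ[R] B) (x u : σ → A) (F : MvPolynomial σ R) :
    φ (dirDeriv x u F) = dirDeriv (fun l => φ (x l)) (fun l => φ (u l)) F := by
  simp only [dirDeriv_apply, map_sum, map_mul]
  refine Finset.sum_congr rfl fun l _ => ?_
  rw [MvPolynomial.comp_aeval_apply]

lemma dirDeriv_map {R' : Type*} [CommRing R'] [Algebra R R'] [Algebra R' A] [IsScalarTower R R' A]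
    (x u : σ → A) (F : MvPolynomial σ R) :
    dirDeriv x u (MvPolynomial.map (algebraMap R R') F) = dirDeriv x u F := by
  simp only [dirDeriv_apply, MvPolynomial.pderiv_map, MvPolynomial.aeval_map_algebraMap]

lemma dirDeriv_smul (x u : σ → A) (c : A) (F : MvPolynomial σ R) :
    dirDeriv x (fun l => c * u l) F = c * dirDeriv x u F := by
  simp only [dirDeriv_apply, Finset.mul_sum]
  exact Finset.sum_congr rfl fun l _ => by ring

end DirDeriv

/-! ### Normalization by a coordinate of largest value -/

section ValuationRing

/-- A coordinate of largest value works. This puts a projective vector into a chart that contains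
its reduction. -/
lemma ValuationRing.exists_forall_div_mem {A F : Type*} [CommRing A] [IsDomain A] [ValuationRing A]
    [Field F] [Algebra A F] [IsFractionRing A F] {ι : Type*} [Finite ι] (x : ι → F)
    (hx : ∃ i, x i ≠ 0) :
    ∃ i, x i ≠ 0 ∧ ∀ j, ∃ a : A, algebraMap A F a = x j / x i := by
  have : Nonempty ι := ⟨hx.choose⟩
  obtain ⟨i, hi⟩ := Finite.exists_max fun j => ValuationRing.valuation A F (x j)
  have hi0 : x i ≠ 0 := by
    intro h0
    obtain ⟨j, hj⟩ := hx
    have := hi j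
    rw [h0, map_zero, le_zero_iff, Valuation.zero_iff] at this
    exact hj this
  refine ⟨i, hi0, fun j => ?_⟩
  rw [← Set.mem_range, ← RingHom.coe_range]
  have : x j / x i ∈ (ValuationRing.valuation A F).integer := by
    rw [Valuation.mem_integer_iff, map_div₀]
    exact div_le_one_of_le₀ (hi j) zero_le
  obtain ⟨a, ha⟩ := (ValuationRing.mem_integer_iff A F _).mp this
  exact ⟨a, ha⟩

/-- After division by a coefficient of largest value one coefficient is `1`, which no residue map
kills. -/
lemma exists_primitive_multiple {V K k : Type*} [CommRing V] [IsDomain V] [ValuationRing V]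
    [Field K] [Algebra V K] [IsFractionRing V K] [Field k] (r : V →+* k) {σ : Type*}
    (f : MvPolynomial σ K) (hf : f ≠ 0) :
    ∃ (E : MvPolynomial σ V) (c : K), MvPolynomial.map (algebraMap V K) E = MvPolynomial.C c * f ∧
      MvPolynomial.map r E ≠ 0 := by
  obtain ⟨s0, hs0⟩ := MvPolynomial.ne_zero_iff.mp hf
  obtain ⟨⟨s1, hs1⟩, h1, h2⟩ := ValuationRing.exists_forall_div_mem (A := V)
    (fun s : f.support => f.coeff s) ⟨⟨s0, MvPolynomial.mem_support_iff.mpr hs0⟩, hs0⟩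
  choose a ha using h2
  classical
  let E : MvPolynomial σ V := ∑ s : f.support, MvPolynomial.monomial s.1 (a s)
  have hE : ∀ s : f.support, E.coeff s = a s := fun s => by
    simp only [E, MvPolynomial.coeff_sum, MvPolynomial.coeff_monomial]
    rw [Finset.sum_eq_single s]
    · simp
    · intro t _ ht
      rw [if_neg]
      exact fun h => ht (Subtype.ext h)
    · simp
  refine ⟨E, (f.coeff s1)⁻¹, ?_, ?_⟩
  · ext s
    rw [MvPolynomial.coeff_map, MvPolynomial.coeff_C_mul]
    by_cases hs : s ∈ f.support
    · rw [hE ⟨s, hs⟩, ha ⟨s, hs⟩, div_eq_inv_mul]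
    · rw [MvPolynomial.notMem_support_iff.mp hs, mul_zero]
      have : E.coeff s = 0 := by
        simp only [E, MvPolynomial.coeff_sum, MvPolynomial.coeff_monomial]
        refine Finset.sum_eq_zero fun t _ => if_neg ?_
        rintro rfl
        exact hs t.2
      rw [this, map_zero]
  · have h3 : a ⟨s1, hs1⟩ = 1 := IsFractionRing.injective V K (by
      rw [ha, map_one]; exact div_self h1)
    refine MvPolynomial.ne_zero_iff.mpr ⟨s1, ?_⟩
    rw [MvPolynomial.coeff_map, hE ⟨s1, hs1⟩, h3, map_one]
    exact one_ne_zero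

end ValuationRing

/-! ### Tangent vectors in terms of a transcendence basis -/

section TangentDependence

variable {K Ω : Type*} [Field K] [Field Ω] [Algebra K Ω]

lemma dirDeriv_rename {σ τ : Type*} [Fintype σ] [Fintype τ] (x u : σ → Ω) (t : τ → σ)
    (C : MvPolynomial τ K) :
    dirDeriv x u (MvPolynomial.rename t C) = dirDeriv (x ∘ t) (u ∘ t) C := by
  induction C using MvPolynomial.induction_on with
  | C a => simp
  | add p q hp hq => rw [map_add, map_add, map_add, hp, hq]
  | mul_X p j hp =>
    rw [map_mul, dirDeriv_mul, dirDeriv_mul, hp, MvPolynomial.rename_X, dirDeriv_X, dirDeriv_X,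
      MvPolynomial.aeval_rename]
    simp

/-- If `x l` is algebraic over `K(x ∘ t)` in characteristic zero, then the `l`-th component of a
tangent vector is a linear combination of the components in the directions `t`. -/
lemma exists_tangent_coeff [CharZero K] {σ τ : Type*} [Fintype σ] [Fintype τ] (x : σ → Ω)
    (t : τ → σ) (ht : AlgebraicIndependent K (x ∘ t)) (l : σ)
    (hl : x l ∈ algSpan K (Set.range (x ∘ t))) :
    ∃ a : τ → algSpan K (Set.range (x ∘ t)), ∀ u : σ → Ω,
      (∀ F : MvPolynomial σ K, MvPolynomial.aeval x F = 0 → dirDeriv x u F = 0) →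
      u l = ∑ m, (a m : Ω) * u (t m) := by
  let B := MvPolynomial τ K
  let f : B →+* Ω := (MvPolynomial.aeval (x ∘ t) : B →ₐ[K] Ω).toRingHom
  let g : B →+* MvPolynomial σ K := (MvPolynomial.rename t : B →ₐ[K] MvPolynomial σ K).toRingHom
  have hf : Function.Injective f := ht
  have hfA : ∀ b, f b ∈ algSpan K (Set.range (x ∘ t)) := by
    intro b
    have : f b ∈ Algebra.adjoin K (Set.range (x ∘ t)) := by
      rw [Algebra.adjoin_range_eq_range_aeval]
      exact ⟨b, rfl⟩
    exact (Algebra.adjoin_le (S := (algSpan K (Set.range (x ∘ t))).toSubalgebra)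
      (subset_algSpan _)) this
  have hev : ∀ p : Polynomial B, MvPolynomial.aeval x (p.eval₂ g (MvPolynomial.X l)) =
      p.eval₂ f (x l) := by
    intro p
    rw [← AlgHom.coe_toRingHom, Polynomial.hom_eval₂]
    congr 1
    · ext <;> simp [f, g]
    · simp
  -- Chain rule for `p(x l)`, where the coefficients of `p` are polynomials in the coordinates `t`:
  -- the first term comes from the variable, the sum from the coefficients.
  have hder : ∀ p : Polynomial B, ∃ b : τ → algSpan K (Set.range (x ∘ t)), ∀ u : σ → Ω,
      dirDeriv x u (p.eval₂ g (MvPolynomial.X l)) =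
        (Polynomial.derivative p).eval₂ f (x l) * u l + ∑ m, (b m : Ω) * u (t m) := by
    intro p
    induction p using Polynomial.induction_on' with
    | add p q hp hq =>
      obtain ⟨b, hb⟩ := hp
      obtain ⟨c, hc⟩ := hq
      refine ⟨b + c, fun u => ?_⟩
      rw [Polynomial.eval₂_add, map_add, hb, hc, Polynomial.derivative_add, Polynomial.eval₂_add]
      simp only [Pi.add_apply, IntermediateField.coe_add, add_mul, Finset.sum_add_distrib]
      ring
    | monomial N c =>
      refine ⟨fun m => ⟨x l ^ N, pow_mem hl N⟩ * ⟨f (MvPolynomial.pderiv m c), hfA _⟩,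
        fun u => ?_⟩
      rw [Polynomial.eval₂_monomial, dirDeriv_mul]
      have h1 : dirDeriv x u (g c) = ∑ m, f (MvPolynomial.pderiv m c) * u (t m) :=
        dirDeriv_rename x u t c
      have h2 : ∀ N : ℕ, dirDeriv x u (MvPolynomial.X l ^ N : MvPolynomial σ K) =
          N * x l ^ (N - 1) * u l := by
        intro N
        induction N with
        | zero => rw [pow_zero, ← MvPolynomial.C_1, dirDeriv_C]; simp
        | succ N ih =>
          rw [pow_succ, dirDeriv_mul, ih, dirDeriv_X]
          rcases N with _ | N
          · simp
          · simp only [map_pow, MvPolynomial.aeval_X, Nat.add_sub_cancel]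
            push_cast
            ring
      have h3 : MvPolynomial.aeval x (g c) = f c := MvPolynomial.aeval_rename _ _ _
      rw [h1, h2, h3, Polynomial.derivative_monomial, Polynomial.eval₂_monomial, map_mul,
        map_natCast]
      simp only [map_pow, MvPolynomial.aeval_X, IntermediateField.coe_mul, Finset.mul_sum]
      congr 1
      · ring
      · exact Finset.sum_congr rfl fun m _ => by ring
  have hex : ∃ p : Polynomial B, p ≠ 0 ∧ p.eval₂ f (x l) = 0 := by
    obtain ⟨p, hp, hp0⟩ := mem_algSpan_iff_adjoin.mp hl
    let e := ht.aevalEquiv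
    refine ⟨p.map e.symm.toRingEquiv.toRingHom,
      (Polynomial.map_ne_zero_iff e.symm.injective).mpr hp, ?_⟩
    rw [Polynomial.eval₂_map, ← hp0, Polynomial.aeval_def]
    congr 1
    ext y
    obtain ⟨y, rfl⟩ := e.surjective y
    change f (e.symm (e y)) = _
    rw [e.symm_apply_apply]
    rfl
  obtain ⟨p, ⟨hp, hp0⟩, hmin⟩ := WellFounded.has_min
    (measure fun p : Polynomial B => p.natDegree).wf
    {p : Polynomial B | p ≠ 0 ∧ p.eval₂ f (x l) = 0} hex
  have hdeg : p.natDegree ≠ 0 := by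
    intro h0
    rw [Polynomial.eq_C_of_natDegree_eq_zero h0, Polynomial.eval₂_C] at hp0
    rw [Polynomial.eq_C_of_natDegree_eq_zero h0] at hp
    exact hp (by rw [(map_eq_zero_iff f hf).mp hp0, map_zero])
  -- `p` has minimal degree among the relations of `x l`, so `p'` does not vanish there; `p' ≠ 0`
  -- uses characteristic zero.
  have hp' : (Polynomial.derivative p).eval₂ f (x l) ≠ 0 := by
    intro h0
    refine hmin _ ⟨?_, h0⟩ (Polynomial.natDegree_derivative_lt hdeg)
    intro h1
    exact hdeg (Polynomial.derivative_eq_zero.mp h1)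
  obtain ⟨b, hb⟩ := hder p
  have hpA : (Polynomial.derivative p).eval₂ f (x l) ∈ algSpan K (Set.range (x ∘ t)) := by
    rw [Polynomial.eval₂_eq_sum]
    exact sum_mem fun N _ => mul_mem (hfA _) (pow_mem hl N)
  refine ⟨fun m => -(⟨_, hpA⟩⁻¹ * b m), fun u hu => ?_⟩
  have h1 := hu _ ((hev p).trans hp0)
  rw [hb] at h1
  have h2 : u l = -(((Polynomial.derivative p).eval₂ f (x l))⁻¹ * ∑ m, (b m : Ω) * u (t m)) := by
    field_simp
    linear_combination h1
  rw [h2, Finset.mul_sum, ← Finset.sum_neg_distrib]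
  refine Finset.sum_congr rfl fun m _ => ?_
  simp only [IntermediateField.coe_neg, IntermediateField.coe_mul, IntermediateField.coe_inv]
  ring

/-- A tangent vector is determined by its components along `t`, with coefficients algebraic over
`K(x ∘ t)`. The conditions on `v` become a square linear system with the nonzero solution `u ∘ t`,
so its determinant vanishes. As a polynomial in `v` this determinant is nonzero, whence `v` is
dependent over the algebraic closure of `K(x ∘ t)` in `Ω`. -/
lemma not_algebraicIndependent_of_tangent [CharZero K] {n d : ℕ} (x u : Fin (n + 1) → Ω)
    (i : Fin (n + 1)) (hi : x i = 1) (t : Fin d → Fin (n + 1))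
    (hall : ∀ l, x l ∈ algSpan K (Set.range (x ∘ t)))
    (htan : ∀ F : MvPolynomial (Fin (n + 1)) K, MvPolynomial.aeval x F = 0 → dirDeriv x u F = 0)
    (hu : u ≠ 0) (v : Fin d × Fin n → Ω)
    (hv : ∀ j, ∑ l, v (j, l) * u (i.succAbove l) = 0) :
    ¬ AlgebraicIndependent K (Sum.elim v (x ∘ t)) := by
  intro hind
  have ht : AlgebraicIndependent K (x ∘ t) := by
    have := hind.comp Sum.inr Sum.inr_injective
    simpa using this
  have hvA := hind.algSpan_of_sumElim
  have h0 : ∀ l, ∃ a : Fin d → algSpan K (Set.range (x ∘ t)),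
      u l = ∑ m, (a m : Ω) * u (t m) ∧ ∀ j, t j = l → a = Pi.single j 1 := by
    intro l
    by_cases hl : ∃ j, t j = l
    · obtain ⟨j, rfl⟩ := hl
      refine ⟨Pi.single j 1, ?_, fun j' hj' => ?_⟩
      · rw [Finset.sum_eq_single j]
        · simp
        · intro m _ hm
          simp [hm]
        · simp
      · have : j' = j := ht.injective (by simp [hj'])
        rw [this]
    · obtain ⟨a, ha⟩ := exists_tangent_coeff x t ht l (hall l)
      exact ⟨a, ha u htan, fun j hj => (hl ⟨j, hj⟩).elim⟩
  choose a ha ha' using h0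
  have hti : ∀ j, t j ≠ i := fun j hj => by
    have := ht.transcendental j
    simp only [Function.comp_apply, hj, hi] at this
    exact this isAlgebraic_one
  let P : MvPolynomial (Fin d × Fin n) (algSpan K (Set.range (x ∘ t))) :=
    (Matrix.of fun j m : Fin d => ∑ l : Fin n,
      MvPolynomial.X (j, l) * MvPolynomial.C (a (i.succAbove l) m)).det
  have hP : P ≠ 0 := by
    intro h1
    classical
    -- Taking for `v_j` the coordinate covector of `t j` turns the matrix into the identity, since
    -- the coefficients of `u (t j)` were chosen to be a unit vector.
    have h2 := congrArg (MvPolynomial.eval fun p : Fin d × Fin n =>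
      if i.succAbove p.2 = t p.1 then (1 : algSpan K (Set.range (x ∘ t))) else 0) h1
    rw [map_zero, RingHom.map_det] at h2
    have h3 : (RingHom.mapMatrix (MvPolynomial.eval fun p : Fin d × Fin n =>
        if i.succAbove p.2 = t p.1 then (1 : algSpan K (Set.range (x ∘ t))) else 0))
        (Matrix.of fun j m : Fin d => ∑ l : Fin n,
          MvPolynomial.X (j, l) * MvPolynomial.C (a (i.succAbove l) m)) = 1 := by
      ext j m
      obtain ⟨l, hl⟩ := Fin.exists_succAbove_eq (hti j)
      simp only [RingHom.mapMatrix_apply, Matrix.map_apply, Matrix.of_apply, map_sum, map_mul,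
        MvPolynomial.eval_X, MvPolynomial.eval_C]
      rw [Finset.sum_eq_single l]
      · rw [if_pos hl, one_mul, ha' _ j hl.symm, Matrix.one_apply, Pi.single_apply]
        simp only [eq_comm]
      · intro l' _ hl'
        rw [if_neg, zero_mul]
        intro h4
        exact hl' (Fin.succAbove_right_injective (h4.trans hl.symm))
      · simp
    rw [h3, Matrix.det_one] at h2
    exact one_ne_zero h2
  refine hP (hvA.eq_zero_of_aeval_eq_zero P ?_)
  rw [← AlgHom.coe_toRingHom, RingHom.map_det]
  refine Matrix.exists_mulVec_eq_zero_iff.mp ⟨fun m => u (t m), ?_, ?_⟩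
  · intro h1
    refine hu (funext fun l => ?_)
    rw [ha l]
    exact Finset.sum_eq_zero fun m _ => by rw [congrFun h1 m]; simp
  · ext j
    simp only [Matrix.mulVec, dotProduct, RingHom.mapMatrix_apply, Matrix.map_apply,
      Matrix.of_apply, Pi.zero_apply]
    rw [← hv j]
    simp only [RingHom.coe_coe, map_sum, map_mul, MvPolynomial.aeval_X,
      MvPolynomial.aeval_C, Finset.sum_mul]
    rw [Finset.sum_comm]
    refine Finset.sum_congr rfl fun l _ => ?_
    rw [ha (i.succAbove l), Finset.mul_sum]
    exact Finset.sum_congr rfl fun m _ => by rw [mul_assoc]; rfl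

end TangentDependence

/-! ### Jets of linear systems that are not transversal -/

section Jets

variable {V : Type u} [CommRing V] {n : ℕ}

/-- The vector `x` satisfies all the equations in `I`. -/
def IsZeroOf (I : Ideal (MvPolynomial (Fin (n + 1)) V)) {A : Type*} [CommRing A] [Algebra V A]
    (x : Fin (n + 1) → A) : Prop :=
  ∀ F ∈ I, MvPolynomial.aeval x F = 0

/-- The vector `u` is tangent at `x` to the scheme defined by `I`. -/
def IsTangentTo (I : Ideal (MvPolynomial (Fin (n + 1)) V)) {A : Type*} [CommRing A] [Algebra V A]
    (x u : Fin (n + 1) → A) : Prop :=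
  ∀ F ∈ I, dirDeriv x u F = 0

/-- The generic fibre of the scheme defined by `I` has dimension at most `d`, and the tangent space
at a generic point of a `d`-dimensional component is the tangent space of that component. -/
def GenericFibreBound (K : Type u) [Field K] [Algebra V K] (d : ℕ)
    (I : Ideal (MvPolynomial (Fin (n + 1)) V)) : Prop :=
  ∀ (Ω : Type u) [Field Ω] [Algebra V Ω] [Algebra K Ω] [IsScalarTower V K Ω]
    (x : Fin (n + 1) → Ω) (i : Fin (n + 1)), x i = 1 → IsZeroOf I x →
    (∀ s : Finset (Fin (n + 1)), AlgebraicIndependent K (fun j : s => x j) → s.card ≤ d) ∧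
    (∀ t : Fin d → Fin (n + 1), AlgebraicIndependent K (x ∘ t) → ∀ u : Fin (n + 1) → Ω, u i = 0 →
      IsTangentTo I x u → ∀ G : MvPolynomial (Fin (n + 1)) V, MvPolynomial.aeval x G = 0 →
        dirDeriv x u G = 0)

/-- A coordinate transcendental over `x ∘ t` would give `d + 1` independent ones. -/
lemma mem_algSpan_of_card_bound {k Ω ι : Type*} [Field k] [Field Ω] [Algebra k Ω]
    {d : ℕ} (x : ι → Ω)
    (h : ∀ s : Finset ι, AlgebraicIndependent k (fun j : s => x j) → s.card ≤ d)
    (t : Fin d → ι) (ht : AlgebraicIndependent k (x ∘ t)) (l : ι) :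
    x l ∈ algSpan k (Set.range (x ∘ t)) := by
  classical
  by_contra hl
  have hinj : Function.Injective t := Function.Injective.of_comp ht.injective
  have h1 : AlgebraicIndepOn k x (Set.range t) :=
    (algebraicIndependent_equiv' (R := k) (Equiv.ofInjective t hinj) rfl).mp ht
  have hlt : l ∉ Set.range t := by
    rintro ⟨j, rfl⟩
    exact hl (subset_algSpan _ ⟨j, rfl⟩)
  have h2 : AlgebraicIndepOn k x (insert l (Set.range t)) := by
    rw [AlgebraicIndepOn.insert_iff hlt]
    refine ⟨h1, fun h3 => hl (mem_algSpan_iff_adjoin.mpr ?_)⟩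
    rwa [Set.range_comp]
  have h3 : insert l (Set.range t) = ((insert l (Finset.univ.image t) : Finset ι) : Set ι) := by
    ext; simp
  rw [h3] at h2
  have h4 := h _ h2
  rw [Finset.card_insert_of_notMem (by simpa using hlt),
    Finset.card_image_of_injective _ hinj] at h4
  simp at h4

/-- If every nonzero polynomial failed to vanish somewhere on the family of degenerate jets over the
algebraic closure, the family would have a generic member with `v` and `x ∘ t` independent. Such an
`x` is generic on a `d`-dimensional component, so `GenericFibreBound` makes `u` tangent to that
component, contradicting `not_algebraicIndependent_of_tangent`. A polynomial vanishing on the family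
thus exists and is then made primitive. -/
lemma exists_jet_equation [IsDomain V] [ValuationRing V] {K : Type u} [Field K] [Algebra V K]
    [IsFractionRing V K] [CharZero K] {d : ℕ} {I : Ideal (MvPolynomial (Fin (n + 1)) V)}
    (hI : GenericFibreBound K d I) {k : Type*} [Field k] (r : V →+* k) (i : Fin (n + 1))
    (t : Fin d → Fin (n + 1)) :
    ∃ E : MvPolynomial ((Fin d × Fin n) ⊕ Fin d) V, MvPolynomial.map r E ≠ 0 ∧
      ∀ (κ : Type u) [Field κ] [Algebra V κ] [Algebra K κ] [IsScalarTower V K κ]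
        [Algebra.IsAlgebraic K κ] (x u : Fin (n + 1) → κ) (v : Fin d × Fin n → κ), x i = 1 →
        u i = 0 → u ≠ 0 → IsZeroOf I x → IsTangentTo I x u →
        (∀ j, ∑ l, v (j, l) * u (i.succAbove l) = 0) →
        MvPolynomial.aeval (Sum.elim v (x ∘ t)) E = 0 := by
  let Kb := AlgebraicClosure K
  have : IsScalarTower V K Kb := inferInstance
  let ι := {p : (Fin (n + 1) → Kb) × (Fin (n + 1) → Kb) × (Fin d × Fin n → Kb) //
    p.1 i = 1 ∧ p.2.1 i = 0 ∧ p.2.1 ≠ 0 ∧ IsZeroOf I p.1 ∧ IsTangentTo I p.1 p.2.1 ∧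
    (∀ j, ∑ l, p.2.2 (j, l) * p.2.1 (i.succAbove l) = 0)}
  have key : ∃ f : MvPolynomial ((Fin d × Fin n) ⊕ Fin d) K, f ≠ 0 ∧
      ∀ p : ι, MvPolynomial.aeval (Sum.elim p.1.2.2 (p.1.1 ∘ t)) f = 0 := by
    by_contra hcon
    push Not at hcon
    obtain ⟨Ω, _, _, _, _, φ, hφ⟩ := exists_generic_point (k := K) (E := Kb) (ι := ι)
      (fun s p => Sum.elim p.1.2.2 (p.1.1 ∘ t) s) (fun f hf => hcon f hf)
    let : Algebra V Ω := ((algebraMap K Ω).comp (algebraMap V K)).toAlgebra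
    have : IsScalarTower V K Ω := IsScalarTower.of_algebraMap_eq fun _ => rfl
    have : IsScalarTower V Kb Ω := IsScalarTower.of_algebraMap_eq fun a => by
      rw [IsScalarTower.algebraMap_apply V K Kb, ← IsScalarTower.algebraMap_apply K Kb Ω]
      rfl
    let φV : (ι → Kb) →ₐ[V] Ω := φ.restrictScalars V
    let x : Fin (n + 1) → Ω := fun l => φ fun p => p.1.1 l
    let u : Fin (n + 1) → Ω := fun l => φ fun p => p.1.2.1 l
    let v : Fin d × Fin n → Ω := fun s => φ fun p => p.1.2.2 s
    have hxi : x i = 1 := by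
      rw [← map_one φ]
      exact congrArg φ (funext fun p => p.2.1)
    have hui : u i = 0 := by
      rw [← map_zero φ]
      exact congrArg φ (funext fun p => p.2.2.1)
    have haev : ∀ F : MvPolynomial (Fin (n + 1)) V, MvPolynomial.aeval x F =
        φ fun p => MvPolynomial.aeval p.1.1 F := by
      intro F
      exact MvPolynomial.aeval_pi_algHom φV (fun l p => p.1.1 l) F
    have hder : ∀ F : MvPolynomial (Fin (n + 1)) V, dirDeriv x u F =
        φ fun p => dirDeriv p.1.1 p.1.2.1 F := by
      intro F
      simp only [dirDeriv_apply, haev]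
      rw [show (fun p : ι => ∑ l, MvPolynomial.aeval p.1.1 (MvPolynomial.pderiv l F) * p.1.2.1 l) =
        ∑ l, (fun p : ι => MvPolynomial.aeval p.1.1 (MvPolynomial.pderiv l F)) *
          fun p : ι => p.1.2.1 l by ext; simp, map_sum]
      simp only [map_mul]
      rfl
    have hx : IsZeroOf I x := fun F hF => by
      rw [haev, ← map_zero φ]
      exact congrArg φ (funext fun p => p.2.2.2.2.1 F hF)
    have hu : IsTangentTo I x u := fun F hF => by
      rw [hder, ← map_zero φ]
      exact congrArg φ (funext fun p => p.2.2.2.2.2.1 F hF)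
    have hv : ∀ j, ∑ l, v (j, l) * u (i.succAbove l) = 0 := fun j => by
      simp only [v, u, ← map_mul, ← map_sum]
      rw [← map_zero φ]
      refine congrArg φ (funext fun p => ?_)
      simpa using p.2.2.2.2.2.2 j
    -- Nonvanishing has to be expressed by an identity to pass to the generic member: at each point
    -- choose a nonzero component and multiply it by its inverse, which makes a combination of the
    -- components equal to `1`.
    have hu0 : u ≠ 0 := by
      have hc : ∀ p : ι, ∃ l, p.1.2.1 l ≠ 0 := fun p => Function.ne_iff.mp p.2.2.2.1
      choose l hl using hc
      classical
      intro h0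
      have h1 : ∑ m, φ (fun p => if l p = m then (p.1.2.1 m)⁻¹ else 0) * u m = 1 := by
        simp only [u, ← map_mul, ← map_sum]
        rw [← map_one φ]
        refine congrArg φ (funext fun p => ?_)
        simp only [Finset.sum_apply, Pi.mul_apply, Pi.one_apply]
        rw [Finset.sum_eq_single (l p)]
        · rw [if_pos rfl, inv_mul_cancel₀ (hl p)]
        · intro m _ hm
          rw [if_neg (Ne.symm hm), zero_mul]
        · simp
      rw [h0] at h1
      simp at h1
    have hind : AlgebraicIndependent K (Sum.elim v (x ∘ t)) := by
      convert hφ using 1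
      ext s
      rcases s with s | s <;> rfl
    obtain ⟨hb1, hb2⟩ := hI Ω x i hxi hx
    have ht : AlgebraicIndependent K (x ∘ t) := by
      simpa using hind.comp Sum.inr Sum.inr_injective
    refine not_algebraicIndependent_of_tangent x u i hxi t
      (mem_algSpan_of_card_bound x hb1 t ht) ?_ hu0 v hv hind
    intro F hF
    by_cases hF0 : F = 0
    · rw [hF0, map_zero]
    -- The bound speaks of polynomials over `V`, so a relation over `K` is first multiplied into
    -- `V`.
    obtain ⟨G, c, hG, hG0⟩ := exists_primitive_multiple r F hF0
    have hc : c ≠ 0 := by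
      rintro rfl
      rw [map_zero, zero_mul] at hG
      have : G = 0 := MvPolynomial.map_injective _ (IsFractionRing.injective V K)
        (hG.trans (map_zero _).symm)
      exact hG0 (by rw [this, map_zero])
    have hG1 := hb2 t ht u hui hu G (by
      rw [← MvPolynomial.aeval_map_algebraMap K, hG, map_mul, hF, mul_zero])
    rw [← dirDeriv_map (R' := K), hG, dirDeriv_mul, dirDeriv_C, mul_zero, add_zero,
      MvPolynomial.aeval_C, mul_eq_zero] at hG1
    exact hG1.resolve_left (by simpa using hc)
  obtain ⟨f, hf0, hf⟩ := key
  obtain ⟨E, c, hE, hE0⟩ := exists_primitive_multiple r f hf0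
  refine ⟨E, hE0, ?_⟩
  intro κ _ _ _ _ _ x u v hxi hui hu hx htan hv
  -- Every algebraic extension embeds in the algebraic closure, so one family over `Kb` serves for
  -- all `κ`.
  let ψ : κ →ₐ[K] Kb := IsAlgClosed.lift
  let ψV : κ →ₐ[V] Kb := ψ.restrictScalars V
  have h1 := hf ⟨(fun l => ψ (x l), fun l => ψ (u l), fun s => ψ (v s)), by simp [hxi],
    by simp [hui], fun h0 => hu (funext fun l => (map_eq_zero ψ).mp (congrFun h0 l)),
    fun F hF => by
      have := congrArg ψV (hx F hF)
      rwa [map_zero, MvPolynomial.comp_aeval_apply] at this,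
    fun F hF => by
      have := congrArg ψV (htan F hF)
      rw [map_zero, map_dirDeriv] at this
      exact this,
    fun j => by
      have := congrArg ψ (hv j)
      simpa using this⟩
  rw [← MvPolynomial.aeval_map_algebraMap K, hE, map_mul]
  have h2 : MvPolynomial.aeval (Sum.elim v (x ∘ t)) f = 0 := by
    apply ψ.injective
    rw [map_zero, ← h1]
    refine (MvPolynomial.comp_aeval_apply _ ψ f).trans ?_
    congr 2
    ext s
    rcases s with s | s <;> rfl
  rw [h2, mul_zero]

end Jets

/-! ### Generic properties of vectors -/

section Generic

variable (k : Type*) [Field k] (W : Type*) [AddCommGroup W] [Module k W]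

/-- The polynomial functions on a vector space. -/
def polyFun : Subalgebra k (W → k) :=
  Algebra.adjoin k (Set.range fun f : Module.Dual k W => (f : W → k))

variable {k W}

/-- A property of the vectors of `W` is generic if it holds where some nonzero polynomial function
does not vanish. -/
def IsGeneric (k : Type*) {W : Type*} [Field k] [AddCommGroup W] [Module k W] (S : W → Prop) :
    Prop :=
  ∃ Ψ ∈ polyFun k W, (∃ w, Ψ w ≠ 0) ∧ ∀ w, Ψ w ≠ 0 → S w

lemma dual_mem_polyFun (f : Module.Dual k W) : (f : W → k) ∈ polyFun k W :=
  Algebra.subset_adjoin ⟨f, rfl⟩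

lemma polyFun_comp_affine {W' : Type*} [AddCommGroup W'] [Module k W'] (L : W' →ₗ[k] W) (w : W)
    {Ψ : W → k} (hΨ : Ψ ∈ polyFun k W) : (fun w' => Ψ (L w' + w)) ∈ polyFun k W' := by
  induction hΨ using Algebra.adjoin_induction with
  | mem x hx =>
    obtain ⟨f, rfl⟩ := hx
    have : (fun w' => f (L w' + w)) = ((f.comp L : Module.Dual k W') : W' → k) +
        algebraMap k (W' → k) (f w) := by
      ext w'; simp
    rw [this]
    exact add_mem (dual_mem_polyFun _) (Subalgebra.algebraMap_mem _ _)
  | algebraMap c => exact Subalgebra.algebraMap_mem (polyFun k W') c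
  | add f g _ _ hf hg => exact add_mem hf hg
  | mul f g _ _ hf hg => exact mul_mem hf hg

lemma exists_polynomial_on_line {Ψ : W → k} (hΨ : Ψ ∈ polyFun k W) (w₁ w₂ : W) :
    ∃ P : Polynomial k, ∀ t, Ψ (w₁ + t • w₂) = P.eval t := by
  induction hΨ using Algebra.adjoin_induction with
  | mem x hx =>
    obtain ⟨f, rfl⟩ := hx
    exact ⟨Polynomial.C (f w₁) + Polynomial.X * Polynomial.C (f w₂), fun t => by
      simp; ring⟩
  | algebraMap c => exact ⟨Polynomial.C c, fun t => by simp⟩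
  | add f g _ _ hf hg =>
    obtain ⟨P, hP⟩ := hf
    obtain ⟨Q, hQ⟩ := hg
    exact ⟨P + Q, fun t => by simp [hP, hQ]⟩
  | mul f g _ _ hf hg =>
    obtain ⟨P, hP⟩ := hf
    obtain ⟨Q, hQ⟩ := hg
    exact ⟨P * Q, fun t => by simp [hP, hQ]⟩

/-- On the line through `w₁` and `w₂` both functions become nonzero polynomials in one variable, and
their product has a non-root because `k` is infinite. -/
lemma polyFun_mul_ne_zero [Infinite k] {Ψ Φ : W → k} (hΨ : Ψ ∈ polyFun k W)
    (hΦ : Φ ∈ polyFun k W) {w₁ w₂ : W} (h₁ : Ψ w₁ ≠ 0) (h₂ : Φ w₂ ≠ 0) :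
    ∃ w, (Ψ * Φ) w ≠ 0 := by
  obtain ⟨P, hP⟩ := exists_polynomial_on_line hΨ w₁ (w₂ - w₁)
  obtain ⟨Q, hQ⟩ := exists_polynomial_on_line hΦ w₁ (w₂ - w₁)
  have hP0 : P ≠ 0 := by
    rintro rfl
    have := hP 0
    simp at this
    exact h₁ this
  have hQ0 : Q ≠ 0 := by
    rintro rfl
    have := hQ 1
    simp at this
    exact h₂ this
  obtain ⟨t, ht⟩ : ∃ t, (P * Q).eval t ≠ 0 := by
    by_contra hcon
    push Not at hcon
    exact mul_ne_zero hP0 hQ0 (Polynomial.funext fun t => by rw [hcon t, Polynomial.eval_zero])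
  exact ⟨w₁ + t • (w₂ - w₁), by simpa [hP, hQ] using ht⟩

lemma IsGeneric.and [Infinite k] {S T : W → Prop} (hS : IsGeneric k S) (hT : IsGeneric k T) :
    IsGeneric k fun w => S w ∧ T w := by
  obtain ⟨Ψ, hΨ, ⟨w₁, h₁⟩, hΨS⟩ := hS
  obtain ⟨Φ, hΦ, ⟨w₂, h₂⟩, hΦT⟩ := hT
  exact ⟨Ψ * Φ, mul_mem hΨ hΦ, polyFun_mul_ne_zero hΨ hΦ h₁ h₂, fun w hw =>
    ⟨hΨS w fun h => hw (by simp [h]), hΦT w fun h => hw (by simp [h])⟩⟩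

lemma IsGeneric.mono {S T : W → Prop} (hS : IsGeneric k S) (h : ∀ w, S w → T w) :
    IsGeneric k T := by
  obtain ⟨Ψ, hΨ, hw, hΨS⟩ := hS
  exact ⟨Ψ, hΨ, hw, fun w hw => h w (hΨS w hw)⟩

lemma isGeneric_of_forall {S : W → Prop} (h : ∀ w, S w) : IsGeneric k S :=
  ⟨1, one_mem _, ⟨0, one_ne_zero⟩, fun w _ => h w⟩

lemma IsGeneric.forall [Infinite k] {ι : Type*} [Finite ι] {S : ι → W → Prop}
    (h : ∀ i, IsGeneric k (S i)) : IsGeneric k fun w => ∀ i, S i w := by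
  classical
  have := Fintype.ofFinite ι
  have key : ∀ s : Finset ι, IsGeneric k fun w => ∀ i ∈ s, S i w := by
    intro s
    induction s using Finset.induction_on with
    | empty => exact isGeneric_of_forall fun w i hi => by simp at hi
    | insert i s _ ih =>
      refine ((h i).and ih).mono fun w hw j hj => ?_
      rcases Finset.mem_insert.mp hj with rfl | hj
      exacts [hw.1, hw.2 j hj]
  exact (key Finset.univ).mono fun w hw i => hw i (Finset.mem_univ i)

/-- It suffices to fix the second component of a point where the polynomial function is nonzero.
This allows an auxiliary hyperplane to be chosen before the linear system. -/
lemma IsGeneric.exists_specialization {W' : Type*} [AddCommGroup W'] [Module k W']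
    {S : W × W' → Prop} (h : IsGeneric k S) : ∃ w', IsGeneric k fun w => S (w, w') := by
  obtain ⟨Ψ, hΨ, ⟨⟨w, w'⟩, hw⟩, hΨS⟩ := h
  refine ⟨w', fun w => Ψ (w, w'), ?_, ⟨w, hw⟩, fun w hw => hΨS _ hw⟩
  have := polyFun_comp_affine (LinearMap.inl k W W') (0, w') hΨ
  simpa using this

lemma eval_mem_polyFun {σ : Type*} (co : σ → Module.Dual k W) (g : MvPolynomial σ k) :
    (fun w => MvPolynomial.eval (fun s => co s w) g) ∈ polyFun k W := by
  induction g using MvPolynomial.induction_on with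
  | C c =>
    have : (fun w => MvPolynomial.eval (fun s => co s w) (MvPolynomial.C c)) =
        algebraMap k (W → k) c := by ext w; simp
    rw [this]
    exact Subalgebra.algebraMap_mem (polyFun k W) c
  | add p q hp hq =>
    simp only [map_add]
    exact add_mem hp hq
  | mul_X p s hp =>
    simp only [map_mul, MvPolynomial.eval_X]
    exact mul_mem hp (dual_mem_polyFun (co s))

/-- A property that fails only where a nonzero polynomial in independent linear coordinates
vanishes is generic. -/
lemma isGeneric_of_polynomial [Infinite k] {S : W → Prop} {σ : Type*} (co : σ → Module.Dual k W)
    (hco : ∀ c : σ → k, ∃ w, ∀ s, co s w = c s) (g : MvPolynomial σ k) (hg : g ≠ 0)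
    (h : ∀ w, ¬ S w → MvPolynomial.eval (fun s => co s w) g = 0) : IsGeneric k S := by
  refine ⟨fun w => MvPolynomial.eval (fun s => co s w) g, ?_, ?_, fun w hw => ?_⟩
  · exact eval_mem_polyFun co g
  · by_contra hcon
    push Not at hcon
    refine hg (MvPolynomial.funext fun c => ?_)
    obtain ⟨w, hw⟩ := hco c
    rw [map_zero, ← hcon w]
    exact congrArg (fun c' => MvPolynomial.eval c' g) (funext fun s => (hw s).symm)
  · by_contra hS
    exact hw (h w hS)

/-- If a property is not generic then there is a generic vector, in the sense of
`exists_generic_point`, for which it fails. -/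
lemma exists_generic_point_of_not_isGeneric {k W : Type u} [Field k] [AddCommGroup W] [Module k W]
    [Infinite k] {S : W → Prop} {σ : Type*} (co : σ → Module.Dual k W)
    (hco : ∀ c : σ → k, ∃ w, ∀ s, co s w = c s) {ι : Type u} (w : ι → W)
    (hw : ∀ w', ¬ S w' → ∃ p, w p = w') (hS : ¬ IsGeneric k S) :
    ∃ (Ω : Type u) (_ : Field Ω) (_ : Algebra k Ω) (φ : (ι → k) →ₐ[k] Ω),
      AlgebraicIndependent k fun s => φ fun p => co s (w p) := by
  obtain ⟨Ω, _, iA, iB, hT, φ, hφ⟩ := exists_generic_point (k := k) (E := k)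
    (fun s p => co s (w p)) fun f hf => by
      by_contra hcon
      push Not at hcon
      refine hS (isGeneric_of_polynomial co hco f hf fun w' hw' => ?_)
      obtain ⟨p, rfl⟩ := hw w' hw'
      exact hcon p
  -- With `E = k` the field `Ω` arrives with two `k`-algebra structures, which the tower condition
  -- identifies.
  have : iA = iB := Algebra.algebra_ext _ _ fun c => by
    have h := hT.smul_assoc c 1 1
    rw [smul_eq_mul, mul_one, one_smul, @Algebra.smul_def k Ω _ _ iB,
      @Algebra.smul_def k Ω _ _ iA, mul_one, mul_one] at h
    exact h.symm
  subst this
  exact ⟨Ω, _, _, φ, hφ⟩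

end Generic

/-! ### Generic systems of quadrics through a point -/

section QuadricsThrough

variable {k : Type u} [Field k] {n : ℕ}

/-- The quadratic forms that vanish at `p`. -/
noncomputable def quadricsThrough (p : Fin (n + 1) → k) :
    Submodule k (MvPolynomial (Fin (n + 1)) k) :=
  MvPolynomial.homogeneousSubmodule (Fin (n + 1)) k 2 ⊓
    LinearMap.ker (MvPolynomial.aeval (R := k) p).toLinearMap

lemma mem_quadricsThrough {p : Fin (n + 1) → k} {F : MvPolynomial (Fin (n + 1)) k} :
    F ∈ quadricsThrough p ↔ F.IsHomogeneous 2 ∧ MvPolynomial.eval p F = 0 := by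
  simp [quadricsThrough, MvPolynomial.mem_homogeneousSubmodule, MvPolynomial.aeval_eq_eval]

lemma finite_homogeneousSubmodule (m : ℕ) :
    Module.Finite k (MvPolynomial.homogeneousSubmodule (Fin (n + 1)) k m) := by
  have h : MvPolynomial.homogeneousSubmodule (Fin (n + 1)) k m ≤
      MvPolynomial.restrictTotalDegree (Fin (n + 1)) k m := fun F hF =>
    (MvPolynomial.mem_restrictTotalDegree _ _ _).mpr (MvPolynomial.IsHomogeneous.totalDegree_le hF)
  exact Submodule.finiteDimensional_of_le h

instance finite_quadricsThrough (p : Fin (n + 1) → k) : Module.Finite k (quadricsThrough p) :=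
  have := finite_homogeneousSubmodule (k := k) (n := n) 2
  Submodule.finiteDimensional_of_le inf_le_left

/-- The linear form `x_s - p_s x_r`, which vanishes at `p` if `p_r = 1`. -/
noncomputable def lineThrough (p : Fin (n + 1) → k) (r s : Fin (n + 1)) :
    MvPolynomial (Fin (n + 1)) k :=
  MvPolynomial.X s - MvPolynomial.C (p s) * MvPolynomial.X r

lemma lineThrough_mul_X_mem {p : Fin (n + 1) → k} {r : Fin (n + 1)} (hr : p r = 1)
    (s l : Fin (n + 1)) : lineThrough p r s * MvPolynomial.X l ∈ quadricsThrough p := by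
  rw [mem_quadricsThrough]
  refine ⟨?_, by simp [lineThrough, hr]⟩
  refine MvPolynomial.IsHomogeneous.mul (m := 1) (n := 1) ?_ (MvPolynomial.isHomogeneous_X _ _)
  refine (MvPolynomial.isHomogeneous_X _ _).sub ?_
  simpa using (MvPolynomial.isHomogeneous_C _ (p s)).mul (MvPolynomial.isHomogeneous_X k r)

/-- At a point where `ℓ_s` does not vanish, the coefficients of the products `ℓ_s x_l` control the
whole first-order jet of the form. The basis elements indexed by `M` only carry free coefficients in
the parameter counts. -/
lemma exists_quadric_basis {p : Fin (n + 1) → k} {r : Fin (n + 1)} (hr : p r = 1)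
    {s : Fin (n + 1)} (hs : lineThrough p r s ≠ 0) :
    ∃ (M : Type u) (_ : Fintype M) (b : Module.Basis (Fin (n + 1) ⊕ M) k (quadricsThrough p)),
      ∀ l, (b (Sum.inl l)).1 = lineThrough p r s * MvPolynomial.X l := by
  let v : Fin (n + 1) → quadricsThrough p := fun l => ⟨_, lineThrough_mul_X_mem hr s l⟩
  have hv : LinearIndependent k v := by
    refine LinearIndependent.of_comp (quadricsThrough p).subtype ?_
    have h1 := (MvPolynomial.linearIndependent_X (Fin (n + 1)) k).map'
      (LinearMap.mulLeft k (lineThrough p r s)) (LinearMap.ker_eq_bot.mpr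
        (mul_right_injective₀ hs))
    exact h1
  let b := Module.Basis.sumExtend hv
  have := Module.Finite.finite_basis b
  have : Finite (Module.Basis.sumExtendIndex hv) := Finite.sum_right (Fin (n + 1))
  refine ⟨_, Fintype.ofFinite _, b, fun l => ?_⟩
  have : b (Sum.inl l) = v l := by
    simp [b, Module.Basis.sumExtend]
    rfl
  rw [this]

/-- The coordinates of a tuple of forms. -/
noncomputable def frameCoord {d : ℕ} {Q : Type*} [AddCommGroup Q] [Module k Q] {β : Type*}
    (b : Module.Basis β k Q) (s : Fin d × β) : Module.Dual k (Fin d → Q) :=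
  b.coord s.2 ∘ₗ LinearMap.proj s.1

lemma frameCoord_surjective {d : ℕ} {Q : Type*} [AddCommGroup Q] [Module k Q] {β : Type*} [Finite β]
    (b : Module.Basis β k Q) (c : Fin d × β → k) :
    ∃ f : Fin d → Q, ∀ s, frameCoord b s f = c s :=
  ⟨fun j => b.equivFun.symm fun m => c (j, m), fun s => by
    simp [frameCoord, ← Module.Basis.equivFun_apply]⟩

variable {Ω : Type u} [Field Ω] [Algebra k Ω]

lemma aeval_mem_algSpan {σ : Type*} {S : Set Ω} {x : σ → Ω} (hx : ∀ l, x l ∈ algSpan k S)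
    (G : MvPolynomial σ k) : MvPolynomial.aeval x G ∈ algSpan k S := by
  have := Subalgebra.mvPolynomial_aeval_coe (algSpan k S).toSubalgebra (fun l => ⟨x l, hx l⟩) G
  rw [this]
  exact SetLike.coe_mem _

/-- Values and derivatives are linear in the coefficients of the form; `D` is used both as the
identity and as a partial derivative. -/
lemma aeval_generic_form {d : ℕ} {Q : Submodule k (MvPolynomial (Fin (n + 1)) k)} {β : Type*}
    [Fintype β] (b : Module.Basis β k Q) {ι : Type*} (f : ι → Fin d → Q)
    (q : ι → Fin (n + 1) → k) (φ : (ι → k) →ₐ[k] Ω)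
    (D : MvPolynomial (Fin (n + 1)) k →ₗ[k] MvPolynomial (Fin (n + 1)) k) (j : Fin d) :
    φ (fun a => MvPolynomial.eval (q a) (D (f a j))) =
      ∑ m, φ (fun a => frameCoord b (j, m) (f a)) *
        MvPolynomial.aeval (fun l => φ fun a => q a l) (D (b m)) := by
  have h1 : ∀ G : MvPolynomial (Fin (n + 1)) k,
      MvPolynomial.aeval (fun l => φ fun a => q a l) G = φ fun a => MvPolynomial.aeval (q a) G :=
    fun G => MvPolynomial.aeval_pi_algHom φ (fun l a => q a l) G
  simp only [h1, ← map_mul, ← map_sum]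
  refine congrArg φ (funext fun a => ?_)
  have h2 : ((f a j : Q) : MvPolynomial (Fin (n + 1)) k) =
      ∑ m, frameCoord b (j, m) (f a) • (b m : MvPolynomial (Fin (n + 1)) k) := by
    have h := congrArg Q.subtype (b.sum_repr (f a j)).symm
    rw [map_sum] at h
    exact h
  rw [h2]
  simp [MvPolynomial.smul_eval, MvPolynomial.aeval_eq_eval]

/-- The zeros of `I` over extensions of `k` have transcendence degree at most `d`. -/
def ZeroBound (d : ℕ) (I : Ideal (MvPolynomial (Fin (n + 1)) k)) : Prop :=
  ∀ (Ω : Type u) [Field Ω] [Algebra k Ω] (x : Fin (n + 1) → Ω) (i : Fin (n + 1)), x i = 1 →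
    IsZeroOf I x → ∀ s : Finset (Fin (n + 1)), AlgebraicIndependent k (fun j : s => x j) →
      s.card ≤ d

lemma ZeroBound.exists_tuple {d : ℕ} {I : Ideal (MvPolynomial (Fin (n + 1)) k)}
    (hI : ZeroBound d I) (x : Fin (n + 1) → Ω) (i : Fin (n + 1)) (hi : x i = 1)
    (hx : IsZeroOf I x) :
    ∃ t : Fin d → Fin (n + 1), ∀ l, x l ∈ algSpan k (Set.range (x ∘ t)) := by
  obtain ⟨s, hs, hsp⟩ := exists_finset_algSpan (k := k) x
  have hc := hI Ω x i hi hx s hs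
  let e := s.equivFin
  -- When fewer than `d` coordinates suffice, the tuple is filled up with the index `i`; only the
  -- span matters.
  refine ⟨fun j => if h : j.1 < s.card then (e.symm ⟨j, h⟩ : Fin (n + 1)) else i, fun l => ?_⟩
  refine algSpan_mono ?_ (hsp l)
  rintro _ ⟨a, ha, rfl⟩
  refine ⟨⟨e ⟨a, ha⟩, (e ⟨a, ha⟩).2.trans_le hc⟩, ?_⟩
  simp

lemma sum_aeval_mul_X (x c : Fin (n + 1) → Ω) (F : MvPolynomial (Fin (n + 1)) k) :
    ∑ l, c l * MvPolynomial.aeval x (F * MvPolynomial.X l) =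
      MvPolynomial.aeval x F * ∑ l, c l * x l := by
  rw [Finset.mul_sum]
  refine Finset.sum_congr rfl fun l _ => ?_
  rw [map_mul, MvPolynomial.aeval_X]
  ring

lemma sum_aeval_pderiv_mul_X (x c : Fin (n + 1) → Ω) (F : MvPolynomial (Fin (n + 1)) k)
    (a : Fin (n + 1)) :
    ∑ l, c l * MvPolynomial.aeval x (MvPolynomial.pderiv a (F * MvPolynomial.X l)) =
      MvPolynomial.aeval x (MvPolynomial.pderiv a F) * (∑ l, c l * x l) +
        MvPolynomial.aeval x F * c a := by
  have h1 : ∀ l, c l * MvPolynomial.aeval x (MvPolynomial.pderiv a (F * MvPolynomial.X l)) =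
      c l * MvPolynomial.aeval x (MvPolynomial.pderiv a F * MvPolynomial.X l) +
        (if l = a then MvPolynomial.aeval x F * c l else 0) := fun l => by
    rw [Derivation.leibniz, MvPolynomial.pderiv_X, Pi.single_apply]
    split_ifs with h
    · simp
      ring
    · simp [mul_comm]
  rw [Finset.sum_congr rfl fun l _ => h1 l, Finset.sum_add_distrib, sum_aeval_mul_X]
  simp

lemma det_mem_polyFun {W : Type*} [AddCommGroup W] [Module k W] {m : ℕ}
    (mat : Fin m → Fin m → Module.Dual k W) :
    (fun w => (Matrix.of fun a b => mat a b w).det) ∈ polyFun k W := by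
  have h1 : (fun w => (Matrix.of fun a b => mat a b w).det) = ∑ σ : Equiv.Perm (Fin m),
      algebraMap k (W → k) ((Equiv.Perm.sign σ : ℤ) : k) *
        ∏ a, ((mat (σ a) a : Module.Dual k W) : W → k) := by
    ext w
    rw [Matrix.det_apply']
    simp
  rw [h1]
  exact sum_mem fun σ _ => mul_mem (Subalgebra.algebraMap_mem _ _)
    (prod_mem fun a _ => dual_mem_polyFun _)

/-- Generic vectors have images of maximal rank under a linear map. -/
lemma isGeneric_finrank_quotient_span_le {Q T : Type u} [AddCommGroup Q] [Module k Q]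
    [AddCommGroup T] [Module k T] [Module.Finite k T] (Λ : Q →ₗ[k] T)
    (hΛ : Function.Surjective Λ) {d c : ℕ} (hT : Module.finrank k T ≤ d + c) :
    IsGeneric k fun f : Fin d → Q =>
      Module.finrank k (T ⧸ Submodule.span k (Set.range (Λ ∘ f))) ≤ c := by
  classical
  -- `m` is the largest possible rank. The `m × m` minor below is a polynomial function of the
  -- tuple, and equals `1` when the first `m` vectors are preimages of the first `m` basis vectors.
  let m := min d (Module.finrank k T)
  let β := Module.finBasis k T
  let ed : Fin m → Fin d := Fin.castLE (min_le_left _ _)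
  let eT : Fin m → Fin (Module.finrank k T) := Fin.castLE (min_le_right _ _)
  let mat : (Fin d → Q) → Matrix (Fin m) (Fin m) k := fun f a b => β.repr (Λ (f (ed a))) (eT b)
  have hed : Function.Injective ed := Fin.castLE_injective _
  have heT : Function.Injective eT := Fin.castLE_injective _
  refine ⟨fun f => (mat f).det, ?_, ?_, fun f hf => ?_⟩
  · exact det_mem_polyFun fun a b => β.coord (eT b) ∘ₗ Λ ∘ₗ
      (LinearMap.proj (ed a) : (Fin d → Q) →ₗ[k] Q)
  · have h1 : ∀ a, ∃ x, Λ x = β (eT a) := fun a => hΛ _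
    choose g hg using h1
    refine ⟨Function.extend ed g 0, ?_⟩
    have h2 : mat (Function.extend ed g 0) = 1 := by
      ext a b
      simp only [mat, hed.extend_apply, hg, Module.Basis.repr_self, Matrix.one_apply,
        Finsupp.single_apply, heT.eq_iff]
    simp only [h2, Matrix.det_one]
    exact one_ne_zero
  · have h1 : LinearIndependent k (Λ ∘ f ∘ ed) := by
      have h2 : LinearIndependent k (mat f).row :=
        Matrix.linearIndependent_rows_of_det_ne_zero hf
      refine LinearIndependent.of_comp
        ((LinearMap.funLeft k k eT) ∘ₗ β.equivFun.toLinearMap) ?_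
      exact h2
    have h3 : m ≤ Module.finrank k (Submodule.span k (Set.range (Λ ∘ f))) := by
      have h4 := finrank_span_eq_card h1
      rw [Fintype.card_fin] at h4
      rw [← h4]
      refine Submodule.finrank_mono (Submodule.span_mono ?_)
      rintro _ ⟨a, rfl⟩
      exact ⟨ed a, rfl⟩
    have h5 := Submodule.finrank_quotient_add_finrank
      (Submodule.span k (Set.range (Λ ∘ f)))
    lia

variable [Infinite k]

/-- A generic system of quadrics through `p` does not have a prescribed algebraic relation between
the coordinates and derivatives at any of its zeros outside the line `ℓ_s = 0`. -/
lemma isGeneric_not_relation {d : ℕ} {I : Ideal (MvPolynomial (Fin (n + 1)) k)}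
    (hI : ZeroBound d I) {p : Fin (n + 1) → k} {r : Fin (n + 1)} (hr : p r = 1)
    (E : (Fin d → Fin (n + 1)) → MvPolynomial ((Fin d × Fin n) ⊕ Fin d) k) (hE : ∀ t, E t ≠ 0)
    (i s : Fin (n + 1)) :
    IsGeneric k fun f : Fin d → quadricsThrough p => ∀ q : Fin (n + 1) → k, q i = 1 →
      IsZeroOf I q → MvPolynomial.eval q (lineThrough p r s) ≠ 0 →
      (∀ j, MvPolynomial.eval q (f j).1 = 0) →
      ∃ t, MvPolynomial.eval (Sum.elim (fun a : Fin d × Fin n =>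
        MvPolynomial.eval q (MvPolynomial.pderiv (i.succAbove a.2) (f a.1).1)) (q ∘ t)) (E t) ≠ 0 := by
  by_cases hs : lineThrough p r s = 0
  · exact isGeneric_of_forall fun f q _ _ h => (h (by rw [hs, map_zero])).elim
  obtain ⟨M, _, b, hb⟩ := exists_quadric_basis hr hs
  by_contra hcon
  let ι := {a : (Fin d → quadricsThrough p) × (Fin (n + 1) → k) // a.2 i = 1 ∧ IsZeroOf I a.2 ∧
    MvPolynomial.eval a.2 (lineThrough p r s) ≠ 0 ∧ (∀ j, MvPolynomial.eval a.2 (a.1 j).1 = 0) ∧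
    ∀ t, MvPolynomial.eval (Sum.elim (fun c : Fin d × Fin n =>
      MvPolynomial.eval a.2 (MvPolynomial.pderiv (i.succAbove c.2) (a.1 c.1).1)) (a.2 ∘ t)) (E t) = 0}
  obtain ⟨Ω, _, _, φ, hφ⟩ := exists_generic_point_of_not_isGeneric (frameCoord b)
    (frameCoord_surjective b) (fun a : ι => a.1.1) (fun f hf => by
      push Not at hf
      obtain ⟨q, h1, h2, h3, h4, h5⟩ := hf
      exact ⟨⟨(f, q), h1, h2, h3, h4, h5⟩, rfl⟩) hcon
  let x : Fin (n + 1) → Ω := fun l => φ fun a => a.1.2 l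
  have haev : ∀ G : MvPolynomial (Fin (n + 1)) k,
      MvPolynomial.aeval x G = φ fun a => MvPolynomial.aeval a.1.2 G :=
    fun G => MvPolynomial.aeval_pi_algHom φ (fun l (a : ι) => a.1.2 l) G
  let c : Fin d × (Fin (n + 1) ⊕ M) → Ω := fun s => φ fun a => frameCoord b s a.1.1
  let v : Fin d × Fin n → Ω := fun a' => φ fun a =>
    MvPolynomial.eval a.1.2 (MvPolynomial.pderiv (i.succAbove a'.2) (a.1.1 a'.1).1)
  have hxi : x i = 1 := by
    rw [← map_one φ]
    exact congrArg φ (funext fun a => a.2.1)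
  have hx : IsZeroOf I x := fun F hF => by
    rw [haev, ← map_zero φ]
    exact congrArg φ (funext fun a => a.2.2.1 F hF)
  let lam : Ω := MvPolynomial.aeval x (lineThrough p r s)
  have hlam : lam ≠ 0 := by
    have h1 : lam * φ (fun a => (MvPolynomial.eval a.1.2 (lineThrough p r s))⁻¹) = 1 := by
      rw [show lam = _ from haev _, ← map_mul, ← map_one φ]
      exact congrArg φ (funext fun a => mul_inv_cancel₀ a.2.2.2.1)
    exact left_ne_zero_of_mul_eq_one h1
  obtain ⟨t, ht⟩ := hI.exists_tuple x i hxi hx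
  -- The new parameters: the jets `v` (`dn` of them), `d` coordinates of `x`, and the free
  -- coefficients (`d|M|`). Their number `d(n + 1 + |M|)` is that of the coefficients of the `d`
  -- forms, and the old coefficients are shown to be algebraic over them.
  let w : ((Fin d × Fin n) ⊕ Fin d) ⊕ (Fin d × M) → Ω :=
    Sum.elim (Sum.elim v (x ∘ t)) fun s => c (s.1, Sum.inr s.2)
  have hvw : ∀ a, v a ∈ algSpan k (Set.range w) := fun a =>
    subset_algSpan _ ⟨Sum.inl (Sum.inl a), rfl⟩
  have hcw : ∀ j m, c (j, Sum.inr m) ∈ algSpan k (Set.range w) := fun j m =>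
    subset_algSpan _ ⟨Sum.inr (j, m), rfl⟩
  have hxw : ∀ l, x l ∈ algSpan k (Set.range w) := fun l => by
    refine algSpan_mono ?_ (ht l)
    rintro _ ⟨j, rfl⟩
    exact ⟨Sum.inl (Sum.inr j), rfl⟩
  have hGw : ∀ G : MvPolynomial (Fin (n + 1)) k, MvPolynomial.aeval x G ∈ algSpan k (Set.range w) :=
    aeval_mem_algSpan hxw
  have hF : ∀ j, lam * ∑ l, c (j, Sum.inl l) * x l +
      ∑ m, c (j, Sum.inr m) * MvPolynomial.aeval x (b (Sum.inr m)).1 = 0 := fun j => by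
    have h1 := aeval_generic_form b (fun a : ι => a.1.1) (fun a => a.1.2) φ LinearMap.id j
    have h2 : φ (fun a : ι => MvPolynomial.eval a.1.2 (LinearMap.id (R := k) (a.1.1 j).1)) = 0 := by
      rw [← map_zero φ]
      exact congrArg φ (funext fun a => a.2.2.2.2.1 j)
    rw [h2, Fintype.sum_sum_type] at h1
    rw [h1]
    refine congrArg₂ _ ((sum_aeval_mul_X x (fun l => c (j, Sum.inl l)) _).symm.trans ?_) rfl
    exact Finset.sum_congr rfl fun l _ => by rw [← hb]; rfl
  -- The equation `f_j(x) = 0` determines the linear form that multiplies `ℓ_s`, since `ℓ_s(x) ≠ 0`.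
  have hS : ∀ j, ∑ l, c (j, Sum.inl l) * x l ∈ algSpan k (Set.range w) := fun j => by
    have h1 : ∑ l, c (j, Sum.inl l) * x l =
        -(∑ m, c (j, Sum.inr m) * MvPolynomial.aeval x (b (Sum.inr m)).1) / lam := by
      rw [eq_div_iff hlam, mul_comm]
      exact eq_neg_of_add_eq_zero_left (hF j)
    rw [h1]
    exact div_mem (neg_mem (sum_mem fun m _ => mul_mem (hcw j m) (hGw _))) (hGw _)
  -- The derivative of `f_j` in direction `a` contains the coefficient with factor `ℓ_s(x) ≠ 0`, and
  -- everything else in it is already known.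
  have hca : ∀ j a, c (j, Sum.inl (i.succAbove a)) ∈ algSpan k (Set.range w) := fun j a => by
    have h1 := aeval_generic_form b (fun a : ι => a.1.1) (fun a => a.1.2) φ
      (MvPolynomial.pderiv (i.succAbove a)).toLinearMap j
    rw [Fintype.sum_sum_type] at h1
    have h2 : v (j, a) = MvPolynomial.aeval x (MvPolynomial.pderiv (i.succAbove a)
        (lineThrough p r s)) * (∑ l, c (j, Sum.inl l) * x l) + lam * c (j, Sum.inl (i.succAbove a)) +
        ∑ m, c (j, Sum.inr m) *
          MvPolynomial.aeval x (MvPolynomial.pderiv (i.succAbove a) (b (Sum.inr m)).1) := by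
      refine h1.trans (congrArg₂ _ (Eq.trans ?_
        (sum_aeval_pderiv_mul_X x (fun l => c (j, Sum.inl l)) _ _)) rfl)
      exact Finset.sum_congr rfl fun l _ => by rw [← hb]; rfl
    have h3 : c (j, Sum.inl (i.succAbove a)) = (v (j, a) - MvPolynomial.aeval x
        (MvPolynomial.pderiv (i.succAbove a) (lineThrough p r s)) * (∑ l, c (j, Sum.inl l) * x l) -
        ∑ m, c (j, Sum.inr m) *
          MvPolynomial.aeval x (MvPolynomial.pderiv (i.succAbove a) (b (Sum.inr m)).1)) / lam := by
      rw [eq_div_iff hlam, h2]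
      ring
    rw [h3]
    exact div_mem (sub_mem (sub_mem (hvw _) (mul_mem (hGw _) (hS j)))
      (sum_mem fun m _ => mul_mem (hcw j m) (hGw _))) (hGw _)
  have hci : ∀ j, c (j, Sum.inl i) ∈ algSpan k (Set.range w) := fun j => by
    have h1 := hS j
    rw [Fin.sum_univ_succAbove _ i, hxi, mul_one] at h1
    have h2 := sub_mem h1 (sum_mem (t := Finset.univ) fun a _ => mul_mem (hca j a)
      (hxw (i.succAbove a)))
    rwa [add_sub_cancel_right] at h2
  -- The generic coefficients are independent, hence so are the new parameters; in particular `v`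
  -- and `x ∘ t` satisfy no relation `E t`.
  have hind := algebraicIndependent_of_card_le hφ w (fun ⟨j, m⟩ => by
    rcases m with l | m
    · rcases Fin.eq_self_or_eq_succAbove i l with rfl | ⟨a, rfl⟩
      exacts [hci j, hca j a]
    · exact hcw j m) (by simp; lia)
  have hind2 : AlgebraicIndependent k (Sum.elim v (x ∘ t)) :=
    hind.comp Sum.inl Sum.inl_injective
  refine hE t (hind2 ?_)
  rw [map_zero]
  have h1 := MvPolynomial.aeval_pi_algHom φ (fun s' (a : ι) => (Sum.elim (fun c : Fin d × Fin n =>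
      MvPolynomial.eval a.1.2 (MvPolynomial.pderiv (i.succAbove c.2) (a.1.1 c.1).1)) (a.1.2 ∘ t)) s')
      (E t)
  rw [← map_zero φ]
  refine Eq.trans ?_ (h1.trans (congrArg φ (funext fun a => a.2.2.2.2.2 t)))
  congr 2
  ext s'
  rcases s' with s' | s' <;> rfl

/-- The common zeros of `I` and `d` generic quadrics depend on no further parameters, so a generic
linear form does not vanish at them. In the count, its vanishing at `x` makes one of its
coefficients redundant. -/
lemma isGeneric_linear_form_ne_zero_aux {d : ℕ} {I : Ideal (MvPolynomial (Fin (n + 1)) k)}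
    (hI : ZeroBound d I) {p : Fin (n + 1) → k} {r : Fin (n + 1)} (hr : p r = 1)
    (i s : Fin (n + 1)) :
    IsGeneric k fun a : (Fin d → quadricsThrough p) × (Fin (n + 1) → k) =>
      ∀ q : Fin (n + 1) → k, q i = 1 →
      IsZeroOf I q → MvPolynomial.eval q (lineThrough p r s) ≠ 0 →
      (∀ j, MvPolynomial.eval q (a.1 j).1 = 0) → ∑ l, a.2 l * q l ≠ 0 := by
  by_cases hs : lineThrough p r s = 0
  · exact isGeneric_of_forall fun f q _ _ h => (h (by rw [hs, map_zero])).elim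
  obtain ⟨M, _, b, hb⟩ := exists_quadric_basis hr hs
  by_contra hcon
  let ι := {a : ((Fin d → quadricsThrough p) × (Fin (n + 1) → k)) × (Fin (n + 1) → k) //
    a.2 i = 1 ∧ IsZeroOf I a.2 ∧ MvPolynomial.eval a.2 (lineThrough p r s) ≠ 0 ∧
    (∀ j, MvPolynomial.eval a.2 (a.1.1 j).1 = 0) ∧ ∑ l, a.1.2 l * a.2 l = 0}
  let co : (Fin d × (Fin (n + 1) ⊕ M)) ⊕ Fin (n + 1) →
      Module.Dual k ((Fin d → quadricsThrough p) × (Fin (n + 1) → k)) :=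
    Sum.elim (fun s => frameCoord b s ∘ₗ LinearMap.fst k _ _)
      (fun l => LinearMap.proj l ∘ₗ LinearMap.snd k _ _)
  obtain ⟨Ω, _, _, φ, hφ⟩ := exists_generic_point_of_not_isGeneric co
    (fun c => by
      obtain ⟨f, hf⟩ := frameCoord_surjective b (fun s => c (Sum.inl s))
      refine ⟨(f, fun l => c (Sum.inr l)), fun s => ?_⟩
      rcases s with s | s
      exacts [hf s, rfl]) (fun a : ι => a.1.1) (fun f hf => by
      push Not at hf
      obtain ⟨q, h1, h2, h3, h4, h5⟩ := hf
      exact ⟨⟨(f, q), h1, h2, h3, h4, h5⟩, rfl⟩) hcon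
  let x : Fin (n + 1) → Ω := fun l => φ fun a => a.1.2 l
  have haev : ∀ G : MvPolynomial (Fin (n + 1)) k,
      MvPolynomial.aeval x G = φ fun a => MvPolynomial.aeval a.1.2 G :=
    fun G => MvPolynomial.aeval_pi_algHom φ (fun l (a : ι) => a.1.2 l) G
  let c : Fin d × (Fin (n + 1) ⊕ M) → Ω := fun s => φ fun a => frameCoord b s a.1.1.1
  let e : Fin (n + 1) → Ω := fun l => φ fun a => a.1.1.2 l
  have hxi : x i = 1 := by
    rw [← map_one φ]
    exact congrArg φ (funext fun a => a.2.1)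
  have hx : IsZeroOf I x := fun F hF => by
    rw [haev, ← map_zero φ]
    exact congrArg φ (funext fun a => a.2.2.1 F hF)
  let lam : Ω := MvPolynomial.aeval x (lineThrough p r s)
  have hlam : lam ≠ 0 := by
    have h1 : lam * φ (fun a => (MvPolynomial.eval a.1.2 (lineThrough p r s))⁻¹) = 1 := by
      rw [show lam = _ from haev _, ← map_mul, ← map_one φ]
      exact congrArg φ (funext fun a => mul_inv_cancel₀ a.2.2.2.1)
    exact left_ne_zero_of_mul_eq_one h1
  obtain ⟨t, ht⟩ := hI.exists_tuple x i hxi hx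
  -- As many entries as there are coefficients of the forms and of the linear form, but with `e i`
  -- replaced by `0`. If all coefficients are algebraic over `w`, the count makes `w` independent,
  -- which its zero entry forbids.
  let w : ((Fin d × Fin n) ⊕ Fin d) ⊕ (Fin d × M) ⊕ Fin (n + 1) → Ω :=
    Sum.elim (Sum.elim (fun s => c (s.1, Sum.inl (i.succAbove s.2))) (x ∘ t))
      (Sum.elim (fun s => c (s.1, Sum.inr s.2)) (Function.update e i 0))
  have hcw : ∀ j m, c (j, Sum.inr m) ∈ algSpan k (Set.range w) := fun j m =>
    subset_algSpan _ ⟨Sum.inr (Sum.inl (j, m)), rfl⟩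
  have hca : ∀ j a, c (j, Sum.inl (i.succAbove a)) ∈ algSpan k (Set.range w) := fun j a =>
    subset_algSpan _ ⟨Sum.inl (Sum.inl (j, a)), rfl⟩
  have hea : ∀ a, e (i.succAbove a) ∈ algSpan k (Set.range w) := fun a =>
    subset_algSpan _ ⟨Sum.inr (Sum.inr (i.succAbove a)), by simp [w]⟩
  have hxw : ∀ l, x l ∈ algSpan k (Set.range w) := fun l => by
    refine algSpan_mono ?_ (ht l)
    rintro _ ⟨j, rfl⟩
    exact ⟨Sum.inl (Sum.inr j), rfl⟩
  have hGw : ∀ G : MvPolynomial (Fin (n + 1)) k, MvPolynomial.aeval x G ∈ algSpan k (Set.range w) :=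
    aeval_mem_algSpan hxw
  have hF : ∀ j, lam * ∑ l, c (j, Sum.inl l) * x l +
      ∑ m, c (j, Sum.inr m) * MvPolynomial.aeval x (b (Sum.inr m)).1 = 0 := fun j => by
    have h1 := aeval_generic_form b (fun a : ι => a.1.1.1) (fun a => a.1.2) φ LinearMap.id j
    have h2 : φ (fun a : ι => MvPolynomial.eval a.1.2 (LinearMap.id (R := k) (a.1.1.1 j).1)) =
        0 := by
      rw [← map_zero φ]
      exact congrArg φ (funext fun a => a.2.2.2.2.1 j)
    rw [h2, Fintype.sum_sum_type] at h1
    rw [h1]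
    refine congrArg₂ _ ((sum_aeval_mul_X x (fun l => c (j, Sum.inl l)) _).symm.trans ?_) rfl
    exact Finset.sum_congr rfl fun l _ => by rw [← hb]; rfl
  have hci : ∀ j, c (j, Sum.inl i) ∈ algSpan k (Set.range w) := fun j => by
    have h1 : ∑ l, c (j, Sum.inl l) * x l =
        -(∑ m, c (j, Sum.inr m) * MvPolynomial.aeval x (b (Sum.inr m)).1) / lam := by
      rw [eq_div_iff hlam, mul_comm]
      exact eq_neg_of_add_eq_zero_left (hF j)
    have h2 : ∑ l, c (j, Sum.inl l) * x l ∈ algSpan k (Set.range w) := by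
      rw [h1]
      exact div_mem (neg_mem (sum_mem fun m _ => mul_mem (hcw j m) (hGw _))) (hGw _)
    rw [Fin.sum_univ_succAbove _ i, hxi, mul_one] at h2
    have h3 := sub_mem h2 (sum_mem (t := Finset.univ) fun a _ => mul_mem (hca j a)
      (hxw (i.succAbove a)))
    rwa [add_sub_cancel_right] at h3
  have hei : e i ∈ algSpan k (Set.range w) := by
    have h1 : ∑ l, e l * x l = 0 := by
      simp only [e, x, ← map_mul, ← map_sum]
      rw [← map_zero φ]
      refine congrArg φ (funext fun a => ?_)
      simpa using a.2.2.2.2.2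
    rw [Fin.sum_univ_succAbove _ i, hxi, mul_one] at h1
    rw [eq_neg_of_add_eq_zero_left h1]
    exact neg_mem (sum_mem fun a _ => mul_mem (hea a) (hxw _))
  have hind := algebraicIndependent_of_card_le hφ w (fun s => by
    rcases s with ⟨j, l | m⟩ | l
    · rcases Fin.eq_self_or_eq_succAbove i l with rfl | ⟨a, rfl⟩
      exacts [hci j, hca j a]
    · exact hcw j m
    · rcases Fin.eq_self_or_eq_succAbove i l with rfl | ⟨a, rfl⟩
      exacts [hei, hea a]) (by simp; lia)
  exact hind.ne_zero (Sum.inr (Sum.inr i)) (by simp [w])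

/-- A generic system of quadrics through `p` has no zeros in common with `I` on some hyperplane. -/
lemma exists_isGeneric_linear_form_ne_zero {d : ℕ} {I : Ideal (MvPolynomial (Fin (n + 1)) k)}
    (hI : ZeroBound d I) {p : Fin (n + 1) → k} {r : Fin (n + 1)} (hr : p r = 1) :
    ∃ e : Fin (n + 1) → k, IsGeneric k fun f : Fin d → quadricsThrough p =>
      ∀ (i : Fin (n + 1)) (q : Fin (n + 1) → k), q i = 1 → IsZeroOf I q →
      (∀ j, MvPolynomial.eval q (f j).1 = 0) → ∑ l, e l * q l ≠ 0 := by
  have h1 := IsGeneric.forall fun i => IsGeneric.forall fun s =>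
    isGeneric_linear_form_ne_zero_aux (d := d) hI hr i s
  have h2 : IsGeneric k fun a : (Fin d → quadricsThrough p) × (Fin (n + 1) → k) =>
      ∑ l, a.2 l * p l ≠ 0 := by
    let g : Module.Dual k ((Fin d → quadricsThrough p) × (Fin (n + 1) → k)) :=
      (∑ l, p l • LinearMap.proj l) ∘ₗ LinearMap.snd k _ _
    refine ⟨g, dual_mem_polyFun g, ⟨(0, Pi.single r 1), ?_⟩, fun a ha => ?_⟩
    · simp [g, Pi.single_apply, hr]
    · have h3 : g a = ∑ l, a.2 l * p l := by
        simp only [g, LinearMap.comp_apply, LinearMap.sum_apply, LinearMap.smul_apply,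
          LinearMap.proj_apply, LinearMap.snd_apply, smul_eq_mul]
        exact Finset.sum_congr rfl fun l _ => mul_comm _ _
      exact fun h => ha (h3.trans h)
  obtain ⟨e, he⟩ := (h1.and h2).exists_specialization
  refine ⟨e, he.mono fun f hf i q hi hq hfq => ?_⟩
  -- If all `ℓ_s` vanish at `q` then `q` is a multiple of `p`, the base point of the system; there
  -- the condition `e(p) ≠ 0` is what is needed.
  by_cases hs : ∃ s, MvPolynomial.eval q (lineThrough p r s) ≠ 0
  · obtain ⟨s, hs⟩ := hs
    exact hf.1 i s q hi hq hs hfq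
  · push Not at hs
    have h3 : ∀ l, q l = p l * q r := fun l => by
      simpa [lineThrough, sub_eq_zero] using hs l
    have h4 : q r ≠ 0 := fun h => by
      have := h3 i
      rw [h, hi, mul_zero] at this
      exact one_ne_zero this
    have h5 : ∑ l, e l * q l = (∑ l, e l * p l) * q r := by
      rw [Finset.sum_mul]
      exact Finset.sum_congr rfl fun l _ => by rw [h3 l, mul_assoc]
    rw [h5]
    exact mul_ne_zero hf.2 h4

end QuadricsThrough

/-! ### Generic linear systems form a dense open set -/

section OpenDense

variable {k : Type u} [Field k] {n d : ℕ}

lemma isTopologicalBasis_zariskiTopology (σ : Type*) (F : Type*) [Field F] :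
    @TopologicalSpace.IsTopologicalBasis _ (zariskiTopology σ F)
      (Set.range fun f : MvPolynomial σ F => {a : σ → F | MvPolynomial.eval a f ≠ 0}) := by
  let := zariskiTopology σ F
  refine ⟨?_, ?_, rfl⟩
  · rintro _ ⟨f, rfl⟩ _ ⟨g, rfl⟩ a ha
    refine ⟨_, ⟨f * g, rfl⟩, ?_, fun b hb => ?_⟩
    · simpa using ha
    · simpa using hb
  · refine Set.eq_univ_of_forall fun a => ⟨_, ⟨1, rfl⟩, ?_⟩
    simp

lemma isOpen_zariskiTopology_ne_zero {σ F : Type*} [Field F] (f : MvPolynomial σ F) :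
    @IsOpen _ (zariskiTopology σ F) {a : σ → F | MvPolynomial.eval a f ≠ 0} :=
  TopologicalSpace.isOpen_generateFrom_of_mem ⟨f, rfl⟩

/-- The coefficients of a frame. -/
noncomputable def QuadFrame.coeffs (q : QuadFrame n d k) (s : Fin d × (Fin (n + 1) →₀ ℕ)) : k :=
  (q.form s.1).coeff s.2

lemma QuadFrame.isOpen_coeffs_ne_zero (f : MvPolynomial (Fin d × (Fin (n + 1) →₀ ℕ)) k) :
    IsOpen {q : QuadFrame n d k | MvPolynomial.eval q.coeffs f ≠ 0} :=
  ⟨_, isOpen_zariskiTopology_ne_zero f, rfl⟩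

lemma QuadFrame.exists_basic_nhd {O : Set (QuadFrame n d k)} (hO : IsOpen O) {q : QuadFrame n d k}
    (hq : q ∈ O) : ∃ f : MvPolynomial (Fin d × (Fin (n + 1) →₀ ℕ)) k,
      MvPolynomial.eval q.coeffs f ≠ 0 ∧
      ∀ q' : QuadFrame n d k, MvPolynomial.eval q'.coeffs f ≠ 0 → q' ∈ O := by
  obtain ⟨O', hO', rfl⟩ := hO
  let := zariskiTopology (Fin d × (Fin (n + 1) →₀ ℕ)) k
  obtain ⟨_, ⟨f, rfl⟩, h1, h2⟩ :=
    (isTopologicalBasis_zariskiTopology _ _).exists_subset_of_mem_open hq hO'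
  exact ⟨f, h1, fun q' hq' => h2 hq'⟩

lemma QuadGrass.ext_space {l l' : QuadGrass n d k} (h : l.space = l'.space) : l = l' := by
  cases l; cases l'; cases h; rfl

lemma QuadGrass.exists_frame (l : QuadGrass n d k) : ∃ q : QuadFrame n d k, q.span = l := by
  have := finite_homogeneousSubmodule (k := k) (n := n) 2
  have : Module.Finite k l.space := Submodule.finiteDimensional_of_le l.le_two
  let b := Module.finBasisOfFinrankEq k l.space l.finrank_eq
  refine ⟨⟨fun j => (b j).1, fun j => l.le_two (b j).2,
    b.linearIndependent.map' l.space.subtype (Submodule.ker_subtype _)⟩, QuadGrass.ext_space ?_⟩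
  have h1 : (Submodule.span k (Set.range b)).map l.space.subtype = l.space := by
    rw [b.span_eq, Submodule.map_top, Submodule.range_subtype]
  rw [Submodule.map_span, ← Set.range_comp] at h1
  exact h1

/-- The action of an invertible matrix on frames. -/
noncomputable def QuadFrame.transform (q : QuadFrame n d k) (A : Matrix (Fin d) (Fin d) k)
    (hA : IsUnit A) : QuadFrame n d k where
  form j := ∑ j', A j j' • q.form j'
  homogeneous j := Submodule.sum_mem (MvPolynomial.homogeneousSubmodule (Fin (n + 1)) k 2)
    fun j' _ => Submodule.smul_mem _ _ (q.homogeneous j')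
  indep := by
    have h1 := Matrix.linearIndependent_rows_iff_isUnit.mpr hA
    exact h1.map' (Fintype.linearCombination k q.form) (LinearMap.ker_eq_bot.mpr
      q.indep.fintypeLinearCombination_injective)

lemma QuadFrame.span_transform (q : QuadFrame n d k) (A : Matrix (Fin d) (Fin d) k)
    (hA : IsUnit A) : (q.transform A hA).span = q.span := by
  refine QuadGrass.ext_space ?_
  have := finite_homogeneousSubmodule (k := k) (n := n) 2
  have : Module.Finite k q.span.space := Submodule.finiteDimensional_of_le q.span.le_two
  refine Submodule.eq_of_le_of_finrank_eq ?_ (by rw [QuadGrass.finrank_eq, QuadGrass.finrank_eq])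
  refine Submodule.span_le.mpr ?_
  rintro _ ⟨j, rfl⟩
  have h1 : ∑ j', A j j' • q.form j' ∈ q.span.space := Submodule.sum_mem _ fun j' _ =>
    Submodule.smul_mem _ _ (Submodule.subset_span (Set.mem_range_self j'))
  exact h1

lemma QuadFrame.exists_transform {q q' : QuadFrame n d k} (h : q'.span = q.span) :
    ∃ (A : Matrix (Fin d) (Fin d) k) (hA : IsUnit A), q' = q.transform A hA := by
  have h1 : ∀ j, ∃ c : Fin d → k, ∑ j', c j' • q.form j' = q'.form j := fun j => by
    have h2 : q'.form j ∈ q'.span.space := Submodule.subset_span ⟨j, rfl⟩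
    rw [h] at h2
    exact (Submodule.mem_span_range_iff_exists_fun k).mp h2
  choose c hc using h1
  have hA : IsUnit (Matrix.of c) := by
    rw [← Matrix.linearIndependent_rows_iff_isUnit]
    refine LinearIndependent.of_comp (Fintype.linearCombination k q.form) ?_
    have h2 : (Fintype.linearCombination k q.form) ∘ (Matrix.of c).row = q'.form := funext hc
    rw [h2]
    exact q'.indep
  refine ⟨Matrix.of c, hA, ?_⟩
  have h3 : q'.form = (q.transform (Matrix.of c) hA).form := funext fun j => (hc j).symm
  cases q'
  cases h3
  rfl

lemma QuadFrame.isOpen_transform_coeffs_ne_zero (A : Matrix (Fin d) (Fin d) k) (hA : IsUnit A)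
    (g : MvPolynomial (Fin d × (Fin (n + 1) →₀ ℕ)) k) :
    IsOpen {q : QuadFrame n d k | MvPolynomial.eval (q.transform A hA).coeffs g ≠ 0} := by
  have h1 : ∀ q : QuadFrame n d k, MvPolynomial.eval (q.transform A hA).coeffs g =
      MvPolynomial.eval q.coeffs (MvPolynomial.bind₁ (fun s =>
        ∑ j', MvPolynomial.C (A s.1 j') * MvPolynomial.X (j', s.2)) g) := fun q => by
    have h2 := MvPolynomial.aeval_bind₁ (S := k) q.coeffs (fun s : Fin d × (Fin (n + 1) →₀ ℕ) =>
      ∑ j', MvPolynomial.C (A s.1 j') * MvPolynomial.X (j', s.2)) g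
    simp only [MvPolynomial.aeval_eq_eval] at h2
    rw [h2]
    refine congrArg (fun c => MvPolynomial.eval c g) (funext fun s => ?_)
    simp [QuadFrame.coeffs, QuadFrame.transform, MvPolynomial.coeff_sum]
  simp only [h1]
  exact QuadFrame.isOpen_coeffs_ne_zero _

/-- The functional on tuples of forms that extracts a coefficient of one of them. -/
noncomputable def coeffDual (Q : Submodule k (MvPolynomial (Fin (n + 1)) k))
    (s : Fin d × (Fin (n + 1) →₀ ℕ)) : Module.Dual k (Fin d → Q) :=
  MvPolynomial.lcoeff k s.2 ∘ₗ Q.subtype ∘ₗ (LinearMap.proj s.1 : (Fin d → Q) →ₗ[k] Q)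

/-- A polynomial function on tuples of forms is a polynomial in their coefficients. -/
lemma exists_coeff_polynomial {Q : Submodule k (MvPolynomial (Fin (n + 1)) k)} [Module.Finite k Q]
    {Ψ : (Fin d → Q) → k} (hΨ : Ψ ∈ polyFun k (Fin d → Q)) :
    ∃ f : MvPolynomial (Fin d × (Fin (n + 1) →₀ ℕ)) k, ∀ w : Fin d → Q,
      Ψ w = MvPolynomial.eval (fun s => coeffDual Q s w) f := by
  induction hΨ using Algebra.adjoin_induction with
  | mem x hx =>
    obtain ⟨g, rfl⟩ := hx
    have hspan : Submodule.span k (Set.range (coeffDual (d := d) Q)) = ⊤ := by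
      -- The coefficient functionals separate tuples of forms, so they span the dual of this
      -- finite-dimensional space.
      refine Submodule.span_eq_top_of_ne_zero fun z hz => ?_
      obtain ⟨j, hj⟩ := Function.ne_iff.mp hz
      obtain ⟨m, hm⟩ := MvPolynomial.ne_zero_iff.mp (fun h => hj (Subtype.ext h))
      exact ⟨_, ⟨(j, m), rfl⟩, hm⟩
    have hg : g ∈ Submodule.span k (Set.range (coeffDual (d := d) Q)) := by
      rw [hspan]; exact Submodule.mem_top
    induction hg using Submodule.span_induction with
    | mem x hx =>
      obtain ⟨s, rfl⟩ := hx
      exact ⟨MvPolynomial.X s, fun w => by rw [MvPolynomial.eval_X]⟩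
    | zero => exact ⟨0, fun w => by simp⟩
    | add x y _ _ hx hy =>
      obtain ⟨P, hP⟩ := hx
      obtain ⟨P', hP'⟩ := hy
      exact ⟨P + P', fun w => by rw [map_add, ← hP, ← hP']; rfl⟩
    | smul c x _ hx =>
      obtain ⟨P, hP⟩ := hx
      exact ⟨MvPolynomial.C c * P, fun w => by rw [map_mul, ← hP, MvPolynomial.eval_C]; rfl⟩
  | algebraMap c => exact ⟨MvPolynomial.C c, fun w => by rw [MvPolynomial.eval_C]; rfl⟩
  | add f g _ _ hf hg =>
    obtain ⟨P, hP⟩ := hf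
    obtain ⟨P', hP'⟩ := hg
    exact ⟨P + P', fun w => by rw [map_add, ← hP, ← hP']; rfl⟩
  | mul f g _ _ hf hg =>
    obtain ⟨P, hP⟩ := hf
    obtain ⟨P', hP'⟩ := hg
    exact ⟨P * P', fun w => by rw [map_mul, ← hP, ← hP']; rfl⟩

/-- With `Λ` a left inverse of the map given by `f`, the determinant of `Λ ∘ w` is `1` at `w = f`,
and its nonvanishing forces independence of `w`. -/
lemma exists_polyFun_linearIndependent {Q : Type*} [AddCommGroup Q] [Module k Q]
    {f : Fin d → Q} (hf : LinearIndependent k f) :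
    ∃ Ψ ∈ polyFun k (Fin d → Q), Ψ f ≠ 0 ∧ ∀ w, Ψ w ≠ 0 → LinearIndependent k w := by
  classical
  obtain ⟨Λ, hΛ⟩ := LinearMap.exists_leftInverse_of_injective (Fintype.linearCombination k f)
    (LinearMap.ker_eq_bot.mpr hf.fintypeLinearCombination_injective)
  have hΛf : ∀ j, Λ (f j) = Pi.single j 1 := fun j => by
    have h1 := LinearMap.congr_fun hΛ (Pi.single j 1)
    simpa using h1
  refine ⟨_, det_mem_polyFun fun a b => LinearMap.proj b ∘ₗ Λ ∘ₗ
    (LinearMap.proj a : (Fin d → Q) →ₗ[k] Q), ?_, fun w hw => ?_⟩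
  · have h2 : (Matrix.of fun a b => (LinearMap.proj b ∘ₗ Λ ∘ₗ
        (LinearMap.proj a : (Fin d → Q) →ₗ[k] Q)) f) = (1 : Matrix (Fin d) (Fin d) k) := by
      ext a b
      simp [hΛf, Matrix.one_apply, Pi.single_apply, eq_comm]
    rw [h2, Matrix.det_one]
    exact one_ne_zero
  · exact LinearIndependent.of_comp Λ (Matrix.linearIndependent_rows_of_det_ne_zero hw)

/-- Let `H` be the set of linear systems contained in `Q`. A generic property of `d`-tuples in `Q`
holds for some frame of every member of a dense open subset of `H`. -/
lemma exists_isOpen_dense_of_isGeneric [Infinite k]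
    {Q : Submodule k (MvPolynomial (Fin (n + 1)) k)}
    (hQ : Q ≤ MvPolynomial.homogeneousSubmodule (Fin (n + 1)) k 2) {H : Set (QuadGrass n d k)}
    (hH : ∀ l, l ∈ H ↔ l.space ≤ Q) {S : (Fin d → Q) → Prop} (hS : IsGeneric k S) :
    ∃ U : Set H, IsOpen U ∧ Dense U ∧ ∀ l ∈ U, ∃ f : Fin d → Q, S f ∧
      l.1.space = Submodule.span k (Set.range fun j => (f j).1) := by
  obtain ⟨Ψ, hΨ, ⟨w, hw⟩, hΨS⟩ := hS
  have := finite_homogeneousSubmodule (k := k) (n := n) 2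
  have : Module.Finite k Q := Submodule.finiteDimensional_of_le hQ
  obtain ⟨g, hg⟩ := exists_coeff_polynomial hΨ
  let U : Set (QuadGrass n d k) :=
    {l | ∃ q : QuadFrame n d k, q.span = l ∧ MvPolynomial.eval q.coeffs g ≠ 0}
  refine ⟨Subtype.val ⁻¹' U, ?_, ?_, ?_⟩
  · refine IsOpen.preimage continuous_subtype_val ?_
    change IsOpen (QuadFrame.span ⁻¹' U)
    -- Saturation under change of frame: two frames with the same span differ by an invertible
    -- matrix, so the preimage is a union of translates of a basic open set.
    have h1 : QuadFrame.span ⁻¹' U = ⋃ A : {A : Matrix (Fin d) (Fin d) k // IsUnit A},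
        {q : QuadFrame n d k | MvPolynomial.eval (q.transform A.1 A.2).coeffs g ≠ 0} := by
      ext q
      simp only [Set.mem_preimage, Set.mem_iUnion, Set.mem_ofPred_eq, U]
      constructor
      · rintro ⟨q', hq', h⟩
        obtain ⟨A, hA, rfl⟩ := QuadFrame.exists_transform hq'
        exact ⟨⟨A, hA⟩, h⟩
      · rintro ⟨A, hA⟩
        exact ⟨_, q.span_transform A.1 A.2, hA⟩
    rw [h1]
    exact isOpen_iUnion fun A => QuadFrame.isOpen_transform_coeffs_ne_zero A.1 A.2 g
  · intro l
    rw [mem_closure_iff]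
    rintro _ ⟨O, hO, rfl⟩ hl
    obtain ⟨q, hq⟩ := l.1.exists_frame
    obtain ⟨g', hg', hgO⟩ := QuadFrame.exists_basic_nhd (O := QuadFrame.span ⁻¹' O) hO (q := q)
      (by rw [Set.mem_preimage, hq]; exact hl)
    have hqQ : ∀ j, q.form j ∈ Q := fun j => (hH _).mp l.2 (by
      rw [← hq]; exact Submodule.subset_span ⟨j, rfl⟩)
    let f : Fin d → Q := fun j => ⟨q.form j, hqQ j⟩
    have hf : LinearIndependent k f := LinearIndependent.of_comp Q.subtype q.indep
    obtain ⟨Φ, hΦ, hΦf, hΦi⟩ := exists_polyFun_linearIndependent hf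
    have h1 := eval_mem_polyFun (coeffDual (d := d) Q) g'
    -- One tuple has to satisfy three conditions at once: the generic property, membership in the
    -- given basic neighbourhood, and linear independence. Each is the nonvanishing of a polynomial
    -- function that is not identically zero.
    obtain ⟨w', hw'⟩ := polyFun_mul_ne_zero hΨ (mul_mem h1 hΦ) hw (w₂ := f)
      (mul_ne_zero hg' hΦf)
    have h2 : Ψ w' ≠ 0 := left_ne_zero_of_mul hw'
    have h3 := right_ne_zero_of_mul hw'
    let q' : QuadFrame n d k := ⟨fun j => (w' j).1, fun j => hQ (w' j).2,
      (hΦi w' (right_ne_zero_of_mul h3)).map' Q.subtype (Submodule.ker_subtype _)⟩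
    have h4 : q'.span ∈ H := (hH _).mpr (Submodule.span_le.mpr (by
      rintro _ ⟨j, rfl⟩; exact (w' j).2))
    refine ⟨⟨q'.span, h4⟩, hgO q' (left_ne_zero_of_mul h3), q', rfl, ?_⟩
    rw [hg] at h2
    exact h2
  · rintro l ⟨q, hq, hgq⟩
    have hqQ : ∀ j, q.form j ∈ Q := fun j => (hH _).mp l.2 (by
      rw [← hq]; exact Submodule.subset_span ⟨j, rfl⟩)
    refine ⟨fun j => ⟨q.form j, hqQ j⟩, hΨS _ (by rw [hg]; exact hgq), ?_⟩
    rw [← hq]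
    rfl

end OpenDense

/-! ### Affine charts of `Proj` -/

section Dehomogenization

open HomogeneousLocalization

variable {R A : Type u} [CommRing R] [CommRing A] [Algebra R A]
  (𝒜 : ℕ → Submodule R A) [GradedAlgebra 𝒜] {f : A} (hf : f ∈ 𝒜 1)

/-- The map `F ↦ F / f ^ m` on forms of degree `m`. -/
noncomputable def dehomDegree (m : ℕ) : 𝒜 m →+ Away 𝒜 f where
  toFun F := Away.mk 𝒜 hf m F (by simp)
  map_zero' := by
    ext
    simp [Localization.mk_zero]
  map_add' F G := by
    ext
    simp [Localization.add_mk_self]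

lemma dehomDegree_one : dehomDegree 𝒜 hf 0 (GradedMonoid.GOne.one (A := fun i => 𝒜 i)) = 1 := by
  ext
  simp [dehomDegree, GradedMonoid.GOne.one]

lemma dehomDegree_mul {i j : ℕ} (F : 𝒜 i) (G : 𝒜 j) :
    dehomDegree 𝒜 hf (i + j) (GradedMonoid.GMul.mul (A := fun i => 𝒜 i) F G) =
      dehomDegree 𝒜 hf i F * dehomDegree 𝒜 hf j G := by
  ext
  simp [dehomDegree, GradedMonoid.GMul.mul, Localization.mk_mul, pow_add]

/-- Dehomogenization with respect to an element of degree one. -/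
noncomputable def dehom : A →+* Away 𝒜 f :=
  (DirectSum.toSemiring (dehomDegree 𝒜 hf) (dehomDegree_one 𝒜 hf) (dehomDegree_mul 𝒜 hf)).comp
    (DirectSum.decomposeRingEquiv 𝒜).toRingHom

lemma dehom_of_mem {m : ℕ} {F : A} (hF : F ∈ 𝒜 m) :
    dehom 𝒜 hf F = Away.mk 𝒜 hf m F (by simpa using hF) := by
  change DirectSum.toSemiring (dehomDegree 𝒜 hf) (dehomDegree_one 𝒜 hf) (dehomDegree_mul 𝒜 hf)
    (DirectSum.decompose 𝒜 F) = _
  rw [DirectSum.decompose_of_mem 𝒜 hF, DirectSum.toSemiring_of]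
  rfl

lemma dehom_self : dehom 𝒜 hf f = 1 := by
  rw [dehom_of_mem 𝒜 hf hf]
  ext
  simp

lemma dehom_surjective : Function.Surjective (dehom 𝒜 hf) := fun z => by
  obtain ⟨n, F, hF, rfl⟩ := Away.mk_surjective 𝒜 hf z
  exact ⟨F, dehom_of_mem 𝒜 hf (by simpa using hF)⟩

variable {C : Type u} [CommRing C] (ψ : A →+* C) (h : ψ f = 1)

/-- The homomorphism on the chart of `Proj` where `f` is invertible induced by a homomorphism that
sends `f` to `1`. -/
noncomputable def awayLift : Away 𝒜 f →+* C :=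
  (IsLocalization.Away.lift (S := Localization.Away f) f (g := ψ) (by rw [h]; exact isUnit_one)).comp
    (algebraMap (Away 𝒜 f) (Localization.Away f))

lemma awayLift_mk {m : ℕ} {F : A} (hF : F ∈ 𝒜 (m • 1)) :
    awayLift 𝒜 ψ h (Away.mk 𝒜 hf m F hF) = ψ F := by
  have h1 : IsUnit (ψ f) := by rw [h]; exact isUnit_one
  have h2 : awayLift 𝒜 ψ h (Away.mk 𝒜 hf m F hF) =
    IsLocalization.Away.lift (S := Localization.Away f) f h1
      (Localization.mk F ⟨f ^ m, m, rfl⟩) := rfl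
  have h3 : Localization.mk F (⟨f ^ m, m, rfl⟩ : Submonoid.powers f) *
      algebraMap A (Localization.Away f) (f ^ m) = algebraMap A _ F := by
    rw [Localization.mk_eq_mk']
    exact IsLocalization.mk'_spec _ F (⟨f ^ m, m, rfl⟩ : Submonoid.powers f)
  have h4 := congrArg (IsLocalization.Away.lift (S := Localization.Away f) f h1) h3
  rw [map_mul, IsLocalization.Away.lift_eq, IsLocalization.Away.lift_eq, map_pow, h, one_pow,
    mul_one] at h4
  rw [h2, h4]

lemma awayLift_comp_dehom : (awayLift 𝒜 ψ h).comp (dehom 𝒜 hf) = ψ := by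
  ext F
  induction F using DirectSum.Decomposition.inductionOn 𝒜 with
  | zero => simp
  | homogeneous F =>
    rw [RingHom.comp_apply, dehom_of_mem 𝒜 hf F.2, awayLift_mk]
  | add F G hF hG => rw [map_add, map_add, hF, hG]

lemma ringHom_ext_dehom {g g' : Away 𝒜 f →+* C}
    (hg : g.comp (dehom 𝒜 hf) = g'.comp (dehom 𝒜 hf)) : g = g' := by
  ext z
  obtain ⟨F, rfl⟩ := dehom_surjective 𝒜 hf z
  exact RingHom.congr_fun hg F

lemma awayLift_comp_dehom_self (g : Away 𝒜 f →+* C) :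
    awayLift 𝒜 (g.comp (dehom 𝒜 hf)) (by simp [dehom_self]) = g :=
  ringHom_ext_dehom 𝒜 hf (awayLift_comp_dehom 𝒜 hf _ _)

/-- The morphism `Spec C ⟶ Proj 𝒜` given by a homomorphism `A → C` that sends `f` to `1`. -/
noncomputable def projPoint : Spec (CommRingCat.of C) ⟶ Proj 𝒜 :=
  Spec.map (CommRingCat.ofHom (awayLift 𝒜 ψ h)) ≫ Proj.awayι 𝒜 f hf one_pos

lemma specMap_projPoint {C' : Type u} [CommRing C'] (g : C →+* C') :
    Spec.map (CommRingCat.ofHom g) ≫ projPoint 𝒜 hf ψ h =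
      projPoint 𝒜 hf (g.comp ψ) (by simp [h]) := by
  have h1 : awayLift 𝒜 (g.comp ψ) (by simp [h]) = g.comp (awayLift 𝒜 ψ h) :=
    ringHom_ext_dehom 𝒜 hf (by
      rw [awayLift_comp_dehom, RingHom.comp_assoc, awayLift_comp_dehom])
  rw [projPoint, projPoint, h1, CommRingCat.ofHom_comp, Spec.map_comp, Category.assoc]

lemma projPoint_injective {ψ' : A →+* C} {h' : ψ' f = 1}
    (hψ : projPoint 𝒜 hf ψ h = projPoint 𝒜 hf ψ' h') : ψ = ψ' := by
  rw [projPoint, projPoint, cancel_mono, Spec.map_inj] at hψ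
  have h1 : awayLift 𝒜 ψ h = awayLift 𝒜 ψ' h' := congrArg CommRingCat.Hom.hom hψ
  rw [← awayLift_comp_dehom 𝒜 hf ψ h, h1, awayLift_comp_dehom]

lemma projPoint_mem_basicOpen (y : Spec (CommRingCat.of C)) :
    projPoint 𝒜 hf ψ h y ∈ Proj.basicOpen 𝒜 f := by
  rw [← Proj.opensRange_awayι 𝒜 f hf one_pos, projPoint, Scheme.Hom.comp_apply]
  exact ⟨_, rfl⟩

lemma mem_projPoint_iff_of_pos {m : ℕ} (hm : 0 < m) {F : A} (hF : F ∈ 𝒜 m)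
    (y : Spec (CommRingCat.of C)) :
    F ∈ (projPoint 𝒜 hf ψ h y).asHomogeneousIdeal ↔ ψ F ∈ y.asIdeal := by
  rw [← not_iff_not, ← Proj.mem_basicOpen 𝒜]
  have h1 := Proj.awayι_preimage_basicOpen 𝒜 hf one_pos hF hm
  have h2 : projPoint 𝒜 hf ψ h y ∈ Proj.basicOpen 𝒜 F ↔
      Spec.map (CommRingCat.ofHom (awayLift 𝒜 ψ h)) y ∈
        Proj.awayι 𝒜 f hf one_pos ⁻¹ᵁ Proj.basicOpen 𝒜 F := by
    rw [projPoint, Scheme.Hom.comp_apply]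
    rfl
  rw [h2, h1]
  change awayLift 𝒜 ψ h (Away.isLocalizationElem hf hF) ∉ y.asIdeal ↔ _
  rw [Away.isLocalizationElem, awayLift_mk, pow_one]

/-- The description of basic opens applies in positive degree. A form of degree zero is first
multiplied by `f`, which does not vanish at the point. -/
lemma mem_projPoint_iff {m : ℕ} {F : A} (hF : F ∈ 𝒜 m) (y : Spec (CommRingCat.of C)) :
    F ∈ (projPoint 𝒜 hf ψ h y).asHomogeneousIdeal ↔ ψ F ∈ y.asIdeal := by
  have h1 := mem_projPoint_iff_of_pos 𝒜 hf ψ h (Nat.succ_pos m) (SetLike.mul_mem_graded hF hf) y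
  have h2 : f ∉ (projPoint 𝒜 hf ψ h y).asHomogeneousIdeal := projPoint_mem_basicOpen 𝒜 hf ψ h y
  rw [map_mul, h, mul_one] at h1
  rw [← h1]
  have hp := (projPoint 𝒜 hf ψ h y).isPrime
  exact ⟨fun h3 => Ideal.mul_mem_right _ _ h3, fun h3 => (hp.mem_or_mem h3).resolve_right h2⟩

lemma projPoint_toSpecZero :
    projPoint 𝒜 hf ψ h ≫ Proj.toSpecZero 𝒜 ≫ Spec.map (CommRingCat.ofHom (algebraMap R (𝒜 0))) =
      Spec.map (CommRingCat.ofHom (ψ.comp (algebraMap R A))) := by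
  rw [projPoint, Category.assoc, Proj.awayι_toSpecZero_assoc, ← Spec.map_comp, ← Spec.map_comp]
  congr 1
  ext a
  have h1 : (algebraMap R (𝒜 0) a : A) ∈ 𝒜 0 := (algebraMap R (𝒜 0) a).2
  have h2 : fromZeroRingHom 𝒜 (Submonoid.powers f) (algebraMap R (𝒜 0) a) =
      dehom 𝒜 hf (algebraMap R A a) := by
    refine Eq.trans ?_ (dehom_of_mem 𝒜 hf h1).symm
    ext
    refine (HomogeneousLocalization.val_mk _).trans ?_
    exact congrArg (Localization.mk _) (Subtype.ext (pow_zero f).symm)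
  change awayLift 𝒜 ψ h (fromZeroRingHom 𝒜 (Submonoid.powers f) (algebraMap R (𝒜 0) a)) = _
  rw [h2]
  exact RingHom.congr_fun (awayLift_comp_dehom 𝒜 hf ψ h) _

lemma projPoint_map {R' B : Type u} [CommRing R'] [CommRing B] [Algebra R' B]
    (ℬ : ℕ → Submodule R' B) [GradedAlgebra ℬ] (φ : GradedRingHom 𝒜 ℬ)
    (hφ : HomogeneousIdeal.irrelevant ℬ ≤ (HomogeneousIdeal.irrelevant 𝒜).map φ)
    (ψ : B →+* C) (h : ψ (φ f) = 1) :
    projPoint ℬ (φ.map_mem hf) ψ h ≫ Proj.map φ hφ =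
      projPoint 𝒜 hf (ψ.comp φ.toRingHom) h := by
  rw [projPoint, Category.assoc]
  have h1 := Proj.awayι_comp_map φ hφ one_pos f hf
  have h2 : (awayLift ℬ ψ h).comp (Away.map φ f) = awayLift 𝒜 (ψ.comp φ.toRingHom) h := by
    refine ringHom_ext_dehom 𝒜 hf ?_
    rw [awayLift_comp_dehom]
    ext F
    induction F using DirectSum.Decomposition.inductionOn 𝒜 with
    | zero => simp
    | homogeneous F =>
      rw [RingHom.comp_apply, dehom_of_mem 𝒜 hf F.2, RingHom.comp_apply, Away.map_mk, awayLift_mk]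
      rfl
    | add F G hF hG => rw [map_add, map_add, hF, hG]
  rw [projPoint, ← h2, CommRingCat.ofHom_comp, Spec.map_comp, Category.assoc, ← h1]
  rfl

/-- The chart of a closed subscheme of `Proj 𝒜` where `f` is invertible. -/
lemma exists_chart {T : Scheme.{u}} (ι : T ⟶ Proj 𝒜) [IsClosedImmersion ι] :
    ∃ (C : Type u) (_ : CommRing C) (γ : A →+* C) (h : γ f = 1) (j : Spec (CommRingCat.of C) ⟶ T),
      Function.Surjective γ ∧ IsOpenImmersion j ∧
      (∀ z : T, z ∈ Set.range j ↔ ι z ∈ Proj.basicOpen 𝒜 f) ∧ j ≫ ι = projPoint 𝒜 hf γ h := by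
  have hc : IsClosedImmersion (pullback.snd ι (Proj.awayι 𝒜 f hf one_pos)) := inferInstance
  obtain ⟨I, e, he⟩ := IsClosedImmersion.Spec_iff.mp hc
  refine ⟨Away 𝒜 f ⧸ I, inferInstance, (Ideal.Quotient.mk I).comp (dehom 𝒜 hf),
    by simp [dehom_self], e.inv ≫ pullback.fst _ _,
    Ideal.Quotient.mk_surjective.comp (dehom_surjective 𝒜 hf), inferInstance, ?_, ?_⟩
  · intro z
    have h1 := IsOpenImmersion.range_pullbackFst (Proj.awayι 𝒜 f hf one_pos) ι
    have h2 : Set.range (e.inv ≫ pullback.fst ι (Proj.awayι 𝒜 f hf one_pos)) =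
        Set.range (pullback.fst ι (Proj.awayι 𝒜 f hf one_pos)) := by
      rw [Scheme.Hom.comp_base, TopCat.coe_comp, Set.range_comp,
        Set.range_eq_univ.mpr (by exact e.inv.homeomorph.surjective), Set.image_univ]
    have h3 := Proj.opensRange_awayι 𝒜 f hf one_pos
    rw [h2, h1, h3]
    rfl
  · rw [Category.assoc, pullback.condition, he]
    rw [projPoint, awayLift_comp_dehom_self]
    exact (congrArg (e.inv ≫ ·) (Category.assoc _ _ _)).trans (e.inv_hom_id_assoc _)

end Dehomogenization

/-! ### Krull dimension -/

section KrullDim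

lemma ringKrullDim_le_of_isIntegral_injective {R S : Type*} [CommRing R] [CommRing S] [IsDomain S]
    (g : R →+* S) (hg : g.IsIntegral) (hinj : Function.Injective g) :
    ringKrullDim R ≤ ringKrullDim S := by
  let := g.toAlgebra
  have : Algebra.IsIntegral R S := ⟨hg⟩
  refine iSup_le fun l => ?_
  obtain ⟨Q, -, hQ, hQl⟩ := Ideal.exists_ideal_over_prime_of_isIntegral l.head.asIdeal (⊥ : Ideal S)
    (by
      intro a ha
      have h1 : g a = 0 := ha
      rw [(map_eq_zero_iff g hinj).mp h1]
      exact zero_mem _)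
  have : Q.LiesOver l.head.asIdeal := ⟨hQl.symm⟩
  obtain ⟨L, hL, -⟩ := Ideal.exists_ltSeries_of_hasGoingUp l Q
  rw [← hL]
  exact Order.LTSeries.length_le_krullDim L

/-- By Noether normalization the algebra is integral over a polynomial ring in `m` variables, so its
dimension is at least `m`; and `m` cannot be smaller than the number of independent elements. -/
lemma card_le_ringKrullDim_adjoin {k Ω ι : Type*} [Field k] [Field Ω] [Algebra k Ω] [Finite ι]
    (x : ι → Ω) (s : Finset ι) (hs : AlgebraicIndependent k (fun j : s => x j)) :
    (s.card : WithBot ℕ∞) ≤ ringKrullDim (Algebra.adjoin k (Set.range x)) := by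
  have : Algebra.FiniteType k (Algebra.adjoin k (Set.range x)) :=
    (Subalgebra.fg_iff_finiteType _).mp ⟨(Set.finite_range x).toFinset, by simp⟩
  obtain ⟨m, g, hinj, hint⟩ := exists_integral_inj_algHom_of_fg k (Algebra.adjoin k (Set.range x))
  have h1 := ringKrullDim_le_of_isIntegral_injective g.toRingHom hint hinj
  rw [MvPolynomial.ringKrullDim_of_isNoetherianRing, ringKrullDim_eq_zero_of_field, zero_add,
    Nat.card_fin] at h1
  refine le_trans (Nat.cast_le.mpr ?_) h1
  by_contra hlt
  let y : Fin m → Ω := fun a => (g (MvPolynomial.X a)).1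
  -- The images of the variables are padded with zeros to `s.card` entries. The cardinality argument
  -- would make this family independent, which a zero entry excludes.
  let w : Fin m ⊕ Fin (s.card - m) → Ω := Sum.elim y 0
  have hgw : ∀ F, (g F).1 ∈ Algebra.adjoin k (Set.range w) := fun F => by
    have h2 : ((Algebra.adjoin k (Set.range x)).val.comp g) F = MvPolynomial.aeval y F := by
      congr 1
      ext a
      simp [y]
    change ((Algebra.adjoin k (Set.range x)).val.comp g) F ∈ _
    rw [h2]
    refine Algebra.adjoin_mono ?_ (by
      rw [Algebra.adjoin_range_eq_range_aeval]
      exact ⟨F, rfl⟩ : MvPolynomial.aeval y F ∈ Algebra.adjoin k (Set.range y))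
    rintro _ ⟨a, rfl⟩
    exact ⟨Sum.inl a, rfl⟩
  have hind := algebraicIndependent_of_card_le hs w (fun j => by
    rw [mem_algSpan_iff_adjoin]
    obtain ⟨P, hP, hP0⟩ := hint ⟨x j, Algebra.subset_adjoin ⟨j, rfl⟩⟩
    let φ : MvPolynomial (Fin m) k →+* Algebra.adjoin k (Set.range w) :=
      { toFun := fun F => ⟨(g F).1, hgw F⟩
        map_one' := by simp; rfl
        map_mul' := fun F G => by simp
        map_zero' := by simp; rfl
        map_add' := fun F G => by simp }
    refine IsIntegral.isAlgebraic ⟨P.map φ, hP.map φ, ?_⟩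
    rw [Polynomial.eval₂_map]
    have h3 := congrArg (Algebra.adjoin k (Set.range x)).val.toRingHom hP0
    rw [Polynomial.hom_eval₂] at h3
    exact h3.trans (map_zero _)) (by simp; lia)
  exact hind.ne_zero (Sum.inr ⟨0, by lia⟩) rfl

end KrullDim

/-! ### Charts of a closed subscheme of projective space -/

section Charts

variable {V : Type u} [CommRing V] {n : ℕ} {X : Scheme.{u}}

/-- A chart of a closed subscheme of `ℙⁿ_V`: the part where the coordinate `x_r` is invertible. -/
structure ProjChart (i : X ⟶ projSpace n V) (r : Fin (n + 1)) where
  /-- the ring of functions -/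
  B : Type u
  [ring : CommRing B]
  [alg : Algebra V B]
  /-- the map from the polynomial ring -/
  γ : MvPolynomial (Fin (n + 1)) V →ₐ[V] B
  γ_X : γ (MvPolynomial.X r) = 1
  surj : Function.Surjective γ
  /-- the inclusion of the chart -/
  j : Spec (CommRingCat.of B) ⟶ X
  [isOpenImmersion : IsOpenImmersion j]
  mem_range : ∀ z : X, z ∈ Set.range j ↔
    i z ∈ Proj.basicOpen (MvPolynomial.homogeneousSubmodule (Fin (n + 1)) V) (MvPolynomial.X r)
  comp : j ≫ i = projPoint (MvPolynomial.homogeneousSubmodule (Fin (n + 1)) V)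
    (MvPolynomial.isHomogeneous_X V r) γ.toRingHom γ_X

attribute [instance] ProjChart.ring ProjChart.alg ProjChart.isOpenImmersion

lemma nonempty_projChart (i : X ⟶ projSpace n V) [IsClosedImmersion i] (r : Fin (n + 1)) :
    Nonempty (ProjChart i r) := by
  let i' : X ⟶ Proj (MvPolynomial.homogeneousSubmodule (Fin (n + 1)) V) := i
  have hc : IsClosedImmersion i' := ‹IsClosedImmersion i›
  obtain ⟨C, _, γ, h, j, h1, h2, h3, h4⟩ := exists_chart
    (MvPolynomial.homogeneousSubmodule (Fin (n + 1)) V) (MvPolynomial.isHomogeneous_X V r) i'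
  let : Algebra V C := (γ.comp (algebraMap V _)).toAlgebra
  exact ⟨⟨C, { γ with commutes' := fun _ => rfl }, h, h1, j, h3, h4⟩⟩

/-- A ring homomorphism is a point of projective space, followed by the projection. -/
lemma projPoint_projSpaceStr {C : Type u} [CommRing C] [Algebra V C] (r : Fin (n + 1))
    (ψ : MvPolynomial (Fin (n + 1)) V →ₐ[V] C) (h : ψ (MvPolynomial.X r) = 1) :
    projPoint (MvPolynomial.homogeneousSubmodule (Fin (n + 1)) V)
      (MvPolynomial.isHomogeneous_X V r) ψ.toRingHom h ≫ projSpaceStr n V =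
      Spec.map (CommRingCat.ofHom (algebraMap V C)) := by
  rw [projSpaceStr]
  refine (projPoint_toSpecZero _ _ _ _).trans ?_
  congr 2
  exact ψ.comp_algebraMap

namespace ProjChart

variable {i : X ⟶ projSpace n V} {r : Fin (n + 1)} (c : ProjChart i r)

lemma comp_str : c.j ≫ i ≫ projSpaceStr n V = Spec.map (CommRingCat.ofHom (algebraMap V c.B)) := by
  rw [← Category.assoc, c.comp]
  exact projPoint_projSpaceStr r c.γ c.γ_X

lemma mem_iff {m : ℕ} {F : MvPolynomial (Fin (n + 1)) V} (hF : F.IsHomogeneous m)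
    (y : Spec (CommRingCat.of c.B)) :
    F ∈ (show ProjectiveSpectrum (MvPolynomial.homogeneousSubmodule (Fin (n + 1)) V) from
      i (c.j y)).asHomogeneousIdeal ↔ c.γ F ∈ y.asIdeal := by
  have h1 : i (c.j y) = (c.j ≫ i) y := by rw [Scheme.Hom.comp_apply]
  rw [h1, c.comp]
  exact mem_projPoint_iff (MvPolynomial.homogeneousSubmodule (Fin (n + 1)) V)
    (MvPolynomial.isHomogeneous_X V r) c.γ.toRingHom c.γ_X hF y

lemma flat (hflat : Flat (i ≫ projSpaceStr n V)) : Module.Flat V c.B := by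
  have h1 : Flat (c.j ≫ i ≫ projSpaceStr n V) := inferInstance
  rw [c.comp_str] at h1
  exact RingHom.flat_algebraMap_iff.mp ((HasRingHomProperty.Spec_iff (P := @Flat)).mp h1)

/-- By flatness `B` embeds into `B ⊗ K`, the ring of an open subscheme of the reduced generic fibre.
-/
lemma isReduced {K : Type u} [Field K] [Algebra V K]
    (hinj : Function.Injective (algebraMap V K)) (hflat : Flat (i ≫ projSpaceStr n V))
    (hred : IsReduced (pullback (i ≫ projSpaceStr n V)
      (Spec.map (CommRingCat.ofHom (algebraMap V K))))) : _root_.IsReduced c.B := by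
  have := c.flat hflat
  let f := pullback.map (Spec.map (CommRingCat.ofHom (algebraMap V c.B)))
    (Spec.map (CommRingCat.ofHom (algebraMap V K))) (i ≫ projSpaceStr n V)
    (Spec.map (CommRingCat.ofHom (algebraMap V K))) c.j (𝟙 _) (𝟙 _)
    (by rw [Category.comp_id, c.comp_str]) (by simp)
  have h1 : IsReduced (pullback (Spec.map (CommRingCat.ofHom (algebraMap V c.B)))
    (Spec.map (CommRingCat.ofHom (algebraMap V K)))) := isReduced_of_isOpenImmersion f
  have h2 : IsReduced (Spec (CommRingCat.of (TensorProduct V c.B K))) :=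
    isReduced_of_isOpenImmersion (pullbackSpecIso V c.B K).inv
  have h3 : _root_.IsReduced (TensorProduct V c.B K) := (affine_isReduced_iff _).mp h2
  exact isReduced_of_injective (Algebra.TensorProduct.includeLeft (R := V) (S := V))
    (Algebra.TensorProduct.includeLeft_injective (S := V) hinj)

lemma finiteType : Algebra.FiniteType V c.B := Algebra.FiniteType.of_surjective c.γ c.surj

lemma isNoetherianRing [IsNoetherianRing V] : IsNoetherianRing c.B :=
  isNoetherianRing_of_surjective _ _ c.γ.toRingHom c.surj

lemma ringKrullDim_le : ringKrullDim c.B ≤ topologicalKrullDim X := by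
  rw [← PrimeSpectrum.topologicalKrullDim_eq_ringKrullDim]
  exact c.j.isOpenEmbedding.isInducing.topologicalKrullDim_le

end ProjChart

/-- The homogeneous ideal of all forms that vanish at all points of `X`. -/
noncomputable def vanishingForms (i : X ⟶ projSpace n V) :
    HomogeneousIdeal (MvPolynomial.homogeneousSubmodule (Fin (n + 1)) V) :=
  ⨅ z : X, (show ProjectiveSpectrum (MvPolynomial.homogeneousSubmodule (Fin (n + 1)) V) from
    i z).asHomogeneousIdeal

lemma mem_vanishingForms {i : X ⟶ projSpace n V} {F : MvPolynomial (Fin (n + 1)) V} :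
    F ∈ (vanishingForms i).toIdeal ↔ ∀ z : X,
      F ∈ (show ProjectiveSpectrum (MvPolynomial.homogeneousSubmodule (Fin (n + 1)) V) from
        i z).asHomogeneousIdeal := by
  rw [vanishingForms, HomogeneousIdeal.toIdeal_iInf, Submodule.mem_iInf]
  rfl

/-- A polynomial is congruent to a form modulo `x_r - 1`. -/
lemma exists_homogenization (r : Fin (n + 1)) (F : MvPolynomial (Fin (n + 1)) V) :
    ∃ (m : ℕ) (H : MvPolynomial (Fin (n + 1)) V), H.IsHomogeneous m ∧
      H - F ∈ Ideal.span {(MvPolynomial.X r - 1 : MvPolynomial (Fin (n + 1)) V)} := by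
  refine ⟨F.totalDegree, ∑ m ∈ Finset.range (F.totalDegree + 1), MvPolynomial.X r ^
    (F.totalDegree - m) * MvPolynomial.homogeneousComponent m F, ?_, ?_⟩
  · refine MvPolynomial.IsHomogeneous.sum _ _ _ fun m hm => ?_
    have h1 := (MvPolynomial.isHomogeneous_X_pow (R := V) r (F.totalDegree - m)).mul
      (MvPolynomial.homogeneousComponent_isHomogeneous m F)
    have h2 := Finset.mem_range.mp hm
    rwa [Nat.sub_add_cancel (by lia)] at h1
  · have h1 : ∑ m ∈ Finset.range (F.totalDegree + 1), MvPolynomial.X r ^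
        (F.totalDegree - m) * MvPolynomial.homogeneousComponent m F - F =
        ∑ m ∈ Finset.range (F.totalDegree + 1), (MvPolynomial.X r ^ (F.totalDegree - m) - 1) *
          MvPolynomial.homogeneousComponent m F := by
      simp only [sub_mul, one_mul, Finset.sum_sub_distrib]
      rw [F.sum_homogeneousComponent]
    rw [h1]
    refine sum_mem fun m _ => Ideal.mul_mem_right _ _ (Ideal.mem_span_singleton.mpr ?_)
    have h2 := sub_dvd_pow_sub_pow (MvPolynomial.X r : MvPolynomial (Fin (n + 1)) V) 1
      (F.totalDegree - m)
    rwa [one_pow] at h2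

namespace ProjChart

variable {i : X ⟶ projSpace n V} {r : Fin (n + 1)} (c : ProjChart i r)

/-- Each homogeneous component lies in every prime of the chart, hence is nilpotent there. With
`exists_mem_vanishingForms` this shows that, for reduced charts, `vanishingForms` cuts out `X` chart
by chart. -/
lemma γ_eq_zero_of_mem_vanishingForms [_root_.IsReduced c.B] {F : MvPolynomial (Fin (n + 1)) V}
    (hF : F ∈ (vanishingForms i).toIdeal) : c.γ F = 0 := by
  have h1 : ∀ m, c.γ (MvPolynomial.homogeneousComponent m F) = 0 := fun m => by
    refine IsReduced.eq_zero _ ?_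
    rw [nilpotent_iff_mem_prime]
    intro J hJ
    rw [← c.mem_iff (MvPolynomial.homogeneousComponent_isHomogeneous m F) ⟨J, hJ⟩]
    refine mem_vanishingForms.mp ?_ _
    have h2 := (vanishingForms i).isHomogeneous m hF
    change ((MvPolynomial.decomposition.decompose' F m : _) : MvPolynomial (Fin (n + 1)) V) ∈ _ at h2
    rwa [MvPolynomial.decomposition.decompose'_apply] at h2
  rw [← MvPolynomial.sum_homogeneousComponent F, map_sum]
  exact Finset.sum_eq_zero fun m _ => h1 m

lemma exists_mem_vanishingForms {F : MvPolynomial (Fin (n + 1)) V} (hF : c.γ F = 0) :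
    ∃ H ∈ (vanishingForms i).toIdeal,
      H - F ∈ Ideal.span {(MvPolynomial.X r - 1 : MvPolynomial (Fin (n + 1)) V)} := by
  obtain ⟨m, H, hH, hHF⟩ := exists_homogenization r F
  -- The homogenization vanishes only on the chart; the extra factor `x_r` makes it vanish on the
  -- rest of `X` and is invisible modulo `x_r - 1`.
  refine ⟨MvPolynomial.X r * H, ?_, ?_⟩
  · rw [mem_vanishingForms]
    intro z
    by_cases hz : z ∈ Set.range c.j
    · obtain ⟨y, rfl⟩ := hz
      refine Ideal.mul_mem_left _ _ ?_
      refine (c.mem_iff hH y).mpr ?_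
      have h1 : c.γ H = 0 := by
        obtain ⟨G, hG⟩ := Ideal.mem_span_singleton.mp hHF
        rw [← sub_add_cancel H F, hG, map_add, map_mul, map_sub, c.γ_X, hF]
        simp
      rw [h1]
      exact zero_mem _
    · rw [c.mem_range] at hz
      exact Ideal.mul_mem_right _ _ (not_not.mp hz)
  · have h1 : MvPolynomial.X r * H - F = (MvPolynomial.X r - 1) * H + (H - F) := by ring
    rw [h1]
    exact add_mem (Ideal.mul_mem_right _ _ (Ideal.subset_span rfl)) hHF

variable {A : Type u} [CommRing A] [Algebra V A]

lemma aeval_eq_zero {x : Fin (n + 1) → A} (hr : x r = 1)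
    (hx : IsZeroOf (vanishingForms i).toIdeal x) {F : MvPolynomial (Fin (n + 1)) V}
    (hF : c.γ F = 0) : MvPolynomial.aeval x F = 0 := by
  obtain ⟨H, hH, hHF⟩ := c.exists_mem_vanishingForms hF
  obtain ⟨G, hG⟩ := Ideal.mem_span_singleton.mp hHF
  have h1 := congrArg (MvPolynomial.aeval x) hG
  rw [map_sub, hx H hH, map_mul, map_sub, MvPolynomial.aeval_X, hr, map_one, sub_self,
    zero_mul, zero_sub, neg_eq_zero] at h1
  exact h1

/-- The conditions `x r = 1` and `u r = 0` make `x_r - 1` vanish to first order, so passing between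
forms and functions on the chart does not affect tangency. -/
lemma dirDeriv_eq_zero {x u : Fin (n + 1) → A} (hr : x r = 1) (hu : u r = 0)
    (hx : IsTangentTo (vanishingForms i).toIdeal x u) {F : MvPolynomial (Fin (n + 1)) V}
    (hF : c.γ F = 0) : dirDeriv x u F = 0 := by
  obtain ⟨H, hH, hHF⟩ := c.exists_mem_vanishingForms hF
  obtain ⟨G, hG⟩ := Ideal.mem_span_singleton.mp hHF
  have h1 := congrArg (dirDeriv (R := V) x u) hG
  have h2 : dirDeriv x u (MvPolynomial.X r - 1 : MvPolynomial (Fin (n + 1)) V) = 0 := by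
    rw [map_sub, dirDeriv_X, hu, ← MvPolynomial.C_1, dirDeriv_C, sub_self]
  rw [map_sub, hx H hH, dirDeriv_mul, h2, map_sub, MvPolynomial.aeval_X, hr] at h1
  simpa using h1

/-- The point of a chart with given coordinates. -/
lemma exists_algHom {x : Fin (n + 1) → A} (hr : x r = 1)
    (hx : IsZeroOf (vanishingForms i).toIdeal x) :
    ∃ e : c.B →ₐ[V] A, e.comp c.γ = MvPolynomial.aeval x := by
  let e' := Ideal.Quotient.liftₐ (RingHom.ker c.γ) (MvPolynomial.aeval x)
    (fun F hF => c.aeval_eq_zero hr hx hF)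
  refine ⟨e'.comp (Ideal.quotientKerAlgEquivOfSurjective c.surj).symm.toAlgHom, ?_⟩
  ext l
  have h1 : (Ideal.quotientKerAlgEquivOfSurjective c.surj).symm (c.γ (MvPolynomial.X l)) =
      Ideal.Quotient.mk _ (MvPolynomial.X l) := by
    rw [AlgEquiv.symm_apply_eq]
    rfl
  change e' ((Ideal.quotientKerAlgEquivOfSurjective c.surj).symm (c.γ (MvPolynomial.X l))) = _
  rw [h1]
  exact Ideal.Quotient.lift_mk _ _ _

/-- The coordinates of a point of a chart. -/
lemma isZeroOf [_root_.IsReduced c.B] (e : c.B →ₐ[V] A) :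
    IsZeroOf (vanishingForms i).toIdeal fun l => e (c.γ (MvPolynomial.X l)) := fun F hF => by
  have h1 : MvPolynomial.aeval (fun l => e (c.γ (MvPolynomial.X l))) F = e (c.γ F) := by
    have : MvPolynomial.aeval (fun l => e (c.γ (MvPolynomial.X l))) = e.comp c.γ := by
      ext l; simp
    rw [this]
    rfl
  rw [h1, c.γ_eq_zero_of_mem_vanishingForms hF, map_zero]

end ProjChart

end Charts

/-! ### Dimension bounds for charts -/

section Proper

variable {R A : Type u} [CommRing R] [CommRing A] [Algebra R A]

lemma isProper_toSpecZero_of_surjective (𝒜 : ℕ → Submodule R A) [GradedAlgebra 𝒜]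
    [Algebra.FiniteType R A] (h : ∀ a ∈ 𝒜 0, ∃ c, algebraMap R A c = a) :
    IsProper (Proj.toSpecZero 𝒜 ≫ Spec.map (CommRingCat.ofHom (algebraMap R (𝒜 0)))) := by
  have h0 : IsScalarTower R (𝒜 0) A := ⟨fun a b c => smul_mul_assoc a (b : A) c⟩
  have h1 : Algebra.FiniteType (𝒜 0) A := Algebra.FiniteType.of_restrictScalars_finiteType R (𝒜 0) A
  have h2 : IsClosedImmersion (Spec.map (CommRingCat.ofHom (algebraMap R (𝒜 0)))) :=
    IsClosedImmersion.spec_of_surjective _ fun a => by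
      obtain ⟨c, hc⟩ := h a.1 a.2
      exact ⟨c, Subtype.ext hc⟩
  infer_instance

lemma isProper_projSpaceStr (n : ℕ) : IsProper (projSpaceStr n R) := by
  refine isProper_toSpecZero_of_surjective _ fun a ha => ?_
  exact ⟨a.coeff 0, (MvPolynomial.totalDegree_eq_zero_iff_eq_C.mp
    (Nat.le_zero.mp ((MvPolynomial.mem_homogeneousSubmodule _ _).mp ha).totalDegree_le)).symm⟩

end Proper

/-! ### Chains of primes and transcendence bounds for both fibres -/

section Chain

/-- In the localization at a minimal prime `b` is nilpotent, so `s b ^ N = 0` for some `s ∉ p`;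
reducedness removes the exponent. -/
lemma exists_notMem_mul_eq_zero_of_mem_minimalPrimes {B : Type*} [CommRing B] [IsReduced B]
    {p : Ideal B} (hp : p ∈ minimalPrimes B) {b : B} (hb : b ∈ p) : ∃ y ∉ p, y * b = 0 := by
  have := Ideal.IsMinimalPrime.isPrime hp
  have h1 := IsLocalization.subsingleton_primeSpectrum_of_mem_minimalPrimes p hp
    (Localization.AtPrime p)
  have h2 : IsNilpotent (algebraMap B (Localization.AtPrime p) b) := by
    rw [nilpotent_iff_mem_prime]
    intro J hJ
    have h3 : (⟨J, hJ⟩ : PrimeSpectrum (Localization.AtPrime p)) =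
      ⟨IsLocalRing.maximalIdeal _, inferInstance⟩ := Subsingleton.elim _ _
    have h4 := congrArg PrimeSpectrum.asIdeal h3
    change J = _ at h4
    rw [h4]
    exact (IsLocalization.AtPrime.to_map_mem_maximal_iff _ p b).mpr hb
  obtain ⟨N, hN⟩ := h2
  rw [← map_pow, IsLocalization.map_eq_zero_iff p.primeCompl] at hN
  obtain ⟨s, hs⟩ := hN
  refine ⟨s, s.2, ?_⟩
  have h5 : ((s : B) * b) ^ (N + 1) = 0 := by
    rw [mul_pow, pow_succ, pow_succ]
    linear_combination ((s : B) ^ N * b) * hs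
  exact eq_zero_of_pow_eq_zero h5

variable {V : Type u} [CommRing V] [IsDomain V] [IsDiscreteValuationRing V] {n : ℕ}
  {X : Scheme.{u}} {i : X ⟶ projSpace n V} {r : Fin (n + 1)}

namespace ProjChart

variable (c : ProjChart i r)

/-- A chain of primes of a chart whose members lie over the generic point is shorter than the
dimension of the whole scheme. -/
lemma length_le [IsClosedImmersion i] {d : ℕ} (hdim : topologicalKrullDim X = (d + 1 : ℕ))
    {π : V} (hπ : Irreducible π)
    (l : LTSeries (PrimeSpectrum c.B)) (hl : algebraMap V c.B π ∉ l.last.asIdeal) :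
    l.length ≤ d := by
  have hproper : IsProper (projSpaceStr n V) := isProper_projSpaceStr n
  have hcl : IsClosedMap (i ≫ projSpaceStr n V) := Scheme.Hom.isClosedMap _
  let g : X ⟶ Spec (CommRingCat.of V) := i ≫ projSpaceStr n V
  have hg : ∀ y : Spec (CommRingCat.of c.B),
      g (c.j y) = Spec.map (CommRingCat.ofHom (algebraMap V c.B)) y := fun y => by
    rw [← c.comp_str]
    simp [g]
  let pt : X → TopologicalSpace.IrreducibleCloseds X := fun z =>
    ⟨closure {z}, isIrreducible_singleton.closure, isClosed_closure⟩
  have hpt : ∀ z w : X, pt w ≤ pt z ↔ z ⤳ w := fun z w => by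
    rw [specializes_iff_closure_subset]
    rfl
  let f : PrimeSpectrum c.B → (TopologicalSpace.IrreducibleCloseds X)ᵒᵈ := fun y =>
    OrderDual.toDual (pt (c.j (show Spec (CommRingCat.of c.B) from y)))
  have hfle : ∀ y y', f y ≤ f y' ↔ y ≤ y' := fun y y' => by
    rw [PrimeSpectrum.le_iff_specializes]
    refine (OrderDual.toDual_le_toDual.trans (hpt _ _)).trans ?_
    exact c.j.isOpenEmbedding.isInducing.specializes_iff
  have hf : StrictMono f := fun y y' h => by
    rw [lt_iff_le_not_ge, hfle, hfle]
    exact lt_iff_le_not_ge.mp h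
  let z : X := c.j (show Spec (CommRingCat.of c.B) from l.last)
  have hgz : g z ≠ IsLocalRing.closedPoint V := by
    intro h
    rw [hg] at h
    have h2 : π ∈ (IsLocalRing.closedPoint V).asIdeal := hπ.1
    rw [← h] at h2
    exact hl h2
  have hgz' : g z ⤳ IsLocalRing.closedPoint V := IsLocalRing.specializes_closedPoint _
  -- Here projectivity enters: the image of the closure of `z` is closed, so `z` specializes to a
  -- point `w` of the special fibre. The chart itself may contain no such point. Appending `w` makes
  -- the chain one step longer.
  obtain ⟨w, hw, hgw⟩ : IsLocalRing.closedPoint V ∈ g '' closure {z} := by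
    have h2 := hcl _ (isClosed_closure (s := {z}))
    refine hgz'.mem_closed h2 ⟨z, subset_closure rfl, rfl⟩
  have hzw : z ⤳ w := specializes_iff_mem_closure.mpr hw
  have hwz : ¬ w ⤳ z := fun h => by
    have h2 := h.map g.continuous
    rw [hgw] at h2
    have h3 := (IsLocalRing.isClosed_singleton_closedPoint V)
    exact hgz (h2.mem_closed h3 rfl)
  let L := (l.map f hf).snoc (OrderDual.toDual (pt w)) (by
    change f l.last < _
    change pt w < pt z
    rw [lt_iff_le_not_ge, hpt, hpt]
    exact ⟨hzw, hwz⟩)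
  have h3 := Order.LTSeries.length_le_krullDim L
  rw [Order.krullDim_orderDual] at h3
  have h4 : topologicalKrullDim X = Order.krullDim (TopologicalSpace.IrreducibleCloseds X) := rfl
  rw [← h4, hdim] at h3
  have h5 : L.length = l.length + 1 := rfl
  rw [h5] at h3
  have h6 := Nat.cast_le.mp h3
  lia

variable {K : Type u} [Field K] [Algebra V K] [IsFractionRing V K]

/-- Transport of chains of primes from the coordinate ring of a point of the generic fibre. -/
lemma exists_ltSeries {π : V} (hπ : Irreducible π) {Ω : Type u} [Field Ω] [Algebra V Ω]
    [Algebra K Ω] [IsScalarTower V K Ω] {x : Fin (n + 1) → Ω} (e : c.B →ₐ[V] Ω)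
    (he : e.comp c.γ = MvPolynomial.aeval x)
    (l : LTSeries (PrimeSpectrum (Algebra.adjoin K (Set.range x)))) :
    ∃ l' : LTSeries (PrimeSpectrum c.B), l'.length = l.length ∧
      algebraMap V c.B π ∉ l'.last.asIdeal ∧ RingHom.ker e ≤ l'.head.asIdeal := by
  let A := Algebra.adjoin K (Set.range x)
  have hx : ∀ F, e (c.γ F) = MvPolynomial.aeval x F := fun F => by rw [← he]; rfl
  have hrange : ∀ b, e b ∈ A := fun b => by
    obtain ⟨F, rfl⟩ := c.surj b
    rw [hx]
    have h1 : MvPolynomial.aeval x F =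
        MvPolynomial.aeval x (MvPolynomial.map (algebraMap V K) F) := by
      rw [MvPolynomial.aeval_map_algebraMap]
    rw [h1, show A = _ from Algebra.adjoin_range_eq_range_aeval K x]
    exact ⟨_, rfl⟩
  let e0 : c.B →+* A := e.toRingHom.codRestrict A.toSubring hrange
  -- Up to a nonzero denominator from `V`, every element of `K[x]` lies in the image of the chart.
  -- Contraction of primes is therefore strictly monotone.
  have hden : ∀ a ∈ A, ∃ s : V, s ≠ 0 ∧ ∃ b, e b = algebraMap V Ω s * a := fun a ha => by
    induction ha using Algebra.adjoin_induction with
    | mem a ha =>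
      obtain ⟨j, rfl⟩ := ha
      exact ⟨1, one_ne_zero, c.γ (MvPolynomial.X j), by simp [hx]⟩
    | algebraMap a =>
      obtain ⟨p, q, hq, rfl⟩ := IsFractionRing.div_surjective (A := V) a
      have hq0 := nonZeroDivisors.ne_zero hq
      refine ⟨q, hq0, algebraMap V _ p, ?_⟩
      have h2 : algebraMap V K q ≠ 0 :=
        (map_ne_zero_iff _ (IsFractionRing.injective V K)).mpr hq0
      rw [AlgHom.commutes, IsScalarTower.algebraMap_apply V K Ω,
        IsScalarTower.algebraMap_apply V K Ω, ← map_mul, mul_div_cancel₀ _ h2]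
    | add a b _ _ ha hb =>
      obtain ⟨s, hs, y, hy⟩ := ha
      obtain ⟨s', hs', y', hy'⟩ := hb
      refine ⟨s * s', mul_ne_zero hs hs', s' • y + s • y', ?_⟩
      rw [map_add, map_smul, map_smul, hy, hy', Algebra.smul_def, Algebra.smul_def, map_mul]
      ring
    | mul a b _ _ ha hb =>
      obtain ⟨s, hs, y, hy⟩ := ha
      obtain ⟨s', hs', y', hy'⟩ := hb
      refine ⟨s * s', mul_ne_zero hs hs', y * y', ?_⟩
      rw [map_mul, hy, hy', map_mul]
      ring
  have hunit : ∀ s : V, s ≠ 0 → IsUnit (algebraMap K A (algebraMap V K s)) := fun s hs =>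
    (IsUnit.mk0 _ ((map_ne_zero_iff _ (IsFractionRing.injective V K)).mpr hs)).map _
  have he0 : ∀ s, e0 (algebraMap V c.B s) = algebraMap K A (algebraMap V K s) := fun s => by
    apply Subtype.ext
    change e (algebraMap V c.B s) = algebraMap K Ω (algebraMap V K s)
    rw [AlgHom.commutes, IsScalarTower.algebraMap_apply V K Ω]
  let f : PrimeSpectrum A → PrimeSpectrum c.B := PrimeSpectrum.comap e0
  have hf : StrictMono f := fun p q hpq => by
    rw [lt_iff_le_not_ge]
    refine ⟨fun b hb => hpq.le hb, fun hle => hpq.not_ge fun a ha => ?_⟩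
    obtain ⟨s, hs, b, hb⟩ := hden a.1 a.2
    have h1 : e0 b = algebraMap K A (algebraMap V K s) * a := by
      apply Subtype.ext
      change e b = algebraMap K Ω (algebraMap V K s) * a.1
      rw [hb, IsScalarTower.algebraMap_apply V K Ω]
    have h2 : b ∈ (f q).asIdeal := by
      change e0 b ∈ q.asIdeal
      rw [h1]
      exact Ideal.mul_mem_left _ _ ha
    have h3 : e0 b ∈ p.asIdeal := hle h2
    rw [h1] at h3
    exact (Ideal.unit_mul_mem_iff_mem _ (hunit s hs)).mp h3
  refine ⟨l.map f hf, rfl, ?_, ?_⟩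
  · intro h
    have h1 : e0 (algebraMap V c.B π) ∈ l.last.asIdeal := h
    rw [he0] at h1
    exact l.last.2.ne_top (Ideal.eq_top_of_isUnit_mem _ h1 (hunit π hπ.ne_zero))
  · intro b hb
    change e0 b ∈ l.head.asIdeal
    have h1 : e0 b = 0 := Subtype.ext hb
    rw [h1]
    exact zero_mem _

end ProjChart

/-- Independent coordinates give chains of primes over the generic point of `V`, which have length
at most `d`. If `d` is attained, `ker e` is a minimal prime, as otherwise the chain could be
prolonged downwards. Since the chart is reduced, a function `G` vanishing at `x` satisfies `H G = 0`
on the chart with `H(x) ≠ 0`, and differentiating this gives the tangency statement. -/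
lemma genericFibreBound_vanishingForms [IsClosedImmersion i] {d : ℕ}
    (hdim : topologicalKrullDim X = (d + 1 : ℕ)) (hflat : Flat (i ≫ projSpaceStr n V))
    (K : Type u) [Field K] [Algebra V K] [IsFractionRing V K]
    (hred : IsReduced (pullback (i ≫ projSpaceStr n V)
      (Spec.map (CommRingCat.ofHom (algebraMap V K))))) :
    GenericFibreBound K d (vanishingForms i).toIdeal := by
  obtain ⟨π, hπ⟩ := IsDiscreteValuationRing.exists_irreducible V
  intro Ω _ _ _ _ x r hr hx
  obtain ⟨c⟩ := nonempty_projChart i r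
  have := c.isReduced (IsFractionRing.injective V K) hflat hred
  obtain ⟨e, he⟩ := c.exists_algHom hr hx
  have h1 : ∀ s : Finset (Fin (n + 1)), AlgebraicIndependent K (fun j : s => x j) →
      ∃ l : LTSeries (PrimeSpectrum c.B), l.length = s.card ∧
        algebraMap V c.B π ∉ l.last.asIdeal ∧ RingHom.ker e ≤ l.head.asIdeal := fun s hs => by
    obtain ⟨l, hl⟩ := Order.le_krullDim_iff.mp (card_le_ringKrullDim_adjoin x s hs)
    rw [← hl]
    exact c.exists_ltSeries hπ e he l
  refine ⟨fun s hs => ?_, fun t ht u hu hux G hG => ?_⟩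
  · obtain ⟨l, hl, hl2, -⟩ := h1 s hs
    exact hl ▸ c.length_le hdim hπ l hl2
  classical
  have hxinj : Function.Injective t := fun a b hab =>
    ht.injective (congrArg x hab)
  have h2 : AlgebraicIndependent K (fun j : (Finset.univ.image t : Finset (Fin (n + 1))) => x j) := by
    let e : Fin d ≃ (Finset.univ.image t : Finset (Fin (n + 1))) :=
      Equiv.ofBijective (fun a => ⟨t a, Finset.mem_image_of_mem _ (Finset.mem_univ _)⟩)
        ⟨fun a b hab => hxinj (congrArg Subtype.val hab), fun ⟨b, hb⟩ => by
          obtain ⟨a, -, rfl⟩ := Finset.mem_image.mp hb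
          exact ⟨a, rfl⟩⟩
    exact (algebraicIndependent_equiv' e rfl).mp ht
  obtain ⟨l, hl, hl2, hl3⟩ := h1 _ h2
  rw [Finset.card_image_of_injective _ hxinj, Finset.card_univ, Fintype.card_fin] at hl
  have hprime : (RingHom.ker e).IsPrime := RingHom.ker_isPrime e.toRingHom
  have hmin : RingHom.ker e ∈ minimalPrimes c.B := by
    obtain ⟨p, hp, hpe⟩ := Ideal.exists_minimalPrimes_le (bot_le : (⊥ : Ideal c.B) ≤ RingHom.ker e)
    have hpp := Ideal.IsMinimalPrime.isPrime hp
    by_cases hlt : p = l.head.asIdeal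
    · have : RingHom.ker e = p := le_antisymm (hlt ▸ hl3) hpe
      exact this ▸ hp
    · have h4 := c.length_le hdim hπ (l.cons ⟨p, hpp⟩
        (show (⟨p, hpp⟩ : PrimeSpectrum c.B) < l.head from
          lt_of_le_of_ne (hpe.trans hl3) fun h => hlt (congrArg PrimeSpectrum.asIdeal h)))
        (by rwa [RelSeries.last_cons])
      rw [RelSeries.cons_length] at h4
      lia
  have hxe : ∀ F, e (c.γ F) = MvPolynomial.aeval x F := fun F => by rw [← he]; rfl
  obtain ⟨y, hy, hyG⟩ := exists_notMem_mul_eq_zero_of_mem_minimalPrimes hmin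
    (show c.γ G ∈ RingHom.ker e from (hxe G).trans hG)
  obtain ⟨H, rfl⟩ := c.surj y
  rw [← map_mul] at hyG
  have h6 := c.dirDeriv_eq_zero hr hu hux hyG
  rw [dirDeriv_mul, hG, zero_mul, add_zero] at h6
  refine (mul_eq_zero.mp h6).resolve_left fun h7 => hy ?_
  exact (hxe H).trans h7

/-- `B / π` surjects onto `k[x]`, and `π` is a nonzerodivisor on the flat algebra `B`, so `B / π`
has dimension at most `dim B - 1 ≤ d`. -/
lemma zeroBound_vanishingForms [IsClosedImmersion i] {d : ℕ}
    (hdim : topologicalKrullDim X = (d + 1 : ℕ)) (hflat : Flat (i ≫ projSpaceStr n V)) :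
    ZeroBound d ((vanishingForms i).toIdeal.map (MvPolynomial.map (IsLocalRing.residue V))) := by
  obtain ⟨π, hπ⟩ := IsDiscreteValuationRing.exists_irreducible V
  intro Ω _ _ x r hr hx s hs
  obtain ⟨c⟩ := nonempty_projChart i r
  let : Algebra V Ω := ((algebraMap (IsLocalRing.ResidueField V) Ω).comp
    (algebraMap V (IsLocalRing.ResidueField V))).toAlgebra
  have : IsScalarTower V (IsLocalRing.ResidueField V) Ω := IsScalarTower.of_algebraMap_eq fun _ => rfl
  have hmap : ∀ F : MvPolynomial (Fin (n + 1)) V,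
      MvPolynomial.aeval x (MvPolynomial.map (IsLocalRing.residue V) F) =
        MvPolynomial.aeval x F := fun F =>
    MvPolynomial.aeval_map_algebraMap _ _ _
  have hx' : IsZeroOf (vanishingForms i).toIdeal x := fun F hF => by
    rw [← hmap]
    exact hx _ (Ideal.mem_map_of_mem _ hF)
  obtain ⟨e, he⟩ := c.exists_algHom hr hx'
  have hxe : ∀ F, e (c.γ F) = MvPolynomial.aeval x F := fun F => by rw [← he]; rfl
  let A := Algebra.adjoin (IsLocalRing.ResidueField V) (Set.range x)
  have hA : A = _ := Algebra.adjoin_range_eq_range_aeval (IsLocalRing.ResidueField V) x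
  have hrange : ∀ b, e b ∈ A := fun b => by
    obtain ⟨F, rfl⟩ := c.surj b
    rw [hxe, ← hmap, hA]
    exact ⟨_, rfl⟩
  let e0 : c.B →+* A := e.toRingHom.codRestrict A.toSubring hrange
  have he0 : ∀ b ∈ Ideal.span {algebraMap V c.B π}, e0 b = 0 := fun b hb => by
    obtain ⟨y, rfl⟩ := Ideal.mem_span_singleton.mp hb
    apply Subtype.ext
    change e _ = 0
    rw [map_mul, AlgHom.commutes, IsScalarTower.algebraMap_apply V (IsLocalRing.ResidueField V),
      IsLocalRing.ResidueField.algebraMap_eq, (IsLocalRing.residue_eq_zero_iff π).mpr hπ.1, map_zero,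
      zero_mul]
  have hsurj : Function.Surjective (Ideal.Quotient.lift _ e0 he0) := fun a => by
    obtain ⟨F, hF⟩ := hA.le a.2
    obtain ⟨G, rfl⟩ := MvPolynomial.map_surjective (IsLocalRing.residue V)
      (IsLocalRing.residue_surjective) F
    refine ⟨Ideal.Quotient.mk _ (c.γ G), Subtype.ext ?_⟩
    rw [Ideal.Quotient.lift_mk]
    change e _ = _
    rw [hxe, ← hmap]
    exact hF
  have h1 := (card_le_ringKrullDim_adjoin x s hs).trans (ringKrullDim_le_of_surjective _ hsurj)
  have := c.flat hflat
  have hreg : algebraMap V c.B π ∈ nonZeroDivisors c.B := by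
    rw [mem_nonZeroDivisors_iff_right]
    intro b hb
    have h2 := (Module.Flat.isSMulRegular_of_nonZeroDivisors (M := c.B)
      (mem_nonZeroDivisors_of_ne_zero hπ.ne_zero))
    refine h2 ?_
    simp only [smul_zero]
    rw [Algebra.smul_def, mul_comm, hb]
  have h3 := (ringKrullDim_quotient_succ_le_of_nonZeroDivisor hreg).trans (c.ringKrullDim_le)
  rw [hdim] at h3
  have h4 := (add_le_add_left h1 1).trans h3
  have h5 : ((s.card + 1 : ℕ) : WithBot ℕ∞) ≤ ((d + 1 : ℕ) : WithBot ℕ∞) := by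
    push_cast at h4 ⊢
    exact h4
  have h6 := Nat.cast_le.mp h5
  lia

end Chain

/-! ### Reduction of tangent vectors modulo a valuation -/

section Rescale

variable {σ : Type*} {R A : Type*} [CommRing R] [CommRing A] [Algebra R A] {m : ℕ}
  {F : MvPolynomial σ R}

lemma aeval_eq_zero_of_map {A B : Type*} [CommRing A] [Algebra R A] [CommRing B] [Algebra R B]
    (φ : A →ₐ[R] B) (hφ : Function.Injective φ) {x : σ → A}
    (h : MvPolynomial.aeval (fun l => φ (x l)) F = 0) : MvPolynomial.aeval x F = 0 := by
  refine hφ ?_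
  rw [map_zero, MvPolynomial.comp_aeval_apply, h]

variable [Fintype σ]

lemma aeval_mul_left_of_isHomogeneous (hF : F.IsHomogeneous m) (c : A) (x : σ → A) :
    MvPolynomial.aeval (fun l => c * x l) F = c ^ m * MvPolynomial.aeval x F := by
  rw [MvPolynomial.aeval_def, MvPolynomial.aeval_def, MvPolynomial.eval₂_eq', MvPolynomial.eval₂_eq',
    Finset.mul_sum]
  refine Finset.sum_congr rfl fun s hs => ?_
  have h1 : ∑ l, s l = m := by
    have h2 := hF (MvPolynomial.mem_support_iff.mp hs)
    rw [Finsupp.weight_apply, Finsupp.sum_fintype _ _ (by simp)] at h2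
    simpa using h2
  simp only [mul_pow, Finset.prod_mul_distrib, Finset.prod_pow_eq_pow_sum, h1]
  ring

lemma dirDeriv_mul_left_of_isHomogeneous (hF : F.IsHomogeneous m) (c : A) (x u : σ → A) :
    dirDeriv (fun l => c * x l) u F = c ^ (m - 1) * dirDeriv x u F := by
  simp only [dirDeriv_apply, Finset.mul_sum]
  refine Finset.sum_congr rfl fun l _ => ?_
  rw [aeval_mul_left_of_isHomogeneous hF.pderiv, mul_assoc]

lemma dirDeriv_self_of_isHomogeneous (hF : F.IsHomogeneous m) (x : σ → A) :
    dirDeriv x x F = m * MvPolynomial.aeval x F := by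
  have h1 := congrArg (MvPolynomial.aeval x) hF.sum_X_mul_pderiv
  simp only [map_sum, map_mul, MvPolynomial.aeval_X, nsmul_eq_mul, map_natCast] at h1
  rw [dirDeriv_apply, ← h1]
  exact Finset.sum_congr rfl fun l _ => mul_comm _ _

lemma dirDeriv_add_right (x u v : σ → A) (F : MvPolynomial σ R) :
    dirDeriv x (fun l => u l + v l) F = dirDeriv x u F + dirDeriv x v F := by
  simp only [dirDeriv_apply, mul_add, Finset.sum_add_distrib]

lemma aeval_rescale_eq_zero (hF : F.IsHomogeneous m) {x : σ → A} (hx : MvPolynomial.aeval x F = 0)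
    (c : A) : MvPolynomial.aeval (fun l => c * x l) F = 0 := by
  rw [aeval_mul_left_of_isHomogeneous hF, hx, mul_zero]

/-- By Euler's relation a form vanishing at `x` is also stationary along `x`. Adding a multiple of
`x` to `u` is thus harmless, and a tangent vector can be moved from one chart to another. -/
lemma dirDeriv_rescale_eq_zero (hF : F.IsHomogeneous m) {x u : σ → A}
    (hx : MvPolynomial.aeval x F = 0) (hu : dirDeriv x u F = 0) (c a b : A) :
    dirDeriv (fun l => c * x l) (fun l => a * u l + b * x l) F = 0 := by
  rw [dirDeriv_mul_left_of_isHomogeneous hF, dirDeriv_add_right, dirDeriv_smul, dirDeriv_smul, hu,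
    dirDeriv_self_of_isHomogeneous hF, hx]
  simp

variable {V : Type u} [CommRing V] {n : ℕ}
  {I : HomogeneousIdeal (MvPolynomial.homogeneousSubmodule (Fin (n + 1)) V)}

lemma HomogeneousIdeal.homogeneousComponent_mem {F : MvPolynomial (Fin (n + 1)) V}
    (hF : F ∈ I.toIdeal) (m : ℕ) : MvPolynomial.homogeneousComponent m F ∈ I.toIdeal := by
  have h2 := I.isHomogeneous m hF
  change ((MvPolynomial.decomposition.decompose' F m : _) : MvPolynomial (Fin (n + 1)) V) ∈ _ at h2
  rwa [MvPolynomial.decomposition.decompose'_apply] at h2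

lemma IsZeroOf.rescale {A : Type*} [CommRing A] [Algebra V A] {x : Fin (n + 1) → A}
    (hx : IsZeroOf I.toIdeal x) (c : A) : IsZeroOf I.toIdeal fun l => c * x l := fun F hF => by
  rw [← MvPolynomial.sum_homogeneousComponent F, map_sum]
  exact Finset.sum_eq_zero fun m _ => aeval_rescale_eq_zero
    (MvPolynomial.homogeneousComponent_isHomogeneous m F)
    (hx _ (HomogeneousIdeal.homogeneousComponent_mem hF m)) c

lemma IsTangentTo.rescale {A : Type*} [CommRing A] [Algebra V A] {x u : Fin (n + 1) → A}
    (hx : IsZeroOf I.toIdeal x) (hu : IsTangentTo I.toIdeal x u) (c a b : A) :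
    IsTangentTo I.toIdeal (fun l => c * x l) (fun l => a * u l + b * x l) := fun F hF => by
  rw [← MvPolynomial.sum_homogeneousComponent F, map_sum]
  exact Finset.sum_eq_zero fun m _ => dirDeriv_rescale_eq_zero
    (MvPolynomial.homogeneousComponent_isHomogeneous m F)
    (hx _ (HomogeneousIdeal.homogeneousComponent_mem hF m))
    (hu _ (HomogeneousIdeal.homogeneousComponent_mem hF m)) c a b

lemma dirDeriv_eq_zero_of_map {A B : Type*} [CommRing A] [Algebra R A] [CommRing B] [Algebra R B]
    (φ : A →ₐ[R] B) (hφ : Function.Injective φ) {x u : σ → A}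
    (h : dirDeriv (fun l => φ (x l)) (fun l => φ (u l)) F = 0) : dirDeriv x u F = 0 := by
  refine hφ ?_
  rw [map_zero, map_dirDeriv, h]

end Rescale

/-! ### Degenerate tangent vectors reduce to the base point -/

section Center

variable {V : Type u} [CommRing V] {n d : ℕ}
  {I : HomogeneousIdeal (MvPolynomial.homogeneousSubmodule (Fin (n + 1)) V)}
  {k : Type u} [Field k] (r₀ : V →+* k) {K : Type u} [Field K] [Algebra V K]

/-- A common tangent vector of `X` and the quadrics `g_j`, none of whose reductions `f_j` is special,
sits at a point that reduces to the base point `p`; it can be scaled to a primitive vector. -/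
lemma exists_primitive_tangent_at_point
    {E : Fin (n + 1) → (Fin d → Fin (n + 1)) → MvPolynomial ((Fin d × Fin n) ⊕ Fin d) V}
    (hE : ∀ i t, ∀ (κ : Type u) [Field κ] [Algebra V κ] [Algebra K κ] [IsScalarTower V K κ]
        [Algebra.IsAlgebraic K κ] (x u : Fin (n + 1) → κ) (v : Fin d × Fin n → κ), x i = 1 →
        u i = 0 → u ≠ 0 → IsZeroOf I.toIdeal x → IsTangentTo I.toIdeal x u →
        (∀ j, ∑ l, v (j, l) * u (i.succAbove l) = 0) →
        MvPolynomial.aeval (Sum.elim v (x ∘ t)) (E i t) = 0)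
    {p : Fin (n + 1) → k} {r : Fin (n + 1)}
    {f : Fin d → MvPolynomial (Fin (n + 1)) k}
    (hf : ∀ i s, ∀ q : Fin (n + 1) → k, q i = 1 →
      IsZeroOf (I.toIdeal.map (MvPolynomial.map r₀)) q → MvPolynomial.eval q (lineThrough p r s) ≠ 0 →
      (∀ j, MvPolynomial.eval q (f j) = 0) →
      ∃ t, MvPolynomial.eval (Sum.elim (fun a : Fin d × Fin n =>
        MvPolynomial.eval q (MvPolynomial.pderiv (i.succAbove a.2) (f a.1))) (q ∘ t))
          (MvPolynomial.map r₀ (E i t)) ≠ 0)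
    {O κ : Type u} [CommRing O] [IsDomain O] [ValuationRing O] [Field κ] [Algebra O κ]
    [IsFractionRing O κ] [Algebra V O] [Algebra V κ] [IsScalarTower V O κ] [Algebra K κ]
    [IsScalarTower V K κ] [Algebra.IsAlgebraic K κ] (ρ : O →+* k)
    (hρ : ∀ a, ρ (algebraMap V O a) = r₀ a) (hunit : ∀ a, ρ a ≠ 0 → IsUnit a)
    {g : Fin d → MvPolynomial (Fin (n + 1)) O} (hg : ∀ j, (g j).IsHomogeneous 2)
    (hgf : ∀ j, MvPolynomial.map ρ (g j) = f j)
    {x u : Fin (n + 1) → κ} {i₀ : Fin (n + 1)} (hxi : x i₀ = 1) (hui : u i₀ = 0) (hu0 : u ≠ 0)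
    (hx : IsZeroOf I.toIdeal x) (hu : IsTangentTo I.toIdeal x u)
    (hgx : ∀ j, MvPolynomial.aeval x (g j) = 0) (hgu : ∀ j, dirDeriv x u (g j) = 0) :
    ∃ x' u' : Fin (n + 1) → O, x' r = 1 ∧ u' r = 0 ∧ (∃ l, ρ (u' l) ≠ 0) ∧ (∀ l, ρ (x' l) = p l) ∧
      IsZeroOf I.toIdeal x' ∧ IsTangentTo I.toIdeal x' u' ∧
      (∀ j, MvPolynomial.aeval x' (g j) = 0) ∧ ∀ j, dirDeriv x' u' (g j) = 0 := by
  have hinj : Function.Injective (algebraMap O κ) := IsFractionRing.injective O κ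
  -- rescaling to a chart containing the reduction
  have hscale : ∀ (y : Fin (n + 1) → O) (i : Fin (n + 1)), y i = 1 → ∀ c : κ, c ≠ 0 →
      (∀ l, algebraMap O κ (y l) = c * x l) → ∃ w : Fin (n + 1) → κ, w i = 0 ∧ w ≠ 0 ∧
        IsZeroOf I.toIdeal (fun l => algebraMap O κ (y l)) ∧
        IsTangentTo I.toIdeal (fun l => algebraMap O κ (y l)) w ∧
        (∀ j, MvPolynomial.aeval (fun l => algebraMap O κ (y l)) (g j) = 0) ∧
        ∀ j, dirDeriv (fun l => algebraMap O κ (y l)) w (g j) = 0 := by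
    intro y i hyi c hc hy
    have hy' : (fun l => algebraMap O κ (y l)) = fun l => c * x l := funext hy
    have hxi' : c * x i = 1 := by rw [← hy, hyi, map_one]
    -- The multiple of `x` is chosen to make the `i`-th component vanish. The result is nonzero
    -- because `u i₀ = 0` while `x i₀ = 1`.
    refine ⟨fun l => 1 * u l + (-(c * u i)) * x l, ?_, fun h0 => ?_, ?_, ?_, fun j => ?_, fun j => ?_⟩
    · linear_combination (-u i) * hxi'
    · have h1 := congrFun h0 i₀
      simp only [hui, hxi, Pi.zero_apply, mul_zero, zero_add, mul_one, neg_eq_zero] at h1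
      refine hu0 (funext fun l => ?_)
      have h2 := congrFun h0 l
      simpa [h1] using h2
    · rw [hy']; exact hx.rescale c
    · rw [hy']; exact hu.rescale hx c _ _
    · rw [hy']; exact aeval_rescale_eq_zero (hg j) (hgx j) c
    · rw [hy']; exact dirDeriv_rescale_eq_zero (hg j) (hgx j) (hgu j) c _ _
  obtain ⟨i, hi0, hi⟩ := ValuationRing.exists_forall_div_mem (A := O) x
    ⟨i₀, by rw [hxi]; exact one_ne_zero⟩
  choose y hy using hi
  have hyi : y i = 1 := hinj (by rw [hy, div_self hi0, map_one])
  obtain ⟨w, hwi, hw0, hyz, hwt, hgy, hgw⟩ := hscale y i hyi (x i)⁻¹ (inv_ne_zero hi0)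
    fun l => by rw [hy, div_eq_inv_mul]
  have hyO : IsZeroOf I.toIdeal y := fun F hF =>
    aeval_eq_zero_of_map (IsScalarTower.toAlgHom V O κ) hinj (hyz F hF)
  have hred : ∀ G : MvPolynomial (Fin (n + 1)) O, MvPolynomial.eval (fun l => ρ (y l))
      (MvPolynomial.map ρ G) = ρ (MvPolynomial.eval y G) := fun G => by
    rw [MvPolynomial.eval_map, MvPolynomial.eval₂_comp]
    rfl
  have hgyO : ∀ j, MvPolynomial.eval y (g j) = 0 := fun j => by
    have := aeval_eq_zero_of_map (Algebra.ofId O κ) hinj (hgy j)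
    rwa [MvPolynomial.aeval_eq_eval] at this
  have hV : (algebraMap V O) = algebraMap V O := rfl
  have hmapV : ∀ {τ : Type} (z : τ → O) (F : MvPolynomial τ V),
      MvPolynomial.eval (fun l => ρ (z l)) (MvPolynomial.map r₀ F) = ρ (MvPolynomial.aeval z F) :=
    fun z F => by
    rw [MvPolynomial.eval_map, MvPolynomial.aeval_def, MvPolynomial.hom_eval₂]
    congr 1
    exact (RingHom.ext hρ).symm
  have hzero : IsZeroOf (I.toIdeal.map (MvPolynomial.map r₀)) fun l => ρ (y l) := fun F hF => by
    have h1 : I.toIdeal.map (MvPolynomial.map r₀) ≤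
        RingHom.ker (MvPolynomial.aeval (R := k) (fun l => ρ (y l))) := by
      rw [Ideal.map_le_iff_le_comap]
      intro G hG
      change MvPolynomial.aeval _ _ = _
      rw [MvPolynomial.aeval_eq_eval]
      exact (hmapV y G).trans (by rw [hyO G hG, map_zero])
    exact h1 hF
  -- the point reduces to `p`
  have hline : ∀ s, MvPolynomial.eval (fun l => ρ (y l)) (lineThrough p r s) = 0 := by
    intro s
    by_contra hs
    -- Off the base point some reduced equation is nonzero at the reduced jet, whereas `E i t`
    -- vanishes at the jet of the `g j` because they kill `w`.
    obtain ⟨t, ht⟩ := hf i s (fun l => ρ (y l)) (by rw [hyi, map_one]) hzero hs fun j => by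
      rw [← hgf, hred, hgyO, map_zero]
    let v : Fin d × Fin n → O := fun a =>
      MvPolynomial.eval y (MvPolynomial.pderiv (i.succAbove a.2) (g a.1))
    have h1 := hE i t κ (fun l => algebraMap O κ (y l)) w (fun a => algebraMap O κ (v a))
      (by rw [hyi, map_one]) hwi hw0 hyz hwt fun j => by
        have h2 := hgw j
        rw [dirDeriv_apply, Fin.sum_univ_succAbove _ i, hwi, mul_zero, zero_add] at h2
        rw [← h2]
        refine Finset.sum_congr rfl fun l _ => ?_
        congr 1
        have h3 := MvPolynomial.comp_aeval_apply (Algebra.ofId O κ) (f := y)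
          (p := MvPolynomial.pderiv (i.succAbove l) (g j))
        rw [MvPolynomial.aeval_eq_eval] at h3
        exact h3
    have h4 : (Sum.elim (fun a => algebraMap O κ (v a)) ((fun l => algebraMap O κ (y l)) ∘ t)) =
        fun a => IsScalarTower.toAlgHom V O κ (Sum.elim v (y ∘ t) a) := by
      ext a; cases a <;> rfl
    rw [h4] at h1
    have h5 := aeval_eq_zero_of_map (IsScalarTower.toAlgHom V O κ) hinj h1
    apply ht
    have h6 := hmapV (Sum.elim v (y ∘ t)) (E i t)
    rw [h5, map_zero] at h6
    rw [← h6]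
    congr 2
    ext a
    cases a with
    | inl a =>
      change MvPolynomial.eval _ _ = ρ (MvPolynomial.eval _ _)
      rw [← hred, ← MvPolynomial.pderiv_map, hgf]
    | inr a => rfl
  -- The reduction is now known to be proportional to `p`, so `y r` is a unit and the point can be
  -- moved to chart `r`.
  have hys : ∀ s, ρ (y s) = p s * ρ (y r) := fun s => by
    have := hline s
    simp only [lineThrough, map_sub, map_mul, MvPolynomial.eval_X, MvPolynomial.eval_C] at this
    exact sub_eq_zero.mp this
  have hyr : ρ (y r) ≠ 0 := fun h0 => by
    have := hys i
    rw [hyi, h0, map_one, mul_zero] at this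
    exact one_ne_zero this
  obtain ⟨ε, hε⟩ := hunit _ hyr
  let y' : Fin (n + 1) → O := fun l => ↑ε⁻¹ * y l
  have hy'r : y' r = 1 := by rw [← ε.inv_mul, hε]
  obtain ⟨w', hwr', hw0', hyz', hwt', hgy', hgw'⟩ := hscale y' r hy'r
    (algebraMap O κ ↑ε⁻¹ * (x i)⁻¹) (mul_ne_zero
      ((map_ne_zero_iff _ hinj).mpr ε⁻¹.ne_zero) (inv_ne_zero hi0))
    fun l => by rw [map_mul, hy, div_eq_inv_mul, mul_assoc]
  -- Dividing by a component of largest value gives an integral tangent vector with a component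
  -- equal to `1`, hence with nonzero reduction.
  obtain ⟨l₀, hl0, hl⟩ := ValuationRing.exists_forall_div_mem (A := O) w'
    (Function.ne_iff.mp hw0')
  choose z hz using hl
  have hz' : (fun l => algebraMap O κ (z l)) = fun l => (w' l₀)⁻¹ * w' l :=
    funext fun l => by rw [hz, div_eq_inv_mul]
  refine ⟨y', z, hy'r, hinj (by rw [hz, hwr', zero_div, map_zero]), ⟨l₀, ?_⟩, fun l => ?_, ?_, ?_,
    fun j => ?_, fun j => ?_⟩
  · have : z l₀ = 1 := hinj (by rw [hz, div_self hl0, map_one])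
    rw [this, map_one]
    exact one_ne_zero
  · have h1 : ρ (↑ε⁻¹ : O) * ρ (y r) = 1 := by rw [← map_mul, ← hε, ε.inv_mul, map_one]
    rw [map_mul, hys]
    linear_combination p l * h1
  · exact fun F hF => aeval_eq_zero_of_map (IsScalarTower.toAlgHom V O κ) hinj (hyz' F hF)
  · intro F hF
    refine dirDeriv_eq_zero_of_map (IsScalarTower.toAlgHom V O κ) hinj ?_
    change dirDeriv (fun l => algebraMap O κ (y' l)) (fun l => algebraMap O κ (z l)) F = 0
    rw [hz', dirDeriv_smul, hwt' F hF, mul_zero]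
  · exact aeval_eq_zero_of_map (Algebra.ofId O κ) hinj (hgy' j)
  · refine dirDeriv_eq_zero_of_map (Algebra.ofId O κ) hinj ?_
    change dirDeriv (fun l => algebraMap O κ (y' l)) (fun l => algebraMap O κ (z l)) (g j) = 0
    rw [hz', dirDeriv_smul, hgw' j, mul_zero]

end Center

/-! ### Places of finite extensions -/

section Place

/-- A place of a finite extension extending a given residue map with algebraically closed target. -/
lemma exists_valuationRing {V K κ W k : Type u} [CommRing V] [IsDedekindDomain V]
    [Field K] [Algebra V K] [IsFractionRing V K] [CharZero K] [Field κ] [Algebra K κ]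
    [FiniteDimensional K κ] [Algebra V κ] [IsScalarTower V K κ] [CommRing W] [Algebra V W]
    [Algebra.IsIntegral V W] [Algebra W κ] [IsScalarTower V W κ] [Field k] [IsAlgClosed k]
    (hWκ : Function.Injective (algebraMap W κ)) (r : W →+* k) (hr : Function.Surjective r) {π : V} (hπ : π ≠ 0)
    (hrπ : r (algebraMap V W π) = 0) :
    ∃ (O : Type u) (_ : CommRing O) (_ : IsDomain O) (_ : ValuationRing O) (_ : Algebra O κ)
      (_ : IsFractionRing O κ) (_ : Algebra W O) (_ : IsScalarTower W O κ) (_ : Algebra V O)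
      (_ : IsScalarTower V O κ) (_ : IsScalarTower V W O) (ρ : O →+* k),
      (∀ a, ρ (algebraMap W O a) = r a) ∧ ∀ a, ρ a ≠ 0 → IsUnit a := by
  let D := integralClosure V κ
  have hD : IsDedekindDomain D := integralClosure.isDedekindDomain V K κ
  have hDf : IsFractionRing D κ := integralClosure.isFractionRing_of_finite_extension K κ
  have hWD : ∀ a : W, algebraMap W κ a ∈ D := fun a =>
    (Algebra.IsIntegral.isIntegral (R := V) a).map (IsScalarTower.toAlgHom V W κ)
  let φ : W →+* D := (algebraMap W κ).codRestrict D.toSubring hWD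
  let algWD : Algebra W D := φ.toAlgebra
  have : IsScalarTower V W D := IsScalarTower.of_algebraMap_eq fun a => Subtype.ext
    (IsScalarTower.algebraMap_apply V W κ a)
  have : IsScalarTower W D κ := IsScalarTower.of_algebraMap_eq fun _ => rfl
  have : Algebra.IsIntegral W D := Algebra.IsIntegral.tower_top V
  let m := RingHom.ker r
  have hm : m.IsMaximal := RingHom.ker_isMaximal_of_surjective r hr
  have hk : RingHom.ker (algebraMap W D) ≤ m := fun a ha => by
    have h1 : algebraMap W κ a = 0 := congrArg Subtype.val ha
    rw [(map_eq_zero_iff _ hWκ).mp h1]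
    exact zero_mem _
  obtain ⟨M, hM, hMm⟩ := Ideal.exists_ideal_over_maximal_of_isIntegral (S := D) m hk
  have : M.LiesOver m := ⟨hMm.symm⟩
  let : Algebra (W ⧸ m) k := (RingHom.kerLift r).toAlgebra
  let := Ideal.Quotient.field M
  let := Ideal.Quotient.field m
  -- The residue field at `M` is integral over that of `W`, so it embeds in the algebraically closed
  -- field `k` compatibly with `r`.
  let ψ : D ⧸ M →ₐ[W ⧸ m] k := IsAlgClosed.lift
  let ρ₀ : D →+* k := ψ.toRingHom.comp (Ideal.Quotient.mk M)
  have hρ₀ : ∀ a, ρ₀ (algebraMap W D a) = r a := fun a =>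
    (ψ.commutes (Ideal.Quotient.mk m a)).trans (RingHom.kerLift_mk r a)
  have hρM : ∀ a, ρ₀ a = 0 ↔ a ∈ M := fun a => by
    change ψ (Ideal.Quotient.mk M a) = 0 ↔ _
    rw [map_eq_zero_iff ψ ψ.toRingHom.injective, Ideal.Quotient.eq_zero_iff_mem]
  -- `M` contains the nonzero element `π`; this makes the localization of the Dedekind domain `D` at
  -- `M` a discrete valuation ring.
  have hM0 : M ≠ ⊥ := fun h0 => by
    have h1 : algebraMap V D π ∈ M := by
      rw [← hρM, IsScalarTower.algebraMap_apply V W D, hρ₀, hrπ]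
    rw [h0] at h1
    have h2 : algebraMap V κ π = 0 := congrArg Subtype.val h1
    rw [IsScalarTower.algebraMap_apply V K κ, map_eq_zero,
      map_eq_zero_iff _ (IsFractionRing.injective V K)] at h2
    exact hπ h2
  let O := Localization.AtPrime M
  have hO : IsDiscreteValuationRing O :=
    IsLocalization.AtPrime.isDiscreteValuationRing_of_dedekind_domain D hM0 O
  have hle : M.primeCompl ≤ nonZeroDivisors D := M.primeCompl_le_nonZeroDivisors
  let : Algebra O κ := (IsLocalization.lift (M := M.primeCompl) (S := O) (g := algebraMap D κ)
    fun s => IsUnit.mk0 _ (IsFractionRing.to_map_ne_zero_of_mem_nonZeroDivisors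
      (hle s.2))).toAlgebra
  have : IsScalarTower D O κ := IsScalarTower.of_algebraMap_eq fun a =>
    (IsLocalization.lift_eq _ a).symm
  have : IsFractionRing O κ :=
    IsFractionRing.isFractionRing_of_isDomain_of_isLocalization M.primeCompl O κ
  let algWO : Algebra W O := ((algebraMap D O).comp (algebraMap W D)).toAlgebra
  let algVO : Algebra V O := ((algebraMap D O).comp (algebraMap V D)).toAlgebra
  have hρu : ∀ s : M.primeCompl, IsUnit (ρ₀ s) := fun s =>
    IsUnit.mk0 _ fun h => s.2 ((hρM _).mp h)
  refine ⟨O, inferInstance, inferInstance, inferInstance, inferInstance, inferInstance, algWO,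
    IsScalarTower.of_algebraMap_eq fun a => ?_, algVO,
    IsScalarTower.of_algebraMap_eq fun a => ?_, IsScalarTower.of_algebraMap_eq fun a => ?_,
    IsLocalization.lift (M := M.primeCompl) hρu, fun a => ?_, fun a ha => ?_⟩
  · exact (IsScalarTower.algebraMap_apply D O κ (algebraMap W D a))
  · exact (IsScalarTower.algebraMap_apply D O κ (algebraMap V D a))
  · exact congrArg (algebraMap D O) (IsScalarTower.algebraMap_apply V W D a)
  · exact (IsLocalization.lift_eq _ _).trans (hρ₀ a)
  · by_contra hna
    apply ha
    have h1 : a ∈ IsLocalRing.maximalIdeal O := hna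
    rw [← Localization.AtPrime.map_eq_maximalIdeal] at h1
    have h2 : M.map (algebraMap D O) ≤
        RingHom.ker (IsLocalization.lift (M := M.primeCompl) (S := O) hρu) := by
      rw [Ideal.map_le_iff_le_comap]
      intro b hb
      change IsLocalization.lift (M := M.primeCompl) (S := O) hρu _ = _
      rw [IsLocalization.lift_eq, (hρM b).mpr hb]
    exact h2 h1

end Place

/-! ### Charts of quadric sections -/

lemma projPoint_congr {R A : Type u} [CommRing R] [CommRing A] [Algebra R A]
    (𝒜 : ℕ → Submodule R A) [GradedAlgebra 𝒜] {C : Type u} [CommRing C] {f f' : A} (e : f = f')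
    (hf : f ∈ 𝒜 1) (hf' : f' ∈ 𝒜 1) (ψ : A →+* C) (h : ψ f = 1) (h' : ψ f' = 1) :
    projPoint 𝒜 hf ψ h = projPoint 𝒜 hf' ψ h' := by
  subst e; rfl

section QuadricLocus

variable {V : Type u} [CommRing V] {n : ℕ} {A : Type u} [CommRing A] [Algebra V A]
  (M : Submodule A (MvPolynomial (Fin (n + 1)) A))
  (hM : M ≤ MvPolynomial.homogeneousSubmodule (Fin (n + 1)) A 2)

lemma projPoint_projSpaceMap {C : Type u} [CommRing C] (φ : MvPolynomial (Fin (n + 1)) A →+* C)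
    {r : Fin (n + 1)} (h : φ (MvPolynomial.X r) = 1) :
    projPoint (MvPolynomial.homogeneousSubmodule (Fin (n + 1)) A)
      (MvPolynomial.isHomogeneous_X A r) φ h ≫ projSpaceMap n V A =
    projPoint (MvPolynomial.homogeneousSubmodule (Fin (n + 1)) V)
      (MvPolynomial.isHomogeneous_X V r) (φ.comp (MvPolynomial.map (algebraMap V A)))
      (by rw [RingHom.comp_apply, MvPolynomial.map_X, h]) := by
  have hX : polyGradedHom n V A (MvPolynomial.X r) = MvPolynomial.X r := MvPolynomial.map_X _ _
  have h1 := projPoint_map (MvPolynomial.homogeneousSubmodule (Fin (n + 1)) V)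
    (MvPolynomial.isHomogeneous_X V r) (MvPolynomial.homogeneousSubmodule (Fin (n + 1)) A)
    (polyGradedHom n V A) (polyGradedHom_irrelevant n V A) φ (by rw [hX, h])
  exact Eq.trans (congrArg (· ≫ projSpaceMap n V A) (projPoint_congr _ hX.symm _ _ _ _ _)) h1

lemma exists_projPoint_quadricLocusι {C : Type u} [CommRing C]
    (φ : MvPolynomial (Fin (n + 1)) A →+* C) {r : Fin (n + 1)} (h : φ (MvPolynomial.X r) = 1)
    (hφ : ∀ F ∈ M, φ F = 0) :
    ∃ g : Spec (CommRingCat.of C) ⟶ quadricLocus M hM, g ≫ quadricLocusι M hM =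
      projPoint (MvPolynomial.homogeneousSubmodule (Fin (n + 1)) A)
        (MvPolynomial.isHomogeneous_X A r) φ h := by
  let I := quadricIdeal M hM
  have hI : ∀ F ∈ I.toIdeal, φ F = 0 := fun F hF =>
    (Ideal.span_le (I := RingHom.ker φ)).mpr (fun G hG => hφ G hG) hF
  exact ⟨projPoint (quotGrading _ I) ((quotGradedHom _ I).map_mem (MvPolynomial.isHomogeneous_X A r))
    (Ideal.Quotient.lift I.toIdeal φ hI) h,
    projPoint_map (MvPolynomial.homogeneousSubmodule (Fin (n + 1)) A)
      (MvPolynomial.isHomogeneous_X A r) (quotGrading _ I) (quotGradedHom _ I)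
      (quotGradedHom_irrelevant _ I) (Ideal.Quotient.lift I.toIdeal φ hI) h⟩

lemma mem_of_mem_range_quadricLocusι {z : projSpace n A}
    (hz : z ∈ Set.range (quadricLocusι M hM)) {F : MvPolynomial (Fin (n + 1)) A} (hF : F ∈ M) :
    F ∈ (show ProjectiveSpectrum (MvPolynomial.homogeneousSubmodule (Fin (n + 1)) A) from
      z).asHomogeneousIdeal := by
  obtain ⟨w, rfl⟩ := hz
  let w' : ProjectiveSpectrum (quotGrading _ (quadricIdeal M hM)) := w
  have h1 : Ideal.Quotient.mk (quadricIdeal M hM).toIdeal F = 0 :=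
    Ideal.Quotient.eq_zero_iff_mem.mpr (Ideal.subset_span hF)
  have h2 : Ideal.Quotient.mk (quadricIdeal M hM).toIdeal F ∈ w'.asHomogeneousIdeal := by
    rw [h1]
    exact zero_mem w'.asHomogeneousIdeal.toIdeal
  exact h2

/-- Checked on the charts `x_r ≠ 0`. It exhibits the structure morphism as that of `Proj` over its
degree-zero part, from which properness follows. -/
lemma toSpecZero_quadricLocus :
    quadricLocusι M hM ≫ projSpaceStr n A =
      Proj.toSpecZero (quotGrading _ (quadricIdeal M hM)) ≫ Spec.map (CommRingCat.ofHom
        (algebraMap A (quotGrading _ (quadricIdeal M hM) 0))) := by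
  let I := quadricIdeal M hM
  let 𝒜 := MvPolynomial.homogeneousSubmodule (Fin (n + 1)) A
  have hX : ∀ r : Fin (n + 1), quotGradedHom 𝒜 I (MvPolynomial.X r) ∈ quotGrading 𝒜 I 1 := fun r =>
    (quotGradedHom 𝒜 I).map_mem (MvPolynomial.isHomogeneous_X A r)
  have hirr : (HomogeneousIdeal.irrelevant (quotGrading 𝒜 I)).toIdeal ≤
      Ideal.span (Set.range fun r => quotGradedHom 𝒜 I (MvPolynomial.X r)) := by
    refine le_trans (show _ ≤ ((HomogeneousIdeal.irrelevant 𝒜).map (quotGradedHom 𝒜 I)).toIdeal from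
      quotGradedHom_irrelevant 𝒜 I) ?_
    refine Ideal.map_le_of_le_comap ?_
    refine (HomogeneousIdeal.toIdeal_irrelevant_le _).mpr fun m hm F hF => ?_
    change quotGradedHom 𝒜 I F ∈ Ideal.span (Set.range fun r => quotGradedHom 𝒜 I (MvPolynomial.X r))
    rw [F.as_sum, map_sum]
    refine Ideal.sum_mem _ fun s hs => ?_
    have hs0 : s ≠ 0 := by
      rintro rfl
      have h2 := hF (MvPolynomial.mem_support_iff.mp hs)
      simp at h2
      lia
    obtain ⟨j, hj⟩ := Finsupp.ne_iff.mp hs0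
    obtain ⟨G, hG⟩ : (MvPolynomial.X j : MvPolynomial (Fin (n + 1)) A) ∣
        MvPolynomial.monomial s (F.coeff s) := MvPolynomial.X_dvd_monomial.mpr (Or.inr hj)
    rw [hG, map_mul]
    exact Ideal.mul_mem_right _ _ (Ideal.subset_span ⟨j, rfl⟩)
  refine (Proj.affineOpenCoverOfIrrelevantLESpan (quotGrading 𝒜 I) _ hX (fun _ => one_pos)
    hirr).openCover.hom_ext _ _ fun r => ?_
  change Proj.awayι (quotGrading 𝒜 I) _ (hX r) one_pos ≫ _ =
    Proj.awayι (quotGrading 𝒜 I) _ (hX r) one_pos ≫ _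
  have h1 : Proj.awayι (quotGrading 𝒜 I) _ (hX r) one_pos =
      projPoint (quotGrading 𝒜 I) (hX r) (dehom _ (hX r)) (dehom_self _ (hX r)) := by
    rw [projPoint]
    have h2 := awayLift_comp_dehom_self (quotGrading 𝒜 I) (hX r)
      (RingHom.id (HomogeneousLocalization.Away (quotGrading 𝒜 I) _))
    simp only [RingHom.id_comp] at h2
    rw [h2]
    exact (Category.id_comp _).symm.trans (congrArg (· ≫ _) (Spec.map_id _).symm)
  rw [h1]
  have h3 := projPoint_toSpecZero (quotGrading 𝒜 I) (hX r) (dehom _ (hX r)) (dehom_self _ (hX r))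
  refine Eq.trans ?_ h3.symm
  have h4 := projPoint_map 𝒜 (MvPolynomial.isHomogeneous_X A r) (quotGrading 𝒜 I)
    (quotGradedHom 𝒜 I) (quotGradedHom_irrelevant 𝒜 I) (dehom _ (hX r)) (dehom_self _ (hX r))
  have h5 := congrArg (· ≫ projSpaceStr n A) h4
  refine ((Category.assoc _ _ _).symm.trans h5).trans ?_
  exact projPoint_toSpecZero 𝒜 (MvPolynomial.isHomogeneous_X A r) _ _

lemma isProper_quadricLocus : IsProper (quadricLocusι M hM ≫ projSpaceStr n A) := by
  rw [toSpecZero_quadricLocus]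
  have : Algebra.FiniteType A (MvPolynomial (Fin (n + 1)) A ⧸ (quadricIdeal M hM).toIdeal) :=
    Algebra.FiniteType.of_surjective (Ideal.Quotient.mkₐ A _) Ideal.Quotient.mk_surjective
  refine isProper_toSpecZero_of_surjective _ ?_
  rintro _ ⟨a, ha, rfl⟩
  refine ⟨a.coeff 0, ?_⟩
  have h1 := (MvPolynomial.totalDegree_eq_zero_iff_eq_C.mp
    (Nat.le_zero.mp ((MvPolynomial.mem_homogeneousSubmodule _ _).mp ha).totalDegree_le))
  change Ideal.Quotient.mk _ (MvPolynomial.C (a.coeff 0)) = Ideal.Quotient.mk _ a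
  rw [← h1]

end QuadricLocus

section SectionChart

variable {V : Type u} [CommRing V] {n : ℕ} {X : Scheme.{u}} {i : X ⟶ projSpace n V}
  {A : Type u} [CommRing A] [Algebra V A]
  {M : Submodule A (MvPolynomial (Fin (n + 1)) A)}
  {hM : M ≤ MvPolynomial.homogeneousSubmodule (Fin (n + 1)) A 2}

lemma isProper_quadricSectionStr [IsClosedImmersion i] : IsProper (quadricSectionStr i M hM) := by
  have h1 := isProper_quadricLocus M hM
  have h2 : IsProper (pullback.snd i (quadricLocusι M hM ≫ projSpaceMap n V A)) := inferInstance
  exact MorphismProperty.comp_mem _ _ _ h2 h1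

/-- The chart of a quadric section where `x_r` is invertible. -/
lemma exists_sectionChart [IsClosedImmersion i] {r : Fin (n + 1)} (c : ProjChart i r) :
    ∃ (C : Type u) (_ : CommRing C) (_ : Algebra A C) (_ : Algebra V C) (_ : IsScalarTower V A C)
      (y : Fin (n + 1) → C)
      (j : Spec (CommRingCat.of C) ⟶ quadricSection i M hM) (_ : IsOpenImmersion j),
      y r = 1 ∧ Function.Surjective (MvPolynomial.aeval (R := A) y) ∧
      (∀ F ∈ M, MvPolynomial.aeval y F = 0) ∧
      (∃ β : c.B →ₐ[V] C, ∀ F, β (c.γ F) = MvPolynomial.aeval y F) ∧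
      (∀ z : quadricSection i M hM, z ∈ Set.range j ↔
        i (pullback.fst i (quadricLocusι M hM ≫ projSpaceMap n V A) z) ∈
        Proj.basicOpen (MvPolynomial.homogeneousSubmodule (Fin (n + 1)) V) (MvPolynomial.X r)) ∧
      j ≫ quadricSectionStr i M hM = Spec.map (CommRingCat.ofHom (algebraMap A C)) ∧
      ∃ h, j ≫ pullback.snd i (quadricLocusι M hM ≫ projSpaceMap n V A) ≫ quadricLocusι M hM =
        projPoint (MvPolynomial.homogeneousSubmodule (Fin (n + 1)) A)
          (MvPolynomial.isHomogeneous_X A r) (MvPolynomial.aeval (R := A) y).toRingHom h := by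
  let I := quadricIdeal M hM
  let 𝒜 := MvPolynomial.homogeneousSubmodule (Fin (n + 1)) A
  let 𝒱 := MvPolynomial.homogeneousSubmodule (Fin (n + 1)) V
  have hX : quotGradedHom 𝒜 I (MvPolynomial.X r) ∈ quotGrading 𝒜 I 1 :=
    (quotGradedHom 𝒜 I).map_mem (MvPolynomial.isHomogeneous_X A r)
  let sn : quadricSection i M hM ⟶ quadricLocus M hM :=
    pullback.snd i (quadricLocusι M hM ≫ projSpaceMap n V A)
  let fs : quadricSection i M hM ⟶ X := pullback.fst i (quadricLocusι M hM ≫ projSpaceMap n V A)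
  let sn' : quadricSection i M hM ⟶ Proj (quotGrading 𝒜 I) := sn
  have hcl : IsClosedImmersion sn' :=
    inferInstanceAs (IsClosedImmersion (pullback.snd i (quadricLocusι M hM ≫ projSpaceMap n V A)))
  obtain ⟨C, _, γ, hγ, j, hsurj, hj, hrange, hcomp⟩ := exists_chart (quotGrading 𝒜 I) hX sn'
  let γ' : MvPolynomial (Fin (n + 1)) A →+* C := γ.comp (quotGradedHom 𝒜 I).toRingHom
  have hγ' : γ' (MvPolynomial.X r) = 1 := hγ
  have hbase : j ≫ sn ≫ quadricLocusι M hM =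
      projPoint 𝒜 (MvPolynomial.isHomogeneous_X A r) γ' hγ' := by
    exact (Category.assoc _ _ _).symm.trans ((congrArg (· ≫ quadricLocusι M hM) hcomp).trans
      (projPoint_map 𝒜 (MvPolynomial.isHomogeneous_X A r) (quotGrading 𝒜 I)
        (quotGradedHom 𝒜 I) (quotGradedHom_irrelevant 𝒜 I) γ hγ))
  let algA : Algebra A C := (γ'.comp (algebraMap A _)).toAlgebra
  let algV : Algebra V C := ((algebraMap A C).comp (algebraMap V A)).toAlgebra
  have hVAC : IsScalarTower V A C := IsScalarTower.of_algebraMap_eq fun _ => rfl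
  let y : Fin (n + 1) → C := fun l => γ' (MvPolynomial.X l)
  let γA : MvPolynomial (Fin (n + 1)) A →ₐ[A] C := { γ' with commutes' := fun _ => rfl }
  have hγA : MvPolynomial.aeval y = γA := by
    ext l
    simp only [MvPolynomial.aeval_X]
    rfl
  have hcondition : fs ≫ i = sn ≫ quadricLocusι M hM ≫ projSpaceMap n V A := pullback.condition
  have hi : (j ≫ fs) ≫ i = projPoint 𝒱 (MvPolynomial.isHomogeneous_X V r)
      (γ'.comp (MvPolynomial.map (algebraMap V A)))
      (by rw [RingHom.comp_apply, MvPolynomial.map_X, hγ']) := by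
    have h1 := congrArg (· ≫ projSpaceMap n V A) hbase
    refine Eq.trans ?_ (h1.trans (projPoint_projSpaceMap γ' hγ'))
    rw [Category.assoc, hcondition]
    exact (congrArg (j ≫ ·) (Category.assoc _ _ _).symm).trans (Category.assoc _ _ _).symm
  have hmap : ∀ F : MvPolynomial (Fin (n + 1)) V,
      γ' (MvPolynomial.map (algebraMap V A) F) = MvPolynomial.aeval y F := fun F => by
    change γA _ = _
    rw [← hγA, MvPolynomial.aeval_map_algebraMap]
  have hr2 : ∀ z : quadricSection i M hM, i (fs z) ∈ Proj.basicOpen 𝒱 (MvPolynomial.X r) ↔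
      sn z ∈ Proj.basicOpen (quotGrading 𝒜 I) (quotGradedHom 𝒜 I (MvPolynomial.X r)) := fun z => by
    have h1 : i (fs z) = projSpaceMap n V A (quadricLocusι M hM (sn z)) := by
      have h2 := congrArg (fun g : quadricSection i M hM ⟶ projSpace n V => g z) hcondition
      rwa [Scheme.Hom.comp_apply, Scheme.Hom.comp_apply, Scheme.Hom.comp_apply] at h2
    rw [h1]
    have hX' : polyGradedHom n V A (MvPolynomial.X r) = MvPolynomial.X r := MvPolynomial.map_X _ _
    change _ ∈ Proj.basicOpen (quotGrading 𝒜 I) (quotGradedHom 𝒜 I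
      (polyGradedHom n V A (MvPolynomial.X r))) ↔ _
    rw [hX']
    exact Iff.rfl
  -- The chart of the section maps into the chart `c` of `X`; the induced map on functions is `β`.
  let lft := IsOpenImmersion.lift c.j (j ≫ fs) (by
    rintro _ ⟨z, rfl⟩
    rw [c.mem_range]
    have h1 : (j ≫ fs) z = fs (j z) := by rw [Scheme.Hom.comp_apply]
    rw [h1]
    exact (hr2 _).mpr ((hrange _).mp ⟨z, rfl⟩))
  have hlft : lft ≫ c.j = j ≫ fs := IsOpenImmersion.lift_fac _ _ _
  obtain ⟨β, hβ⟩ := Spec.map_surjective lft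
  have hβ2 : β.hom.comp c.γ.toRingHom = γ'.comp (MvPolynomial.map (algebraMap V A)) := by
    refine projPoint_injective 𝒱 (MvPolynomial.isHomogeneous_X V r) _ ?_ (h' := ?_) ?_
    · change β.hom (c.γ _) = 1
      rw [c.γ_X, map_one]
    · rw [RingHom.comp_apply, MvPolynomial.map_X, hγ']
    · rw [← hi, ← hlft, Category.assoc, c.comp, ← hβ]
      exact (specMap_projPoint 𝒱 (MvPolynomial.isHomogeneous_X V r) c.γ.toRingHom c.γ_X β.hom).symm
  have hβ3 : ∀ F, β.hom (c.γ F) = MvPolynomial.aeval y F := fun F => by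
    rw [← hmap]
    exact RingHom.congr_fun hβ2 F
  refine ⟨C, inferInstance, algA, algV, hVAC, y, j, hj, hγ', ?_, ?_,
    ⟨{ β.hom with commutes' := fun a => ?_ }, hβ3⟩, ?_, ?_, by rw [hγA]; exact ⟨hγ', hbase⟩⟩
  · rw [hγA]
    intro z
    obtain ⟨w, rfl⟩ := hsurj z
    obtain ⟨F, rfl⟩ := Ideal.Quotient.mk_surjective w
    exact ⟨F, rfl⟩
  · intro F hF
    rw [hγA]
    change γ (Ideal.Quotient.mk I.toIdeal F) = 0
    have h1 : Ideal.Quotient.mk I.toIdeal F = 0 :=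
      Ideal.Quotient.eq_zero_iff_mem.mpr (Ideal.subset_span hF)
    rw [h1, map_zero]
  · have h1 := hβ3 (algebraMap V _ a)
    rw [AlgHom.commutes, AlgHom.commutes] at h1
    exact h1
  · intro z
    exact (hrange z).trans (hr2 z).symm
  · have h1 : j ≫ quadricSectionStr i M hM =
        (j ≫ sn ≫ quadricLocusι M hM) ≫ projSpaceStr n A := by
      simp only [quadricSectionStr, Category.assoc]
      rfl
    rw [h1, hbase]
    exact projPoint_projSpaceStr r γA hγ'

lemma exists_mem_basicOpen_X (z : projSpace n V) : ∃ r : Fin (n + 1),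
    z ∈ Proj.basicOpen (MvPolynomial.homogeneousSubmodule (Fin (n + 1)) V) (MvPolynomial.X r) := by
  by_contra! hcon
  let z' : ProjectiveSpectrum (MvPolynomial.homogeneousSubmodule (Fin (n + 1)) V) := z
  refine z'.not_irrelevant_le ?_
  refine (HomogeneousIdeal.irrelevant_le _).mpr fun m hm F hF => ?_
  change F ∈ z'.asHomogeneousIdeal.toIdeal
  rw [F.as_sum]
  refine Ideal.sum_mem _ fun s hs => ?_
  have hs0 : s ≠ 0 := by
    rintro rfl
    have h2 := hF (MvPolynomial.mem_support_iff.mp hs)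
    simp at h2
    lia
  obtain ⟨j, hj⟩ := Finsupp.ne_iff.mp hs0
  refine Ideal.mem_of_dvd _ (MvPolynomial.X_dvd_monomial.mpr (Or.inr hj)) ?_
  exact not_not.mp (hcon j)

end SectionChart

/-! ### Closed points, and criteria for finiteness and étaleness -/

/-- A maximal ideal of an algebra of finite type over an algebraically closed field is the kernel of
a point. -/
lemma exists_algHom_ker_eq {k C : Type u} [Field k] [IsAlgClosed k] [CommRing C] [Algebra k C]
    [Algebra.FiniteType k C] (m : Ideal C) [hm : m.IsMaximal] : ∃ e : C →ₐ[k] k, RingHom.ker e = m := by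
  let := Ideal.Quotient.field m
  have h1 : Algebra.FiniteType k (C ⧸ m) :=
    Algebra.FiniteType.of_surjective (Ideal.Quotient.mkₐ k m) Ideal.Quotient.mk_surjective
  have h2 : Module.Finite k (C ⧸ m) := finite_of_finite_type_of_isJacobsonRing k (C ⧸ m)
  let e := AlgEquiv.ofBijective (Algebra.ofId k (C ⧸ m))
    (IsAlgClosed.algebraMap_bijective_of_isIntegral (k := k) (K := C ⧸ m))
  refine ⟨e.symm.toAlgHom.comp (Ideal.Quotient.mkₐ k m), ?_⟩
  ext a
  rw [RingHom.mem_ker]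
  change e.symm (Ideal.Quotient.mk m a) = 0 ↔ _
  rw [map_eq_zero_iff _ e.symm.injective, Ideal.Quotient.eq_zero_iff_mem]

section Chart

variable {V : Type u} [CommRing V] [IsLocalRing V] {n : ℕ} {X : Scheme.{u}} {i : X ⟶ projSpace n V}

local notation "𝕜" => IsLocalRing.ResidueField V

/-- A closed point of the special fibre, in a chart containing it. -/
lemma exists_chart_of_closedPoint [IsAlgClosed 𝕜] [IsClosedImmersion i] {P : X}
    (hPk : (i ≫ projSpaceStr n V) P = IsLocalRing.closedPoint V) (hPclosed : IsClosed ({P} : Set X)) :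
    ∃ (r : Fin (n + 1)) (c : ProjChart i r) (y : Spec (CommRingCat.of c.B)) (e : c.B →ₐ[V] 𝕜),
      c.j y = P ∧ RingHom.ker e = y.asIdeal ∧ y.asIdeal.IsMaximal := by
  obtain ⟨r, hr⟩ := exists_mem_basicOpen_X (i P)
  obtain ⟨c⟩ := nonempty_projChart i r
  obtain ⟨y, rfl⟩ := (c.mem_range P).mpr hr
  have hmax : y.asIdeal.IsMaximal := by
    refine (PrimeSpectrum.isClosed_singleton_iff_isMaximal (show PrimeSpectrum c.B from y)).mp ?_
    have h1 := hPclosed.preimage c.j.continuous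
    have h2 : c.j ⁻¹' {c.j y} = {y} := by
      ext z
      exact c.j.isOpenEmbedding.injective.eq_iff
    rwa [h2] at h1
  have hker : IsLocalRing.maximalIdeal V ≤ y.asIdeal.comap (algebraMap V c.B) := by
    have h1 : (i ≫ projSpaceStr n V) (c.j y) = (c.j ≫ i ≫ projSpaceStr n V) y := by
      rw [← Scheme.Hom.comp_apply]
    rw [h1, c.comp_str] at hPk
    exact (congrArg PrimeSpectrum.asIdeal hPk).ge
  let : Algebra 𝕜 (c.B ⧸ y.asIdeal) :=
    (Ideal.Quotient.lift (IsLocalRing.maximalIdeal V) (algebraMap V (c.B ⧸ y.asIdeal)) fun a ha =>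
      Ideal.Quotient.eq_zero_iff_mem.mpr (hker ha)).toAlgebra
  have hT : IsScalarTower V 𝕜 (c.B ⧸ y.asIdeal) := IsScalarTower.of_algebraMap_eq fun _ => rfl
  have := c.finiteType
  have h1 : Algebra.FiniteType V (c.B ⧸ y.asIdeal) :=
    Algebra.FiniteType.of_surjective (Ideal.Quotient.mkₐ V y.asIdeal) Ideal.Quotient.mk_surjective
  have h2 : Algebra.FiniteType 𝕜 (c.B ⧸ y.asIdeal) :=
    Algebra.FiniteType.of_restrictScalars_finiteType V 𝕜 _
  let := Ideal.Quotient.field y.asIdeal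
  obtain ⟨e, he⟩ := exists_algHom_ker_eq (k := 𝕜) (⊥ : Ideal (c.B ⧸ y.asIdeal))
    (hm := Ideal.bot_isMaximal)
  refine ⟨r, c, y, (e.restrictScalars V).comp (Ideal.Quotient.mkₐ V y.asIdeal), rfl, ?_, hmax⟩
  ext a
  rw [RingHom.mem_ker]
  change e (Ideal.Quotient.mk _ a) = 0 ↔ _
  rw [← RingHom.mem_ker (f := e), he, Ideal.mem_bot, Ideal.Quotient.eq_zero_iff_mem]

lemma exists_homogeneous_map_residue {m : ℕ} {F : MvPolynomial (Fin (n + 1)) 𝕜}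
    (hF : F.IsHomogeneous m) : ∃ G : MvPolynomial (Fin (n + 1)) V, G.IsHomogeneous m ∧
      MvPolynomial.map (IsLocalRing.residue V) G = F := by
  obtain ⟨G, hG⟩ := MvPolynomial.map_surjective (IsLocalRing.residue V)
    IsLocalRing.residue_surjective F
  refine ⟨MvPolynomial.homogeneousComponent m G, MvPolynomial.homogeneousComponent_isHomogeneous m G, ?_⟩
  ext s
  rw [MvPolynomial.coeff_map, MvPolynomial.coeff_homogeneousComponent]
  split_ifs with hs
  · rw [← MvPolynomial.coeff_map, hG]
  · rw [map_zero, hF.coeff_eq_zero hs]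

lemma ProjChart.aeval_residue {r : Fin (n + 1)} (c : ProjChart i r) (e : c.B →ₐ[V] 𝕜)
    (F : MvPolynomial (Fin (n + 1)) V) :
    MvPolynomial.eval (fun l => e (c.γ (MvPolynomial.X l)))
      (MvPolynomial.map (IsLocalRing.residue V) F) = e (c.γ F) := by
  have h1 : MvPolynomial.aeval (fun l => e (c.γ (MvPolynomial.X l))) = e.comp c.γ := by
    ext l; simp
  have h2 := congrArg (fun g : MvPolynomial (Fin (n + 1)) V →ₐ[V] 𝕜 => g F) h1
  rw [MvPolynomial.eval_map]
  exact h2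

/-- A form over `k` lifts to a form over `V` of the same degree, so membership in the homogeneous
prime of `P` becomes vanishing at the coordinate vector. Conversely, this vector defines a point of
the quadric locus lying over `P`. -/
lemma mem_throughPoint_iff {r : Fin (n + 1)} (c : ProjChart i r)
    {y : Spec (CommRingCat.of c.B)} {e : c.B →ₐ[V] 𝕜} (he : RingHom.ker e = y.asIdeal) {d : ℕ}
    (l : QuadGrass n d 𝕜) : l ∈ throughPoint i (c.j y) d ↔
      l.space ≤ quadricsThrough fun l => e (c.γ (MvPolynomial.X l)) := by
  constructor
  · rintro ⟨w, hw⟩ F hF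
    refine mem_quadricsThrough.mpr ⟨l.le_two hF, ?_⟩
    obtain ⟨G, hG, rfl⟩ := exists_homogeneous_map_residue (V := V) (l.le_two hF)
    rw [c.aeval_residue]
    change c.γ G ∈ RingHom.ker e
    rw [he, ← c.mem_iff hG, ← hw]
    have h1 := mem_of_mem_range_quadricLocusι l.space l.le_two ⟨w, rfl⟩ hF
    exact h1
  · intro hl
    let p : Fin (n + 1) → 𝕜 := fun l => e (c.γ (MvPolynomial.X l))
    have hp : MvPolynomial.eval p (MvPolynomial.X r) = 1 := by
      rw [MvPolynomial.eval_X]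
      change e (c.γ _) = 1
      rw [c.γ_X, map_one]
    obtain ⟨g, hg⟩ := exists_projPoint_quadricLocusι l.space l.le_two (MvPolynomial.eval p) hp
      fun F hF => (mem_quadricsThrough.mp (hl hF)).2
    have h1 : g ≫ quadricLocusι l.space l.le_two ≫ projSpaceMap n V 𝕜 =
        Spec.map (CommRingCat.ofHom e.toRingHom) ≫ c.j ≫ i := by
      rw [c.comp]
      refine Eq.trans ?_ (specMap_projPoint _ _ c.γ.toRingHom c.γ_X e.toRingHom).symm
      refine (Category.assoc _ _ _).symm.trans ((congrArg (· ≫ projSpaceMap n V 𝕜) hg).trans ?_)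
      refine (projPoint_projSpaceMap _ hp).trans ?_
      congr 1
      exact RingHom.ext fun F => c.aeval_residue e F
    have h2 := congrArg (fun f : Spec (CommRingCat.of 𝕜) ⟶ projSpace n V =>
      f (⟨⊥, Ideal.isPrime_bot⟩ : PrimeSpectrum 𝕜)) h1
    refine ⟨g (⟨⊥, Ideal.isPrime_bot⟩ : PrimeSpectrum 𝕜), ?_⟩
    rw [← Scheme.Hom.comp_apply]
    refine h2.trans ?_
    have h3 : Spec.map (CommRingCat.ofHom e.toRingHom) (⟨⊥, Ideal.isPrime_bot⟩ : PrimeSpectrum 𝕜) =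
        y := by
      apply PrimeSpectrum.ext
      exact he
    rw [← h3]
    rfl

end Chart

section Criteria

variable {V : Type u} [CommRing V] {n : ℕ} {X : Scheme.{u}} {i : X ⟶ projSpace n V}

lemma iSup_opensRange_eq_top {Y : Scheme.{u}} {ι : Type*} {C : ι → Scheme.{u}} (j : ∀ r, C r ⟶ Y)
    [∀ r, IsOpenImmersion (j r)] (h : ∀ z, ∃ r, z ∈ Set.range (j r)) :
    ⨆ r, (j r).opensRange = ⊤ := by
  refine eq_top_iff.mpr fun z _ => ?_
  obtain ⟨r, hr⟩ := h z
  exact TopologicalSpace.Opens.mem_iSup.mpr ⟨r, hr⟩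

lemma derivation_aeval {R A N σ : Type*} [Fintype σ] [CommRing R] [CommRing A] [Algebra R A]
    [AddCommGroup N] [Module A N] [Module R N] [IsScalarTower R A N] (D : Derivation R A N)
    (y : σ → A) (G : MvPolynomial σ R) :
    D (MvPolynomial.aeval y G) = ∑ l, MvPolynomial.aeval y (MvPolynomial.pderiv l G) • D (y l) := by
  classical
  induction G using MvPolynomial.induction_on with
  | C a => simp
  | add p q hp hq => simp only [map_add, hp, hq, add_smul, Finset.sum_add_distrib]
  | mul_X p s hp =>
    simp only [map_mul, Derivation.leibniz, hp, MvPolynomial.aeval_X, MvPolynomial.pderiv_X,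
      smul_eq_mul, map_add, add_smul, Finset.sum_add_distrib, Finset.smul_sum, mul_smul]
    congr 1
    rw [Finset.sum_eq_single s]
    · simp
    · intro l _ hl
      rw [Pi.single_eq_of_ne' hl]
      simp
    · simp

/-- An algebra of finite type is formally unramified if it has no derivations with values in its
residue fields. -/
lemma formallyUnramified_of_forall_derivation {R A : Type u} [CommRing R] [CommRing A] [Algebra R A]
    [Algebra.FiniteType R A]
    (h : ∀ (m : Ideal A) [m.IsMaximal] (D : Derivation R A (A ⧸ m)), D = 0) :
    Algebra.FormallyUnramified R A := by
  refine ⟨?_⟩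
  by_contra hns
  rw [not_subsingleton_iff_nontrivial] at hns
  -- A nonzero finitely generated module of differentials has a simple quotient `A / m`, and the
  -- corresponding derivation would be nonzero.
  obtain ⟨N, hN, -⟩ := (eq_top_or_exists_le_coatom (⊥ : Submodule A (KaehlerDifferential R A))).resolve_left
    bot_ne_top
  have hs : IsSimpleModule A (KaehlerDifferential R A ⧸ N) := isSimpleModule_iff_isCoatom.mpr hN
  obtain ⟨m, hm, ⟨e⟩⟩ := isSimpleModule_iff_quot_maximal.mp hs
  let D : Derivation R A (A ⧸ m) :=
    (e.toLinearMap ∘ₗ N.mkQ).compDer (KaehlerDifferential.D R A)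
  have hD := h m D
  apply hN.1
  rw [eq_top_iff, ← KaehlerDifferential.span_range_derivation R A, Submodule.span_le]
  rintro _ ⟨a, rfl⟩
  have h1 : D a = 0 := by rw [hD]; rfl
  have h2 : e (N.mkQ (KaehlerDifferential.D R A a)) = 0 := h1
  rw [map_eq_zero_iff _ e.injective] at h2
  exact (Submodule.Quotient.mk_eq_zero N).mp h2

/-- A quadric section over a field is étale if it has no tangent vectors with
values in finite extensions. -/
lemma etale_quadricSectionStr [IsClosedImmersion i] (hred : ∀ r (c : ProjChart i r), _root_.IsReduced c.B)
    {F : Type u} [Field F] [Algebra V F]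
    {M : Submodule F (MvPolynomial (Fin (n + 1)) F)}
    {hM : M ≤ MvPolynomial.homogeneousSubmodule (Fin (n + 1)) F 2}
    (h : ∀ (κ : Type u) [Field κ] [Algebra F κ] [FiniteDimensional F κ] [Algebra V κ]
      [IsScalarTower V F κ] (x u : Fin (n + 1) → κ) (r : Fin (n + 1)), x r = 1 → u r = 0 →
      IsZeroOf (vanishingForms i).toIdeal x → IsTangentTo (vanishingForms i).toIdeal x u →
      (∀ G ∈ M, MvPolynomial.aeval x G = 0) → (∀ G ∈ M, dirDeriv x u G = 0) → u = 0) :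
    Etale (quadricSectionStr i M hM) := by
  let c : ∀ r, ProjChart i r := fun r => (nonempty_projChart i r).some
  choose C hC1 hC2 hC3 hC4 y j hj hyr hsurj hyM hβ hrange hstr hpt using fun r =>
    exists_sectionChart (A := F) (M := M) (hM := hM) (c r)
  have hcover : ⨆ r, (j r).opensRange = ⊤ := iSup_opensRange_eq_top j fun z => by
    obtain ⟨r, hr⟩ := exists_mem_basicOpen_X
      (i (pullback.fst i (quadricLocusι M hM ≫ projSpaceMap n V F) z))
    exact ⟨r, (hrange r z).mpr hr⟩
  have hloc : IsZariskiLocalAtSource (@Etale.{u}) :=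
    HasRingHomProperty.instIsZariskiLocalAtSource (Q := RingHom.Etale)
  have hiso : MorphismProperty.RespectsIso (@Etale.{u}) :=
    MorphismProperty.IsStableUnderBaseChange.respectsIso
  rw [IsZariskiLocalAtSource.iff_of_iSup_eq_top (P := @Etale.{u}) _ hcover]
  intro r
  rw [← MorphismProperty.cancel_left_of_respectsIso (P := @Etale.{u}) (j r).isoOpensRange.hom,
    ← Category.assoc, Scheme.Hom.isoOpensRange_hom_ι, hstr]
  refine (HasRingHomProperty.Spec_iff (P := @Etale)).mpr ?_
  change RingHom.Etale (algebraMap F (C r))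
  rw [RingHom.etale_algebraMap]
  have hft : Algebra.FiniteType F (C r) := Algebra.FiniteType.of_surjective _ (hsurj r)
  have hun : Algebra.FormallyUnramified F (C r) := by
    -- A derivation into a residue field is a tangent vector with components `D (y l)`, and the
    -- residue fields are finite over `F`.
    refine formallyUnramified_of_forall_derivation fun m hm D => ?_
    let := Ideal.Quotient.field m
    have hft' : Algebra.FiniteType F (C r ⧸ m) :=
      Algebra.FiniteType.of_surjective (Ideal.Quotient.mkₐ F m) Ideal.Quotient.mk_surjective
    have hfin : Module.Finite F (C r ⧸ m) := finite_of_finite_type_of_isJacobsonRing F (C r ⧸ m)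
    have hT : IsScalarTower V F (C r ⧸ m) := IsScalarTower.of_algebraMap_eq fun a =>
      congrArg (Ideal.Quotient.mk m) (IsScalarTower.algebraMap_apply V F (C r) a)
    let x : Fin (n + 1) → C r ⧸ m := fun l => Ideal.Quotient.mk m (y r l)
    have hx : ∀ G : MvPolynomial (Fin (n + 1)) F,
        MvPolynomial.aeval x G = Ideal.Quotient.mk m (MvPolynomial.aeval (y r) G) := fun G =>
      (MvPolynomial.comp_aeval_apply _ (Ideal.Quotient.mkₐ F m) _).symm
    have hxV : ∀ G : MvPolynomial (Fin (n + 1)) V,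
        MvPolynomial.aeval x G = Ideal.Quotient.mk m (MvPolynomial.aeval (y r) G) := fun G => by
      rw [← MvPolynomial.aeval_map_algebraMap F, hx, MvPolynomial.aeval_map_algebraMap]
    have hD : ∀ G : MvPolynomial (Fin (n + 1)) F,
        D (MvPolynomial.aeval (y r) G) = dirDeriv x (fun l => D (y r l)) G := fun G => by
      rw [derivation_aeval, dirDeriv_apply]
      refine Finset.sum_congr rfl fun l _ => ?_
      rw [hx, Algebra.smul_def]
      rfl
    obtain ⟨β, hβ'⟩ := hβ r
    have := hred r (c r)
    have hvan : ∀ G ∈ (vanishingForms i).toIdeal, MvPolynomial.aeval (y r) G = 0 := fun G hG => by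
      rw [← hβ', (c r).γ_eq_zero_of_mem_vanishingForms hG, map_zero]
    have h0 := h (C r ⧸ m) x (fun l => D (y r l)) r
      (by change Ideal.Quotient.mk m (y r r) = 1; rw [hyr, map_one])
      (by rw [hyr, Derivation.map_one_eq_zero])
      (fun G hG => by rw [hxV, hvan G hG, map_zero])
      (fun G hG => by
        rw [← dirDeriv_map (R' := F), ← hD, MvPolynomial.aeval_map_algebraMap, hvan G hG, map_zero])
      (fun G hG => by rw [hx, hyM r G hG, map_zero])
      (fun G hG => by rw [← hD, hyM r G hG, map_zero])
    ext a
    obtain ⟨G, rfl⟩ := hsurj r a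
    rw [hD, h0, dirDeriv_apply]
    simp
  have := Algebra.FormallyEtale.of_formallyUnramified_of_field F (C r)
  exact ⟨inferInstance, Algebra.FinitePresentation.of_finiteType.mp hft⟩

/-- A quadric section over an algebraically closed field is finite if it misses a hyperplane. -/
lemma isFinite_quadricSectionStr [IsClosedImmersion i]
    (hred : ∀ r (c : ProjChart i r), _root_.IsReduced c.B)
    {k : Type u} [Field k] [IsAlgClosed k] [Algebra V k]
    {M : Submodule k (MvPolynomial (Fin (n + 1)) k)}
    {hM : M ≤ MvPolynomial.homogeneousSubmodule (Fin (n + 1)) k 2} (a : Fin (n + 1) → k)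
    (h : ∀ (q : Fin (n + 1) → k) (r : Fin (n + 1)), q r = 1 →
      IsZeroOf (vanishingForms i).toIdeal q → (∀ G ∈ M, MvPolynomial.aeval q G = 0) →
      ∑ l, a l * q l ≠ 0) :
    IsFinite (quadricSectionStr i M hM) := by
  have hproper : IsProper (quadricSectionStr i M hM) := isProper_quadricSectionStr
  refine IsFinite.iff_isProper_and_isAffineHom.mpr ⟨hproper, ?_⟩
  suffices haff : IsAffine (quadricSection i M hM) from
    isAffineHom_of_isAffine _
  let 𝒜 := MvPolynomial.homogeneousSubmodule (Fin (n + 1)) k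
  let I := quadricIdeal M hM
  let L : MvPolynomial (Fin (n + 1)) k := ∑ l, MvPolynomial.C (a l) * MvPolynomial.X l
  have hL : L ∈ 𝒜 1 := by
    refine sum_mem fun l _ => ?_
    have := (MvPolynomial.isHomogeneous_X k l).C_mul (a l)
    exact this
  have hL' : quotGradedHom 𝒜 I L ∈ quotGrading 𝒜 I 1 := (quotGradedHom 𝒜 I).map_mem hL
  let sn' : quadricSection i M hM ⟶ Proj (quotGrading 𝒜 I) :=
    pullback.snd i (quadricLocusι M hM ≫ projSpaceMap n V k)
  have hcl : IsClosedImmersion sn' :=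
    inferInstanceAs (IsClosedImmersion (pullback.snd i (quadricLocusι M hM ≫ projSpaceMap n V k)))
  obtain ⟨D, _, γ, hγ, j', -, hj', hrange', -⟩ := exists_chart (quotGrading 𝒜 I) hL' sn'
  -- The chart where the linear form is invertible is affine, so it is enough that it is the whole
  -- section.
  have hsurj' : Function.Surjective j' := fun z => by
    change z ∈ Set.range j'
    rw [hrange']
    obtain ⟨r, hr⟩ := exists_mem_basicOpen_X
      (i (pullback.fst i (quadricLocusι M hM ≫ projSpaceMap n V k) z))
    obtain ⟨c⟩ := nonempty_projChart i r
    obtain ⟨C, _, _, _, _, y, j, hj, hyr, hsurj, hyM, ⟨β, hβ⟩, hrange, -, h1, hpt⟩ :=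
      exists_sectionChart (A := k) (M := M) (hM := hM) c
    obtain ⟨w, rfl⟩ := (hrange z).mpr hr
    have h2 : quadricLocusι M hM (sn' (j w)) = (j ≫ pullback.snd i (quadricLocusι M hM ≫
        projSpaceMap n V k) ≫ quadricLocusι M hM) w := rfl
    rw [hpt] at h2
    change ¬ L ∈ (show ProjectiveSpectrum 𝒜 from quadricLocusι M hM (sn' (j w))).asHomogeneousIdeal
    rw [h2]
    intro h3
    have h4 := (mem_projPoint_iff 𝒜 (MvPolynomial.isHomogeneous_X k r)
      (MvPolynomial.aeval (R := k) y).toRingHom h1 hL w).mp h3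
    have hft : Algebra.FiniteType k C := Algebra.FiniteType.of_surjective _ hsurj
    -- A point on the hyperplane specializes within this chart to a closed point on it, which is
    -- `k`-rational; the hypothesis excludes it.
    obtain ⟨m, hm, hwm⟩ := Ideal.exists_le_maximal w.asIdeal w.isPrime.ne_top
    obtain ⟨e, he⟩ := exists_algHom_ker_eq (k := k) m
    have hq : ∀ G : MvPolynomial (Fin (n + 1)) k,
        MvPolynomial.aeval (fun l => e (y l)) G = e (MvPolynomial.aeval y G) := fun G =>
      (MvPolynomial.comp_aeval_apply _ e _).symm
    have := hred r c
    refine h (fun l => e (y l)) r (by rw [hyr, map_one]) (fun G hG => ?_) (fun G hG => ?_) ?_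
    · rw [← MvPolynomial.aeval_map_algebraMap k, hq, MvPolynomial.aeval_map_algebraMap, ← hβ,
        c.γ_eq_zero_of_mem_vanishingForms hG, map_zero, map_zero]
    · rw [hq, hyM G hG, map_zero]
    · have h5 : e (MvPolynomial.aeval y L) = 0 := by
        rw [← RingHom.mem_ker (f := e), he]
        exact hwm h4
      rw [← hq] at h5
      simpa [L] using h5
  have hepi : Epi j'.base := (TopCat.epi_iff_surjective _).mpr hsurj'
  have hiso : IsIso j' := IsOpenImmersion.isIso j'
  exact IsAffine.of_isIso (inv j')

end Criteria

/-! ### Cotangent spaces at closed points of the special fibre -/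

section Cotangent

variable {V : Type u} [CommRing V] [IsLocalRing V] {B : Type u} [CommRing B] [Algebra V B]

/-- The submodule `𝔓² + J` of the kernel `𝔓` of a residue map. -/
noncomputable def cotangentRel (e : B →ₐ[V] (IsLocalRing.ResidueField V)) (J : Ideal B) : Submodule B (RingHom.ker e) :=
  Submodule.comap (Submodule.subtype (RingHom.ker e)) (RingHom.ker e ^ 2 ⊔ J)

/-- The quotient `𝔓 / (𝔓² + J)` for the kernel `𝔓` of a residue map. -/
noncomputable def CotangentQuotient (e : B →ₐ[V] (IsLocalRing.ResidueField V)) (J : Ideal B) : Type u :=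
  RingHom.ker e ⧸ cotangentRel e J

namespace CotangentQuotient

variable (e : B →ₐ[V] (IsLocalRing.ResidueField V)) (J : Ideal B)

noncomputable instance : AddCommGroup (CotangentQuotient e J) :=
  inferInstanceAs (AddCommGroup (RingHom.ker e ⧸ cotangentRel e J))

noncomputable instance : Module B (CotangentQuotient e J) :=
  inferInstanceAs (Module B (RingHom.ker e ⧸ cotangentRel e J))

noncomputable instance : Module V (CotangentQuotient e J) :=
  Module.compHom (CotangentQuotient e J) (algebraMap V B)

/-- The class of an element of `𝔓`. -/
noncomputable def mk : RingHom.ker e →ₗ[B] CotangentQuotient e J :=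
  Submodule.mkQ (cotangentRel e J)

lemma mk_surjective : Function.Surjective (mk e J) := Submodule.mkQ_surjective (cotangentRel e J)

lemma mk_eq_zero (b : RingHom.ker e) : mk e J b = 0 ↔ b.1 ∈ RingHom.ker e ^ 2 ⊔ J :=
  Submodule.Quotient.mk_eq_zero _

lemma smul_eq_zero_of_mem {b : B} (hb : b ∈ RingHom.ker e) (x : CotangentQuotient e J) :
    b • x = 0 := by
  obtain ⟨y, rfl⟩ := mk_surjective e J x
  rw [← map_smul, mk_eq_zero]
  refine Ideal.mem_sup_left ?_
  rw [pow_two]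
  exact Ideal.mul_mem_mul hb y.2

lemma algebraMap_mem {a : V} (ha : a ∈ IsLocalRing.maximalIdeal V) :
    algebraMap V B a ∈ RingHom.ker e := by
  rw [RingHom.mem_ker, AlgHom.commutes]
  exact (IsLocalRing.residue_eq_zero_iff a).mpr ha

noncomputable instance : Module (IsLocalRing.ResidueField V) (CotangentQuotient e J) :=
  Module.IsTorsionBySet.module (R := V) (I := IsLocalRing.maximalIdeal V) fun x a =>
    smul_eq_zero_of_mem e J (algebraMap_mem e a.2) x

lemma residue_smul (a : V) (x : CotangentQuotient e J) :
    IsLocalRing.residue V a • x = algebraMap V B a • x := rfl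

lemma smul_eq (b : B) (x : CotangentQuotient e J) : e b • x = b • x := by
  obtain ⟨a, ha⟩ := IsLocalRing.residue_surjective (e b)
  rw [← ha, residue_smul, ← sub_eq_zero, ← sub_smul]
  refine smul_eq_zero_of_mem e J ?_ x
  rw [RingHom.mem_ker, map_sub, AlgHom.commutes, ← ha, sub_eq_zero]
  rfl

/-- A `V`-linear map is linear over the residue field. -/
noncomputable def linearMap {Q : Type u} [AddCommGroup Q] [Module (IsLocalRing.ResidueField V) Q] (f : Q →+ CotangentQuotient e J)
    (hf : ∀ (a : V) x, f (IsLocalRing.residue V a • x) = algebraMap V B a • f x) :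
    Q →ₗ[(IsLocalRing.ResidueField V)] CotangentQuotient e J where
  __ := f
  map_smul' := fun c x => by
    obtain ⟨a, rfl⟩ := IsLocalRing.residue_surjective c
    exact hf a x

/-- The span over the residue field. -/
lemma mem_span_iff {ι : Type*} [Finite ι] (φ : ι → RingHom.ker e) (b : RingHom.ker e) :
    mk e J b ∈ Submodule.span (IsLocalRing.ResidueField V) (Set.range fun j => mk e J (φ j)) ↔
      b.1 ∈ Ideal.span (Set.range fun j => (φ j).1) ⊔ (RingHom.ker e ^ 2 ⊔ J) := by
  classical
  have := Fintype.ofFinite ι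
  constructor
  · intro h
    obtain ⟨w, hw⟩ := (Submodule.mem_span_range_iff_exists_fun (IsLocalRing.ResidueField V)).mp h
    choose a ha using fun j => IsLocalRing.residue_surjective (w j)
    have h1 : mk e J (b - ∑ j, algebraMap V B (a j) • φ j) = 0 := by
      rw [map_sub, ← hw, map_sum, sub_eq_zero]
      refine Finset.sum_congr rfl fun j _ => ?_
      rw [map_smul, ← residue_smul, ha]
    rw [mk_eq_zero] at h1
    have h2 : b.1 = (∑ j, algebraMap V B (a j) * (φ j).1) +
        (b - ∑ j, algebraMap V B (a j) • φ j : RingHom.ker e).1 := by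
      simp [Algebra.smul_def]
    rw [h2]
    exact Submodule.add_mem_sup (sum_mem fun j _ => Ideal.mul_mem_left _ _
      (Ideal.subset_span ⟨j, rfl⟩)) h1
  · intro h
    obtain ⟨y, hy, z, hz, hyz⟩ := Submodule.mem_sup.mp h
    obtain ⟨w, hw⟩ := (Submodule.mem_span_range_iff_exists_fun B).mp hy
    have h1 : mk e J (b - ∑ j, w j • φ j) = 0 := by
      rw [mk_eq_zero]
      have h2 : (b - ∑ j, w j • φ j : RingHom.ker e).1 = z := by
        rw [← hw] at hyz
        simp only [smul_eq_mul] at hyz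
        simp [← hyz]
      rwa [h2]
    rw [map_sub, sub_eq_zero] at h1
    rw [h1, map_sum]
    refine sum_mem fun j _ => ?_
    rw [map_smul, ← smul_eq]
    exact Submodule.smul_mem _ _ (Submodule.subset_span ⟨j, rfl⟩)

/-- An element `s` outside `𝔓` acts on the quotient as the nonzero scalar `e s`, so local generators
of `𝔓` already span. -/
lemma span_eq_top {ι : Type*} [Finite ι] (φ : ι → RingHom.ker e)
    (h : ∀ b ∈ RingHom.ker e, ∃ s ∉ RingHom.ker e, s * b ∈ Ideal.span (Set.range fun j => (φ j).1)) :
    Submodule.span (IsLocalRing.ResidueField V) (Set.range fun j => mk e J (φ j)) = ⊤ := by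
  rw [eq_top_iff]
  intro x _
  obtain ⟨b, rfl⟩ := mk_surjective e J x
  obtain ⟨s, hs, hsb⟩ := h b.1 b.2
  have h1 : mk e J (s • b) ∈ Submodule.span (IsLocalRing.ResidueField V) (Set.range fun j => mk e J (φ j)) :=
    (mem_span_iff e J φ _).mpr (Ideal.mem_sup_left hsb)
  rw [map_smul, ← smul_eq] at h1
  exact (Submodule.smul_mem_iff _ hs).mp h1

lemma finite_of_fg [IsNoetherianRing B] : Module.Finite (IsLocalRing.ResidueField V) (CotangentQuotient e J) := by
  obtain ⟨m, a, ha⟩ := Submodule.fg_iff_exists_fin_generating_family.mp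
    (IsNoetherian.noetherian (RingHom.ker e))
  have hmem : ∀ j, a j ∈ RingHom.ker e := fun j => by
    rw [← ha]
    exact Submodule.subset_span ⟨j, rfl⟩
  have h1 := span_eq_top e J (fun j => (⟨a j, hmem j⟩ : RingHom.ker e)) fun b hb =>
    ⟨1, by rw [RingHom.mem_ker, map_one]; exact one_ne_zero, by
      rw [one_mul]
      change b ∈ Submodule.span B (Set.range a)
      rwa [ha]⟩
  exact ⟨by rw [← h1]; exact Submodule.fg_span (Set.finite_range _)⟩

lemma finrank_le {m : ℕ} (φ : Fin m → RingHom.ker e)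
    (h : ∀ b ∈ RingHom.ker e, ∃ s ∉ RingHom.ker e, s * b ∈ Ideal.span (Set.range fun j => (φ j).1)) :
    Module.finrank (IsLocalRing.ResidueField V) (CotangentQuotient e J) ≤ m := by
  have h1 := finrank_range_le_card (R := (IsLocalRing.ResidueField V)) fun j => mk e J (φ j)
  rw [Set.finrank, span_eq_top e J φ h, finrank_top, Fintype.card_fin] at h1
  exact h1

lemma ker_le_of_finrank_eq_zero [IsNoetherianRing B] {ι : Type*} [Finite ι] (φ : ι → RingHom.ker e)
    (h : Module.finrank (IsLocalRing.ResidueField V) (CotangentQuotient e J ⧸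
      Submodule.span (IsLocalRing.ResidueField V) (Set.range fun j => mk e J (φ j))) ≤ 0) :
    RingHom.ker e ≤ Ideal.span (Set.range fun j => (φ j).1) ⊔ (RingHom.ker e ^ 2 ⊔ J) := by
  have := finite_of_fg e J
  have h1 := Module.finrank_zero_iff.mp (Nat.le_zero.mp h)
  rw [Submodule.Quotient.subsingleton_iff] at h1
  intro b hb
  refine (mem_span_iff e J φ ⟨b, hb⟩).mp ?_
  rw [h1]
  trivial

lemma ker_le_of_finrank_le_one [IsNoetherianRing B] {ι : Type*} [Finite ι] (φ : ι → RingHom.ker e)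
    (h : Module.finrank (IsLocalRing.ResidueField V) (CotangentQuotient e J ⧸
      Submodule.span (IsLocalRing.ResidueField V) (Set.range fun j => mk e J (φ j))) ≤ 1) :
    ∃ t ∈ RingHom.ker e, RingHom.ker e ≤
      (Ideal.span (Set.range fun j => (φ j).1) ⊔ Ideal.span {t}) ⊔ (RingHom.ker e ^ 2 ⊔ J) := by
  have := finite_of_fg e J
  obtain ⟨x, hx⟩ := finrank_le_one_iff.mp h
  obtain ⟨x, rfl⟩ := Submodule.mkQ_surjective _ x
  obtain ⟨t, rfl⟩ := mk_surjective e J x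
  refine ⟨t.1, t.2, fun b hb => ?_⟩
  obtain ⟨a, ha⟩ := hx (Submodule.mkQ _ (mk e J ⟨b, hb⟩))
  obtain ⟨a, rfl⟩ := IsLocalRing.residue_surjective a
  rw [← map_smul, ← sub_eq_zero, ← map_sub, Submodule.mkQ_apply, Submodule.Quotient.mk_eq_zero,
    residue_smul, ← map_smul, ← map_sub] at ha
  have h1 := (mem_span_iff e J φ _).mp ha
  have h2 : b = algebraMap V B a * t.1 - (algebraMap V B a • t - ⟨b, hb⟩ : RingHom.ker e).1 := by
    simp [Algebra.smul_def]
  rw [h2]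
  refine sub_mem (Ideal.mem_sup_left (Ideal.mem_sup_right (Ideal.mul_mem_left _ _
    (Ideal.subset_span rfl)))) ?_
  have h3 := sup_le_sup_right (le_sup_left (a := Ideal.span (Set.range fun j => (φ j).1))
    (b := Ideal.span {t.1})) (RingHom.ker e ^ 2 ⊔ J)
  exact h3 h1

/-- The class of `x` in `𝔓/𝔓²` is nonzero and dies in the smaller quotient. -/
lemma finrank_succ_le [IsNoetherianRing B] (x : RingHom.ker e) (hx : x.1 ∉ RingHom.ker e ^ 2) :
    Module.finrank (IsLocalRing.ResidueField V) (CotangentQuotient e (Ideal.span {x.1})) + 1 ≤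
      Module.finrank (IsLocalRing.ResidueField V) (CotangentQuotient e ⊥) := by
  have := finite_of_fg e ⊥
  let g : CotangentQuotient e ⊥ →ₗ[B] CotangentQuotient e (Ideal.span {x.1}) :=
    Submodule.factor (Submodule.comap_mono (sup_le_sup_left bot_le _))
  have hg : ∀ b, g (mk e ⊥ b) = mk e _ b := fun b => rfl
  let f : CotangentQuotient e ⊥ →ₗ[(IsLocalRing.ResidueField V)] CotangentQuotient e (Ideal.span {x.1}) :=
    linearMap e _ g.toAddMonoidHom fun a y => by
      rw [residue_smul]
      exact g.map_smul _ _
  have hf : Function.Surjective f := fun y => by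
    obtain ⟨b, rfl⟩ := mk_surjective e _ y
    exact ⟨mk e ⊥ b, rfl⟩
  have h1 := f.finrank_range_add_finrank_ker
  rw [LinearMap.range_eq_top.mpr hf, finrank_top] at h1
  have h2 : LinearMap.ker f ≠ ⊥ := fun h0 => by
    have h3 : mk e ⊥ x ∈ LinearMap.ker f := by
      change mk e _ x = 0
      rw [mk_eq_zero]
      exact Ideal.mem_sup_right (Ideal.subset_span rfl)
    rw [h0, Submodule.mem_bot, mk_eq_zero, sup_bot_eq] at h3
    exact hx h3
  have h3 : 1 ≤ Module.finrank (IsLocalRing.ResidueField V) (LinearMap.ker f) := Submodule.one_le_finrank_iff.mpr h2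
  lia

variable {n : ℕ} (γ : MvPolynomial (Fin (n + 1)) V →ₐ[V] B)

lemma eval_map_residue (F : MvPolynomial (Fin (n + 1)) V) :
    MvPolynomial.eval (fun l => e (γ (MvPolynomial.X l)))
      (MvPolynomial.map (IsLocalRing.residue V) F) = e (γ F) := by
  have h1 : MvPolynomial.aeval (fun l => e (γ (MvPolynomial.X l))) = e.comp γ := by
    ext l; simp
  have h2 := congrArg (fun g : MvPolynomial (Fin (n + 1)) V →ₐ[V] (IsLocalRing.ResidueField V) => g F) h1
  rw [MvPolynomial.eval_map]
  exact h2

/-- The differential at the point `e` of quadratic forms that vanish there, computed in the special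
fibre. -/
lemma exists_differential {r : Fin (n + 1)} (hr : γ (MvPolynomial.X r) = 1)
    (hγ : Function.Surjective γ) :
    ∃ Λ : quadricsThrough (fun l => e (γ (MvPolynomial.X l))) →ₗ[(IsLocalRing.ResidueField V)]
        CotangentQuotient e ((IsLocalRing.maximalIdeal V).map (algebraMap V B)),
      Function.Surjective Λ ∧ ∀ (f : quadricsThrough fun l => e (γ (MvPolynomial.X l)))
        (F : MvPolynomial (Fin (n + 1)) V) (_ : MvPolynomial.map (IsLocalRing.residue V) F = f.1)
        (h : γ F ∈ RingHom.ker e), Λ f = mk e _ ⟨γ F, h⟩ := by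
  let J := (IsLocalRing.maximalIdeal V).map (algebraMap V B)
  let p : Fin (n + 1) → (IsLocalRing.ResidueField V) := fun l => e (γ (MvPolynomial.X l))
  have hsurj := MvPolynomial.map_surjective (σ := Fin (n + 1)) (IsLocalRing.residue V)
    IsLocalRing.residue_surjective
  have hker : ∀ F : MvPolynomial (Fin (n + 1)) V, MvPolynomial.map (IsLocalRing.residue V) F = 0 →
      γ F ∈ J := fun F hF => by
    have h1 : F ∈ RingHom.ker (MvPolynomial.map (IsLocalRing.residue V)) := hF
    rw [MvPolynomial.ker_map, IsLocalRing.ker_residue] at h1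
    have h2 := Ideal.mem_map_of_mem γ.toRingHom h1
    rw [Ideal.map_map] at h2
    have h3 : γ.toRingHom.comp MvPolynomial.C = algebraMap V B := γ.comp_algebraMap
    rwa [h3] at h2
  choose G hG using fun f : quadricsThrough p => hsurj f.1
  have hmem : ∀ (f : quadricsThrough p) (F : MvPolynomial (Fin (n + 1)) V),
      MvPolynomial.map (IsLocalRing.residue V) F = f.1 → γ F ∈ RingHom.ker e := fun f F hF => by
    rw [RingHom.mem_ker, ← eval_map_residue, hF]
    exact (mem_quadricsThrough.mp f.2).2
  let Λ₀ : quadricsThrough p → CotangentQuotient e J := fun f => mk e J ⟨γ (G f), hmem f _ (hG f)⟩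
  have hΛ₀ : ∀ (f : quadricsThrough p) (F : MvPolynomial (Fin (n + 1)) V)
      (hF : MvPolynomial.map (IsLocalRing.residue V) F = f.1) (h : γ F ∈ RingHom.ker e),
      Λ₀ f = mk e J ⟨γ F, h⟩ := fun f F hF h => by
    rw [← sub_eq_zero, ← map_sub, mk_eq_zero]
    refine Ideal.mem_sup_right ?_
    change γ (G f) - γ F ∈ J
    rw [← map_sub]
    exact hker _ (by rw [map_sub, hG, hF, sub_self])
  let Λ₁ : quadricsThrough p →+ CotangentQuotient e J := AddMonoidHom.mk' Λ₀ fun f g => by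
    have h1 : MvPolynomial.map (IsLocalRing.residue V) (G f + G g) = (f + g).1 := by
      rw [map_add, hG, hG]; rfl
    rw [hΛ₀ (f + g) (G f + G g) h1 (hmem _ _ h1), ← map_add]
    congr 1
    exact Subtype.ext (map_add γ _ _)
  refine ⟨linearMap e J Λ₁ fun a f => ?_, fun x => ?_, hΛ₀⟩
  · have h1 : MvPolynomial.map (IsLocalRing.residue V) (MvPolynomial.C a * G f) =
        (IsLocalRing.residue V a • f).1 := by
      rw [map_mul, hG, MvPolynomial.map_C, ← MvPolynomial.smul_eq_C_mul]; rfl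
    refine (hΛ₀ _ _ h1 (hmem _ _ h1)).trans ?_
    change _ = algebraMap V B a • mk e J _
    rw [← map_smul]
    congr 1
    refine Subtype.ext ?_
    change γ (MvPolynomial.C a * G f) = algebraMap V B a * γ (G f)
    rw [map_mul]
    congr 1
    exact γ.commutes a
  · obtain ⟨⟨b, hb⟩, rfl⟩ := mk_surjective e J x
    obtain ⟨F, rfl⟩ := hγ b
    choose a ha using fun s => IsLocalRing.residue_surjective (p s)
    have hφ : ∀ s, γ (MvPolynomial.X s) - algebraMap V B (a s) ∈ RingHom.ker e := fun s => by
      rw [RingHom.mem_ker, map_sub, AlgHom.commutes, sub_eq_zero]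
      exact (ha s).symm
    let φ : Fin (n + 1) → RingHom.ker e := fun s => ⟨_, hφ s⟩
    -- First-order expansion at the point: modulo the functions `x_s - a_s` a polynomial equals its
    -- value at `a`. So these functions and the maximal ideal of `V` generate `𝔓`.
    have h1 : γ F - algebraMap V B (MvPolynomial.aeval a F) ∈
        Ideal.span (Set.range fun s => (φ s).1) := by
      have h2 : (Ideal.Quotient.mkₐ V (Ideal.span (Set.range fun s => (φ s).1))).comp γ =
          (Algebra.ofId V _).comp (MvPolynomial.aeval a) := by
        ext s
        simp only [AlgHom.comp_apply, MvPolynomial.aeval_X]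
        exact Ideal.Quotient.eq.mpr (Ideal.subset_span ⟨s, rfl⟩)
      exact Ideal.Quotient.eq.mp (congrArg (fun g : MvPolynomial (Fin (n + 1)) V →ₐ[V] _ => g F) h2)
    have h2 : algebraMap V B (MvPolynomial.aeval a F) ∈ J := by
      refine Ideal.mem_map_of_mem _ ((IsLocalRing.residue_eq_zero_iff _).mp ?_)
      have h3 : e (γ F - algebraMap V B (MvPolynomial.aeval a F)) = 0 := by
        refine (Ideal.span_le.mpr ?_ : Ideal.span _ ≤ RingHom.ker e) h1
        rintro _ ⟨s, rfl⟩
        exact (φ s).2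
      rw [map_sub, hb, zero_sub, neg_eq_zero, AlgHom.commutes] at h3
      exact h3
    have h3 := (mem_span_iff (J := J) e φ ⟨γ F, hb⟩).mpr (by
      have h4 := Submodule.add_mem_sup h1 (Ideal.mem_sup_right (S := RingHom.ker e ^ 2) h2)
      rwa [sub_add_cancel] at h4)
    rw [← LinearMap.mem_range]
    refine (Submodule.span_le.mpr ?_ : Submodule.span _ _ ≤ LinearMap.range _) h3
    rintro _ ⟨s, rfl⟩
    have hpr : p r = 1 := by simp only [p, hr, map_one]
    -- The quadric `(x_s - p_s x_r) x_r` passes through `p` and restricts on the chart to the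
    -- function `x_s - a_s`; this is where degree two suffices to reach every cotangent vector.
    refine ⟨⟨lineThrough p r s * MvPolynomial.X r, lineThrough_mul_X_mem hpr _ _⟩, ?_⟩
    have h5 : γ ((MvPolynomial.X s - MvPolynomial.C (a s) * MvPolynomial.X r) *
        MvPolynomial.X r) = (φ s).1 := by
      rw [map_mul, map_sub, map_mul, hr, mul_one, mul_one]
      exact congrArg (γ (MvPolynomial.X s) - ·) (γ.commutes (a s))
    refine (hΛ₀ _ ((MvPolynomial.X s - MvPolynomial.C (a s) * MvPolynomial.X r) *
      MvPolynomial.X r) ?_ (by rw [h5]; exact (φ s).2)).trans ?_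
    · simp [lineThrough, ha]
    · congr 1
      exact Subtype.ext h5

end CotangentQuotient

end Cotangent

/-! ### Rigidity of points with given quadrics through a closed point -/

section TangentIdeal

variable {R A : Type*} [CommRing R] [CommRing A] [Algebra R A] {σ : Type*} [Fintype σ]

/-- The polynomials that vanish at `x` together with their derivative in the direction `u`. -/
noncomputable def tangentIdeal (R : Type*) [CommRing R] [Algebra R A] (x u : σ → A) :
    Ideal (MvPolynomial σ R) where
  carrier := {F | MvPolynomial.aeval x F = 0 ∧ dirDeriv x u F = 0}
  add_mem' := fun ha hb => ⟨by rw [map_add, ha.1, hb.1, add_zero], by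
    rw [map_add, ha.2, hb.2, add_zero]⟩
  zero_mem' := ⟨map_zero _, map_zero _⟩
  smul_mem' := fun c F hF => ⟨by rw [smul_eq_mul, map_mul, hF.1, mul_zero], by
    rw [smul_eq_mul, dirDeriv_mul, hF.1, hF.2, mul_zero, zero_mul, add_zero]⟩

lemma dirDeriv_aeval_X (x u : σ → A) (l : σ) (h : Polynomial R) :
    dirDeriv x u (Polynomial.aeval (MvPolynomial.X l : MvPolynomial σ R) h) =
      Polynomial.aeval (x l) (Polynomial.derivative h) * u l := by
  induction h using Polynomial.induction_on' with
  | add p q hp hq => simp only [map_add, hp, hq, add_mul]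
  | monomial m a =>
    rw [Polynomial.aeval_monomial, Polynomial.derivative_monomial, Polynomial.aeval_monomial]
    have h1 : ∀ m : ℕ, dirDeriv x u ((MvPolynomial.X l : MvPolynomial σ R) ^ m) =
        m * x l ^ (m - 1) * u l := fun m => by
      induction m with
      | zero => rw [pow_zero, ← MvPolynomial.C_1, dirDeriv_C, Nat.cast_zero, zero_mul, zero_mul]
      | succ m ih =>
        rw [pow_succ, dirDeriv_mul, ih, dirDeriv_X, map_pow, MvPolynomial.aeval_X]
        rcases m with - | m
        · simp
        · simp only [Nat.add_sub_cancel]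
          push_cast
          ring
    rw [MvPolynomial.algebraMap_eq, dirDeriv_mul, dirDeriv_C, mul_zero, add_zero, h1,
      MvPolynomial.aeval_C, map_mul, map_natCast]
    ring

/-- A vector along which all polynomial relations are stationary vanishes in the algebraic
coordinates, in characteristic zero. -/
lemma eq_zero_of_isAlgebraic {V K κ O : Type*} [CommRing V] [IsDomain V] [Field K] [CharZero K]
    [Field κ] [Algebra V K]
    [IsFractionRing V K] [Algebra K κ] [Algebra V κ] [IsScalarTower V K κ] [CommRing O]
    [Algebra V O] [Algebra O κ] [IsScalarTower V O κ] (hO : Function.Injective (algebraMap O κ))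
    (x u : σ → O) (l : σ) (hx : IsAlgebraic K (algebraMap O κ (x l)))
    (h : ∀ F : MvPolynomial σ V, MvPolynomial.aeval x F = 0 → dirDeriv x u F = 0) : u l = 0 := by
  -- The minimal polynomial of the coordinate, with denominators cleared, is a relation over `V`;
  -- its derivative does not vanish at the coordinate by separability.
  obtain ⟨b, hb0, hb⟩ := IsLocalization.integerNormalization_spec (nonZeroDivisors V)
    (minpoly K (algebraMap O κ (x l)))
  set y := algebraMap O κ (x l) with hy
  set H := IsLocalization.integerNormalization (nonZeroDivisors V) (minpoly K y) with hH
  have hb' : H.map (algebraMap V K) = algebraMap V K b • minpoly K y := by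
    rw [hb, algebraMap_smul]
  have hbK : algebraMap V K b ≠ 0 := fun h0 => nonZeroDivisors.ne_zero hb0
    (IsFractionRing.injective V K (h0.trans (map_zero (algebraMap V K)).symm))
  have h1 : MvPolynomial.aeval x (Polynomial.aeval (MvPolynomial.X l : MvPolynomial σ V) H) = 0 := by
    refine hO ?_
    rw [← Polynomial.aeval_algHom_apply, MvPolynomial.aeval_X, map_zero,
      ← Polynomial.aeval_algebraMap_apply, ← Polynomial.aeval_map_algebraMap K, hb', map_smul,
      minpoly.aeval K y, smul_zero]
  have h2 := h _ h1
  rw [dirDeriv_aeval_X] at h2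
  have h3 : algebraMap O κ (Polynomial.aeval (x l) (Polynomial.derivative H)) ≠ 0 := by
    rw [← Polynomial.aeval_algebraMap_apply, ← Polynomial.aeval_map_algebraMap K,
      ← Polynomial.derivative_map, hb', Polynomial.derivative_smul, map_smul]
    exact smul_ne_zero hbK ((minpoly.irreducible hx.isIntegral).separable.aeval_derivative_ne_zero
      (minpoly.aeval K y))
  have h4 := congrArg (algebraMap O κ) h2
  rw [map_mul, map_zero] at h4
  exact hO (((mul_eq_zero.mp h4).resolve_left h3).trans (map_zero _).symm)

end TangentIdeal

namespace ProjChart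

variable {V : Type u} [CommRing V] [IsLocalRing V] {n : ℕ} {X : Scheme.{u}}
  {i : X ⟶ projSpace n V} {r : Fin (n + 1)} (c : ProjChart i r)
  (e : c.B →ₐ[V] IsLocalRing.ResidueField V)

/-- The functions vanishing at the point and stationary along `u` include the `F j`, all of `𝔓²` and
the maximal ideal of `V`, hence all of `𝔓`. Applied to `x_l - a` with `a` lifting the `l`-th
coordinate, this gives `u l = 0`. -/
lemma tangent_eq_zero {d : ℕ} (F : Fin d → MvPolynomial (Fin (n + 1)) V)
    (hF : ∀ j, c.γ (F j) ∈ RingHom.ker e)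
    (h : RingHom.ker e ≤ Ideal.span (Set.range fun j => c.γ (F j)) ⊔
      (RingHom.ker e ^ 2 ⊔ (IsLocalRing.maximalIdeal V).map (algebraMap V c.B)))
    {u : Fin (n + 1) → IsLocalRing.ResidueField V} (hur : u r = 0)
    (hu : IsTangentTo (vanishingForms i).toIdeal (fun l => e (c.γ (MvPolynomial.X l))) u)
    (hFu : ∀ j, dirDeriv (fun l => e (c.γ (MvPolynomial.X l))) u (F j) = 0) : u = 0 := by
  let p : Fin (n + 1) → IsLocalRing.ResidueField V := fun l => e (c.γ (MvPolynomial.X l))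
  have hp : ∀ F, MvPolynomial.aeval p F = e (c.γ F) := fun F => by
    have h1 : MvPolynomial.aeval p = e.comp c.γ := by ext l; simp [p]
    rw [h1]; rfl
  have hpr : p r = 1 := by simp only [p, c.γ_X, map_one]
  let T := tangentIdeal V p u
  have hker : ∀ F, c.γ F = 0 → F ∈ T := fun F hF =>
    ⟨by rw [hp, hF, map_zero], c.dirDeriv_eq_zero hpr hur hu hF⟩
  have hle : RingHom.ker e ≤ T.map c.γ := by
    refine h.trans (sup_le (Ideal.span_le.mpr ?_) (sup_le ?_ (Ideal.map_le_iff_le_comap.mpr ?_)))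
    · rintro _ ⟨j, rfl⟩
      exact Ideal.mem_map_of_mem _ ⟨by rw [hp]; exact hF j, hFu j⟩
    · rw [pow_two, Ideal.mul_le]
      intro a ha b hb
      obtain ⟨F, rfl⟩ := c.surj a
      obtain ⟨G, rfl⟩ := c.surj b
      rw [← map_mul]
      refine Ideal.mem_map_of_mem _ ⟨?_, ?_⟩
      · rw [hp, map_mul, map_mul, show e (c.γ F) = 0 from ha, zero_mul]
      · rw [dirDeriv_mul, hp, hp, show e (c.γ F) = 0 from ha, show e (c.γ G) = 0 from hb, zero_mul,
          zero_mul, add_zero]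
    · intro a ha
      rw [Ideal.mem_comap, ← c.γ.commutes]
      refine Ideal.mem_map_of_mem _ ⟨?_, dirDeriv_C _ _ _⟩
      rw [AlgHom.commutes]
      exact (IsLocalRing.residue_eq_zero_iff a).mpr ha
  have hT : ∀ F, e (c.γ F) = 0 → F ∈ T := fun F hF => by
    obtain ⟨G, hG, hGF⟩ := (Ideal.mem_map_iff_of_surjective c.γ c.surj).mp (hle hF)
    have h1 := hker (F - G) (by rw [map_sub, hGF, sub_self])
    have h2 := T.add_mem h1 hG
    rwa [sub_add_cancel] at h2
  funext l
  obtain ⟨a, ha⟩ := IsLocalRing.residue_surjective (p l)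
  have h1 := (hT (MvPolynomial.X l - MvPolynomial.C a) (by
    rw [map_sub, map_sub, sub_eq_zero, ← hp, MvPolynomial.aeval_X, ← hp, MvPolynomial.aeval_C]
    exact ha.symm)).2
  rwa [map_sub, dirDeriv_X, dirDeriv_C, sub_zero] at h1

end ProjChart

/-- Let `𝔮 ⊂ 𝔓` be primes and suppose that `𝔓` is generated near `𝔓` by elements of `𝔮` and one
further element. Then `𝔮` is generated near `𝔓` by those elements if `𝔮 ≠ 𝔓`. -/
lemma exists_smul_mem_of_le_sup_span_singleton {B : Type*} [CommRing B] [IsNoetherianRing B]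
    {P q J : Ideal B} [P.IsPrime] [q.IsPrime] (hqP : q ≤ P) (hne : ¬ P ≤ q) (hJ : J ≤ q) {t : B} (htP : t ∈ P)
    (h : P ≤ (J ⊔ Ideal.span {t}) ⊔ P ^ 2) {b : B} (hb : b ∈ q) : ∃ s ∉ P, s * b ∈ J := by
  let A := Localization.AtPrime P
  let f := algebraMap B A
  have hjac : P.map f ≤ Ideal.jacobson ⊥ := by
    rw [IsLocalRing.jacobson_eq_maximalIdeal _ bot_ne_top]
    exact (Localization.AtPrime.map_eq_maximalIdeal (I := P)).le
  -- First application of Nakayama: after localization `J` and `t` generate `P`.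
  have h1 : P.map f ≤ (J ⊔ Ideal.span {t}).map f := by
    refine Submodule.le_of_le_smul_of_le_jacobson_bot (I := P.map f) (IsNoetherian.noetherian _)
      hjac ?_
    have h2 := Ideal.map_mono (f := f) h
    rwa [Ideal.map_sup, pow_two, Ideal.map_mul] at h2
  have hdisj : Disjoint (P.primeCompl : Set B) (q : Set B) :=
    Set.disjoint_left.mpr fun x hx hxq => hx (hqP hxq)
  have hqA : (q.map f).IsPrime := IsLocalization.isPrime_of_isPrime_disjoint P.primeCompl A q ‹_› hdisj
  have hcomap : (q.map f).comap f = q :=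
    IsLocalization.under_map_of_isPrime_disjoint P.primeCompl A ‹_› hdisj
  -- Otherwise both `J` and `t`, and so all of `P`, would lie in `q`.
  have ht : f t ∉ q.map f := fun ht => hne fun x hx => by
    rw [← hcomap, Ideal.mem_comap]
    refine (h1.trans ?_) (Ideal.mem_map_of_mem f hx)
    rw [Ideal.map_sup, Ideal.map_span, Set.image_singleton]
    exact sup_le (Ideal.map_mono hJ) ((Ideal.span_singleton_le_iff_mem _).mpr ht)
  have h2 : q.map f ≤ J.map f := by
    refine Submodule.le_of_le_smul_of_le_jacobson_bot (I := P.map f) (IsNoetherian.noetherian _)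
      hjac fun y hy => ?_
    -- Second application of Nakayama: write `y = z + t v` with `z` in `J`. Then `t v ∈ q` and `t ∉
    -- q` give `v ∈ q`, so `q` is contained in `J + P q`.
    have h3 := h1 (Ideal.map_mono hqP hy)
    rw [Ideal.map_sup, Ideal.map_span, Set.image_singleton] at h3
    obtain ⟨z, hz, w, hw, hzw⟩ := Submodule.mem_sup.mp h3
    obtain ⟨v, rfl⟩ := Ideal.mem_span_singleton.mp hw
    have h4 : f t * v ∈ q.map f := by
      have h5 := sub_mem hy (Ideal.map_mono hJ hz)
      rwa [← hzw, add_sub_cancel_left] at h5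
    have h5 := (hqA.mem_or_mem h4).resolve_left ht
    rw [← hzw]
    refine Submodule.add_mem_sup hz ?_
    have h6 : f t ∈ P.map f := Ideal.mem_map_of_mem f htP
    exact Ideal.mul_mem_mul h6 h5
  obtain ⟨s, hs, hsb⟩ := (IsLocalization.algebraMap_mem_map_algebraMap_iff P.primeCompl A J b).mp
    (h2 (Ideal.mem_map_of_mem f hb))
  exact ⟨s, hs, hsb⟩

namespace ProjChart

variable {V : Type u} [CommRing V] [IsLocalRing V] {n : ℕ} {X : Scheme.{u}}
  {i : X ⟶ projSpace n V} {r : Fin (n + 1)} (c : ProjChart i r)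
  (e : c.B →ₐ[V] IsLocalRing.ResidueField V)

/-- The integral point `x` corresponds to a prime `𝔮 = ker e'` inside `𝔓`, distinct from it because
`π` is not in `𝔮`. The `F j` lie in `𝔮` and generate it near `𝔓`, so `u` annihilates every relation
over `V` satisfied by `x`, and algebraicity of the coordinates finishes the argument. It is
essential that the `F j` have coefficients in `V`, so that they are functions on the chart. -/
lemma tangent_eq_zero_of_isAlgebraic [IsDomain V] [IsNoetherianRing V] {K κ O : Type u} [Field K]
    [CharZero K] [Field κ] [Algebra V K] [IsFractionRing V K] [Algebra K κ] [Algebra V κ]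
    [IsScalarTower V K κ] [Algebra.IsAlgebraic K κ] [CommRing O] [IsDomain O] [Algebra V O]
    [Algebra O κ] [IsScalarTower V O κ] (hO : Function.Injective (algebraMap O κ))
    (ρ : O →ₐ[V] IsLocalRing.ResidueField V) {π : V} (hπ0 : π ≠ 0)
    (hπ : π ∈ IsLocalRing.maximalIdeal V)
    {d : ℕ} (F : Fin d → MvPolynomial (Fin (n + 1)) V)
    {t : c.B} (ht : t ∈ RingHom.ker e)
    (h : RingHom.ker e ≤ Ideal.span (Set.range fun j => c.γ (F j)) ⊔ Ideal.span {t} ⊔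
      RingHom.ker e ^ 2)
    {x u : Fin (n + 1) → O} (hxr : x r = 1) (hur : u r = 0)
    (hxe : ∀ l, ρ (x l) = e (c.γ (MvPolynomial.X l)))
    (hx : IsZeroOf (vanishingForms i).toIdeal x) (hu : IsTangentTo (vanishingForms i).toIdeal x u)
    (hFx : ∀ j, MvPolynomial.aeval x (F j) = 0) (hFu : ∀ j, dirDeriv x u (F j) = 0) : u = 0 := by
  have := c.isNoetherianRing
  obtain ⟨e', he'⟩ := c.exists_algHom hxr hx
  have hγ : ∀ F, e' (c.γ F) = MvPolynomial.aeval x F := fun F => congrArg (fun g => g F) he'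
  have hρ : ρ.comp e' = e := by
    refine AlgHom.ext fun b => ?_
    obtain ⟨F, rfl⟩ := c.surj b
    have h1 : (ρ.comp e').comp c.γ = e.comp c.γ := by
      ext l
      simp [hγ, hxe]
    exact congrArg (fun g => g F) h1
  have hqP : RingHom.ker e' ≤ RingHom.ker e := fun b hb => by
    rw [RingHom.mem_ker] at hb ⊢
    rw [← hρ, AlgHom.comp_apply, hb, map_zero]
  have hVO : Function.Injective (algebraMap V κ) := by
    rw [IsScalarTower.algebraMap_eq V K κ]
    exact (algebraMap K κ).injective.comp (IsFractionRing.injective V K)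
  have hne : ¬ RingHom.ker e ≤ RingHom.ker e' := fun hle => by
    have h1 := hle (CotangentQuotient.algebraMap_mem e hπ)
    rw [RingHom.mem_ker, AlgHom.commutes] at h1
    refine hπ0 (hVO ?_)
    rw [IsScalarTower.algebraMap_apply V O κ, h1, map_zero, map_zero]
  have hJ : Ideal.span (Set.range fun j => c.γ (F j)) ≤ RingHom.ker e' := by
    rw [Ideal.span_le]
    rintro _ ⟨j, rfl⟩
    exact (hγ _).trans (hFx j)
  have : (RingHom.ker e).IsPrime := RingHom.ker_isPrime _
  have : (RingHom.ker e').IsPrime := RingHom.ker_isPrime _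
  have hker : ∀ F, c.γ F = 0 → F ∈ tangentIdeal V x u := fun F hF =>
    ⟨by rw [← hγ, hF, map_zero], c.dirDeriv_eq_zero hxr hur hu hF⟩
  have hst : ∀ G : MvPolynomial (Fin (n + 1)) V, MvPolynomial.aeval x G = 0 → dirDeriv x u G = 0 := by
    intro G hG
    obtain ⟨s, hs, hsG⟩ := exists_smul_mem_of_le_sup_span_singleton hqP hne hJ ht h
      (b := c.γ G) ((hγ G).trans hG)
    obtain ⟨S, rfl⟩ := c.surj s
    have h1 : Ideal.span (Set.range fun j => c.γ (F j)) ≤ (tangentIdeal V x u).map c.γ := by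
      rw [Ideal.span_le]
      rintro _ ⟨j, rfl⟩
      exact Ideal.mem_map_of_mem _ ⟨hFx j, hFu j⟩
    obtain ⟨H, hH, hHS⟩ := (Ideal.mem_map_iff_of_surjective c.γ c.surj).mp (h1 hsG)
    have h2 := (hker (S * G - H) (by rw [map_sub, map_mul, hHS, sub_self])).2
    rw [map_sub, hH.2, sub_zero, dirDeriv_mul, hG, zero_mul, add_zero] at h2
    refine (mul_eq_zero.mp h2).resolve_left fun h3 => hs ?_
    rw [RingHom.mem_ker, ← hρ, AlgHom.comp_apply, hγ, h3, map_zero]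
  funext l
  exact eq_zero_of_isAlgebraic (K := K) hO x u l (Algebra.IsAlgebraic.isAlgebraic _) hst

end ProjChart

/-! ### Dimension of cotangent spaces at regular and at smooth points -/

section

open TensorProduct

namespace CotangentQuotient

variable {V : Type u} [CommRing V] [IsLocalRing V] {B : Type u} [CommRing B] [Algebra V B]
  (e : B →ₐ[V] IsLocalRing.ResidueField V)

instance : IsScalarTower V B (CotangentQuotient e
    ((IsLocalRing.maximalIdeal V).map (algebraMap V B))) :=
  ⟨fun a b x => by
    rw [Algebra.smul_def, mul_smul]
    rfl⟩

/-- The universal derivation of the special fibre at a rational point. -/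
lemma exists_derivation : ∃ D : Derivation V B (CotangentQuotient e
    ((IsLocalRing.maximalIdeal V).map (algebraMap V B))), Function.Surjective D := by
  let J := (IsLocalRing.maximalIdeal V).map (algebraMap V B)
  choose s hs using fun c => IsLocalRing.residue_surjective (R := V) c
  have hmem : ∀ b a, e b = IsLocalRing.residue V a → b - algebraMap V B a ∈ RingHom.ker e :=
    fun b a h => by
      rw [RingHom.mem_ker, map_sub, AlgHom.commutes, h, sub_eq_zero]
      rfl
  -- `δ b` is the class of `b` minus a lift to `V` of its value; the choice of lift does not matter
  -- modulo the maximal ideal of `V`.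
  let δ : B → CotangentQuotient e J := fun b => mk e J ⟨_, hmem b (s (e b)) (hs _).symm⟩
  have hδ : ∀ b a (h : e b = IsLocalRing.residue V a), δ b = mk e J ⟨_, hmem b a h⟩ := by
    intro b a h
    rw [← sub_eq_zero, ← map_sub, mk_eq_zero]
    refine Ideal.mem_sup_right ?_
    change b - algebraMap V B (s (e b)) - (b - algebraMap V B a) ∈ J
    rw [sub_sub_sub_cancel_left, ← map_sub]
    refine Ideal.mem_map_of_mem _ ((IsLocalRing.residue_eq_zero_iff _).mp ?_)
    rw [map_sub, hs, h, sub_self]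
  have hadd : ∀ b b', δ (b + b') = δ b + δ b' := fun b b' => by
    refine (hδ (b + b') (s (e b) + s (e b')) (by rw [map_add, map_add, hs, hs])).trans
      (Eq.trans ?_ ((mk e J).map_add _ _))
    congr 1
    refine Subtype.ext ?_
    change b + b' - algebraMap V B (s (e b) + s (e b')) =
      b - algebraMap V B (s (e b)) + (b' - algebraMap V B (s (e b')))
    rw [map_add]
    ring
  have hmul : ∀ b b', δ (b * b') = b • δ b' + b' • δ b := fun b b' => by
    rw [hδ (b * b') (s (e b) * s (e b')) (by rw [map_mul, map_mul, hs, hs]), ← map_smul, ← map_smul,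
      ← map_add, ← sub_eq_zero, ← map_sub, mk_eq_zero]
    refine Ideal.mem_sup_left ?_
    have h1 : b * b' - algebraMap V B (s (e b) * s (e b')) -
        (b * (b' - algebraMap V B (s (e b'))) + b' * (b - algebraMap V B (s (e b)))) =
        -((b - algebraMap V B (s (e b))) * (b' - algebraMap V B (s (e b')))) := by
      rw [map_mul]
      ring
    have h2 : (b - algebraMap V B (s (e b))) * (b' - algebraMap V B (s (e b'))) ∈
        RingHom.ker e ^ 2 := by
      rw [pow_two]
      exact Ideal.mul_mem_mul (hmem _ _ (hs _).symm) (hmem _ _ (hs _).symm)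
    have h3 := neg_mem h2
    rw [← h1] at h3
    exact h3
  have hV : ∀ a, δ (algebraMap V B a) = 0 := fun a => by
    rw [hδ _ a (by rw [AlgHom.commutes]; rfl), mk_eq_zero]
    change algebraMap V B a - algebraMap V B a ∈ _
    rw [sub_self]
    exact zero_mem _
  refine ⟨Derivation.mk' { toFun := δ, map_add' := hadd, map_smul' := fun a b => ?_ } hmul, ?_⟩
  · rw [Algebra.smul_def, hmul, hV, smul_zero, add_zero]
    rfl
  · intro x
    obtain ⟨b, rfl⟩ := mk_surjective e _ x
    refine ⟨b.1, (hδ b.1 0 (by rw [map_zero]; exact b.2)).trans ?_⟩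
    congr 1
    refine Subtype.ext ?_
    change b.1 - algebraMap V B 0 = b.1
    rw [map_zero, sub_zero]

lemma finrank_le_finrank_kaehler [Algebra B (IsLocalRing.ResidueField V)]
    (he : ∀ b, algebraMap B (IsLocalRing.ResidueField V) b = e b)
    [Module.Finite B (Ω[B⁄V])] :
    Module.finrank (IsLocalRing.ResidueField V) (CotangentQuotient e
      ((IsLocalRing.maximalIdeal V).map (algebraMap V B))) ≤
      Module.finrank (IsLocalRing.ResidueField V) (IsLocalRing.ResidueField V ⊗[B] Ω[B⁄V]) := by
  obtain ⟨D, hD⟩ := exists_derivation e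
  have : IsScalarTower B (IsLocalRing.ResidueField V) (CotangentQuotient e
      ((IsLocalRing.maximalIdeal V).map (algebraMap V B))) := ⟨fun b x y => by
    rw [Algebra.smul_def, mul_smul, he, smul_eq]⟩
  refine LinearMap.finrank_le_finrank_of_surjective
    (f := D.liftKaehlerDifferential.liftBaseChange (IsLocalRing.ResidueField V)) fun x => ?_
  obtain ⟨b, rfl⟩ := hD x
  refine ⟨1 ⊗ₜ KaehlerDifferential.D V B b, ?_⟩
  rw [LinearMap.liftBaseChange_tmul, one_smul, Derivation.liftKaehlerDifferential_comp_D]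

end CotangentQuotient

/-- The rank of the differentials at a field-valued point that specializes to `𝔓`. -/
lemma finrank_kaehler_eq {V B A E : Type u} [CommRing V] [CommRing B] [Algebra V B] (P : Ideal B)
    [P.IsPrime] [CommRing A] [Algebra B A] [Algebra V A] [IsScalarTower V B A]
    [IsLocalization.AtPrime A P] [Module.Free A (Ω[A⁄V])] [Field E] [Algebra B E]
    (hE : ∀ b ∉ P, algebraMap B E b ≠ 0) :
    Module.finrank E (E ⊗[B] Ω[B⁄V]) = Module.finrank A (Ω[A⁄V]) := by
  let : Algebra A E := (IsLocalization.lift (M := P.primeCompl) (g := algebraMap B E) fun b =>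
    (isUnit_iff_ne_zero.mpr (hE b.1 b.2))).toAlgebra
  have : IsScalarTower B A E := .of_algebraMap_eq' (IsLocalization.lift_comp _).symm
  have : Algebra.FormallyEtale B A := .of_isLocalization P.primeCompl
  let e := KaehlerDifferential.tensorKaehlerEquivOfFormallyEtale V B A
  have : Module.Free A (A ⊗[B] Ω[B⁄V]) := .of_equiv e.symm
  have h1 := (TensorProduct.AlgebraTensorModule.cancelBaseChange B A E E (Ω[B⁄V])).finrank_eq
  have : Nontrivial A := (algebraMap A E).domain_nontrivial
  rw [← h1, Module.finrank_baseChange, e.finrank_eq]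

namespace ProjChart

variable {V : Type u} [CommRing V] {n : ℕ} {X : Scheme.{u}}
  {i : X ⟶ projSpace n V} {r : Fin (n + 1)} (c : ProjChart i r)

/-- The differentials of a transcendence basis among the coordinates, at most `d` of them, span.
Otherwise a nonzero functional gives a derivation vanishing on the basis, and by
`exists_tangent_coeff` on all coordinates. The condition `hL` ensures that the derivation respects
every relation at the point. -/
lemma finrank_kaehler_le [IsDomain V] [ValuationRing V] [_root_.IsReduced c.B] {K L : Type u}
    [Field K] [CharZero K] [Algebra V K] [IsFractionRing V K] [Field L] [Algebra c.B L] [Algebra V L]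
    [IsScalarTower V c.B L] [Algebra K L] [IsScalarTower V K L] {d : ℕ}
    (hG : GenericFibreBound K d (vanishingForms i).toIdeal)
    (hL : ∀ b, algebraMap c.B L b = 0 → ∃ y, algebraMap c.B L y ≠ 0 ∧ y * b = 0) :
    Module.finrank L (L ⊗[c.B] Ω[c.B⁄V]) ≤ d := by
  let x : Fin (n + 1) → L := fun l => algebraMap c.B L (c.γ (MvPolynomial.X l))
  have hxγ : ∀ F, algebraMap c.B L (c.γ F) = MvPolynomial.aeval x F := fun F => by
    have h1 : (IsScalarTower.toAlgHom V c.B L).comp c.γ = MvPolynomial.aeval x := by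
      ext l; simp [x]
    exact congrArg (fun g => g F) h1
  obtain ⟨s, hs, hxs⟩ := exists_finset_algSpan (k := K) x
  have hsd : s.card ≤ d := (hG L x r (by simp [x, c.γ_X])
    (c.isZeroOf (IsScalarTower.toAlgHom V c.B L))).1 s hs
  let w : s → L ⊗[c.B] Ω[c.B⁄V] := fun l => 1 ⊗ₜ KaehlerDifferential.D V c.B
    (c.γ (MvPolynomial.X l.1))
  suffices h : Submodule.span L (Set.range w) = ⊤ by
    have h1 := finrank_range_le_card (R := L) w
    rw [Set.finrank, h, finrank_top, Fintype.card_coe] at h1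
    exact h1.trans hsd
  by_contra hne
  obtain ⟨f, hf0, hf⟩ := Submodule.exists_dual_map_eq_bot_of_lt_top (lt_top_iff_ne_top.mpr hne)
    inferInstance
  let g : Ω[c.B⁄V] →ₗ[c.B] L := f.restrictScalars c.B ∘ₗ TensorProduct.mk c.B L (Ω[c.B⁄V]) 1
  let D : Derivation V c.B L := g.compDer (KaehlerDifferential.D V c.B)
  let u : Fin (n + 1) → L := fun l => D (c.γ (MvPolynomial.X l))
  have hγ : ∀ F, MvPolynomial.aeval (fun l => c.γ (MvPolynomial.X l)) F = c.γ F := fun F => by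
    have h1 : MvPolynomial.aeval (fun l => c.γ (MvPolynomial.X l)) = c.γ := by
      ext l; simp
    rw [h1]
  have hDγ : ∀ F, D (c.γ F) = dirDeriv x u F := fun F => by
    rw [← hγ, derivation_aeval, dirDeriv_apply]
    refine Finset.sum_congr rfl fun l _ => ?_
    rw [hγ, Algebra.smul_def, hxγ]
  have hstat : ∀ F : MvPolynomial (Fin (n + 1)) V, MvPolynomial.aeval x F = 0 →
      dirDeriv x u F = 0 := fun F hF => by
    obtain ⟨y, hy, hyF⟩ := hL (c.γ F) ((hxγ F).trans hF)
    have h1 := congrArg D hyF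
    rw [Derivation.leibniz, map_zero, Algebra.smul_def, Algebra.smul_def, hxγ F, hF, zero_mul,
      add_zero, hDγ] at h1
    exact (mul_eq_zero.mp h1).resolve_left hy
  have hstatK : ∀ F : MvPolynomial (Fin (n + 1)) K, MvPolynomial.aeval x F = 0 →
      dirDeriv x u F = 0 := fun F hF => by
    by_cases hF0 : F = 0
    · rw [hF0, map_zero]
    obtain ⟨E, a, hE, hE0⟩ := exists_primitive_multiple (IsLocalRing.residue V) F hF0
    have ha : a ≠ 0 := fun h0 => by
      rw [h0, map_zero, zero_mul] at hE
      rw [MvPolynomial.map_injective _ (IsFractionRing.injective V K)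
        (hE.trans (map_zero _).symm), map_zero] at hE0
      exact hE0 rfl
    have h1 : MvPolynomial.aeval x E = 0 := by
      rw [← MvPolynomial.aeval_map_algebraMap K, hE, map_mul, hF, mul_zero]
    have h2 := hstat E h1
    rw [← dirDeriv_map (R' := K), hE, dirDeriv_mul, hF, zero_mul, add_zero,
      MvPolynomial.aeval_C] at h2
    exact (mul_eq_zero.mp h2).resolve_left ((map_ne_zero _).mpr ha)
  have hu : ∀ l, u l = 0 := fun l => by
    have h1 : Set.range (x ∘ ((↑) : s → Fin (n + 1))) = x '' s := by
      rw [Set.range_comp, Subtype.range_coe]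
    obtain ⟨a, ha⟩ := exists_tangent_coeff (K := K) x ((↑) : s → Fin (n + 1)) hs l
      (by rw [h1]; exact hxs l)
    rw [ha u hstatK]
    refine Finset.sum_eq_zero fun m _ => ?_
    have h2 : u m = 0 := by
      have h3 : f (w m) ∈ Submodule.map f (Submodule.span L (Set.range w)) :=
        ⟨_, Submodule.subset_span ⟨m, rfl⟩, rfl⟩
      rw [hf] at h3
      exact h3
    rw [h2, mul_zero]
  have hD0 : ∀ b, D b = 0 := fun b => by
    obtain ⟨F, rfl⟩ := c.surj b
    rw [hDγ, dirDeriv_apply]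
    exact Finset.sum_eq_zero fun l _ => by rw [hu, mul_zero]
  refine hf0 ?_
  have hg : g = 0 := by
    have h1 : D = 0 := Derivation.ext hD0
    have h2 := Derivation.liftKaehlerDifferential_unique g 0 (by
      refine Eq.trans h1 ?_
      ext
      rfl)
    exact h2
  refine TensorProduct.AlgebraTensorModule.curry_injective (LinearMap.ext_ring ?_)
  exact hg

end ProjChart

end

namespace ProjChart

variable {V : Type u} [CommRing V] {n : ℕ} {X : Scheme.{u}}
  {i : X ⟶ projSpace n V} {r : Fin (n + 1)} (c : ProjChart i r)

lemma exists_smooth_away {y : PrimeSpectrum c.B}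
    (h : IsSmoothAtPoint (i ≫ projSpaceStr n V) (c.j y)) :
    ∃ g ∉ y.asIdeal, Algebra.Smooth V (Localization.Away g) := by
  obtain ⟨U, hyU, hU⟩ := h
  obtain ⟨_, ⟨g, rfl⟩, hyg, hgU⟩ :=
    PrimeSpectrum.isTopologicalBasis_basic_opens.exists_subset_of_mem_open
      (show y ∈ (c.j ⁻¹ᵁ U : Set (Spec (CommRingCat.of c.B))) from hyU) (c.j ⁻¹ᵁ U).isOpen
  refine ⟨g, hyg, ?_⟩
  let a : Spec (CommRingCat.of (Localization.Away g)) ⟶ Spec (CommRingCat.of c.B) :=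
    Spec.map (CommRingCat.ofHom (algebraMap c.B (Localization.Away g)))
  have : IsOpenImmersion a := inferInstance
  have hrange : Set.range (a ≫ c.j) ⊆ Set.range U.ι := by
    rintro _ ⟨z, rfl⟩
    rw [Scheme.Opens.range_ι]
    refine hgU ?_
    have h1 : a z ∈ Set.range (PrimeSpectrum.comap (algebraMap c.B (Localization.Away g))) := ⟨z, rfl⟩
    rwa [PrimeSpectrum.localization_away_comap_range _ g] at h1
  let b := IsOpenImmersion.lift U.ι (a ≫ c.j) hrange
  have hb : b ≫ U.ι = a ≫ c.j := IsOpenImmersion.lift_fac _ _ _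
  have hbo : IsOpenImmersion b := by
    have h1 : IsOpenImmersion (b ≫ U.ι) := by rw [hb]; infer_instance
    exact IsOpenImmersion.of_comp b U.ι
  have h1 : Smooth (b ≫ U.ι ≫ i ≫ projSpaceStr n V) := inferInstance
  rw [reassoc_of% hb, c.comp_str, ← Spec.map_comp, ← CommRingCat.ofHom_comp,
    ← IsScalarTower.algebraMap_eq, HasRingHomProperty.Spec_iff (P := @Smooth.{u})] at h1
  exact RingHom.smooth_algebraMap.mp h1

/-- The maximal ideal of a regular local ring has as many generators as its dimension, which is at
most `m`; denominators are then cleared. -/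
lemma exists_generators_of_isRegularLocalRing [IsNoetherianRing c.B] {m : ℕ}
    (hdim : ringKrullDim c.B ≤ m) {y : PrimeSpectrum c.B}
    (h : IsRegularLocalRing (X.presheaf.stalk (c.j y))) :
    ∃ k ≤ m, ∃ φ : Fin k → y.asIdeal, ∀ b ∈ y.asIdeal, ∃ s ∉ y.asIdeal,
      s * b ∈ Ideal.span (Set.range fun j => (φ j).1) := by
  let A := Localization.AtPrime y.asIdeal
  let S : Type u := (Spec.structureSheaf c.B).presheaf.stalk y
  let : CommRing S := inferInstanceAs (CommRing ((Spec.structureSheaf c.B).presheaf.stalk y))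
  let : Algebra c.B S := StructureSheaf.stalkAlgebra c.B y
  have : IsLocalization.AtPrime S y.asIdeal := StructureSheaf.IsLocalization.to_stalk c.B y
  let y' : Spec (CommRingCat.of c.B) := y
  have : IsIso (c.j.stalkMap y') := inferInstance
  let e₁ : X.presheaf.stalk (c.j y') ≃+* S := (asIso (c.j.stalkMap y')).commRingCatIsoToRingEquiv
  let e₂ : S ≃+* A := (IsLocalization.algEquiv y.asIdeal.primeCompl S A).toRingEquiv
  have : IsRegularLocalRing A := .of_ringEquiv (e₁.trans e₂)
  let 𝔪 := IsLocalRing.maximalIdeal A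
  have hfg : 𝔪.FG := IsNoetherian.noetherian 𝔪
  have hk : 𝔪.spanFinrank ≤ m := by
    have h1 := IsRegularLocalRing.spanFinrank_maximalIdeal (R := A)
    rw [IsLocalization.AtPrime.ringKrullDim_eq_height y.asIdeal A] at h1
    have h2 := (h1.le.trans (Ideal.height_le_ringKrullDim_of_ne_top Ideal.IsPrime.ne_top')).trans hdim
    exact_mod_cast h2
  have hfin := Submodule.FG.finite_generators hfg
  have : Finite 𝔪.generators := hfin
  let ε : Fin 𝔪.spanFinrank ≃ 𝔪.generators := (Finite.equivFinOfCardEq (Submodule.FG.generators_ncard hfg)).symm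
  have hmem : ∀ j, (ε j).1 ∈ 𝔪 := fun j => by
    exact 𝔪.span_generators.le (Submodule.subset_span (ε j).2)
  have h2 : ∀ j, ∃ b : y.asIdeal, ∃ s : A, (ε j).1 = s * algebraMap c.B A b := fun j => by
    obtain ⟨⟨b, t⟩, hbt⟩ := IsLocalization.surj y.asIdeal.primeCompl (ε j).1
    have hb : b ∈ y.asIdeal := by
      rw [← IsLocalization.AtPrime.to_map_mem_maximal_iff A y.asIdeal, ← hbt]
      exact Ideal.mul_mem_right _ _ (hmem j)
    obtain ⟨u, hu⟩ := IsLocalization.map_units A t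
    refine ⟨⟨b, hb⟩, ↑u⁻¹, ?_⟩
    rw [← hbt, ← hu, mul_comm, mul_assoc, Units.mul_inv, mul_one]
  choose φ s hφ using h2
  refine ⟨_, hk, φ, fun b hb => ?_⟩
  have h3 : 𝔪 ≤ (Ideal.span (Set.range fun j => (φ j).1)).map (algebraMap c.B A) := by
    refine 𝔪.span_generators.ge.trans (Submodule.span_le.mpr fun x hx => ?_)
    obtain ⟨j, hj⟩ := ε.surjective ⟨x, hx⟩
    have h4 : x = (ε j).1 := by rw [hj]
    rw [h4, hφ]
    exact Ideal.mul_mem_left _ _ (Ideal.mem_map_of_mem _ (Ideal.subset_span ⟨j, rfl⟩))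
  obtain ⟨s, hs, hsb⟩ := (IsLocalization.algebraMap_mem_map_algebraMap_iff y.asIdeal.primeCompl A
    _ b).mp (h3 ((IsLocalization.AtPrime.to_map_mem_maximal_iff A y.asIdeal b).mpr hb))
  exact ⟨s, hs, hsb⟩

variable [IsDomain V] [IsDiscreteValuationRing V] {K : Type u}
    [Field K] [CharZero K] [Algebra V K] [IsFractionRing V K]
    (e : c.B →ₐ[V] IsLocalRing.ResidueField V)

/-- Smoothness makes the differentials of the local ring free, so their rank at the point equals the
rank at the generic point of a component through it. There characteristic zero and
`GenericFibreBound` give at most `d`. -/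
lemma finrank_cotangentQuotient_le_of_isSmoothAtPoint {d : ℕ} [_root_.IsReduced c.B]
    (hflat : Flat (i ≫ projSpaceStr n V))
    (hG : GenericFibreBound K d (vanishingForms i).toIdeal) {y : PrimeSpectrum c.B}
    (he : RingHom.ker e = y.asIdeal)
    (h : IsSmoothAtPoint (i ≫ projSpaceStr n V) (c.j y)) :
    Module.finrank (IsLocalRing.ResidueField V) (CotangentQuotient e
      ((IsLocalRing.maximalIdeal V).map (algebraMap V c.B))) ≤ d := by
  obtain ⟨g, hg, hs⟩ := c.exists_smooth_away h
  have := c.flat hflat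
  have := c.finiteType
  have hle : Submonoid.powers g ≤ y.asIdeal.primeCompl := Submonoid.powers_le.mpr hg
  let A := Localization.AtPrime y.asIdeal
  let := IsLocalization.localizationAlgebraOfSubmonoidLe (Localization.Away g) A
    (Submonoid.powers g) y.asIdeal.primeCompl hle
  have := IsLocalization.localization_isScalarTower_of_submonoid_le (Localization.Away g) A
    (Submonoid.powers g) y.asIdeal.primeCompl hle
  have := IsLocalization.isLocalization_of_submonoid_le (Localization.Away g) A
    (Submonoid.powers g) y.asIdeal.primeCompl hle
  have : IsScalarTower V (Localization.Away g) A := .to₁₃₄ V c.B (Localization.Away g) A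
  have h1 : Algebra.FormallySmooth (Localization.Away g) A :=
    .of_isLocalization (y.asIdeal.primeCompl.map (algebraMap c.B (Localization.Away g)))
  have h2 : Algebra.FormallySmooth V A := .comp V (Localization.Away g) A
  have h3 : Algebra.EssFiniteType c.B A := .of_isLocalization _ y.asIdeal.primeCompl
  have h4 : Algebra.EssFiniteType V A := .comp V c.B A
  have h5 : Module.Free A (Ω[A⁄V]) := Module.free_of_flat_of_isLocalRing
  let : Algebra c.B (IsLocalRing.ResidueField V) := e.toRingHom.toAlgebra
  refine (CotangentQuotient.finrank_le_finrank_kaehler e fun _ => rfl).trans ?_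
  rw [finrank_kaehler_eq (A := A) y.asIdeal fun b hb hb0 => hb (by rw [← he]; exact hb0)]
  obtain ⟨q, hq, hqy⟩ := Ideal.exists_minimalPrimes_le (bot_le : ⊥ ≤ y.asIdeal)
  have hqp : q.IsPrime := Ideal.IsMinimalPrime.isPrime hq
  let L := FractionRing (c.B ⧸ q)
  have hker : ∀ b, algebraMap c.B L b = 0 ↔ b ∈ q := fun b => by
    rw [IsScalarTower.algebraMap_apply c.B (c.B ⧸ q) L,
      (IsFractionRing.injective (c.B ⧸ q) L).eq_iff' (map_zero _)]
    exact Ideal.Quotient.eq_zero_iff_mem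
  -- Flatness makes nonzero elements of `V` nonzerodivisors, which lie in no minimal prime. So the
  -- component dominates `Spec V` and `L` contains `K`.
  have hVL : Function.Injective (algebraMap V L) := by
    rw [injective_iff_map_eq_zero]
    intro a ha
    rw [IsScalarTower.algebraMap_apply V c.B L, hker] at ha
    by_contra ha0
    have h6 : algebraMap V c.B a ∈ nonZeroDivisors c.B := by
      rw [mem_nonZeroDivisors_iff_right]
      intro z hz
      refine (Module.Flat.isSMulRegular_of_nonZeroDivisors (M := c.B)
        (mem_nonZeroDivisors_of_ne_zero ha0)) ?_
      change a • z = a • 0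
      rw [Algebra.smul_def, mul_comm, hz, smul_zero]
    exact Set.disjoint_left.mp (Ideal.disjoint_nonZeroDivisors_of_mem_minimalPrimes hq) ha h6
  let : Algebra K L := (IsFractionRing.lift hVL).toAlgebra
  have : IsScalarTower V K L := .of_algebraMap_eq fun a => (IsFractionRing.lift_algebraMap hVL a).symm
  rw [← finrank_kaehler_eq (A := A) (E := L) y.asIdeal fun b hb hb0 => hb (hqy ((hker b).mp hb0))]
  refine c.finrank_kaehler_le (K := K) hG fun b hb => ?_
  obtain ⟨z, hz, hzb⟩ := exists_notMem_mul_eq_zero_of_mem_minimalPrimes hq ((hker b).mp hb)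
  exact ⟨z, fun hz0 => hz ((hker z).mp hz0), hzb⟩

/-- `𝔓` has at most `d + 1` local generators. If `π ∉ 𝔓²`, dividing by `π` lowers the dimension of
`𝔓/𝔓²` by one; if `π ∈ 𝔓²`, the special fibre has the same cotangent space as `X`. -/
lemma finrank_cotangentQuotient_le_of_isRegularLocalRing {d : ℕ} [IsNoetherianRing c.B]
    (hdim : ringKrullDim c.B ≤ (d + 1 : ℕ)) {y : PrimeSpectrum c.B}
    (he : RingHom.ker e = y.asIdeal)
    (h : IsRegularLocalRing (X.presheaf.stalk (c.j y))) :
    Module.finrank (IsLocalRing.ResidueField V) (CotangentQuotient e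
      ((IsLocalRing.maximalIdeal V).map (algebraMap V c.B))) ≤ d ∨
    Module.finrank (IsLocalRing.ResidueField V) (CotangentQuotient e
      ((IsLocalRing.maximalIdeal V).map (algebraMap V c.B))) ≤ d + 1 ∧
      (IsLocalRing.maximalIdeal V).map (algebraMap V c.B) ≤ RingHom.ker e ^ 2 := by
  obtain ⟨k, hk, φ, hφ⟩ : ∃ k ≤ d + 1, ∃ φ : Fin k → RingHom.ker e, ∀ b ∈ RingHom.ker e,
      ∃ s ∉ RingHom.ker e, s * b ∈ Ideal.span (Set.range fun j => (φ j).1) := by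
    rw [he]
    exact c.exists_generators_of_isRegularLocalRing hdim h
  obtain ⟨π, hπ⟩ := IsDiscreteValuationRing.exists_irreducible V
  have hJ : (IsLocalRing.maximalIdeal V).map (algebraMap V c.B) =
      Ideal.span {algebraMap V c.B π} := by
    rw [hπ.maximalIdeal_eq, Ideal.map_span, Set.image_singleton]
  rw [hJ]
  have h1 := fun J => CotangentQuotient.finrank_le e J φ hφ
  by_cases hπ2 : algebraMap V c.B π ∈ RingHom.ker e ^ 2
  · exact Or.inr ⟨(h1 _).trans hk, (Ideal.span_singleton_le_iff_mem _).mpr hπ2⟩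
  · left
    have h2 := CotangentQuotient.finrank_succ_le e ⟨algebraMap V c.B π,
      CotangentQuotient.algebraMap_mem e ((IsLocalRing.mem_maximalIdeal _).mpr hπ.not_isUnit)⟩ hπ2
    have h3 := h1 ⊥
    lia

end ProjChart

/-! ### Independent functions on chains of primes -/

section ResidueIndependent

variable {V B : Type*} [CommRing V] [CommRing B] [Algebra V B]

/-- The family `y` is algebraically independent modulo the prime `P`, over the image of `V`. -/
def ResidueIndependent (V : Type*) [CommRing V] [Algebra V B] (P : Ideal B) {ι : Type*}
    (y : ι → B) : Prop :=
  ∀ h : MvPolynomial ι V, MvPolynomial.aeval y h ∈ P → ∀ m, algebraMap V B (h.coeff m) ∈ P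

lemma residueIndependent_of_isEmpty (P : Ideal B) {ι : Type*} [IsEmpty ι] (y : ι → B) :
    ResidueIndependent V P y := fun h hh m => by
  rw [MvPolynomial.eq_C_of_isEmpty h] at hh ⊢
  rw [MvPolynomial.aeval_C] at hh
  rw [MvPolynomial.coeff_C]
  split_ifs
  · exact hh
  · rw [map_zero]
    exact zero_mem _

/-- Expand a relation in powers of `z`. Modulo `P'` only the constant coefficient survives, so its
coefficients lie in `P'`, hence in `P` by `hV`. The rest is divisible by `z ∉ P`, and the argument
repeats with the quotient. -/
lemma ResidueIndependent.option {P P' : Ideal B} [P.IsPrime] (hP : P ≤ P') {z : B}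
    (hz : z ∈ P') (hzP : z ∉ P) (hV : ∀ a, algebraMap V B a ∈ P' → algebraMap V B a ∈ P)
    {ι : Type*} {y : ι → B} (hy : ResidueIndependent V P' y) :
    ResidueIndependent V P (fun o : Option ι => o.elim z y) := by
  have key : ∀ (k : ℕ) (H : Polynomial (MvPolynomial ι V)),
      Polynomial.eval₂ (MvPolynomial.aeval y).toRingHom z H ∈ P →
      ∀ m, algebraMap V B ((H.coeff k).coeff m) ∈ P := by
    have h0 : ∀ H : Polynomial (MvPolynomial ι V),
        Polynomial.eval₂ (MvPolynomial.aeval y).toRingHom z H ∈ P →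
        (∀ m, algebraMap V B ((H.coeff 0).coeff m) ∈ P) ∧
          Polynomial.eval₂ (MvPolynomial.aeval y).toRingHom z H.divX ∈ P := fun H hH => by
      have h1 : Polynomial.eval₂ (MvPolynomial.aeval y).toRingHom z H =
          Polynomial.eval₂ (MvPolynomial.aeval y).toRingHom z H.divX * z +
            MvPolynomial.aeval y (H.coeff 0) := by
        conv_lhs => rw [← Polynomial.divX_mul_X_add H]
        rw [Polynomial.eval₂_add, Polynomial.eval₂_mul, Polynomial.eval₂_X, Polynomial.eval₂_C]
        rfl
      rw [h1] at hH
      have h2 : MvPolynomial.aeval y (H.coeff 0) ∈ P' :=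
        (Ideal.add_mem_iff_right _ (Ideal.mul_mem_left _ _ hz)).mp (hP hH)
      have h3 : ∀ m, algebraMap V B ((H.coeff 0).coeff m) ∈ P := fun m => hV _ (hy _ h2 m)
      refine ⟨h3, ?_⟩
      have h4 : MvPolynomial.aeval y (H.coeff 0) ∈ P := by
        rw [MvPolynomial.aeval_def, MvPolynomial.eval₂_eq]
        exact sum_mem fun m _ => Ideal.mul_mem_right _ _ (h3 m)
      exact ((‹P.IsPrime›.mem_or_mem ((Ideal.add_mem_iff_left _ h4).mp hH)).resolve_right hzP)
    intro k
    induction k with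
    | zero => exact fun H hH => (h0 H hH).1
    | succ k ih =>
      intro H hH m
      rw [← Polynomial.coeff_divX]
      exact ih _ (h0 H hH).2 m
  intro h hh m
  rw [← MvPolynomial.optionEquivLeft_coeff_some_coeff_none]
  refine key _ _ ?_ _
  have h1 : MvPolynomial.aeval (fun o : Option ι => o.elim z y) h =
      Polynomial.eval₂ (MvPolynomial.aeval y).toRingHom z (MvPolynomial.optionEquivLeft V ι h) := by
    let g : Polynomial (MvPolynomial ι V) →ₐ[V] B :=
      { Polynomial.eval₂RingHom (MvPolynomial.aeval y).toRingHom z with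
        commutes' := fun a => by
          change Polynomial.eval₂ _ _ (Polynomial.C (MvPolynomial.C a)) = _
          rw [Polynomial.eval₂_C]
          exact MvPolynomial.aeval_C _ _ }
    have h2 : MvPolynomial.aeval (fun o : Option ι => o.elim z y) =
        g.comp (MvPolynomial.optionEquivLeft V ι).toAlgHom := by
      refine MvPolynomial.algHom_ext fun o => ?_
      cases o with
      | none =>
        rw [MvPolynomial.aeval_X]
        change z = Polynomial.eval₂ _ _ (MvPolynomial.optionEquivLeft V ι _)
        rw [MvPolynomial.optionEquivLeft_X_none, Polynomial.eval₂_X]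
      | some j =>
        rw [MvPolynomial.aeval_X]
        change y j = Polynomial.eval₂ _ _ (MvPolynomial.optionEquivLeft V ι _)
        rw [MvPolynomial.optionEquivLeft_X_some, Polynomial.eval₂_C]
        exact (MvPolynomial.aeval_X _ _).symm
    rw [h2]
    rfl
  rwa [← h1]

variable [IsDomain V] [IsDiscreteValuationRing V] {π : V}

lemma mem_of_algebraMap_mem {P : Ideal B} [P.IsPrime] {a : V} (ha0 : a ≠ 0)
    (ha : algebraMap V B a ∈ P) (hπ : Irreducible π) : algebraMap V B π ∈ P := by
  obtain ⟨m, u, rfl⟩ := IsDiscreteValuationRing.eq_unit_mul_pow_irreducible ha0 hπ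
  rw [map_mul, map_pow] at ha
  refine ‹P.IsPrime›.mem_of_pow_mem m ((‹P.IsPrime›.mem_or_mem ha).resolve_left fun h => ?_)
  exact ‹P.IsPrime›.ne_top (Ideal.eq_top_of_isUnit_mem _ h (u.isUnit.map _))

lemma algebraMap_mem_of_irreducible_mem {P P' : Ideal B} [P'.IsPrime] (hπ : Irreducible π)
    (hP : algebraMap V B π ∈ P) {a : V} (ha : algebraMap V B a ∈ P') : algebraMap V B a ∈ P := by
  have h1 : a ∈ IsLocalRing.maximalIdeal V := by
    rw [IsLocalRing.mem_maximalIdeal]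
    intro hu
    exact ‹P'.IsPrime›.ne_top (Ideal.eq_top_of_isUnit_mem _ ha (hu.map _))
  rw [hπ.maximalIdeal_eq, Ideal.mem_span_singleton] at h1
  obtain ⟨b, rfl⟩ := h1
  rw [map_mul]
  exact Ideal.mul_mem_right _ _ hP

/-- A nonzero relation modulo `P` has a primitive multiple, which is still a relation modulo `P`
since nonzero elements of `V` are outside `P`. It is then a relation modulo `P'` with a unit
coefficient, which is impossible. -/
lemma ResidueIndependent.generalize {P P' : Ideal B} [P.IsPrime] [P'.IsPrime] (hP : P ≤ P')
    (hπ : Irreducible π) (hπP : algebraMap V B π ∉ P)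
    {ι : Type*} {y : ι → B} (hy : ResidueIndependent V P' y) : ResidueIndependent V P y := by
  intro h hh m
  by_cases h0 : h = 0
  · rw [h0, MvPolynomial.coeff_zero, map_zero]
    exact zero_mem _
  exfalso
  let K := FractionRing V
  have hinj := IsFractionRing.injective V K
  obtain ⟨E, c, hE, hE0⟩ := exists_primitive_multiple (K := K) (IsLocalRing.residue V)
    (MvPolynomial.map (algebraMap V K) h)
    (fun h1 => h0 (MvPolynomial.map_injective _ hinj (h1.trans (map_zero _).symm)))
  obtain ⟨a, b, hb, rfl⟩ := IsFractionRing.div_surjective (A := V) c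
  have hb0 : b ≠ 0 := nonZeroDivisors.ne_zero hb
  have h1 : MvPolynomial.C b * E = MvPolynomial.C a * h := by
    refine MvPolynomial.map_injective _ hinj ?_
    rw [map_mul, map_mul, hE, MvPolynomial.map_C, MvPolynomial.map_C, ← mul_assoc, ← map_mul,
      mul_div_cancel₀ _ (fun h2 => hb0 (hinj (h2.trans (map_zero _).symm)))]
  have h2 := congrArg (MvPolynomial.aeval y) h1
  rw [map_mul, map_mul, MvPolynomial.aeval_C, MvPolynomial.aeval_C] at h2
  have h3 : MvPolynomial.aeval y E ∈ P := by
    refine (‹P.IsPrime›.mem_or_mem (h2 ▸ Ideal.mul_mem_left _ _ hh)).resolve_left fun h4 => ?_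
    exact hπP (mem_of_algebraMap_mem hb0 h4 hπ)
  refine hE0 (MvPolynomial.ext _ _ fun m => ?_)
  rw [MvPolynomial.coeff_map, MvPolynomial.coeff_zero, IsLocalRing.residue_eq_zero_iff,
    IsLocalRing.mem_maximalIdeal]
  intro hu
  exact ‹P'.IsPrime›.ne_top (Ideal.eq_top_of_isUnit_mem _ (hy E (hP h3) m) (hu.map _))

/-- Going down the chain, each step contributes an element of `P'` outside `P`, provided both primes
meet `V` in the same ideal. The only possible exception is the single step at which `π` leaves the
prime, hence the loss of at most one. -/
lemma exists_residueIndependent_of_strictMono (hπ : Irreducible π) (m : ℕ)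
    (f : Fin (m + 1) → PrimeSpectrum B) (hf : StrictMono f) :
    ∃ (ι : Type) (_ : Fintype ι) (y : ι → B), ResidueIndependent V (f 0).asIdeal y ∧
      (m ≤ Fintype.card ι ∨
        algebraMap V B π ∉ (f 0).asIdeal ∧ m ≤ Fintype.card ι + 1) := by
  induction m with
  | zero => exact ⟨Empty, inferInstance, Empty.elim, residueIndependent_of_isEmpty _ _, Or.inl
      (Nat.zero_le _)⟩
  | succ m ih =>
    obtain ⟨ι, _, y, hy, hm⟩ := ih (f ∘ Fin.succ) (hf.comp (Fin.strictMono_succ))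
    have hlt : f 0 < (f ∘ Fin.succ) 0 := hf (Fin.succ_pos 0)
    set P := (f 0).asIdeal
    set P' := ((f ∘ Fin.succ) 0).asIdeal
    have hP : P ≤ P' := hlt.le
    obtain ⟨z, hz, hzP⟩ : ∃ z ∈ P', z ∉ P := Set.not_subset.mp fun h => hlt.not_ge h
    have hP' : P'.IsPrime := ((f ∘ Fin.succ) 0).isPrime
    have hPp : P.IsPrime := (f 0).isPrime
    by_cases hπP : algebraMap V B π ∈ P
    · refine ⟨Option ι, inferInstance, _, hy.option hP hz hzP fun a ha =>
        algebraMap_mem_of_irreducible_mem hπ hπP ha, Or.inl ?_⟩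
      have h1 := hm.resolve_right fun h => h.1 (hP hπP)
      simpa using h1
    by_cases hπP' : algebraMap V B π ∈ P'
    · refine ⟨ι, inferInstance, y, hy.generalize hP hπ hπP, Or.inr ⟨hπP, ?_⟩⟩
      have h1 := hm.resolve_right fun h => h.1 hπP'
      simpa using h1
    · refine ⟨Option ι, inferInstance, _, hy.option hP hz hzP fun a ha => ?_, Or.inr ⟨hπP, ?_⟩⟩
      · by_cases ha0 : a = 0
        · rw [ha0, map_zero]
          exact zero_mem _
        · exact (hπP' (mem_of_algebraMap_mem ha0 ha hπ)).elim
      · rw [Fintype.card_option]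
        rcases hm with h | h
        · lia
        · have := h.2
          lia

/-- If the lowest prime contains `π`, no element was lost on the chain, and by flatness a minimal
prime below it avoids `π`. Otherwise at most one of the `d + 1` was lost. -/
lemma exists_residueIndependent {V : Type*} [CommRing V] [Algebra V B] [Module.Flat V B] [IsDomain V]
    [IsDiscreteValuationRing V]
    {π : V} (hπ : Irreducible π) {d : ℕ} (hdim : ((d + 1 : ℕ) : WithBot ℕ∞) ≤ ringKrullDim B) :
    ∃ (q : Ideal B) (_ : q.IsPrime) (ι : Type) (_ : Fintype ι) (y : ι → B),
      algebraMap V B π ∉ q ∧ ResidueIndependent V q y ∧ d ≤ Fintype.card ι := by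
  obtain ⟨l, hl⟩ := Order.le_krullDim_iff.mp hdim
  obtain ⟨m, f, hf⟩ : ∃ (m : ℕ) (f : Fin (m + 1) → PrimeSpectrum B), StrictMono f ∧ m = d + 1 :=
    ⟨l.length, l.toFun, l.strictMono, hl⟩
  obtain ⟨hf, rfl⟩ := hf
  obtain ⟨ι, _, y, hy, hm⟩ := exists_residueIndependent_of_strictMono hπ _ f hf
  have hp : (f 0).asIdeal.IsPrime := (f 0).isPrime
  by_cases hπ0 : algebraMap V B π ∈ (f 0).asIdeal
  · obtain ⟨q, hq, hqf⟩ := Ideal.exists_minimalPrimes_le (bot_le : ⊥ ≤ (f 0).asIdeal)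
    have hqp : q.IsPrime := Ideal.IsMinimalPrime.isPrime hq
    have hπq : algebraMap V B π ∉ q := fun h => by
      refine Set.disjoint_left.mp (Ideal.disjoint_nonZeroDivisors_of_mem_minimalPrimes hq) h ?_
      rw [SetLike.mem_coe, mem_nonZeroDivisors_iff_right]
      intro z hz
      refine (Module.Flat.isSMulRegular_of_nonZeroDivisors (M := B)
        (mem_nonZeroDivisors_of_ne_zero hπ.ne_zero)) ?_
      change π • z = π • 0
      rw [Algebra.smul_def, mul_comm, hz, smul_zero]
    have := hm.resolve_right fun h => h.1 hπ0
    exact ⟨q, hqp, ι, inferInstance, y, hπq, hy.generalize hqf hπ hπq, by lia⟩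
  · refine ⟨_, hp, ι, inferInstance, y, hπ0, hy, ?_⟩
    rcases hm with h | h
    · lia
    · have := h.2
      lia

end ResidueIndependent

/-! ### Existence of points on intersections with quadrics -/

section ProjectiveZeros

variable {V K F : Type u} [CommRing V] [Field K] [Field F] [Algebra K F]
  [Algebra.IsAlgebraic K F] [Algebra V F] {n d : ℕ}
  {I : HomogeneousIdeal (MvPolynomial.homogeneousSubmodule (Fin (n + 1)) V)}

/-- Some place is finite on the values `f_j(z)` but infinite at `z l`. After division by the
coordinate `z m` of largest value, the forms take the values `z_m⁻² f_j(z)`, which lie in the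
maximal ideal. The reduction of the normalized vector is the desired zero. -/
lemma exists_zero_of_notMem_algSpan {Ω : Type u} [Field Ω] [Algebra K Ω]
    [Algebra F Ω] [IsScalarTower K F Ω] [Algebra V Ω] [IsScalarTower V F Ω]
    {f : Fin d → MvPolynomial (Fin (n + 1)) F}
    (hf : ∀ j, (f j).IsHomogeneous 2) {z : Fin (n + 1) → Ω} (hz : IsZeroOf I.toIdeal z)
    {l : Fin (n + 1)}
    (hl : z l ∉ algSpan K (Set.range fun j => MvPolynomial.aeval z (f j))) :
    ∃ (κ : Type u) (_ : Field κ) (_ : Algebra F κ) (_ : Algebra V κ) (_ : IsScalarTower V F κ)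
      (x : Fin (n + 1) → κ) (r : Fin (n + 1)), x r = 1 ∧ IsZeroOf I.toIdeal x ∧
        ∀ j, MvPolynomial.aeval x (f j) = 0 := by
  let E := algSpan K (Set.range fun j => MvPolynomial.aeval z (f j))
  have hE : IsIntegrallyClosedIn E.toSubring Ω := by
    rw [Subring.isIntegrallyClosedIn_iff]
    intro a ha
    have h1 : IsIntegral (algebraicClosure (IntermediateField.adjoin K
        (Set.range fun j => MvPolynomial.aeval z (f j))) Ω) a := ha
    exact mem_algSpan.mpr (isAlgebraic_iff_isIntegral.mpr (isIntegral_trans _ h1))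
  -- `E` is algebraically closed in `Ω`, hence integrally closed in it, so an element outside `E` is
  -- avoided by some valuation ring containing `E`. This `O` contains `F`, which is algebraic over
  -- `K`.
  obtain ⟨O, hEO, hlO⟩ := Subring.exists_le_valuationSubring_of_isIntegrallyClosedIn
    (R := E.toSubring) (x := z l) hl
  have hF : ∀ a : F, algebraMap F Ω a ∈ O := fun a => hEO (by
    change algebraMap F Ω a ∈ E
    refine mem_algSpan.mpr ?_
    have h1 : IsAlgebraic K (algebraMap F Ω a) := (Algebra.IsAlgebraic.isAlgebraic a).algebraMap
    exact h1.tower_top _)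
  have hwO : ∀ j, MvPolynomial.aeval z (f j) ∈ O := fun j => hEO (subset_algSpan _ ⟨j, rfl⟩)
  let : Algebra F O := ((algebraMap F Ω).codRestrict O.toSubring hF).toAlgebra
  have : IsScalarTower F O Ω := .of_algebraMap_eq fun _ => rfl
  let : Algebra V O := ((algebraMap F O).comp (algebraMap V F)).toAlgebra
  have : IsScalarTower V F O := .of_algebraMap_eq fun _ => rfl
  have : IsScalarTower V O Ω := .of_algebraMap_eq fun a => IsScalarTower.algebraMap_apply V F Ω a
  let κ := IsLocalRing.ResidueField O
  have : IsScalarTower V F κ := .of_algebraMap_eq fun a => rfl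
  have hinj := IsFractionRing.injective O Ω
  obtain ⟨m, hm0, hm⟩ := ValuationRing.exists_forall_div_mem (A := O) z
    ⟨l, fun h => hlO (by rw [h]; exact zero_mem O)⟩
  choose x hx using hm
  have hmO : z m ∉ O := fun h => hlO (by
    have h1 := O.mul_mem _ _ (x l).2 h
    have h2 : ((x l : O) : Ω) = z l / z m := hx l
    rwa [h2, div_mul_cancel₀ _ hm0] at h1)
  have hbO : (z m)⁻¹ ∈ O := (O.mem_or_inv_mem _).resolve_left hmO
  let b : O := ⟨_, hbO⟩
  have hb : IsLocalRing.residue O b = 0 := by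
    rw [IsLocalRing.residue_eq_zero_iff, IsLocalRing.mem_maximalIdeal]
    rintro hu
    obtain ⟨c, hc⟩ := hu.exists_right_inv
    have h1 : (z m)⁻¹ * (c : Ω) = 1 := congrArg (algebraMap O Ω) hc
    have h2 : (c : Ω) = z m := by
      rw [inv_mul_eq_iff_eq_mul₀ hm0, mul_one] at h1
      exact h1
    exact hmO (h2 ▸ c.2)
  have hx' : (fun l => algebraMap O Ω (x l)) = fun l => (z m)⁻¹ * z l := funext fun l => by
    rw [hx, div_eq_inv_mul]
  refine ⟨κ, inferInstance, inferInstance, inferInstance, inferInstance,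
    fun l => algebraMap O κ (x l), m, ?_, fun G hG => ?_, fun j => ?_⟩
  · have h1 : x m = 1 := hinj (by rw [hx, div_self hm0, map_one])
    change algebraMap O κ (x m) = 1
    rw [h1, map_one]
  · have h1 : MvPolynomial.aeval x G = 0 := by
      refine hinj ?_
      rw [← MvPolynomial.aeval_algebraMap_apply, map_zero]
      change MvPolynomial.aeval (fun l => algebraMap O Ω (x l)) G = 0
      rw [hx']
      exact hz.rescale _ G hG
    have h2 := MvPolynomial.aeval_algebraMap_apply κ x G
    rw [h1, map_zero] at h2
    exact h2
  · have h1 : MvPolynomial.aeval x (f j) = b ^ 2 * ⟨_, hwO j⟩ := by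
      refine hinj ?_
      rw [← MvPolynomial.aeval_algebraMap_apply]
      change MvPolynomial.aeval (fun l => algebraMap O Ω (x l)) (f j) = _
      rw [hx', aeval_mul_left_of_isHomogeneous (hf j)]
      rfl
    have h2 := MvPolynomial.aeval_algebraMap_apply κ x (f j)
    rw [h1, map_mul, map_pow] at h2
    rw [show algebraMap O κ b = 0 from hb, zero_pow two_ne_zero, zero_mul] at h2
    exact h2

lemma algebraicIndependent_option_X {Ω : Type u} [Field Ω] [Algebra K Ω] {ι : Type*} {y : ι → Ω}
    (hy : AlgebraicIndependent K y) :
    AlgebraicIndependent K fun o : Option ι => algebraMap (Polynomial Ω)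
      (FractionRing (Polynomial Ω)) (o.elim Polynomial.X fun j => Polynomial.C (y j)) := by
  have h1 : AlgebraicIndependent K fun o : Option ι =>
      (o.elim Polynomial.X fun j => Polynomial.C (y j) : Polynomial Ω) := by
    rw [algebraicIndependent_iff]
    intro h hh
    have h2 : MvPolynomial.aeval (fun o : Option ι =>
        (o.elim Polynomial.X fun j => Polynomial.C (y j) : Polynomial Ω)) =
        (Polynomial.mapAlgHom (MvPolynomial.aeval (R := K) y)).comp
          (MvPolynomial.optionEquivLeft K ι).toAlgHom := by
      refine MvPolynomial.algHom_ext fun o => ?_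
      rw [MvPolynomial.aeval_X]
      change _ = Polynomial.mapAlgHom _ (MvPolynomial.optionEquivLeft K ι _)
      cases o with
      | none => simp
      | some j => simp
    rw [h2] at hh
    have h3 : MvPolynomial.optionEquivLeft K ι h = 0 := by
      refine Polynomial.map_injective (MvPolynomial.aeval (R := K) y).toRingHom hy ?_
      rw [Polynomial.map_zero]
      exact hh
    exact (map_eq_zero_iff _ (MvPolynomial.optionEquivLeft K ι).injective).mp h3
  exact h1.map' (f := IsScalarTower.toAlgHom K (Polynomial Ω) (FractionRing (Polynomial Ω)))
    (IsFractionRing.injective _ _)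

/-- The vectors `X · x` run through the cone over `x`. If all its coordinates were algebraic over
the `d` elements `w`, so would be `X` (as `x r = 1`) and the `y j`, which together are at least `d +
1` independent elements. -/
lemma exists_notMem_algSpan {Ω Λ : Type u} [Field Ω] [Algebra K Ω] [Field Λ] [Algebra K Λ]
    {ι : Type} [Fintype ι] {y : ι → Ω} (g : Ω →ₐ[K] Λ) {X : Λ}
    (hy : AlgebraicIndependent K fun o : Option ι => o.elim X fun j => g (y j))
    (hd : d ≤ Fintype.card ι) {x : Fin (n + 1) → Ω}
    {r : Fin (n + 1)} (hr : x r = 1) (hyx : ∀ j, y j ∈ Algebra.adjoin K (Set.range x))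
    (w : Fin d → Λ) : ∃ l, g (x l) * X ∉ algSpan K (Set.range w) := by
  by_contra! h
  have hX : X ∈ algSpan K (Set.range w) := by
    have h1 := h r
    rwa [hr, map_one, one_mul] at h1
  have hX0 : X ≠ 0 := hy.ne_zero none
  have hx : ∀ l, g (x l) ∈ algSpan K (Set.range w) := fun l => by
    have h2 := div_mem (h l) hX
    rwa [mul_div_cancel_right₀ _ hX0] at h2
  have hg : ∀ a ∈ Algebra.adjoin K (Set.range x), g a ∈ algSpan K (Set.range w) := by
    have h1 : Algebra.adjoin K (Set.range x) ≤ (algSpan K (Set.range w)).toSubalgebra.comap g := by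
      rw [Algebra.adjoin_le_iff]
      rintro _ ⟨l, rfl⟩
      exact hx l
    exact h1
  have h1 := algebraicIndependent_of_card_le hy
    -- `w` is padded by one zero, so that a bound on the size of an independent family becomes a
    -- contradiction with `ne_zero`.
    (fun o : Option (Fin d) => o.elim 0 w) (fun o => ?_) (by simpa using hd)
  · exact h1.ne_zero none rfl
  · have h2 : algSpan K (Set.range w) ≤ algSpan K (Set.range fun o : Option (Fin d) => o.elim 0 w) :=
      algSpan_mono (by rintro _ ⟨j, rfl⟩; exact ⟨some j, rfl⟩)
    refine h2 ?_
    cases o with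
    | none => exact hX
    | some j => exact hg _ (hyx j)

lemma ResidueIndependent.algebraicIndependent [IsDomain V] [Algebra V K] [IsFractionRing V K]
    {B Ω : Type*}
    [CommRing B] [Algebra V B] {q : Ideal B} [Field Ω] [Algebra V Ω] [Algebra K Ω]
    [IsScalarTower V K Ω] (g : B →ₐ[V] Ω) (hg : RingHom.ker g = q) {ι : Type*} {y : ι → B}
    (hy : ResidueIndependent V q y) : AlgebraicIndependent K fun j => g (y j) := by
  have h1 : AlgebraicIndependent V fun j => g (y j) := by
    rw [algebraicIndependent_iff]
    intro h hh
    have h2 : MvPolynomial.aeval y h ∈ q := by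
      rw [← hg, RingHom.mem_ker]
      exact (MvPolynomial.comp_aeval_apply y g h).trans hh
    ext m
    have h3 := hy h h2 m
    rw [← hg, RingHom.mem_ker, AlgHom.commutes] at h3
    have h4 : Function.Injective (algebraMap V Ω) := by
      rw [IsScalarTower.algebraMap_eq V K Ω]
      exact (algebraMap K Ω).injective.comp (IsFractionRing.injective V K)
    exact h4 (h3.trans (map_zero _).symm)
  have := IsLocalization.isAlgebraic K (nonZeroDivisors V)
  exact h1.extendScalars K

/-- A chain of `d + 1` steps yields a point of the generic fibre with `d` independent functions.
Over the cone, with one more free variable `X`, the `d` forms cannot control all coordinates, and a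
place at infinity supplies the zero. -/
lemma exists_projective_zero [IsDomain V] [IsDiscreteValuationRing V] [Algebra V K]
    [IsFractionRing V K] [IsScalarTower V K F] {B : Type u} [CommRing B] [Algebra V B]
    [Module.Flat V B] (hdim : (d + 1 : ℕ) ≤ ringKrullDim B)
    (γ : MvPolynomial (Fin (n + 1)) V →ₐ[V] B) (hγ : Function.Surjective γ) {r : Fin (n + 1)}
    (hr : γ (MvPolynomial.X r) = 1) (hI : ∀ G ∈ I.toIdeal, γ G = 0)
    {f : Fin d → MvPolynomial (Fin (n + 1)) F} (hf : ∀ j, (f j).IsHomogeneous 2) :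
    ∃ (κ : Type u) (_ : Field κ) (_ : Algebra F κ) (_ : Algebra V κ) (_ : IsScalarTower V F κ)
      (x : Fin (n + 1) → κ) (r : Fin (n + 1)), x r = 1 ∧ IsZeroOf I.toIdeal x ∧
        ∀ j, MvPolynomial.aeval x (f j) = 0 := by
  obtain ⟨π, hπ⟩ := IsDiscreteValuationRing.exists_irreducible V
  obtain ⟨q, hq, ι, _, y, hπq, hy, hd⟩ := exists_residueIndependent (d := d) hπ hdim
  let Ω₀ := FractionRing (B ⧸ q)
  let Ω := AlgebraicClosure Ω₀
  have hinj₀ : Function.Injective (algebraMap (B ⧸ q) Ω) := by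
    rw [IsScalarTower.algebraMap_eq (B ⧸ q) Ω₀ Ω]
    exact (algebraMap Ω₀ Ω).injective.comp (IsFractionRing.injective _ _)
  let g₀ : B →ₐ[V] Ω := (IsScalarTower.toAlgHom V (B ⧸ q) Ω).comp (Ideal.Quotient.mkₐ V q)
  have hg₀ : RingHom.ker g₀ = q := by
    ext b
    rw [RingHom.mem_ker, ← Ideal.Quotient.eq_zero_iff_mem]
    exact map_eq_zero_iff (algebraMap (B ⧸ q) Ω) hinj₀
  have hinj : Function.Injective (algebraMap V Ω) := by
    rw [injective_iff_map_eq_zero]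
    intro a ha
    by_contra h0
    refine hπq (mem_of_algebraMap_mem h0 ?_ hπ)
    rw [← hg₀, RingHom.mem_ker, AlgHom.commutes, ha]
  let : Algebra K Ω := (IsFractionRing.lift hinj : K →+* Ω).toAlgebra
  have : IsScalarTower V K Ω := .of_algebraMap_eq fun a => (IsFractionRing.lift_algebraMap hinj a).symm
  let : Algebra F Ω := (IsAlgClosed.lift (M := Ω) (R := K) (S := F)).toRingHom.toAlgebra
  have : IsScalarTower K F Ω := .of_algebraMap_eq fun a => ((IsAlgClosed.lift (M := Ω) (R := K) (S := F)).commutes a).symm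
  have : IsScalarTower V F Ω := .of_algebraMap_eq fun a => by
    rw [IsScalarTower.algebraMap_apply V K Ω, IsScalarTower.algebraMap_apply V K F, ← IsScalarTower.algebraMap_apply K F Ω]
  have hyK : AlgebraicIndependent K fun j => g₀ (y j) := hy.algebraicIndependent g₀ hg₀
  let Λ := FractionRing (Polynomial Ω)
  let g : Ω →ₐ[K] Λ := (IsScalarTower.toAlgHom K (Polynomial Ω) Λ).comp
    (IsScalarTower.toAlgHom K Ω (Polynomial Ω))
  let X : Λ := algebraMap (Polynomial Ω) Λ Polynomial.X
  have hyΛ : AlgebraicIndependent K fun o : Option ι => o.elim X fun j => g (g₀ (y j)) := by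
    convert algebraicIndependent_option_X hyK using 2 with o
    cases o <;> rfl
  let x : Fin (n + 1) → Ω := fun l => g₀ (γ (MvPolynomial.X l))
  have hx : ∀ G, MvPolynomial.aeval x G = g₀ (γ G) := fun G => by
    have h1 : MvPolynomial.aeval x = g₀.comp γ := MvPolynomial.algHom_ext fun l => by
      rw [MvPolynomial.aeval_X]
      rfl
    rw [h1]
    rfl
  have hyx : ∀ j, g₀ (y j) ∈ Algebra.adjoin K (Set.range x) := fun j => by
    obtain ⟨G, hG⟩ := hγ (y j)
    rw [← hG, ← hx, ← MvPolynomial.aeval_map_algebraMap K]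
    rw [Algebra.adjoin_range_eq_range_aeval]
    exact ⟨_, rfl⟩
  let z : Fin (n + 1) → Λ := fun l => g (x l) * X
  obtain ⟨l, hl⟩ := exists_notMem_algSpan g hyΛ hd (x := x) (r := r)
    (by change g₀ (γ _) = 1; rw [hr, map_one]) hyx (fun j => MvPolynomial.aeval z (f j))
  have hz : IsZeroOf I.toIdeal z := by
    have h1 : IsZeroOf I.toIdeal fun l => algebraMap Ω Λ (x l) := fun G hG => by
      refine (MvPolynomial.aeval_algebraMap_apply Λ x G).trans ?_
      rw [hx, hI G hG, map_zero, map_zero]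
    have h2 := h1.rescale X
    convert h2 using 2 with l
    exact mul_comm _ _
  exact exists_zero_of_notMem_algSpan (K := K) hf hz hl

end ProjectiveZeros

/-! ### Nonemptiness of quadric sections -/

section Nonempty

variable {V : Type u} [CommRing V] {n : ℕ} {X : Scheme.{u}} {i : X ⟶ projSpace n V}

lemma nonempty_quadricSection [IsClosedImmersion i] {A κ : Type u} [CommRing A] [Algebra V A] [Field κ] [Algebra A κ]
    [Algebra V κ] [IsScalarTower V A κ] {M : Submodule A (MvPolynomial (Fin (n + 1)) A)}
    (hM : M ≤ MvPolynomial.homogeneousSubmodule (Fin (n + 1)) A 2) {x : Fin (n + 1) → κ}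
    {r : Fin (n + 1)} (hX : ∀ r (c : ProjChart i r), IsReduced c.B) (hr : x r = 1)
    (hx : IsZeroOf (vanishingForms i).toIdeal x) (hMx : ∀ F ∈ M, MvPolynomial.aeval x F = 0) : Nonempty (quadricSection i M hM) := by
  obtain ⟨c⟩ := nonempty_projChart i r
  have := hX r c
  obtain ⟨e, he⟩ := c.exists_algHom hr hx
  obtain ⟨g, hg⟩ := exists_projPoint_quadricLocusι M hM (MvPolynomial.aeval (R := A) x).toRingHom
    (r := r) (by simpa using hr) hMx
  have h1 : (Spec.map (CommRingCat.ofHom e.toRingHom) ≫ c.j) ≫ i =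
      g ≫ quadricLocusι M hM ≫ projSpaceMap n V A := by
    rw [Category.assoc, c.comp]
    refine (specMap_projPoint _ _ c.γ.toRingHom c.γ_X e.toRingHom).trans (Eq.symm ?_)
    refine (Category.assoc _ _ _).symm.trans ((congrArg (· ≫ projSpaceMap n V A) hg).trans ?_)
    refine (projPoint_projSpaceMap _ _).trans ?_
    congr 1
    refine RingHom.ext fun F => ?_
    refine (MvPolynomial.aeval_map_algebraMap A x F).trans ?_
    exact (AlgHom.congr_fun he F).symm
  exact ⟨pullback.lift _ _ h1 (⟨⊥, Ideal.isPrime_bot⟩ : PrimeSpectrum κ)⟩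

lemma ProjChart.le_ringKrullDim {r : Fin (n + 1)} (c : ProjChart i r) (y : PrimeSpectrum c.B) :
    dimAt (c.j y) ≤ ringKrullDim c.B := by
  refine (iInf_le _ ⟨c.j.opensRange, ⟨y, rfl⟩⟩).trans ?_
  rw [← PrimeSpectrum.topologicalKrullDim_eq_ringKrullDim]
  have h1 : Topology.IsEmbedding c.j := c.j.isOpenEmbedding.isEmbedding
  exact (IsHomeomorph.topologicalKrullDim_eq _ h1.toHomeomorph.isHomeomorph).ge

/-- A chart of dimension `d + 1` of a flat projective scheme meets, over an algebraic extension of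
the fraction field, every linear system spanned by `d` quadrics. -/
lemma ProjChart.nonempty_quadricSection [IsClosedImmersion i] (K : Type u) {F : Type u}
    [IsDomain V] [IsDiscreteValuationRing V] [Field K] [Algebra V K] [IsFractionRing V K]
    [Field F] [Algebra K F] [Algebra.IsAlgebraic K F] [Algebra V F] [IsScalarTower V K F] {d : ℕ}
    {r : Fin (n + 1)} (c : ProjChart i r)
    (hflat : Flat (i ≫ projSpaceStr n V)) (hX : ∀ r (c : ProjChart i r), IsReduced c.B)
    (hdim : (d + 1 : ℕ) ≤ ringKrullDim c.B)
    (L : QuadGrass n d F) {A : Type u} [CommRing A] [Algebra V A] [Algebra A F]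
    [IsScalarTower V A F] :
    Nonempty (quadricSection i (L.lattice A) (L.lattice_le_two A)) ∧
      Nonempty (quadricSection i L.space L.le_two) := by
  have := c.flat hflat
  obtain ⟨q, rfl⟩ := L.exists_frame
  obtain ⟨κ, _, _, _, _, x, m, hm, hx, hxf⟩ := exists_projective_zero (K := K) hdim c.γ c.surj
    c.γ_X (fun G hG => c.γ_eq_zero_of_mem_vanishingForms hG) q.homogeneous
  have h1 : ∀ F ∈ q.span.space, MvPolynomial.aeval x F = 0 := fun G hG => by
    have h2 : q.span.space ≤ LinearMap.ker (MvPolynomial.aeval (R := F) x).toLinearMap :=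
      Submodule.span_le.mpr (by rintro _ ⟨j, rfl⟩; exact hxf j)
    exact h2 hG
  refine ⟨?_, _root_.nonempty_quadricSection _ hX hm hx h1⟩
  let : Algebra A κ := ((algebraMap F κ).comp (algebraMap A F)).toAlgebra
  have : IsScalarTower A F κ := .of_algebraMap_eq fun _ => rfl
  have : IsScalarTower V A κ := .of_algebraMap_eq fun a => by
    rw [IsScalarTower.algebraMap_apply V F κ, IsScalarTower.algebraMap_apply V A F]
    rfl
  refine _root_.nonempty_quadricSection _ hX hm hx fun G hG => ?_
  rw [← MvPolynomial.aeval_map_algebraMap F]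
  exact h1 _ hG.2

end Nonempty

/-! ### Lifting a frame of the specialization -/

section Lift

variable {n d : ℕ} {F k W : Type u} [Field F] [Field k] [CommRing W] [Algebra W F]

/-- Members of the lattice reducing to the frame `f` remain independent over `F`, and `L` has
dimension `d`, so they span it. -/
lemma QuadGrass.SpecializesTo.exists_lift {L : QuadGrass n d F} {r : W →+* k}
    {l : QuadGrass n d k} (h : L.SpecializesTo r l) (hr : Function.Surjective r)
    {f : Fin d → MvPolynomial (Fin (n + 1)) k} (hf : l.space = Submodule.span k (Set.range f))
    {O : Type u} [CommRing O] [IsDomain O] [ValuationRing O] [Algebra O F] [IsFractionRing O F]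
    [Algebra W O] [IsScalarTower W O F] (ρ : O →+* k) (hρ : ∀ a, ρ (algebraMap W O a) = r a) :
    ∃ g : Fin d → MvPolynomial (Fin (n + 1)) W, (∀ j, (g j).IsHomogeneous 2) ∧
      (∀ j, MvPolynomial.map r (g j) = f j) ∧
      L.space = Submodule.span F (Set.range fun j => MvPolynomial.map (algebraMap W F) (g j)) := by
  have h1 : ∀ p ∈ l.space, ∃ g ∈ L.lattice W, MvPolynomial.map r g = p := fun p hp => by
    rw [show l.space = _ from h] at hp
    induction hp using Submodule.span_induction with
    | mem p hp => exact hp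
    | zero => exact ⟨0, zero_mem _, map_zero _⟩
    | add p q _ _ hp hq =>
      obtain ⟨a, ha, rfl⟩ := hp
      obtain ⟨b, hb, rfl⟩ := hq
      exact ⟨a + b, add_mem ha hb, map_add _ _ _⟩
    | smul c p _ hp =>
      obtain ⟨a, ha, rfl⟩ := hp
      obtain ⟨c, rfl⟩ := hr c
      refine ⟨c • a, Submodule.smul_mem _ _ ha, ?_⟩
      rw [MvPolynomial.smul_eq_C_mul, map_mul, MvPolynomial.map_C, MvPolynomial.smul_eq_C_mul]
  have h2 : ∀ j, ∃ g ∈ L.lattice W, MvPolynomial.map r g = f j := fun j =>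
    h1 _ (hf ▸ Submodule.subset_span ⟨j, rfl⟩)
  choose g hgL hgf using h2
  have hind : LinearIndependent k f := by
    rw [linearIndependent_iff_card_eq_finrank_span, Set.finrank, ← hf, l.finrank_eq,
      Fintype.card_fin]
  refine ⟨g, fun j => (hgL j).1, hgf, ?_⟩
  have hindF : LinearIndependent F fun j => MvPolynomial.map (algebraMap W F) (g j) := by
    rw [Fintype.linearIndependent_iff]
    intro a ha
    by_contra! hne
    -- A linear relation is divided by its coefficient of largest value. It then reduces to a
    -- relation among the `f j` with a coefficient `1`.
    obtain ⟨m, hm0, hm⟩ := ValuationRing.exists_forall_div_mem (A := O) a hne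
    choose b hb using hm
    have h3 : ∑ j, MvPolynomial.C (b j) * MvPolynomial.map (algebraMap W O) (g j) = 0 := by
      refine MvPolynomial.map_injective (algebraMap O F) (IsFractionRing.injective O F) ?_
      rw [map_zero, map_sum, ← mul_zero (MvPolynomial.C (a m)⁻¹), ← ha, Finset.mul_sum]
      refine Finset.sum_congr rfl fun j _ => ?_
      rw [map_mul, MvPolynomial.map_C, hb, MvPolynomial.map_map,
        ← IsScalarTower.algebraMap_eq, MvPolynomial.smul_eq_C_mul, ← mul_assoc, ← map_mul,
        div_eq_inv_mul]
    have h4 := congrArg (MvPolynomial.map ρ) h3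
    rw [map_zero, map_sum] at h4
    have h5 := Fintype.linearIndependent_iff.mp hind (fun j => ρ (b j)) (by
      rw [← h4]
      refine Finset.sum_congr rfl fun j _ => ?_
      rw [map_mul, MvPolynomial.map_C, MvPolynomial.map_map, ← hgf, MvPolynomial.smul_eq_C_mul]
      congr 3
      exact RingHom.ext fun a => (hρ a).symm) m
    have h6 : b m = 1 := IsFractionRing.injective O F (by rw [hb, div_self hm0, map_one])
    rw [h6, map_one] at h5
    exact one_ne_zero h5
  obtain ⟨q, rfl⟩ := L.exists_frame
  have : FiniteDimensional F q.span.space := FiniteDimensional.span_of_finite F (Set.finite_range _)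
  refine (Submodule.eq_of_le_of_finrank_eq (Submodule.span_le.mpr ?_) ?_).symm
  · rintro _ ⟨j, rfl⟩
    exact (hgL j).2
  · rw [q.span.finrank_eq, finrank_span_eq_card hindF, Fintype.card_fin]

end Lift

/-! ### Degenerating tangent vectors -/

section Limits

variable {V : Type u} [CommRing V] {n d : ℕ}

/-- `E i t` vanishes on the first jets of `d` functions along which a non-zero vector tangent to
the generic fibre of `V₊(I)` is killed. -/
def IsJetEquation (K : Type u) [Field K] [Algebra V K]
    (I : Ideal (MvPolynomial (Fin (n + 1)) V))
    (E : Fin (n + 1) → (Fin d → Fin (n + 1)) → MvPolynomial ((Fin d × Fin n) ⊕ Fin d) V) : Prop :=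
  ∀ i t, ∀ (κ : Type u) [Field κ] [Algebra V κ] [Algebra K κ] [IsScalarTower V K κ]
    [Algebra.IsAlgebraic K κ] (x u : Fin (n + 1) → κ) (v : Fin d × Fin n → κ), x i = 1 →
    u i = 0 → u ≠ 0 → IsZeroOf I x → IsTangentTo I x u →
    (∀ j, ∑ l, v (j, l) * u (i.succAbove l) = 0) →
    MvPolynomial.aeval (Sum.elim v (x ∘ t)) (E i t) = 0

/-- The jets of the forms `f` at their common zeros on `V₊(J)`, outside the point `p`, do not
satisfy the equations `E`. -/
def AvoidsJets {k : Type u} [Field k] (J : Ideal (MvPolynomial (Fin (n + 1)) k))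
    (E : Fin (n + 1) → (Fin d → Fin (n + 1)) → MvPolynomial ((Fin d × Fin n) ⊕ Fin d) k)
    (p : Fin (n + 1) → k) (r : Fin (n + 1)) (f : Fin d → MvPolynomial (Fin (n + 1)) k) : Prop :=
  ∀ i s, ∀ q : Fin (n + 1) → k, q i = 1 → IsZeroOf J q →
    MvPolynomial.eval q (lineThrough p r s) ≠ 0 → (∀ j, MvPolynomial.eval q (f j) = 0) →
    ∃ t, MvPolynomial.eval (Sum.elim (fun a : Fin d × Fin n =>
      MvPolynomial.eval q (MvPolynomial.pderiv (i.succAbove a.2) (f a.1))) (q ∘ t)) (E i t) ≠ 0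

variable [IsDomain V] [IsDiscreteValuationRing V] [IsAlgClosed (IsLocalRing.ResidueField V)]
  {X : Scheme.{u}} {i : X ⟶ projSpace n V} [IsClosedImmersion i]
  {K F W : Type u} [Field K] [Algebra V K] [IsFractionRing V K] [CharZero K]
  [Field F] [Algebra K F] [FiniteDimensional K F] [Algebra V F] [IsScalarTower V K F]
  [CommRing W] [Algebra V W] [Algebra.IsIntegral V W] [Algebra W F] [IsScalarTower V W F]

/-- The section by a linear system is étale if no tangent vector to it specializes to a non-zero
vector at the point `p`. -/
lemma etale_of_specializesTo (hX : ∀ r (c : ProjChart i r), _root_.IsReduced c.B)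
    (hWF : Function.Injective (algebraMap W F)) (r₀ : W →ₐ[V] IsLocalRing.ResidueField V)
    {E : Fin (n + 1) → (Fin d → Fin (n + 1)) → MvPolynomial ((Fin d × Fin n) ⊕ Fin d) V}
    (hE : IsJetEquation K (vanishingForms i).toIdeal E)
    {p : Fin (n + 1) → IsLocalRing.ResidueField V} {r : Fin (n + 1)}
    {L : QuadGrass n d F} {l : QuadGrass n d (IsLocalRing.ResidueField V)}
    (hL : L.SpecializesTo r₀.toRingHom l)
    {f : Fin d → MvPolynomial (Fin (n + 1)) (IsLocalRing.ResidueField V)}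
    (hlf : l.space = Submodule.span _ (Set.range f))
    (hf : AvoidsJets ((vanishingForms i).toIdeal.map (MvPolynomial.map (IsLocalRing.residue V)))
      (fun i t => MvPolynomial.map (IsLocalRing.residue V) (E i t)) p r f)
    (h : ∀ (O κ : Type u) [CommRing O] [IsDomain O] [Field κ] [Algebra O κ] [Algebra V O]
      [Algebra W O] [IsScalarTower V W O] [Algebra V κ] [IsScalarTower V O κ] [Algebra K κ]
      [IsScalarTower V K κ] [Algebra.IsAlgebraic K κ] (ρ : O →ₐ[V] IsLocalRing.ResidueField V)
      (g : Fin d → MvPolynomial (Fin (n + 1)) W) (x u : Fin (n + 1) → O),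
      Function.Injective (algebraMap O κ) → (∀ a, ρ (algebraMap W O a) = r₀ a) →
      (∀ j, MvPolynomial.map r₀.toRingHom (g j) = f j) → x r = 1 → u r = 0 →
      (∀ l, ρ (x l) = p l) → IsZeroOf (vanishingForms i).toIdeal x →
      IsTangentTo (vanishingForms i).toIdeal x u → (∀ j, MvPolynomial.aeval x (g j) = 0) →
      (∀ j, dirDeriv x u (g j) = 0) → ∀ l, ρ (u l) = 0) :
    Etale (quadricSectionStr i L.space L.le_two) := by
  have hr₀ : Function.Surjective r₀.toRingHom := fun b => by
    obtain ⟨a, rfl⟩ := IsLocalRing.residue_surjective b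
    exact ⟨algebraMap V W a, r₀.commutes a⟩
  obtain ⟨π, hπ⟩ := IsDiscreteValuationRing.exists_irreducible V
  have hrπ : r₀.toRingHom (algebraMap V W π) = 0 := by
    refine (r₀.commutes π).trans ((IsLocalRing.residue_eq_zero_iff _).mpr ?_)
    rw [hπ.maximalIdeal_eq]
    exact Ideal.mem_span_singleton_self π
  obtain ⟨g, hg2, hgf, hgL⟩ : ∃ g : Fin d → MvPolynomial (Fin (n + 1)) W,
      (∀ j, (g j).IsHomogeneous 2) ∧ (∀ j, MvPolynomial.map r₀.toRingHom (g j) = f j) ∧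
      L.space = Submodule.span F
        (Set.range fun j => MvPolynomial.map (algebraMap W F) (g j)) := by
    -- The lift needs a place of `F`; the tangent vector below lives over a larger field `κ`, for
    -- which a second place is chosen.
    obtain ⟨O, _, _, _, _, _, _, _, _, _, _, ρ, hρ, -⟩ :=
      exists_valuationRing (K := K) (κ := F) hWF r₀.toRingHom hr₀ hπ.ne_zero hrπ
    exact hL.exists_lift hr₀ hlf ρ hρ
  refine etale_quadricSectionStr hX ?_
  intro κ _ _ _ _ _ x u i₀ hxi hui hx hu hLx hLu
  by_contra hu0
  let : Algebra K κ := ((algebraMap F κ).comp (algebraMap K F)).toAlgebra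
  have : IsScalarTower K F κ := .of_algebraMap_eq fun _ => rfl
  have : FiniteDimensional K κ := Module.Finite.trans F κ
  have : IsScalarTower V K κ := .of_algebraMap_eq fun a => by
    rw [IsScalarTower.algebraMap_apply V F κ, IsScalarTower.algebraMap_apply V K F]
    rfl
  let : Algebra W κ := ((algebraMap F κ).comp (algebraMap W F)).toAlgebra
  have : IsScalarTower W F κ := .of_algebraMap_eq fun _ => rfl
  have : IsScalarTower V W κ := .of_algebraMap_eq fun a => by
    rw [IsScalarTower.algebraMap_apply V F κ, IsScalarTower.algebraMap_apply V W F]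
    rfl
  have hWκ : Function.Injective (algebraMap W κ) := (algebraMap F κ).injective.comp hWF
  obtain ⟨O, _, _, _, _, _, _, _, _, _, _, ρ, hρ, hunit⟩ :=
    exists_valuationRing (K := K) (κ := κ) hWκ r₀.toRingHom hr₀ hπ.ne_zero hrπ
  have hρV : ∀ a, ρ (algebraMap V O a) = IsLocalRing.residue V a := fun a => by
    rw [IsScalarTower.algebraMap_apply V W O, hρ]
    exact r₀.commutes a
  have hgO : ∀ j, MvPolynomial.map ρ (MvPolynomial.map (algebraMap W O) (g j)) = f j := fun j => by
    rw [MvPolynomial.map_map, ← hgf, show ρ.comp (algebraMap W O) = r₀.toRingHom from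
      RingHom.ext hρ]
  have hgLj : ∀ j, MvPolynomial.map (algebraMap W F) (g j) ∈ L.space := fun j =>
    hgL ▸ Submodule.subset_span ⟨j, rfl⟩
  -- The equations `E` exclude a reduction different from `p`, and `u'` has a component with nonzero
  -- reduction, against `h`.
  obtain ⟨x', u', hx'r, hu'r, ⟨m, hm⟩, hx'p, hx', hu', hgx', hgu'⟩ :=
    exists_primitive_tangent_at_point (K := K) (I := vanishingForms i) (IsLocalRing.residue V) hE
      hf ρ hρV hunit (g := fun j => MvPolynomial.map (algebraMap W O) (g j))
      (fun j => (hg2 j).map _) hgO hxi hui hu0 hx hu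
      (fun j => by
        rw [MvPolynomial.aeval_map_algebraMap, ← MvPolynomial.aeval_map_algebraMap F]
        exact hLx _ (hgLj j))
      (fun j => by
        rw [dirDeriv_map, ← dirDeriv_map (R' := F)]
        exact hLu _ (hgLj j))
  exact hm (h O κ { ρ with commutes' := hρV } g x' u' (IsFractionRing.injective O κ) hρ hgf hx'r
    hu'r hx'p hx' hu' (fun j => by rw [← hgx' j, MvPolynomial.aeval_map_algebraMap])
    (fun j => by rw [← hgu' j, dirDeriv_map]) m)

end Limits

/-! ### The generic linear system through a point -/

section GenericSystem

lemma dirDeriv_map_eq_zero {σ R A B : Type*} [Fintype σ] [CommRing R] [CommRing A] [CommRing B]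
    [Algebra R A] (φ : R →+* B) (ρ : A →+* B) (h : ∀ a, ρ (algebraMap R A a) = φ a) {x u : σ → A}
    {F : MvPolynomial σ R} (hF : dirDeriv x u F = 0) :
    dirDeriv (fun l => ρ (x l)) (fun l => ρ (u l)) (MvPolynomial.map φ F) = 0 := by
  let := φ.toAlgebra
  let ρ' : A →ₐ[R] B := { ρ with commutes' := h }
  refine (dirDeriv_map (R := R) (R' := B) _ _ F).trans ?_
  exact (map_dirDeriv ρ' x u F).symm.trans ((congrArg ρ' hF).trans (map_zero ρ'))

variable {V : Type u} [CommRing V] [IsDomain V] [IsDiscreteValuationRing V] {n d : ℕ}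
  {X : Scheme.{u}} {i : X ⟶ projSpace n V} {r : Fin (n + 1)}
  (c : ProjChart i r) (e : c.B →ₐ[V] IsLocalRing.ResidueField V)

/-- Three generic conditions are imposed together: the system misses a fixed hyperplane on `X_k`,
its jets away from the point avoid the reduced equations, and its differentials at the point have
maximal rank. The number `m` bounds the remaining corank: `0` when the cotangent space of the
special fibre has dimension at most `d`, and `1` in the other regular case. -/
lemma ProjChart.exists_isOpen_dense [IsClosedImmersion i] [IsAlgClosed (IsLocalRing.ResidueField V)]
    {K : Type u} [Field K] [Algebra V K]
    [IsFractionRing V K] [CharZero K] {y : Spec (CommRingCat.of c.B)}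
    (he : RingHom.ker e = y.asIdeal) (hdim : topologicalKrullDim X = (d + 1 : ℕ))
    (hflat : Flat (i ≫ projSpaceStr n V)) (hX : ∀ r (c : ProjChart i r), _root_.IsReduced c.B)
    (hK : GenericFibreBound K d (vanishingForms i).toIdeal) {m : ℕ}
    (hm : Module.finrank (IsLocalRing.ResidueField V) (CotangentQuotient e
      ((IsLocalRing.maximalIdeal V).map (algebraMap V c.B))) ≤ d + m) :
    ∃ (E : Fin (n + 1) → (Fin d → Fin (n + 1)) → MvPolynomial ((Fin d × Fin n) ⊕ Fin d) V)
      (U : Set (throughPoint i (c.j y) d)), IsJetEquation K (vanishingForms i).toIdeal E ∧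
      IsOpen U ∧ Dense U ∧ ∀ l ∈ U, IsFinite (quadricSectionStr i l.1.space l.1.le_two) ∧
        ∃ f : Fin d → quadricsThrough fun l => e (c.γ (MvPolynomial.X l)),
          l.1.space = Submodule.span _ (Set.range fun j => (f j).1) ∧
          AvoidsJets ((vanishingForms i).toIdeal.map (MvPolynomial.map (IsLocalRing.residue V)))
            (fun i t => MvPolynomial.map (IsLocalRing.residue V) (E i t))
            (fun l => e (c.γ (MvPolynomial.X l))) r (fun j => (f j).1) ∧
          ∀ (F : Fin d → MvPolynomial (Fin (n + 1)) V) (hF : ∀ j, c.γ (F j) ∈ RingHom.ker e),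
            (∀ j, MvPolynomial.map (IsLocalRing.residue V) (F j) = (f j).1) →
            Module.finrank (IsLocalRing.ResidueField V) (CotangentQuotient e
              ((IsLocalRing.maximalIdeal V).map (algebraMap V c.B)) ⧸
              Submodule.span (IsLocalRing.ResidueField V) (Set.range fun j =>
                CotangentQuotient.mk e ((IsLocalRing.maximalIdeal V).map (algebraMap V c.B))
                  ⟨c.γ (F j), hF j⟩)) ≤ m := by
  have hp : (fun l => e (c.γ (MvPolynomial.X l))) r = 1 := by
    change e (c.γ _) = 1
    rw [c.γ_X, map_one]
  have hZ := zeroBound_vanishingForms hdim hflat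
  have : Infinite (IsLocalRing.ResidueField V) := IsAlgClosed.instInfinite
  have := c.isNoetherianRing
  have := CotangentQuotient.finite_of_fg e ((IsLocalRing.maximalIdeal V).map (algebraMap V c.B))
  choose E hE0 hE using exists_jet_equation hK (IsLocalRing.residue V)
  obtain ⟨a, ha⟩ := exists_isGeneric_linear_form_ne_zero
    (p := fun l => e (c.γ (MvPolynomial.X l))) hZ hp
  obtain ⟨Λ, hΛ, hΛF⟩ := CotangentQuotient.exists_differential e c.γ c.γ_X c.surj
  have h1 := IsGeneric.forall fun i => IsGeneric.forall fun s =>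
    isGeneric_not_relation (p := fun l => e (c.γ (MvPolynomial.X l))) hZ hp (fun t => MvPolynomial.map (IsLocalRing.residue V) (E i t))
      (hE0 i) i s
  have h2 := (ha.and h1).and (isGeneric_finrank_quotient_span_le Λ hΛ hm)
  obtain ⟨U, hUo, hUd, hU⟩ := exists_isOpen_dense_of_isGeneric
    (Q := quadricsThrough fun l => e (c.γ (MvPolynomial.X l))) inf_le_left
    (mem_throughPoint_iff c he) h2
  refine ⟨E, U, hE, hUo, hUd, fun l hl => ?_⟩
  obtain ⟨f, ⟨⟨hfa, hfE⟩, hfΛ⟩, hlf⟩ := hU l hl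
  refine ⟨?_, f, hlf, hfE, fun F hF hFf => ?_⟩
  · refine isFinite_quadricSectionStr hX a fun q s hqs hq hGq => ?_
    refine hfa s q hqs ?_ fun j => hGq _ (hlf ▸ Submodule.subset_span ⟨j, rfl⟩)
    have h3 : Ideal.map (MvPolynomial.map (IsLocalRing.residue V)) (vanishingForms i).toIdeal ≤
        RingHom.ker (MvPolynomial.aeval (R := IsLocalRing.ResidueField V) q) := by
      rw [Ideal.map_le_iff_le_comap]
      intro G hG
      exact (MvPolynomial.aeval_map_algebraMap _ q G).trans (hq G hG)
    exact fun G hG => h3 hG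
  · have h3 : (Λ ∘ f) = fun j =>
        CotangentQuotient.mk e ((IsLocalRing.maximalIdeal V).map (algebraMap V c.B))
          ⟨c.γ (F j), hF j⟩ := funext fun j => hΛF _ _ (hFf j) _
    rwa [h3] at hfΛ

variable {K O κ : Type u} [CommRing O] [Algebra V O] (ρ : O →ₐ[V] IsLocalRing.ResidueField V)

/-- The reduction of `u` is tangent to `X` at the point and is killed by differentials that span the
cotangent space of the special fibre. As only reductions matter, the forms `g` may have coefficients
in any `W`. -/
lemma ProjChart.map_eq_zero_of_finrank_le_zero {W : Type u} [CommRing W] [Algebra W O]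
    (r₀ : W →+* IsLocalRing.ResidueField V) (hr₀ : ∀ a, ρ (algebraMap W O a) = r₀ a)
    {f : Fin d → quadricsThrough fun l => e (c.γ (MvPolynomial.X l))}
    (hf : ∀ (F : Fin d → MvPolynomial (Fin (n + 1)) V) (hF : ∀ j, c.γ (F j) ∈ RingHom.ker e),
      (∀ j, MvPolynomial.map (IsLocalRing.residue V) (F j) = (f j).1) →
      Module.finrank (IsLocalRing.ResidueField V) (CotangentQuotient e
        ((IsLocalRing.maximalIdeal V).map (algebraMap V c.B)) ⧸
        Submodule.span (IsLocalRing.ResidueField V) (Set.range fun j =>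
          CotangentQuotient.mk e ((IsLocalRing.maximalIdeal V).map (algebraMap V c.B))
            ⟨c.γ (F j), hF j⟩)) ≤ 0)
    {g : Fin d → MvPolynomial (Fin (n + 1)) W} (hg : ∀ j, MvPolynomial.map r₀ (g j) = (f j).1)
    {x u : Fin (n + 1) → O} (hur : u r = 0) (hxp : ∀ l, ρ (x l) = e (c.γ (MvPolynomial.X l)))
    (hu : IsTangentTo (vanishingForms i).toIdeal x u) (hgu : ∀ j, dirDeriv x u (g j) = 0)
    (l : Fin (n + 1)) : ρ (u l) = 0 := by
  have hxp' : (fun l => ρ (x l)) = fun l => e (c.γ (MvPolynomial.X l)) := funext hxp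
  have := c.isNoetherianRing
  choose F _ hFf using fun j => exists_homogeneous_map_residue (V := V) (f j).2.1
  have hF : ∀ j, c.γ (F j) ∈ RingHom.ker e := fun j => by
    rw [RingHom.mem_ker]
    exact (c.aeval_residue e (F j)).symm.trans (hFf j ▸ (f j).2.2)
  have hker := CotangentQuotient.ker_le_of_finrank_eq_zero e _ _ (hf F hF hFf)
  have hur' : (fun l => ρ (u l)) r = 0 := (congrArg ρ hur).trans (map_zero ρ)
  have hu' : IsTangentTo (vanishingForms i).toIdeal
      (fun l => e (c.γ (MvPolynomial.X l))) fun l => ρ (u l) := fun G hG => by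
    rw [← hxp', ← map_dirDeriv, hu G hG, map_zero]
  have hFu : ∀ j, dirDeriv (fun l => e (c.γ (MvPolynomial.X l))) (fun l => ρ (u l)) (F j) = 0 :=
    fun j => by
      refine (dirDeriv_map (R' := IsLocalRing.ResidueField V) _ _ (F j)).symm.trans ?_
      refine (congrArg (dirDeriv _ _) ((hFf j).trans (hg j).symm)).trans ?_
      rw [← hxp']
      exact dirDeriv_map_eq_zero r₀ ρ.toRingHom hr₀ (hgu j)
  exact congrFun (c.tangent_eq_zero e F hF hker hur' hu' hFu) l

/-- By `hJ` the cotangent space of the special fibre is `𝔓/𝔓²`, so corank one means that the `g j`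
and one further element generate `𝔓` modulo `𝔓²`. Here the forms must have coefficients in `V`. -/
lemma ProjChart.eq_zero_of_finrank_le_one [IsDomain O] [Field K] [CharZero K] [Field κ]
    [Algebra V K] [IsFractionRing V K] [Algebra K κ] [Algebra V κ] [IsScalarTower V K κ]
    [Algebra.IsAlgebraic K κ] [Algebra O κ] [IsScalarTower V O κ]
    (hO : Function.Injective (algebraMap O κ))
    (hJ : (IsLocalRing.maximalIdeal V).map (algebraMap V c.B) ≤ RingHom.ker e ^ 2)
    {f : Fin d → quadricsThrough fun l => e (c.γ (MvPolynomial.X l))}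
    (hf : ∀ (F : Fin d → MvPolynomial (Fin (n + 1)) V) (hF : ∀ j, c.γ (F j) ∈ RingHom.ker e),
      (∀ j, MvPolynomial.map (IsLocalRing.residue V) (F j) = (f j).1) →
      Module.finrank (IsLocalRing.ResidueField V) (CotangentQuotient e
        ((IsLocalRing.maximalIdeal V).map (algebraMap V c.B)) ⧸
        Submodule.span (IsLocalRing.ResidueField V) (Set.range fun j =>
          CotangentQuotient.mk e ((IsLocalRing.maximalIdeal V).map (algebraMap V c.B))
            ⟨c.γ (F j), hF j⟩)) ≤ 1)
    {g : Fin d → MvPolynomial (Fin (n + 1)) V}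
    (hg : ∀ j, MvPolynomial.map (IsLocalRing.residue V) (g j) = (f j).1)
    {x u : Fin (n + 1) → O} (hxr : x r = 1) (hur : u r = 0)
    (hxp : ∀ l, ρ (x l) = e (c.γ (MvPolynomial.X l)))
    (hx : IsZeroOf (vanishingForms i).toIdeal x)
    (hu : IsTangentTo (vanishingForms i).toIdeal x u) (hgx : ∀ j, MvPolynomial.aeval x (g j) = 0)
    (hgu : ∀ j, dirDeriv x u (g j) = 0) : u = 0 := by
  have := c.isNoetherianRing
  obtain ⟨π, hπ⟩ := IsDiscreteValuationRing.exists_irreducible V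
  have hF : ∀ j, c.γ (g j) ∈ RingHom.ker e := fun j => by
    rw [RingHom.mem_ker]
    exact (c.aeval_residue e (g j)).symm.trans (hg j ▸ (f j).2.2)
  obtain ⟨t, ht, h⟩ := CotangentQuotient.ker_le_of_finrank_le_one e _ _ (hf g hF hg)
  rw [sup_eq_left.mpr hJ] at h
  exact c.tangent_eq_zero_of_isAlgebraic e (K := K) (κ := κ) hO ρ hπ.ne_zero
    (hπ.maximalIdeal_eq ▸ Ideal.mem_span_singleton_self π) g ht h hxr hur hxp hx hu hgx hgu

/-- The sections of `X` by generic linear systems through a point at which the special fibre has a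
`d`-dimensional cotangent space. -/
lemma ProjChart.exists_isOpen_dense_etale [IsClosedImmersion i]
    [IsAlgClosed (IsLocalRing.ResidueField V)] [Field K] [Algebra V K] [IsFractionRing V K]
    [CharZero K] {y : Spec (CommRingCat.of c.B)}
    (he : RingHom.ker e = y.asIdeal) (hdim : topologicalKrullDim X = (d + 1 : ℕ))
    (hflat : Flat (i ≫ projSpaceStr n V)) (hX : ∀ r (c : ProjChart i r), _root_.IsReduced c.B)
    (hK : GenericFibreBound K d (vanishingForms i).toIdeal)
    (hd : Module.finrank (IsLocalRing.ResidueField V) (CotangentQuotient e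
      ((IsLocalRing.maximalIdeal V).map (algebraMap V c.B))) ≤ d) :
    ∃ U : Set (throughPoint i (c.j y) d), IsOpen U ∧ Dense U ∧
      ∀ (F W : Type u) [Field F] [Algebra K F] [FiniteDimensional K F] [Algebra V F]
        [IsScalarTower V K F] [CommRing W] [Algebra V W] [Algebra.IsIntegral V W] [Algebra W F]
        [IsScalarTower V W F] (_ : Function.Injective (algebraMap W F))
        (r₀ : W →ₐ[V] IsLocalRing.ResidueField V) (L : QuadGrass n d F)
        (l : throughPoint i (c.j y) d), l ∈ U → L.SpecializesTo r₀.toRingHom l.1 →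
          IsFinite (quadricSectionStr i l.1.space l.1.le_two) ∧
          Etale (quadricSectionStr i L.space L.le_two) := by
  obtain ⟨E, U, hE, hUo, hUd, hU⟩ := c.exists_isOpen_dense e he hdim hflat hX hK (m := 0) hd
  refine ⟨U, hUo, hUd, fun F W _ _ _ _ _ _ _ _ _ _ hWF r₀ L l hl hL => ?_⟩
  obtain ⟨hfin, f, hlf, hfE, hfm⟩ := hU l hl
  refine ⟨hfin, etale_of_specializesTo hX hWF r₀ hE hL hlf hfE ?_⟩
  intro O κ _ _ _ _ _ _ _ _ _ _ _ _ ρ g x u _ hρ hgf _ hur hxp _ hu _ hgu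
  exact c.map_eq_zero_of_finrank_le_zero e ρ r₀.toRingHom hρ hfm hgf hur hxp hu hgu

/-- The sections of `X` by generic linear systems through a regular point at which the special
fibre is singular. -/
lemma ProjChart.exists_isOpen_dense_etale_of_maximalIdeal_le [IsClosedImmersion i]
    [IsAlgClosed (IsLocalRing.ResidueField V)] [Field K] [Algebra V K] [IsFractionRing V K]
    [CharZero K] {y : Spec (CommRingCat.of c.B)}
    (he : RingHom.ker e = y.asIdeal) (hdim : topologicalKrullDim X = (d + 1 : ℕ))
    (hflat : Flat (i ≫ projSpaceStr n V)) (hX : ∀ r (c : ProjChart i r), _root_.IsReduced c.B)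
    (hK : GenericFibreBound K d (vanishingForms i).toIdeal)
    (hd : Module.finrank (IsLocalRing.ResidueField V) (CotangentQuotient e
      ((IsLocalRing.maximalIdeal V).map (algebraMap V c.B))) ≤ d + 1)
    (hJ : (IsLocalRing.maximalIdeal V).map (algebraMap V c.B) ≤ RingHom.ker e ^ 2) :
    ∃ U : Set (throughPoint i (c.j y) d), IsOpen U ∧ Dense U ∧
      ∀ (L : QuadGrass n d K) (l : throughPoint i (c.j y) d), l ∈ U →
        L.SpecializesTo (IsLocalRing.residue V) l.1 →
          IsFinite (quadricSectionStr i l.1.space l.1.le_two) ∧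
          Etale (quadricSectionStr i L.space L.le_two) := by
  obtain ⟨E, U, hE, hUo, hUd, hU⟩ := c.exists_isOpen_dense e he hdim hflat hX hK hd
  refine ⟨U, hUo, hUd, fun L l hl hL => ?_⟩
  obtain ⟨hfin, f, hlf, hfE, hfm⟩ := hU l hl
  refine ⟨hfin, etale_of_specializesTo hX (IsFractionRing.injective V K)
    (Algebra.ofId V (IsLocalRing.ResidueField V)) hE hL hlf hfE ?_⟩
  intro O κ _ _ _ _ algV algW hVW _ _ _ _ _ ρ g x u hO hρ hgf hxr hur hxp hx hu hgx hgu l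
  -- With `W = V` the ring `O` carries two `V`-algebra structures, which the tower condition
  -- identifies.
  have halg : algW = algV := Algebra.algebra_ext _ _ fun a =>
    (@IsScalarTower.algebraMap_apply V V O _ _ _ _ algW algV hVW a).symm
  subst halg
  rw [c.eq_zero_of_finrank_le_one e ρ (K := K) hO hJ hfm hgf hxr hur hxp hx hu hgx hgu]
  exact map_zero ρ

end GenericSystem

theorem mainTheorem3 {V K : Type u} [CommRing V] [IsDomain V] [IsDiscreteValuationRing V]
    [IsAdicComplete (IsLocalRing.maximalIdeal V) V]
    [IsAlgClosed (IsLocalRing.ResidueField V)]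
    [Field K] [Algebra V K] [IsFractionRing V K] [CharZero K]
    (n d : ℕ) {X : Scheme.{u}} (i : X ⟶ projSpace n V) [IsClosedImmersion i]
    (hflat : Flat (i ≫ projSpaceStr n V))
    (hdim : topologicalKrullDim X = (d + 1 : ℕ))
    (hred : IsReduced (pullback (i ≫ projSpaceStr n V)
      (Spec.map (CommRingCat.ofHom (algebraMap V K)))))
    (P : X) (hPk : (i ≫ projSpaceStr n V) P = IsLocalRing.closedPoint V)
    (hPclosed : IsClosed ({P} : Set X))
    (hPdim : dimAt P = (d + 1 : ℕ)) :
    (IsRegularLocalRing (X.presheaf.stalk P) →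
      ∃ U : Set (throughPoint i P d), IsOpen U ∧ Dense U ∧
        ∀ (L : QuadGrass n d K) (l : throughPoint i P d), l ∈ U →
          L.SpecializesTo (IsLocalRing.residue V) l.1 →
            IsFinite (quadricSectionStr i l.1.space l.1.le_two) ∧
            Etale (quadricSectionStr i L.space L.le_two) ∧
            Nonempty (quadricSection i (L.lattice V) (L.lattice_le_two V)) ∧
            Nonempty (quadricSection i L.space L.le_two)) ∧
    (IsSmoothAtPoint (i ≫ projSpaceStr n V) P →
      ∃ U : Set (throughPoint i P d), IsOpen U ∧ Dense U ∧
        ∀ (K' : Type u) [Field K'] [Algebra K K'] [FiniteDimensional K K'] [Algebra V K']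
          [IsScalarTower V K K'] (L : QuadGrass n d K') (l : throughPoint i P d), l ∈ U →
          L.SpecializesTo (residueHom V K').toRingHom l.1 →
            IsFinite (quadricSectionStr i l.1.space l.1.le_two) ∧
            Etale (quadricSectionStr i L.space L.le_two) ∧
            Nonempty (quadricSection i (L.lattice (integralClosure V K'))
              (L.lattice_le_two (integralClosure V K'))) ∧
            Nonempty (quadricSection i L.space L.le_two)) := by
  obtain ⟨r, c, y, e, rfl, he, -⟩ := exists_chart_of_closedPoint hPk hPclosed
  have hX : ∀ r (c : ProjChart i r), _root_.IsReduced c.B := fun r c =>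
    c.isReduced (IsFractionRing.injective V K) hflat hred
  have hK := genericFibreBound_vanishingForms hdim hflat K hred
  -- The dimension of `X` at `P` enters here: it bounds the dimension of the chart from below, as
  -- nonemptiness requires.
  have hB : (d + 1 : ℕ) ≤ ringKrullDim c.B := hPdim ▸ c.le_ringKrullDim y
  have := hX r c
  have := c.isNoetherianRing
  constructor
  · intro hreg
    obtain ⟨U, hUo, hUd, hU⟩ : ∃ U : Set (throughPoint i (c.j y) d), IsOpen U ∧ Dense U ∧
        ∀ (L : QuadGrass n d K) (l : throughPoint i (c.j y) d), l ∈ U →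
          L.SpecializesTo (IsLocalRing.residue V) l.1 →
            IsFinite (quadricSectionStr i l.1.space l.1.le_two) ∧
            Etale (quadricSectionStr i L.space L.le_two) := by
      -- The two cases are `π ∉ 𝔓²`, handled as at a smooth point with `K' = K` and `W = V`, and `π
      -- ∈ 𝔓²`, which relies on `L` being defined over `K`.
      rcases c.finrank_cotangentQuotient_le_of_isRegularLocalRing e (hdim ▸ c.ringKrullDim_le) he
        hreg with h | ⟨h, hJ⟩
      · obtain ⟨U, hUo, hUd, hU⟩ := c.exists_isOpen_dense_etale e he hdim hflat hX hK h
        exact ⟨U, hUo, hUd, hU K V (IsFractionRing.injective V K) (Algebra.ofId V _)⟩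
      · exact c.exists_isOpen_dense_etale_of_maximalIdeal_le e he hdim hflat hX hK h hJ
    refine ⟨U, hUo, hUd, fun L l hl hL => ?_⟩
    obtain ⟨hfin, het⟩ := hU L l hl hL
    exact ⟨hfin, het, c.nonempty_quadricSection K hflat hX hB L⟩
  · intro hsm
    obtain ⟨U, hUo, hUd, hU⟩ := c.exists_isOpen_dense_etale e he hdim hflat hX hK
      (c.finrank_cotangentQuotient_le_of_isSmoothAtPoint (K := K) e hflat hK he hsm)
    refine ⟨U, hUo, hUd, fun K' _ _ _ _ _ L l hl hL => ?_⟩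
    obtain ⟨hfin, het⟩ := hU K' (integralClosure V K') Subtype.val_injective (residueHom V K') L l
      hl hL
    exact ⟨hfin, het, c.nonempty_quadricSection K hflat hX hB L⟩
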